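/- **Setting.** Let $M$ be a smooth manifold (Hausdorff, second countable, without boundary) of dimension $n$, $g$ a smooth Riemannian metric on $M$, $\phi\in C^\infty(M)$, $\lambda\in\mathbb{R}$, and $[\phi]=\{\phi+\omega:\omega\in C^\infty(M)\}$. Let $\mathcal{G}$ be the set of triples $(x,g_x,l)$ with $x\in M$, $l\in\mathbb{R}$. A representative $\phi$ of the class identifies $\mathcal{G}$ with $\mathbb{R}\times M\ni(v,x)$ through $l=\phi(x)-v$, and $\mathcal{G}\times\mathbb{R}$ with $\mathbb{R}\times M\times\mathbb{R}\ni(v,x,u)$. Where $\lambda u\neq 1$ put $\delta_s(v,x,u)=(v+(\lambda u-1)^{-1}s,x,u)$, $s\in\mathbb{R}$ (dilations); a dilation-invariant set is one that lies in $\{\lambda u\ne1\}$ and is preserved by all $\delta_s$. For a pseudo-Riemannian metric $h$ and a function $f$ on an $N$-dimensional manifold put $P_f=\mathrm{Ric}_h+\nabla^2f-\lambda h$ and $F_f=\Delta f-|\nabla f|^2+2\lambda f-N\lambda$. A function or tensor near $\{u=0\}$ is $O(u^\infty)$ if its components in the coordinates $(v,x^1,\dots,x^n,u)$ are $O(u^k)$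 as $u\to0$ for every $k$. A *pre-ambient space* of $(M,g,[\phi],\lambda)$ is a triple $(\widetilde{\mathcal{G}},\widetilde g,\widetilde\phi)$ such that (i) $\widetilde{\mathcal{G}}$ is a dilation-invariant open neighbourhood of $\mathcal{G}\times\{0\}$ in $\mathcal{G}\times\mathbb{R}$; (ii) $\widetilde g$ is a smooth metric of signature $(n+1,1)$ and $\widetilde\phi$ a smooth function on $\widetilde{\mathcal{G}}$; (iii) $\widetilde g$ is invariant under the translations $v\mapsto v+s$, and $\delta_s^*\widetilde\phi=\widetilde\phi+s$ (that is, $\widetilde\phi=\phi_u-v+\lambda uv$ with $\phi_u$ independent of $v$); (iv) at $u=0$, the pullback of $\widetilde g$ to $\mathcal{G}$ is the pullback of $g$ under $\mathcal{G}\to M$, and $\widetilde\phi=l$; (v) $\nabla_{\partial_v}\partial_v=0$ at $u=0$. It is a *weighted ambient space* if moreover $\widetilde P_{\phi}:=P_{\widetilde\phi}$ and $\widetilde F_\phi:=F_{\widetilde\phi}$ of $(\widetilde g,\widetilde\phi)$ (with $N=n+2$) are $O(u^\infty)$. It is in *normal form* relative to $(g,\phi)$ if, in the coordinates given by $\phi$,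 for all $(v,x)$ the set of $u$ with $(v,x,u)\in\widetilde{\mathcal{G}}$ is an open interval, the curves $u\mapsto(v,x,u)$ are geodesics of $\widetilde g$, and $\widetilde g=g+2\,du\,dv$ at $u=0$. Two pre-ambient spaces are *ambient-equivalent* if there are dilation-invariant open sets $\mathcal{U}_j\subset\widetilde{\mathcal{G}}_j$ containing $\mathcal{G}\times\{0\}$ and a diffeomorphism $\psi:\mathcal{U}_1\to\mathcal{U}_2$ that commutes with dilations, is the identity on $\mathcal{G}\times\{0\}$, and satisfies $\widetilde g_1-\psi^*\widetilde g_2=O(u^\infty)$ and $\widetilde\phi_1-\psi^*\widetilde\phi_2=O(u^\infty)$. **Theorem.** Every manifold with density $(M^n,g,[\phi],\lambda)$ has a weighted ambient space, and any two weighted ambient spaces for it are ambient-equivalent. Moreover, there is one in normal form relative to $(g,\phi)$, and for any two weighted ambient spaces $(\widetilde{\mathcal{G}}_j,\widetilde g_j,\widetilde\phi_j)$, $j=1,2$, in normal form relative to $(g,\phi)$, one has $\widetilde g_1-\widetilde g_2=O(u^\infty)$ and $\widetilde\phi_1-\widetilde\phi_2=O(u^\infty)$. -/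

import Mathlib

open scoped Manifold ContDiff Topology

noncomputable section

namespace WeightedAmbient

/-! ### Weighted curvature in local coordinates

`W` is the coordinate space, `e : ι → W` the coordinate vectors, `G y` the matrix `(g_{IJ}(y))`
of the metric and `f` the density function, all in the given coordinates. -/

section Coordinates

variable {W : Type*} [NormedAddCommGroup W] [NormedSpace ℝ W]
variable {ι : Type*} [Fintype ι] [DecidableEq ι]

/-- The partial derivative `∂_I f`. -/
def pd (e : ι → W) (I : ι) (f : W → ℝ) (y : W) : ℝ :=
  fderiv ℝ f y (e I)

/-- `Γ^K_{IJ} = ½ g^{KL} (∂_I g_{JL} + ∂_J g_{IL} - ∂_L g_{IJ})`. -/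
def christoffel (e : ι → W) (G : W → Matrix ι ι ℝ) (K I J : ι) (y : W) : ℝ :=
  (1 / 2) * ∑ L, (G y)⁻¹ K L *
    (pd e I (fun z => G z J L) y + pd e J (fun z => G z I L) y - pd e L (fun z => G z I J) y)

/-- `Ric_{IJ} = ∂_K Γ^K_{IJ} - ∂_J Γ^K_{IK} + Γ^K_{KL} Γ^L_{IJ} - Γ^K_{JL} Γ^L_{IK}`. -/
def ricci (e : ι → W) (G : W → Matrix ι ι ℝ) (I J : ι) (y : W) : ℝ :=
  ∑ K, (pd e K (christoffel e G K I J) y - pd e J (christoffel e G K I K) y) +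
    ∑ K, ∑ L, (christoffel e G K K L y * christoffel e G L I J y -
      christoffel e G K J L y * christoffel e G L I K y)

/-- `(∇²f)_{IJ} = ∂_I ∂_J f - Γ^K_{IJ} ∂_K f`. -/
def hessian (e : ι → W) (G : W → Matrix ι ι ℝ) (f : W → ℝ) (I J : ι) (y : W) : ℝ :=
  pd e I (pd e J f) y - ∑ K, christoffel e G K I J y * pd e K f y

/-- `Δf = g^{IJ} (∇²f)_{IJ}`. -/
def laplacian (e : ι → W) (G : W → Matrix ι ι ℝ) (f : W → ℝ) (y : W) : ℝ :=
  ∑ I, ∑ J, (G y)⁻¹ I J * hessian e G f I J y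

/-- `|∇f|² = g^{IJ} ∂_I f ∂_J f`. -/
def gradSq (e : ι → W) (G : W → Matrix ι ι ℝ) (f : W → ℝ) (y : W) : ℝ :=
  ∑ I, ∑ J, (G y)⁻¹ I J * pd e I f y * pd e J f y

/-- The components of `P_φ = Ric + ∇²φ - λ g`. -/
def weightedP (e : ι → W) (G : W → Matrix ι ι ℝ) (f : W → ℝ) (lam : ℝ) (I J : ι) (y : W) : ℝ :=
  ricci e G I J y + hessian e G f I J y - lam * G y I J

/-- `F_φ = Δφ - |∇φ|² + 2 λ φ - (dim) λ`; the dimension is the number of coordinates. -/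
def weightedF (e : ι → W) (G : W → Matrix ι ι ℝ) (f : W → ℝ) (lam : ℝ) (y : W) : ℝ :=
  laplacian e G f y - gradSq e G f y + 2 * lam * f y - (Fintype.card ι : ℝ) * lam

end Coordinates

/-- A family of bilinear forms on the tangent spaces of a manifold. -/
abbrev TangentForm {E H : Type*} [NormedAddCommGroup E] [NormedSpace ℝ E] [TopologicalSpace H]
    (I : ModelWithCorners ℝ E H) (X : Type*) [TopologicalSpace X] [ChartedSpace H X] :=
  ∀ p : X, TangentSpace I p →L[ℝ] TangentSpace I p →L[ℝ] ℝ

/-- The pullback `(f^* h)_p (a, b) = h_{f p} (df a, df b)`. -/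
def pullback {E H E' H' : Type*} [NormedAddCommGroup E] [NormedSpace ℝ E] [TopologicalSpace H]
    [NormedAddCommGroup E'] [NormedSpace ℝ E'] [TopologicalSpace H']
    (I : ModelWithCorners ℝ E H) (I' : ModelWithCorners ℝ E' H')
    {X Y : Type*} [TopologicalSpace X] [ChartedSpace H X]
    [TopologicalSpace Y] [ChartedSpace H' Y]
    (f : X → Y) (h : TangentForm I' Y) (p : X) (a b : TangentSpace I p) : ℝ :=
  h (f p) (mfderiv I I' f p a) (mfderiv I I' f p b)

/-! ### The space `𝒢 × ℝ`

A representative `φ` of the class `[φ]` identifies `𝒢 = {(x, g_x, l) : x ∈ M, l ∈ ℝ}` with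
`ℝ × M ∋ (v, x)` through `l = φ(x) - v`; hence `𝒢 × ℝ` is `ℝ × M × ℝ ∋ (v, x, u)`. -/

/-- The weighted conformal class `[φ] = {φ + ω : ω ∈ C^∞(M)}`. -/
def conformalClass {n : ℕ} {M : Type*} [TopologicalSpace M]
    [ChartedSpace (EuclideanSpace ℝ (Fin n)) M] (φ : C^∞⟮𝓡 n, M; ℝ⟯) : Set C^∞⟮𝓡 n, M; ℝ⟯ :=
  {φ' | ∃ w : C^∞⟮𝓡 n, M; ℝ⟯, φ' = φ + w}

/-- The model of the manifold `ℝ × M × ℝ`. -/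
abbrev model (n : ℕ) := 𝓘(ℝ, ℝ).prod ((𝓡 n).prod 𝓘(ℝ, ℝ))

/-- The coordinate space of `(v, x¹, …, xⁿ, u)`. -/
abbrev Coord (n : ℕ) := ℝ × EuclideanSpace ℝ (Fin n) × ℝ

/-- The coordinate indices: `0` (for `v`), `1, …, n` and `∞` (for `u`). -/
abbrev Idx (n : ℕ) := Unit ⊕ Fin n ⊕ Unit

/-- The index `0` of the coordinate `v`. -/
abbrev idxV (n : ℕ) : Idx n := Sum.inl ()

/-- The index `∞` of the coordinate `u`. -/
abbrev idxU (n : ℕ) : Idx n := Sum.inr (Sum.inr ())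

/-- The coordinate vectors `∂_v, ∂_1, …, ∂_n, ∂_u`. -/
def coordVec (n : ℕ) : Idx n → Coord n :=
  Sum.elim (fun _ => (1, 0, 0))
    (Sum.elim (fun i => (0, EuclideanSpace.single i 1, 0)) (fun _ => (0, 0, 1)))

/-- The dilation `δ_s (v, x, u) = (v + (λ u - 1)⁻¹ s, x, u)`, to be used where `λ u ≠ 1`. -/
def dilation {M : Type*} (lam s : ℝ) (p : ℝ × M × ℝ) : ℝ × M × ℝ :=
  (p.1 + (lam * p.2.2 - 1)⁻¹ * s, p.2.1, p.2.2)

/-- The translation `(v, x, u) ↦ (v + s, x, u)`. -/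
def translation {M : Type*} (s : ℝ) (p : ℝ × M × ℝ) : ℝ × M × ℝ :=
  (p.1 + s, p.2.1, p.2.2)

/-- A set is dilation-invariant if the dilations are defined on it and preserve it. -/
def DilationInvariant {M : Type*} (lam : ℝ) (S : Set (ℝ × M × ℝ)) : Prop :=
  ∀ p ∈ S, lam * p.2.2 ≠ 1 ∧ ∀ s, dilation lam s p ∈ S

section Ambient

variable {n : ℕ} {M : Type*} [TopologicalSpace M] [ChartedSpace (EuclideanSpace ℝ (Fin n)) M]

/-- The inverse `(v, x¹, …, xⁿ, u) ↦ (v, x, u)` of the coordinates of `ℝ × M × ℝ` given by the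
chart of `M` at `x₀`; used over the target of that chart. -/
def param (x₀ : M) (y : Coord n) : ℝ × M × ℝ :=
  (y.1, (chartAt (EuclideanSpace ℝ (Fin n)) x₀).symm y.2.1, y.2.2)

/-- The components of a bilinear form in the coordinates given by the chart at `x₀`. -/
def components (x₀ : M) (h : ∀ p : ℝ × M × ℝ, TangentSpace (model n) p →
    TangentSpace (model n) p → ℝ) (y : Coord n) : Matrix (Idx n) (Idx n) ℝ :=
  Matrix.of fun I J => h (param x₀ y)
    (mfderiv 𝓘(ℝ, Coord n) (model n) (param x₀) y (coordVec n I))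
    (mfderiv 𝓘(ℝ, Coord n) (model n) (param x₀) y (coordVec n J))

/-- `f = O(u^∞)` for a function of the single variable `u`. -/
def OInfty (f : ℝ → ℝ) : Prop :=
  ∀ N : ℕ, f =O[𝓝 0] fun u => u ^ N

/-- `f = O(u^∞)` at `u = 0` for a function `f` on (a neighbourhood of `u = 0` in) `ℝ × M × ℝ`. -/
def FunOInfty (f : ℝ × M × ℝ → ℝ) : Prop :=
  ∀ v x, OInfty fun u => f (v, x, u)

/-- `h = O(u^∞)` at `u = 0` for a bilinear form: its components in the coordinates
`(v, x¹, …, xⁿ, u)` given by the charts of `M` are `O(u^∞)`. -/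
def FormOInfty (h : ∀ p : ℝ × M × ℝ, TangentSpace (model n) p →
    TangentSpace (model n) p → ℝ) : Prop :=
  ∀ x₀ : M, ∀ v, ∀ ξ ∈ (chartAt (EuclideanSpace ℝ (Fin n)) x₀).target, ∀ I J,
    OInfty fun u => components x₀ h (v, ξ, u) I J

variable (n M) in
/-- A subset of `ℝ × M × ℝ` with a family of bilinear forms and a function; only their values on
the subset matter. -/
structure AmbientData where
  /-- The set `𝒢̃`. -/
  carrier : Set (ℝ × M × ℝ)
  /-- The metric `g̃`. -/
  metric : TangentForm (model n) (ℝ × M × ℝ)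
  /-- The density function `φ̃`. -/
  density : ℝ × M × ℝ → ℝ

namespace AmbientData

/-- The components `g̃_{IJ}` in the coordinates given by the chart at `x₀`. -/
def matrix (A : AmbientData n M) (x₀ : M) : Coord n → Matrix (Idx n) (Idx n) ℝ :=
  components x₀ fun p a b => A.metric p a b

/-- The Christoffel symbols `Γ̃^K_{IJ}` in the coordinates given by the chart at `x₀`. -/
def gamma (A : AmbientData n M) (x₀ : M) (K I J : Idx n) (y : Coord n) : ℝ :=
  christoffel (coordVec n) (A.matrix x₀) K I J y

/-- The components `(P̃_φ)_{IJ}` in the coordinates given by the chart at `x₀`. -/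
def tildeP (A : AmbientData n M) (lam : ℝ) (x₀ : M) (I J : Idx n) (y : Coord n) : ℝ :=
  weightedP (coordVec n) (A.matrix x₀) (A.density ∘ param x₀) lam I J y

/-- The function `F̃_φ` in the coordinates given by the chart at `x₀`. -/
def tildeF (A : AmbientData n M) (lam : ℝ) (x₀ : M) (y : Coord n) : ℝ :=
  weightedF (coordVec n) (A.matrix x₀) (A.density ∘ param x₀) lam y

end AmbientData

/-- The differential `df_p (a)` of a function on `ℝ × M × ℝ`. -/
def differential (f : ℝ × M × ℝ → ℝ) (p : ℝ × M × ℝ) (a : TangentSpace (model n) p) : ℝ :=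
  mfderiv (model n) 𝓘(ℝ, ℝ) f p a

/-- A bilinear form on the tangent space at `p` is symmetric of signature `(n + 1, 1)`. -/
def IsLorentzianAt (p : ℝ × M × ℝ)
    (h : TangentSpace (model n) p →L[ℝ] TangentSpace (model n) p →L[ℝ] ℝ) : Prop :=
  ∃ b : Module.Basis (Fin (n + 2)) ℝ (TangentSpace (model n) p), ∀ i j,
    h (b i) (b j) = if i = j then (if i = 0 then -1 else 1) else 0

variable [IsManifold (𝓡 n) ∞ M]

/-- A smooth Riemannian metric on `M`. -/
abbrev RiemannianMetric (n : ℕ) (M : Type*) [TopologicalSpace M]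
    [ChartedSpace (EuclideanSpace ℝ (Fin n)) M] [IsManifold (𝓡 n) ∞ M] :=
  Bundle.ContMDiffRiemannianMetric (𝓡 n) ∞ (EuclideanSpace ℝ (Fin n))
    (fun x : M => TangentSpace (𝓡 n) x)

/-- Pre-ambient spaces of `(M, g, [φ], λ)`, in the coordinates `(v, x, u)` on `𝒢 × ℝ` given by the
representative `φ`. -/
structure IsPreAmbient (g : RiemannianMetric n M) (φ : C^∞⟮𝓡 n, M; ℝ⟯) (lam : ℝ)
    (A : AmbientData n M) : Prop where
  isOpen : IsOpen A.carrier
  zero_mem : ∀ (v : ℝ) (x : M), (v, x, (0 : ℝ)) ∈ A.carrier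
  invariant : DilationInvariant lam A.carrier
  smooth_metric : ContMDiffOn (model n)
    ((model n).prod 𝓘(ℝ, Coord n →L[ℝ] Coord n →L[ℝ] ℝ)) ∞
    (fun p => Bundle.TotalSpace.mk' (Coord n →L[ℝ] Coord n →L[ℝ] ℝ)
      (E := fun p : ℝ × M × ℝ =>
        TangentSpace (model n) p →L[ℝ] TangentSpace (model n) p →L[ℝ] ℝ) p (A.metric p))
    A.carrier
  signature : ∀ p ∈ A.carrier, IsLorentzianAt p (A.metric p)
  smooth_density : ContMDiffOn (model n) 𝓘(ℝ, ℝ) ∞ A.density A.carrier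
  /-- Homogeneity of the metric: `g̃` is independent of `v`. -/
  metric_homogeneous : ∀ s, ∀ p ∈ A.carrier, ∀ a b : TangentSpace (model n) p,
    pullback (model n) (model n) (translation s) A.metric p a b = A.metric p a b
  /-- Homogeneity of the density: `δ_s^* φ̃ = φ̃ + s`. -/
  density_homogeneous : ∀ s, ∀ p ∈ A.carrier,
    A.density (dilation lam s p) = A.density p + s
  /-- `ι^* g̃ = π^* g`, where `ι (v, x) = (v, x, 0)` and `π (v, x) = x`. -/
  initial_metric : ∀ (z : ℝ × M) (a b : TangentSpace (𝓘(ℝ, ℝ).prod (𝓡 n)) z),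
    pullback (𝓘(ℝ, ℝ).prod (𝓡 n)) (model n) (fun w : ℝ × M => (w.1, w.2, (0 : ℝ)))
      A.metric z a b =
    pullback (𝓘(ℝ, ℝ).prod (𝓡 n)) (𝓡 n) (fun w : ℝ × M => w.2) g.inner z a b
  /-- `ι^* φ̃ (v, x) = φ(x) - v`, the tautological function `l` on `𝒢`. -/
  initial_density : ∀ (v : ℝ) (x : M), A.density (v, x, 0) = φ x - v
  /-- `∇̃_{∂_v} ∂_v = 0` along `u = 0`. -/
  straight : ∀ x₀ : M, ∀ v, ∀ ξ ∈ (chartAt (EuclideanSpace ℝ (Fin n)) x₀).target, ∀ K,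
    A.gamma x₀ K (idxV n) (idxV n) (v, ξ, 0) = 0

/-- Weighted ambient spaces: pre-ambient spaces with `P̃_φ = O(u^∞)` and `F̃_φ = O(u^∞)`. -/
structure IsWeightedAmbient (g : RiemannianMetric n M) (φ : C^∞⟮𝓡 n, M; ℝ⟯) (lam : ℝ)
    (A : AmbientData n M) : Prop extends IsPreAmbient g φ lam A where
  tildeP_vanishes : ∀ x₀ : M, ∀ v, ∀ ξ ∈ (chartAt (EuclideanSpace ℝ (Fin n)) x₀).target,
    ∀ I J, OInfty fun u => A.tildeP lam x₀ I J (v, ξ, u)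
  tildeF_vanishes : ∀ x₀ : M, ∀ v, ∀ ξ ∈ (chartAt (EuclideanSpace ℝ (Fin n)) x₀).target,
    OInfty fun u => A.tildeF lam x₀ (v, ξ, u)

/-- Normal form relative to `(g, φ)`; `(v, x, u)` are the coordinates given by `φ`. -/
structure IsNormal (g : RiemannianMetric n M) (A : AmbientData n M) : Prop where
  /-- The (open) set of the `u` with `(v, x, u) ∈ 𝒢̃` is an interval. -/
  interval : ∀ (v : ℝ) (x : M), Set.OrdConnected {u : ℝ | (v, x, u) ∈ A.carrier}
  /-- The curves `u ↦ (v, x, u)` are geodesics. -/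
  geodesic : ∀ x₀ : M, ∀ y : Coord n,
    y.2.1 ∈ (chartAt (EuclideanSpace ℝ (Fin n)) x₀).target → param x₀ y ∈ A.carrier →
      ∀ K, A.gamma x₀ K (idxU n) (idxU n) y = 0
  /-- `g̃ = g + 2 du dv` along `u = 0`. -/
  initial : ∀ (v : ℝ) (x : M) (a b : TangentSpace (model n) ((v, x, 0) : ℝ × M × ℝ)),
    A.metric (v, x, 0) a b =
      pullback (model n) (𝓡 n) (fun q : ℝ × M × ℝ => q.2.1) g.inner (v, x, 0) a b +
      (differential (fun q => q.2.2) (v, x, 0) a * differential (fun q => q.1) (v, x, 0) b +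
        differential (fun q => q.1) (v, x, 0) a * differential (fun q => q.2.2) (v, x, 0) b)

/-- Ambient-equivalence of `A₁` and `A₂`, given in the coordinates of the representatives `φ₁` and
`φ₂` of one class. The identity map of `𝒢`, which fixes `(x, g_x, l)` with
`l = φ₁(x) - v₁ = φ₂(x) - v₂`, reads `(v, x) ↦ (v + φ₂(x) - φ₁(x), x)` in these coordinates; for
`φ₁ = φ₂` it is the identity of `ℝ × M`. -/
def AmbientEquivalent (φ₁ φ₂ : C^∞⟮𝓡 n, M; ℝ⟯) (lam : ℝ) (A₁ A₂ : AmbientData n M) : Prop :=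
  ∃ ψ : OpenPartialHomeomorph (ℝ × M × ℝ) (ℝ × M × ℝ),
    ContMDiffOn (model n) (model n) ∞ ψ ψ.source ∧
    ContMDiffOn (model n) (model n) ∞ ψ.symm ψ.target ∧
    ψ.source ⊆ A₁.carrier ∧ ψ.target ⊆ A₂.carrier ∧
    (∀ (v : ℝ) (x : M), (v, x, (0 : ℝ)) ∈ ψ.source ∧ (v, x, (0 : ℝ)) ∈ ψ.target) ∧
    DilationInvariant lam ψ.source ∧ DilationInvariant lam ψ.target ∧
    (∀ s, ∀ p ∈ ψ.source, ψ (dilation lam s p) = dilation lam s (ψ p)) ∧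
    (∀ (v : ℝ) (x : M), ψ (v, x, 0) = (v + φ₂ x - φ₁ x, x, 0)) ∧
    FormOInfty (fun p a b => A₁.metric p a b -
      pullback (model n) (model n) ψ A₂.metric p a b) ∧
    FunOInfty (fun p => A₁.density p - A₂.density (ψ p))

end Ambient

end WeightedAmbient

end

open scoped Manifold ContDiff Topology

noncomputable section

set_option linter.unusedSectionVars false

namespace WeightedAmbient

open Finset (sum_congr sum_comm mul_sum sum_add_distrib sum_mul sum_sub_distrib sum_ite_eq'
  sum_eq_zero sum_neg_distrib sum_const_zero mem_univ)
open Matrix (of mul_nonsing_inv nonsing_inv_mul of_apply mulVec map_apply trace transpose_mul)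
open Matrix renaming mul_apply → mul_app, one_apply → one_app, add_apply → add_app
open Filter (Tendsto Eventually)
open Metric (closedBall mem_closedBall_self ball_subset_closedBall ball isOpen_ball
  closedBall_subset_closedBall)
open Ideal (mul_mem_left mul_mem_right)
open Derivation (leibniz)
open Function (comp_apply iterate_succ_apply Injective Surjective)
open ContinuousLinearMap renaming fst → fstL, snd → sndL

local notation:max "𝔼" n:max => EuclideanSpace ℝ (Fin n)
local notation:max "𝔠" n:max => chartAt (EuclideanSpace ℝ (Fin n))
local notation:max "𝒳" M:max => ℝ × M × ℝ
local notation:max "𝒯" n:max M:max => TangentForm (model n) (ℝ × M × ℝ)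
local notation:max "𝓡₁" n:max => ModelWithCorners.prod (𝓡 n) 𝓘(ℝ, ℝ)
local notation "iV" => idxV _
local notation "iU" => idxU _

lemma sum_ext {ι A : Type*} [Fintype ι] [AddCommMonoid A] {f g : ι → A} (h : ∀ i, f i = g i) :
    ∑ i, f i = ∑ i, g i :=
  Finset.sum_congr rfl fun i _ => h i

lemma sum_ext₂ {ι κ A : Type*} [Fintype ι] [Fintype κ] [AddCommMonoid A] {f g : ι → κ → A}
    (h : ∀ i j, f i j = g i j) : ∑ i, ∑ j, f i j = ∑ i, ∑ j, g i j :=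
  sum_ext fun i => sum_ext (h i)

lemma sum_swap {ι κ A : Type*} [Fintype ι] [Fintype κ] [AddCommMonoid A] {f : ι → κ → A}
    {g : κ → ι → A} (h : ∀ j i, f i j = g j i) : ∑ i, ∑ j, f i j = ∑ j, ∑ i, g j i :=
  sum_comm.trans (sum_ext₂ h)

section

/-! ### Curvature in a commutative ring with commuting derivations -/

section Algebraic

variable {A : Type*} [CommRing A] [Algebra ℝ A]
variable {ι : Type*} [Fintype ι] [DecidableEq ι]

variable (A) in
/-- The element `1 / 2` of a real algebra. -/
def half : A := algebraMap ℝ A (1 / 2)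

lemma two_mul_half : (2 : A) * half A = 1 := by
  rw [half, ← map_ofNat (algebraMap ℝ A) 2, ← map_mul]; norm_num

lemma derivation_half (d : Derivation ℝ A A) : d (half A) = 0 := d.map_algebraMap _

/-- Christoffel symbols of the matrix `G` for the derivations `D`. -/
def aChr (D : ι → Derivation ℝ A A) (G : Matrix ι ι A) (K I J : ι) : A :=
  half A * ∑ L, G⁻¹ K L * (D I (G J L) + D J (G I L) - D L (G I J))

/-- Ricci curvature of the matrix `G` for the derivations `D`. -/
def aRic (D : ι → Derivation ℝ A A) (G : Matrix ι ι A) (I J : ι) : A :=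
  ∑ K, (D K (aChr D G K I J) - D J (aChr D G K I K)) +
    ∑ K, ∑ L, (aChr D G K K L * aChr D G L I J - aChr D G K J L * aChr D G L I K)

/-- Hessian of `f`. -/
def aHess (D : ι → Derivation ℝ A A) (G : Matrix ι ι A) (f : A) (I J : ι) : A :=
  D I (D J f) - ∑ K, aChr D G K I J * D K f

/-- Laplacian of `f`. -/
def aLap (D : ι → Derivation ℝ A A) (G : Matrix ι ι A) (f : A) : A :=
  ∑ I, ∑ J, G⁻¹ I J * aHess D G f I J

/-- Squared norm of the gradient of `f`. -/
def aGradSq (D : ι → Derivation ℝ A A) (G : Matrix ι ι A) (f : A) : A :=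
  ∑ I, ∑ J, G⁻¹ I J * D I f * D J f

/-- The weighted tensor `Ric + ∇²f - λ G`. -/
def aP (D : ι → Derivation ℝ A A) (G : Matrix ι ι A) (f : A) (lam : ℝ) (I J : ι) : A :=
  aRic D G I J + aHess D G f I J - algebraMap ℝ A lam * G I J

/-- The weighted function `Δf - |∇f|² + 2 λ f - N λ`. -/
def aF (D : ι → Derivation ℝ A A) (G : Matrix ι ι A) (f : A) (lam : ℝ) : A :=
  aLap D G f - aGradSq D G f + 2 * algebraMap ℝ A lam * f -
    algebraMap ℝ A ((Fintype.card ι : ℝ) * lam)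

/-- The connection matrices, with rows indexed by the upper index. -/
def conn (D : ι → Derivation ℝ A A) (G : Matrix ι ι A) (I : ι) : Matrix ι ι A :=
  of fun K J => aChr D G K I J

/-- Entrywise derivation of a matrix. -/
def dMat (d : Derivation ℝ A A) (M : Matrix ι ι A) : Matrix ι ι A := M.map d

/-- The curvature of a family of connection matrices. -/
def curvOf (D : ι → Derivation ℝ A A) (C : ι → Matrix ι ι A) (I J : ι) : Matrix ι ι A :=
  dMat (D I) (C J) - dMat (D J) (C I) + (C I * C J - C J * C I)

@[simp] lemma dMat_apply (d : Derivation ℝ A A) (M : Matrix ι ι A) (i j : ι) :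
    dMat d M i j = d (M i j) := rfl

lemma dMat_add (d : Derivation ℝ A A) (M N : Matrix ι ι A) :
    dMat d (M + N) = dMat d M + dMat d N := by ext; simp

lemma dMat_sub (d : Derivation ℝ A A) (M N : Matrix ι ι A) :
    dMat d (M - N) = dMat d M - dMat d N := by ext; simp

lemma dMat_mul (d : Derivation ℝ A A) (M N : Matrix ι ι A) :
    dMat d (M * N) = dMat d M * N + M * dMat d N := by
  ext i j
  simp only [dMat_apply, mul_app, add_app, map_sum, leibniz, smul_eq_mul, ← sum_add_distrib]
  exact sum_ext fun _ => by ring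

lemma dMat_transpose (d : Derivation ℝ A A) (M : Matrix ι ι A) :
    dMat d M.transpose = (dMat d M).transpose := rfl

lemma dMat_one (d : Derivation ℝ A A) : dMat d (1 : Matrix ι ι A) = 0 := by
  ext i j
  by_cases h : i = j <;> simp [h]

lemma dMat_comm {d e : Derivation ℝ A A} (h : ∀ a, d (e a) = e (d a)) (M : Matrix ι ι A) :
    dMat d (dMat e M) = dMat e (dMat d M) := by ext; simp [h]

variable {D : ι → Derivation ℝ A A} {G : Matrix ι ι A}

lemma aChr_symm (hG : G.IsSymm) (K I J : ι) : aChr D G K I J = aChr D G K J I := by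
  unfold aChr
  congr 1
  refine sum_ext fun L => ?_
  rw [hG.apply I J]; ring

/-- The Levi-Civita connection is determined by being torsion-free and metric. -/
lemma eq_aChr_of_compat (hG : G.IsSymm) (hu : IsUnit G.det) (C : ι → Matrix ι ι A)
    (hs : ∀ I J K, C I K J = C J K I) (hc : ∀ I, dMat (D I) G = (C I).transpose * G + G * C I)
    (K I J : ι) : aChr D G K I J = C I K J := by
  have e : ∀ I J L, D I (G J L) = ∑ M, C I M J * G M L + ∑ M, G J M * C I M L := by
    intro I J L
    have := congrFun (congrFun (hc I) J) L
    simpa [mul_app] using this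
  have x : (fun L => D I (G J L) + D J (G I L) - D L (G I J)) =
      (2 : A) • (G.mulVec fun M => C I M J) := by
    funext L
    rw [e, e, e]
    simp only [Pi.smul_apply, mulVec, dotProduct, smul_eq_mul, mul_sum,
      ← sum_add_distrib, ← sum_sub_distrib]
    refine sum_ext fun M => ?_
    rw [hs J I M, hs J L M, hs I L M, hG.apply M L, hG.apply M J]; ring
  have : aChr D G K I J = half A * (G⁻¹.mulVec
      (fun L => D I (G J L) + D J (G I L) - D L (G I J))) K := rfl
  rw [this, x, Matrix.mulVec_smul, Matrix.mulVec_mulVec, nonsing_inv_mul _ hu]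
  simp only [Matrix.one_mulVec, Pi.smul_apply, smul_eq_mul]
  linear_combination C I K J * two_mul_half (A := A)

lemma sum_mul_aChr (hu : IsUnit G.det) (M I J : ι) :
    ∑ K, G M K * aChr D G K I J = half A * (D I (G J M) + D J (G I M) - D M (G I J)) := by
  have : (G.mulVec (G⁻¹.mulVec (fun L => D I (G J L) + D J (G I L) - D L (G I J)))) M =
      D I (G J M) + D J (G I M) - D M (G I J) := by
    rw [Matrix.mulVec_mulVec, mul_nonsing_inv _ hu, Matrix.one_mulVec]
  rw [← this, mulVec, dotProduct, mul_sum]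
  refine sum_ext fun K => ?_
  unfold aChr mulVec dotProduct
  ring

/-- The Levi-Civita connection is metric. -/
lemma dMat_metric (hG : G.IsSymm) (hu : IsUnit G.det) (I : ι) :
    dMat (D I) G = (conn D G I).transpose * G + G * conn D G I := by
  ext J K
  simp only [dMat_apply, add_app, mul_app, Matrix.transpose_apply, conn, of_apply]
  have h1 := sum_mul_aChr (D := D) hu K I J
  have h2 := sum_mul_aChr (D := D) hu J I K
  have h3 : ∑ x, aChr D G x I J * G x K = ∑ x, G K x * aChr D G x I J :=
    sum_ext fun x => by rw [hG.apply x K]; ring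
  rw [h3, h1, h2, hG.apply J K, hG.apply K I]
  linear_combination (-D I (G J K)) * two_mul_half (A := A)

lemma dMat_inv (hG : G.IsSymm) (hu : IsUnit G.det) (I : ι) :
    dMat (D I) G⁻¹ = -(G⁻¹ * (conn D G I).transpose + conn D G I * G⁻¹) := by
  have h1 : G⁻¹ * G = 1 := nonsing_inv_mul _ hu
  have h2 : G * G⁻¹ = 1 := mul_nonsing_inv _ hu
  have h : dMat (D I) G⁻¹ * G + G⁻¹ * dMat (D I) G = 0 := by rw [← dMat_mul, h1, dMat_one]
  have h' : dMat (D I) G⁻¹ = -(G⁻¹ * dMat (D I) G * G⁻¹) := by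
    have := congrArg (· * G⁻¹) h
    simp only [add_mul, mul_assoc, h2, mul_one, zero_mul] at this
    rw [eq_neg_iff_add_eq_zero, mul_assoc]; exact this
  rw [h', dMat_metric hG hu, mul_add, add_mul, ← mul_assoc, ← mul_assoc, h1, one_mul,
    mul_assoc _ G, h2, mul_one]

lemma conn_symm (hG : G.IsSymm) (I J K : ι) : conn D G I K J = conn D G J K I := aChr_symm hG K I J

lemma curvOf_antisymm (C : ι → Matrix ι ι A) (I J : ι) : curvOf D C J I = -curvOf D C I J := by
  unfold curvOf; abel

/-- The second Bianchi identity. -/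
lemma curvOf_bianchi (hD : ∀ I J a, D I (D J a) = D J (D I a)) (C : ι → Matrix ι ι A) (M I J : ι) :
    (dMat (D M) (curvOf D C I J) + (C M * curvOf D C I J - curvOf D C I J * C M)) +
    (dMat (D I) (curvOf D C J M) + (C I * curvOf D C J M - curvOf D C J M * C I)) +
    (dMat (D J) (curvOf D C M I) + (C J * curvOf D C M I - curvOf D C M I * C J)) = 0 := by
  simp only [curvOf, dMat_add, dMat_sub, dMat_mul]
  rw [dMat_comm (hD M I) (C J), dMat_comm (hD J M) (C I), dMat_comm (hD I J) (C M)]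
  noncomm_ring

lemma aRic_eq_curv (hG : G.IsSymm) (I J : ι) : aRic D G I J = ∑ K, curvOf D (conn D G) K J K I := by
  unfold aRic curvOf
  simp only [add_app, Matrix.sub_apply, dMat_apply, mul_app,
    sum_add_distrib, sum_sub_distrib, conn, of_apply]
  congr 1
  · congr 1
    · exact sum_ext fun K => by rw [aChr_symm hG K I J]
    · exact sum_ext fun K => by rw [aChr_symm hG K I K]
  · congr 1
    · exact sum_ext₂ fun K L => by rw [aChr_symm hG L I J]
    · exact sum_ext₂ fun K L => by rw [aChr_symm hG L I K]

/-- The lowered curvature is antisymmetric. -/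
lemma curv_lower_antisymm (hD : ∀ I J a, D I (D J a) = D J (D I a)) (hG : G.IsSymm)
    (hu : IsUnit G.det) (I J : ι) :
    (curvOf D (conn D G) I J).transpose * G + G * curvOf D (conn D G) I J = 0 := by
  have h := dMat_comm (hD I J) G
  rw [dMat_metric hG hu, dMat_metric hG hu, dMat_add, dMat_add, dMat_mul, dMat_mul, dMat_mul,
    dMat_mul, dMat_metric hG hu, dMat_metric hG hu] at h
  rw [← sub_eq_zero] at h
  rw [← h]
  simp only [curvOf, Matrix.transpose_add, Matrix.transpose_sub, transpose_mul, dMat_transpose]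
  noncomm_ring

lemma inv_isSymm (hG : G.IsSymm) : (G⁻¹).IsSymm := by
  rw [Matrix.IsSymm, Matrix.transpose_nonsing_inv, hG.eq]

lemma curv_raise_antisymm (hD : ∀ I J a, D I (D J a) = D J (D I a)) (hG : G.IsSymm)
    (hu : IsUnit G.det) (I J : ι) :
    (curvOf D (conn D G) I J * G⁻¹).transpose = -(curvOf D (conn D G) I J * G⁻¹) := by
  have h := curv_lower_antisymm hD hG hu I J
  have h1 : G⁻¹ * G = 1 := nonsing_inv_mul _ hu
  have h2 : G * G⁻¹ = 1 := mul_nonsing_inv _ hu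
  set R := curvOf D (conn D G) I J
  rw [transpose_mul, (inv_isSymm hG).eq, eq_neg_iff_add_eq_zero]
  calc G⁻¹ * R.transpose + R * G⁻¹ = G⁻¹ * (R.transpose * G + G * R) * G⁻¹ := by
        rw [mul_add, add_mul, ← mul_assoc G⁻¹ G, h1, one_mul, mul_assoc G⁻¹ (R.transpose * G),
          mul_assoc R.transpose, h2, mul_one]
    _ = 0 := by rw [h]; simp

/-- The divergence of a mixed tensor `T^J_I`, with rows indexed by the upper index. -/
def divMixed (D : ι → Derivation ℝ A A) (G T : Matrix ι ι A) (I : ι) : A :=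
  ∑ J, D J (T J I) + ∑ J, ∑ L, aChr D G J J L * T L I - ∑ M, ∑ L, aChr D G M I L * T L M

/-- The contracted second Bianchi identity. -/
lemma contracted_bianchi (hD : ∀ I J a, D I (D J a) = D J (D I a)) (hG : G.IsSymm)
    (hu : IsUnit G.det) (I : ι) :
    2 * divMixed D G (G⁻¹ * of (aRic D G)) I = D I (∑ K, ∑ L, G⁻¹ K L * aRic D G K L) := by
  have h1 : G⁻¹ * G = 1 := nonsing_inv_mul _ hu
  set C := conn D G with hC
  set S : ι → ι → Matrix ι ι A := fun I J => curvOf D C I J * G⁻¹ with hS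
  have hlow : ∀ I J K L, S J I K L = -S I J K L := fun I J K L => by
    simp only [hS]; rw [curvOf_antisymm]; simp
  have hup : ∀ I J K L, S I J L K = -S I J K L := fun I J K L =>
    congrFun (congrFun (curv_raise_antisymm hD hG hu I J) K) L
  have hric : ∀ L J, (G⁻¹ * of (aRic D G)) L J = ∑ K, S K J K L := by
    intro L J
    simp only [mul_app, of_apply, hS, aRic_eq_curv hG, mul_sum]
    refine sum_swap fun K M => ?_
    rw [(inv_isSymm hG).apply, mul_comm]
  have hscal : ∑ K, ∑ L, G⁻¹ K L * aRic D G K L = ∑ J, ∑ K, S K J K J := by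
    simp only [← hric, mul_app, of_apply]
    refine sum_swap fun K M => ?_
    rw [(inv_isSymm hG).apply]
  have hcov : ∀ M I J, dMat (D M) (S I J) + C M * S I J + S I J * (C M).transpose =
      (dMat (D M) (curvOf D C I J) + (C M * curvOf D C I J - curvOf D C I J * C M)) * G⁻¹ := by
    intro M I J
    simp only [hS, dMat_mul, dMat_inv hG hu, ← hC]
    noncomm_ring
  have hb : ∀ M I J, (dMat (D M) (S I J) + C M * S I J + S I J * (C M).transpose) +
      (dMat (D I) (S J M) + C I * S J M + S J M * (C I).transpose) +
      (dMat (D J) (S M I) + C J * S M I + S M I * (C J).transpose) = 0 := by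
    intro M I J
    rw [hcov, hcov, hcov, ← add_mul, ← add_mul, curvOf_bianchi hD, zero_mul]
  have hb' : ∑ M, ∑ J, ((D M (S I J M J) + ∑ L, C M M L * S I J L J + ∑ L, S I J M L * C M J L) +
      (D I (S J M M J) + ∑ L, C I M L * S J M L J + ∑ L, S J M M L * C I J L) +
      (D J (S M I M J) + ∑ L, C J M L * S M I L J + ∑ L, S M I M L * C J J L)) = 0 := by
    refine sum_eq_zero fun M _ => sum_eq_zero fun J _ => ?_
    have := congrFun (congrFun (hb M I J) M) J
    simpa [mul_app] using this
  -- the terms of the third and first kind agree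
  have z : ∑ M, ∑ J, ∑ L, C J M L * S M I L J = 0 := by
    refine sum_eq_zero fun M _ => ?_
    have e : ∑ J, ∑ L, C J M L * S M I L J = -∑ J, ∑ L, C J M L * S M I L J := by
      conv_lhs => rw [sum_comm]
      simp only [← sum_neg_distrib]
      refine sum_ext₂ fun J L => ?_
      rw [hup, hC, conn_symm hG L J M]; ring
    have : (2 : A) * ∑ J, ∑ L, C J M L * S M I L J = 0 := by linear_combination e
    calc _ = (2 * half A) * ∑ J, ∑ L, C J M L * S M I L J := by rw [two_mul_half, one_mul]
      _ = half A * (2 * ∑ J, ∑ L, C J M L * S M I L J) := by ring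
      _ = 0 := by rw [this, mul_zero]
  have z' : ∑ M, ∑ J, ∑ L, S I J M L * C M J L = 0 := by
    rw [← z, sum_comm]
    refine sum_ext₂ fun M J => sum_ext fun L => ?_
    rw [hlow M I J L, hup M I L J]; ring
  have t3 : ∑ M, ∑ J, D J (S M I M J) = ∑ J, D J (∑ K, S K I K J) := by
    rw [sum_comm]; simp only [map_sum]
  have t1 : ∑ M, ∑ J, D M (S I J M J) = ∑ J, D J (∑ K, S K I K J) := by
    simp only [map_sum]
    refine sum_ext₂ fun M J => ?_
    rw [hlow J I M J, hup J I J M]; simp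
  have t3' : ∑ M, ∑ J, ∑ L, S M I M L * C J J L = ∑ J, ∑ L, C J J L * ∑ K, S K I K L := by
    rw [sum_comm]
    refine sum_ext fun J => ?_
    rw [sum_comm]
    refine sum_ext fun L => ?_
    rw [mul_sum]
    exact sum_ext fun _ => mul_comm _ _
  have t1' : ∑ M, ∑ J, ∑ L, C M M L * S I J L J = ∑ J, ∑ L, C J J L * ∑ K, S K I K L := by
    refine sum_ext fun M => ?_
    rw [sum_comm]
    refine sum_ext fun L => ?_
    rw [mul_sum]
    refine sum_ext fun J => ?_
    rw [hlow J I L J, hup J I J L]; simp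
  have t2 : ∑ M, ∑ J, D I (S J M M J) = -D I (∑ J, ∑ K, S K J K J) := by
    simp only [map_sum, ← sum_neg_distrib]
    refine sum_ext₂ fun M J => ?_
    rw [hup J M J M]; simp
  have t2' : ∑ M, ∑ J, ∑ L, C I M L * S J M L J = -∑ M, ∑ L, C I M L * ∑ K, S K M K L := by
    simp only [← sum_neg_distrib]
    refine sum_ext fun M => ?_
    rw [sum_comm]
    refine sum_ext fun L => ?_
    rw [mul_sum, ← sum_neg_distrib]
    refine sum_ext fun J => ?_
    rw [hup J M J L]; simp
  have t2'' : ∑ M, ∑ J, ∑ L, S J M M L * C I J L = -∑ M, ∑ L, C I M L * ∑ K, S K M K L := by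
    simp only [← sum_neg_distrib]
    rw [sum_comm]
    refine sum_ext fun J => ?_
    rw [sum_comm]
    refine sum_ext fun L => ?_
    rw [mul_sum, ← sum_neg_distrib]
    refine sum_ext fun M => ?_
    rw [hlow M J M L]; ring
  simp only [sum_add_distrib] at hb'
  rw [t1, t1', z', t2, t2', t2'', t3, t3', z] at hb'
  rw [hscal]
  unfold divMixed
  simp only [hric]
  have hCe : ∀ I K J, C I K J = aChr D G K I J := fun _ _ _ => rfl
  simp only [hCe] at hb'
  linear_combination hb'

end Algebraic

end

section

section Algebraic

variable {A : Type*} [CommRing A] [Algebra ℝ A]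
variable {ι : Type*} [Fintype ι] [DecidableEq ι]
variable {D : ι → Derivation ℝ A A} {G : Matrix ι ι A}

lemma eq_zero_of_two_mul {a : A} (h : 2 * a = 0) : a = 0 := by
  linear_combination half A * h - a * two_mul_half (A := A)

lemma two_mul_sum_aChr (hG : G.IsSymm) (I : ι) :
    2 * ∑ K, aChr D G K I K = trace (G⁻¹ * dMat (D I) G) := by
  have : ∑ K, ∑ L, G⁻¹ K L * D K (G I L) = ∑ K, ∑ L, G⁻¹ K L * D L (G I K) := by
    refine sum_swap fun K L => ?_
    rw [(inv_isSymm hG).apply]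
  simp only [trace, Matrix.diag, mul_app, dMat_apply, aChr, ← mul_sum,
    ← mul_assoc, two_mul_half, one_mul, mul_add, mul_sub, sum_add_distrib,
    sum_sub_distrib, this, add_sub_cancel_right]
  refine sum_ext₂ fun K L => ?_
  rw [hG.apply]

/-- The Ricci tensor is symmetric. -/
lemma aRic_symm (hD : ∀ I J a, D I (D J a) = D J (D I a)) (hG : G.IsSymm) (hu : IsUnit G.det)
    (I J : ι) : aRic D G I J = aRic D G J I := by
  have h1 : G⁻¹ * G = 1 := nonsing_inv_mul _ hu
  have h2 : G * G⁻¹ = 1 := mul_nonsing_inv _ hu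
  have hinv : ∀ I, dMat (D I) G⁻¹ = -(G⁻¹ * dMat (D I) G * G⁻¹) := by
    intro I
    rw [dMat_inv hG hu, dMat_metric hG hu, mul_add, add_mul, ← mul_assoc, ← mul_assoc, h1,
      one_mul, mul_assoc _ G, h2, mul_one]
  have htr : ∀ I J, D J (trace (G⁻¹ * dMat (D I) G)) = trace (dMat (D J) (G⁻¹ * dMat (D I) G)) := by
    intro I J; simp [trace, map_sum]
  have key : ∀ I J, D J (trace (G⁻¹ * dMat (D I) G)) = D I (trace (G⁻¹ * dMat (D J) G)) := by
    intro I J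
    rw [htr, htr, dMat_mul, dMat_mul, hinv, hinv, dMat_comm (hD J I), Matrix.trace_add,
      Matrix.trace_add]
    congr 1
    simp only [neg_mul, Matrix.trace_neg, neg_inj, mul_assoc]
    rw [← mul_assoc, Matrix.trace_mul_comm, mul_assoc]
  have key' : D J (∑ K, aChr D G K I K) = D I (∑ K, aChr D G K J K) := by
    have := key I J
    rw [← two_mul_sum_aChr hG, ← two_mul_sum_aChr hG] at this
    have e : ∀ (d : Derivation ℝ A A) (a : A), d (2 * a) = 2 * d a := fun d a => by
      rw [two_mul, map_add, two_mul]
    rw [e, e, ← sub_eq_zero, ← mul_sub] at this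
    exact sub_eq_zero.1 (eq_zero_of_two_mul this)
  unfold aRic
  simp only [sum_sub_distrib, ← map_sum] at key' ⊢
  rw [key', map_sum]
  congr 1
  · congr 1
    simp only [aChr_symm hG _ I J]
  · congr 1
    · simp only [aChr_symm hG _ I J]
    · refine sum_swap fun K L => mul_comm _ _

/-- The gradient `f^J`. -/
def grad (D : ι → Derivation ℝ A A) (G : Matrix ι ι A) (f : A) (J : ι) : A := ∑ K, G⁻¹ J K * D K f

lemma aHess_symm (hD : ∀ I J a, D I (D J a) = D J (D I a)) (hG : G.IsSymm) (f : A) (I J : ι) :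
    aHess D G f I J = aHess D G f J I := by
  unfold aHess; rw [hD I J]; simp only [aChr_symm hG _ I J]

/-- The mixed Hessian is the covariant derivative of the gradient. -/
lemma raise_aHess (hG : G.IsSymm) (hu : IsUnit G.det) (f : A) (J I : ι) :
    ∑ K, G⁻¹ J K * aHess D G f I K = D I (grad D G f J) + ∑ K, aChr D G J I K * grad D G f K := by
  have h : ∀ K, D I (G⁻¹ J K) = -(∑ L, G⁻¹ J L * aChr D G K I L + ∑ L, aChr D G J I L * G⁻¹ L K) := by
    intro K
    have := congrFun (congrFun (dMat_inv (D := D) hG hu I) J) K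
    simpa [mul_app, conn] using this
  have e1 : ∑ K, aChr D G J I K * grad D G f K = ∑ K, (∑ L, aChr D G J I L * G⁻¹ L K) * D K f := by
    simp only [grad, mul_sum, sum_mul]
    exact sum_swap fun _ _ => by ring
  have e2 : ∑ K, G⁻¹ J K * ∑ L, aChr D G L I K * D L f =
      ∑ K, (∑ L, G⁻¹ J L * aChr D G K I L) * D K f := by
    simp only [mul_sum, sum_mul]
    exact sum_swap fun _ _ => by ring
  simp only [aHess, mul_sub, sum_sub_distrib, e2, e1]
  simp only [grad, map_sum, leibniz, smul_eq_mul, h, sum_add_distrib,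
    mul_neg, mul_add, sum_neg_distrib]
  simp only [mul_comm (D _ f)]
  ring

lemma divMixed_add (T U : Matrix ι ι A) (I : ι) :
    divMixed D G (T + U) I = divMixed D G T I + divMixed D G U I := by
  simp only [divMixed, add_app, map_add, mul_add, sum_add_distrib]; ring

lemma divMixed_hess (hD : ∀ I J a, D I (D J a) = D J (D I a)) (hG : G.IsSymm) (f : A) (I : ι) :
    divMixed D G (of fun J I => D I (grad D G f J) + ∑ K, aChr D G J I K * grad D G f K) I = D I
    (∑ J, (D J (grad D G f J) + ∑ K, aChr D G J J K * grad D G f K)) + ∑ K, aRic D G K I * grad D G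
    f K := by
  set p := grad D G f
  have hric : ∑ K, aRic D G K I * p K =
      ∑ J, ∑ K, D J (aChr D G J I K) * p K - ∑ J, ∑ K, D I (aChr D G J J K) * p K +
      ∑ J, ∑ L, ∑ K, aChr D G J J L * (aChr D G L I K * p K) -
      ∑ M, ∑ L, ∑ K, aChr D G M I L * (aChr D G L M K * p K) := by
    have s1 : ∑ K, (∑ J, D J (aChr D G J K I)) * p K = ∑ J, ∑ K, D J (aChr D G J I K) * p K := by
      simp only [sum_mul]; rw [sum_comm]; simp only [aChr_symm hG _ _ I]
    have s2 : ∑ K, (∑ J, D I (aChr D G J K J)) * p K = ∑ J, ∑ K, D I (aChr D G J J K) * p K := by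
      simp only [sum_mul]; exact sum_swap fun J K => by rw [aChr_symm hG J K J]
    have s3 : ∑ K, (∑ J, ∑ L, aChr D G J J L * aChr D G L K I) * p K =
        ∑ J, ∑ L, ∑ K, aChr D G J J L * (aChr D G L I K * p K) := by
      simp only [sum_mul]; rw [sum_comm]
      refine sum_ext fun J => ?_
      refine sum_swap fun L K => ?_
      rw [aChr_symm hG L K I]; ring
    have s4 : ∑ K, (∑ J, ∑ L, aChr D G J I L * aChr D G L K J) * p K =
        ∑ J, ∑ L, ∑ K, aChr D G J I L * (aChr D G L J K * p K) := by
      simp only [sum_mul]; rw [sum_comm]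
      refine sum_ext fun J => ?_
      refine sum_swap fun L K => ?_
      rw [aChr_symm hG L K J]; ring
    simp only [aRic, sum_sub_distrib, add_mul, sub_mul, sum_add_distrib]
    rw [s1, s2, s3, s4]; ring
  rw [hric]
  simp only [divMixed, of_apply, map_add, map_sum, leibniz, smul_eq_mul, mul_add,
    sum_add_distrib, mul_sum]
  have c1 : ∑ J, D J (D I (p J)) = ∑ J, D I (D J (p J)) := sum_ext fun J => hD _ _ _
  have c2 : ∀ (a b : ι → ι → A), ∑ J, ∑ K, a J K * b J K = ∑ J, ∑ K, b J K * a J K := fun a b =>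
    sum_ext₂ fun _ _ => mul_comm _ _
  rw [c1, c2 (fun J K => p K) (fun J K => D J (aChr D G J I K)),
    c2 (fun J K => p K) (fun J K => D I (aChr D G J J K))]
  ring

lemma divMixed_one (hG : G.IsSymm) (I : ι) (c : ℝ) :
    divMixed D G (algebraMap ℝ A c • (1 : Matrix ι ι A)) I = 0 := by
  have : ∀ J, D J (algebraMap ℝ A c * (1 : Matrix ι ι A) J I) = 0 := by
    intro J
    rcases eq_or_ne J I with rfl | h
    · simp
    · simp [h]
  simp only [divMixed, Matrix.smul_apply, smul_eq_mul, this, sum_const_zero, zero_add]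
  simp only [one_app, mul_ite, mul_one, mul_zero, sum_ite_eq', mem_univ, if_true]
  rw [sub_eq_zero]
  exact sum_ext fun J => by rw [aChr_symm hG J J I]

lemma aLap_eq (hG : G.IsSymm) (hu : IsUnit G.det) (f : A) :
    aLap D G f = ∑ J, (D J (grad D G f J) + ∑ K, aChr D G J J K * grad D G f K) := by
  unfold aLap
  exact sum_ext fun J => raise_aHess hG hu f J J

lemma aGradSq_eq (f : A) : aGradSq D G f = ∑ K, D K f * grad D G f K := by
  unfold aGradSq grad
  refine sum_ext fun J => ?_
  rw [mul_sum]
  exact sum_ext fun _ => by ring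

lemma derivation_aGradSq (hG : G.IsSymm) (hu : IsUnit G.det) (f : A) (I : ι) :
    D I (aGradSq D G f) = 2 * ∑ K, aHess D G f I K * grad D G f K := by
  set p := grad D G f with hp
  have h : ∀ K, D I (p K) = ∑ L, G⁻¹ K L * aHess D G f I L - ∑ L, aChr D G K I L * p L := by
    intro K; rw [raise_aHess hG hu]; ring
  have e1 : ∑ K, D K f * ∑ L, G⁻¹ K L * aHess D G f I L = ∑ K, aHess D G f I K * p K := by
    simp only [hp, grad, mul_sum]
    refine sum_swap fun K L => ?_
    rw [(inv_isSymm hG).apply]; ring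
  have e2 : ∑ K, D K f * ∑ L, aChr D G K I L * p L = ∑ L, (∑ K, aChr D G K I L * D K f) * p L := by
    simp only [mul_sum, sum_mul]
    exact sum_swap fun _ _ => by ring
  have e3 : ∑ K, D I (D K f) * p K = ∑ K, aHess D G f I K * p K +
      ∑ L, (∑ K, aChr D G K I L * D K f) * p L := by
    rw [← sum_add_distrib]
    exact sum_ext fun _ => by unfold aHess; ring
  rw [aGradSq_eq, ← hp]
  simp only [map_sum, leibniz, smul_eq_mul, sum_add_distrib, h, mul_sub, sum_sub_distrib, e1, e2]
  simp only [mul_comm (p _) (D I _), e3]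
  ring

/-- The weighted contracted Bianchi identity. -/
lemma weighted_bianchi (hD : ∀ I J a, D I (D J a) = D J (D I a)) (hG : G.IsSymm) (hu : IsUnit G.det)
    (f : A) (lam : ℝ) (I : ι) : 2 *
    (divMixed D G (G⁻¹ * of (aP D G f lam)) I - ∑ K, aP D G f lam K I * grad D G f K) = D I
    (∑ K, ∑ L, G⁻¹ K L * aP D G f lam K L + aF D G f lam) := by
  have h1 : G⁻¹ * G = 1 := nonsing_inv_mul _ hu
  have hmix : G⁻¹ * of (aP D G f lam) = G⁻¹ * of (aRic D G) +
      ((of fun J I => D I (grad D G f J) + ∑ K, aChr D G J I K * grad D G f K) +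
        algebraMap ℝ A (-lam) • (1 : Matrix ι ι A)) := by
    have : of (aP D G f lam) = of (aRic D G) + of (aHess D G f) + algebraMap ℝ A (-lam) • G := by
      ext a b
      simp only [aP, of_apply, add_app, Matrix.smul_apply, smul_eq_mul, map_neg]
      ring
    rw [this, mul_add, mul_add, add_assoc, Matrix.mul_smul, h1]
    congr 2
    ext J I
    simp only [mul_app, of_apply]
    rw [← raise_aHess hG hu]
    exact sum_ext fun K => by rw [aHess_symm hD hG]
  have htr : ∑ K, ∑ L, G⁻¹ K L * aP D G f lam K L = ∑ K, ∑ L, G⁻¹ K L * aRic D G K L + aLap D G f -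
        algebraMap ℝ A ((Fintype.card ι : ℝ) * lam) := by
    have : ∑ K, ∑ L, G⁻¹ K L * (algebraMap ℝ A lam * G K L) =
        algebraMap ℝ A ((Fintype.card ι : ℝ) * lam) := by
      have e : ∑ K, ∑ L, G⁻¹ K L * G L K = (Fintype.card ι : A) := by
        have := congrArg trace h1
        simpa [trace, mul_app] using this
      rw [map_mul, map_natCast, ← e, sum_mul]
      refine sum_ext fun K => ?_
      rw [sum_mul]
      exact sum_ext fun L => by rw [hG.apply K L]; ring
    simp only [aP, mul_add, mul_sub, sum_add_distrib, sum_sub_distrib, this, aLap]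
  have hP : ∑ K, aP D G f lam K I * grad D G f K = ∑ K, aRic D G K I * grad D G f K +
      ∑ K, aHess D G f I K * grad D G f K - algebraMap ℝ A lam * D I f := by
    have : ∑ K, algebraMap ℝ A lam * G K I * grad D G f K = algebraMap ℝ A lam * D I f := by
      have e := congrFun (Matrix.mulVec_mulVec (fun K => D K f) G G⁻¹) I
      rw [mul_nonsing_inv _ hu, Matrix.one_mulVec] at e
      rw [← e, mulVec, dotProduct, mul_sum]
      exact sum_ext fun K => by rw [hG.apply I K]; unfold grad mulVec dotProduct; ring
    simp only [aP, add_mul, sub_mul, sum_add_distrib, sum_sub_distrib, this]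
    simp only [aHess_symm hD hG f I]
  rw [hmix, divMixed_add, divMixed_add, divMixed_one hG, divMixed_hess hD hG, ← aLap_eq hG hu,
    hP, htr, aF]
  have h2 : D I (2 * algebraMap ℝ A lam * f) = 2 * algebraMap ℝ A lam * D I f := by
    rw [← map_ofNat (algebraMap ℝ A) 2, ← map_mul, leibniz, Derivation.map_algebraMap,
      smul_zero, add_zero, smul_eq_mul]
  simp only [map_add, map_sub, h2, Derivation.map_algebraMap, derivation_aGradSq hG hu]
  have := contracted_bianchi hD hG hu I
  linear_combination this

/-! #### Naturality -/

lemma sum_reorder {B : Type*} [AddCommMonoid B] (H : ι → ι → ι → ι → B) :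
    ∑ a, ∑ M, ∑ N, ∑ b, H a M N b = ∑ b, ∑ N, ∑ M, ∑ a, H a M N b := by
  calc _ = ∑ a, ∑ M, ∑ b, ∑ N, H a M N b := sum_ext₂ fun _ _ => sum_comm
    _ = ∑ a, ∑ b, ∑ M, ∑ N, H a M N b := sum_ext fun _ => sum_comm
    _ = ∑ b, ∑ a, ∑ M, ∑ N, H a M N b := sum_comm
    _ = ∑ b, ∑ a, ∑ N, ∑ M, H a M N b := sum_ext₂ fun _ _ => sum_comm
    _ = ∑ b, ∑ N, ∑ a, ∑ M, H a M N b := sum_ext fun _ => sum_comm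
    _ = _ := sum_ext₂ fun _ _ => sum_comm

variable {B : Type*} [CommRing B] [Algebra ℝ B] {D' : ι → Derivation ℝ B B}

section Naturality

variable (σ : A →ₐ[ℝ] B) (Q : Matrix ι ι B)

/-- The pullback of a matrix of components by a ring homomorphism with Jacobian matrix `Q`. -/
def pullMat (σ : A →ₐ[ℝ] B) (Q : Matrix ι ι B) (G : Matrix ι ι A) : Matrix ι ι B :=
  Q.transpose * G.map σ * Q

variable {σ Q}

lemma pullMat_apply (G : Matrix ι ι A) (I J : ι) :
    pullMat σ Q G I J = ∑ a, ∑ b, Q a I * Q b J * σ (G a b) := by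
  simp only [pullMat, mul_app, Matrix.transpose_apply, map_apply, sum_mul]
  exact sum_swap fun _ _ => by ring

lemma pullMat_isSymm (hG : G.IsSymm) : (pullMat σ Q G).IsSymm := by
  unfold pullMat Matrix.IsSymm
  rw [transpose_mul, transpose_mul, Matrix.transpose_transpose, mul_assoc,
    ← Matrix.transpose_map, hG.eq]

lemma isUnit_det_map (hu : IsUnit G.det) : IsUnit (G.map σ).det := by
  have h : (G.map σ).det = σ G.det := by
    rw [show G.map σ = (σ : A →+* B).mapMatrix G from rfl, ← RingHom.map_det]; rfl
  rw [h]; exact hu.map σ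

lemma isUnit_det_pullMat (hu : IsUnit G.det) (hQ : IsUnit Q.det) : IsUnit (pullMat σ Q G).det := by
  rw [pullMat, Matrix.det_mul, Matrix.det_mul, Matrix.det_transpose]
  exact (hQ.mul (isUnit_det_map hu)).mul hQ

lemma map_inv_map (hu : IsUnit G.det) : (G⁻¹).map σ = (G.map σ)⁻¹ := by
  refine (Matrix.inv_eq_left_inv ?_).symm
  rw [← Matrix.map_mul, nonsing_inv_mul _ hu, Matrix.map_one] <;> simp

variable (hchain : ∀ I a, D' I (σ a) = ∑ L, Q L I * σ (D L a))
  (hQs : ∀ I J L, D' I (Q L J) = D' J (Q L I))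

/-- The pulled back connection matrices, before the change of frame. -/
def pullConn (σ : A →ₐ[ℝ] B) (Q : Matrix ι ι B) (C : ι → Matrix ι ι A) (I : ι) : Matrix ι ι B :=
  ∑ M, Q M I • (C M).map σ

lemma pullConn_apply (C : ι → Matrix ι ι A) (I a b : ι) :
    pullConn σ Q C I a b = ∑ M, Q M I * σ (C M a b) := by simp [pullConn, Matrix.sum_apply]

include hchain in
lemma dMat_map (I : ι) (M : Matrix ι ι A) :
    dMat (D' I) (M.map σ) = ∑ L, Q L I • (dMat (D L) M).map σ := by
  ext a b; simp [hchain, Matrix.sum_apply]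

include hchain hQs in
lemma aChr_pullMat (hG : G.IsSymm) (hu : IsUnit G.det) (hQ : IsUnit Q.det) (K I J : ι) : aChr D'
    (pullMat σ Q G) K I J = (Q⁻¹ * (dMat (D' I) Q + pullConn σ Q (conn D G) I * Q)) K J := by
  have q1 : Q * Q⁻¹ = 1 := mul_nonsing_inv _ hQ
  have hsym : ∀ I J L, (dMat (D' I) Q + pullConn σ Q (conn D G) I * Q) L J =
      (dMat (D' J) Q + pullConn σ Q (conn D G) J * Q) L I := by
    intro I J L
    simp only [add_app, dMat_apply, mul_app, pullConn_apply, hQs I J L, sum_mul]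
    congr 1
    refine sum_swap fun a b => ?_
    rw [conn_symm hG a b L]; ring
  refine eq_aChr_of_compat (pullMat_isSymm hG) (isUnit_det_pullMat hu hQ)
    (fun I => Q⁻¹ * (dMat (D' I) Q + pullConn σ Q (conn D G) I * Q)) ?_ ?_ K I J
  · intro I J K
    change ∑ L, Q⁻¹ K L * _ = ∑ L, Q⁻¹ K L * _
    exact sum_ext fun L => congrArg (Q⁻¹ K L * ·) (hsym I J L)
  · intro I
    set C' := Q⁻¹ * (dMat (D' I) Q + pullConn σ Q (conn D G) I * Q) with hC'
    have hC : dMat (D' I) Q = Q * C' - pullConn σ Q (conn D G) I * Q := by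
      rw [hC', ← mul_assoc, q1, one_mul]; abel
    have hĜ : dMat (D' I) (G.map σ) = (pullConn σ Q (conn D G) I).transpose * G.map σ +
          G.map σ * pullConn σ Q (conn D G) I := by
      rw [dMat_map hchain]
      simp only [pullConn, Matrix.transpose_sum, sum_mul, mul_sum,
        ← sum_add_distrib, Matrix.transpose_smul, Matrix.smul_mul, Matrix.mul_smul, ← smul_add]
      refine sum_ext fun L => ?_
      rw [dMat_metric hG hu, ← Matrix.map_mul.symm.symm]
      congr 1
      ext a b
      simp [mul_app]
    unfold pullMat
    rw [dMat_mul, dMat_mul, dMat_transpose, hĜ, hC]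
    simp only [Matrix.transpose_sub, transpose_mul]
    noncomm_ring

include hchain hQs in
lemma curvOf_pullConn (C : ι → Matrix ι ι A) (I J : ι) :
    curvOf D' (pullConn σ Q C) I J = ∑ M, ∑ N, (Q M I * Q N J) • (curvOf D C M N).map σ := by
  ext a b
  have e1 : ∀ I J, D' I (pullConn σ Q C J a b) = ∑ M, D' I (Q M J) * σ (C M a b) +
      ∑ M, ∑ N, Q M I * Q N J * σ (D M (C N a b)) := by
    intro I J
    rw [pullConn_apply, map_sum]
    simp only [leibniz, hchain, smul_eq_mul, sum_add_distrib, mul_sum]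
    rw [add_comm, sum_comm (γ := ι)]
    congr 1
    · exact sum_ext fun _ => by ring
    · exact sum_ext₂ fun _ _ => by ring
  have e2 : ∀ I J, ∑ c, pullConn σ Q C I a c * pullConn σ Q C J c b =
      ∑ M, ∑ N, Q M I * Q N J * ∑ c, σ (C M a c) * σ (C N c b) := by
    intro I J
    simp only [pullConn_apply, Finset.sum_mul_sum]
    rw [sum_comm]
    refine sum_ext fun M => ?_
    rw [sum_comm]
    refine sum_ext fun N => ?_
    rw [mul_sum]
    exact sum_ext fun c => by ring
  have e3 : ∀ F : ι → ι → B, ∑ M, ∑ N, Q M J * Q N I * F M N = ∑ M, ∑ N, Q M I * Q N J * F N M := by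
    intro F
    exact sum_swap fun _ _ => by ring
  simp only [curvOf, add_app, Matrix.sub_apply, dMat_apply, mul_app,
    Matrix.sum_apply, Matrix.smul_apply, map_apply, smul_eq_mul, map_add, map_sub, map_sum,
    map_mul, e1, e2]
  rw [e3, e3 (fun M N => ∑ c, σ (C M a c) * σ (C N c b))]
  simp only [hQs I J, mul_add, mul_sub, sum_add_distrib, sum_sub_distrib]
  ring

include hchain hQs in
lemma aRic_pullMat (hD' : ∀ I J a, D' I (D' J a) = D' J (D' I a)) (hG : G.IsSymm)
    (hu : IsUnit G.det) (hQ : IsUnit Q.det) (I J : ι) :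
    aRic D' (pullMat σ Q G) I J = ∑ a, ∑ b, Q a I * Q b J * σ (aRic D G a b) := by
  have q1 : Q * Q⁻¹ = 1 := mul_nonsing_inv _ hQ
  have q2 : Q⁻¹ * Q = 1 := nonsing_inv_mul _ hQ
  set C' := conn D' (pullMat σ Q G) with hC'
  set Ĉ := pullConn σ Q (conn D G) with hĈ
  have hc : ∀ I, Q * C' I = dMat (D' I) Q + Ĉ I * Q := by
    intro I
    have : C' I = Q⁻¹ * (dMat (D' I) Q + Ĉ I * Q) := by
      ext a b; exact aChr_pullMat hchain hQs hG hu hQ a I b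
    rw [this, ← mul_assoc, q1, one_mul]
  have hd : ∀ I J, Q * dMat (D' I) (C' J) = dMat (D' I) (dMat (D' J) Q) + dMat (D' I) (Ĉ J) * Q +
      Ĉ J * dMat (D' I) Q - dMat (D' I) Q * C' J := by
    intro I J
    have := congrArg (dMat (D' I)) (hc J)
    rw [dMat_mul, dMat_add, dMat_mul] at this
    rw [eq_sub_iff_add_eq, add_comm, this]; abel
  have hR : ∀ I J, Q * curvOf D' C' I J = curvOf D' Ĉ I J * Q := by
    intro I J
    have h3 : ∀ I J, Q * (C' I * C' J) = dMat (D' I) Q * C' J + Ĉ I * dMat (D' J) Q +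
        Ĉ I * Ĉ J * Q := by
      intro I J
      rw [← mul_assoc, hc I, add_mul, mul_assoc (Ĉ I), hc J, mul_add]; noncomm_ring
    simp only [curvOf, mul_add, mul_sub, hd, h3, dMat_comm (hD' I J)]
    noncomm_ring
  have hR' : ∀ I J, curvOf D' C' I J = Q⁻¹ * (curvOf D' Ĉ I J * Q) := by
    intro I J; rw [← hR, ← mul_assoc, q2, one_mul]
  rw [aRic_eq_curv (pullMat_isSymm hG), ← hC']
  have step : ∀ K, curvOf D' C' K J K I = ∑ b, ∑ N, ∑ M, ∑ a, (Q⁻¹ K a * Q M K) *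
      (Q N J * Q b I * σ (curvOf D (conn D G) M N a b)) := by
    intro K
    rw [hR', curvOf_pullConn hchain hQs]
    simp only [mul_app, Matrix.sum_apply, Matrix.smul_apply, map_apply,
      smul_eq_mul, sum_mul, mul_sum]
    rw [sum_reorder]
    exact sum_ext₂ fun b N => sum_ext₂ fun M a => by ring
  have hδ : ∀ a M, ∑ K, Q⁻¹ K a * Q M K = if M = a then 1 else 0 := by
    intro a M
    have := congrFun (congrFun q1 M) a
    rw [mul_app, one_app] at this
    rw [← this]; exact sum_ext fun _ => mul_comm _ _
  simp only [step]
  rw [sum_comm]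
  refine sum_ext fun b => ?_
  rw [sum_comm]
  refine sum_ext fun N => ?_
  rw [sum_comm, aRic_eq_curv hG, map_sum, mul_sum]
  refine sum_ext fun M => ?_
  rw [sum_comm]
  simp only [← sum_mul, hδ, ite_mul, one_mul, zero_mul, Finset.sum_ite_eq, mem_univ, if_true]
  ring

include hchain hQs in
lemma aHess_pullMat (hG : G.IsSymm) (hu : IsUnit G.det) (hQ : IsUnit Q.det) (f : A) (I J : ι) :
    aHess D' (pullMat σ Q G) (σ f) I J = ∑ a, ∑ b, Q a I * Q b J * σ (aHess D G f a b) := by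
  have q1 : Q * Q⁻¹ = 1 := mul_nonsing_inv _ hQ
  have hc : ∀ L, ∑ K, Q L K * aChr D' (pullMat σ Q G) K I J =
      D' I (Q L J) + ∑ a, ∑ b, Q a I * Q b J * σ (aChr D G L a b) := by
    intro L
    have : Q * (Q⁻¹ * (dMat (D' I) Q + pullConn σ Q (conn D G) I * Q)) =
        dMat (D' I) Q + pullConn σ Q (conn D G) I * Q := by rw [← mul_assoc, q1, one_mul]
    have e : ∑ K, Q L K * aChr D' (pullMat σ Q G) K I J =
        (Q * (Q⁻¹ * (dMat (D' I) Q + pullConn σ Q (conn D G) I * Q))) L J := by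
      rw [mul_app]
      exact sum_ext fun K => by rw [aChr_pullMat hchain hQs hG hu hQ]
    rw [e, this, add_app, dMat_apply, mul_app]
    congr 1
    simp only [pullConn_apply, sum_mul]
    exact sum_swap fun a b => by simp only [conn, of_apply]; ring
  have e1 : ∑ K, aChr D' (pullMat σ Q G) K I J * D' K (σ f) = ∑ L, D' I (Q L J) * σ (D L f) +
        ∑ L, ∑ a, ∑ b, Q a I * Q b J * σ (aChr D G L a b) * σ (D L f) := by
    simp only [← sum_mul, ← add_mul, ← sum_add_distrib, ← hc]
    simp only [hchain, mul_sum, sum_mul]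
    exact sum_swap fun _ _ => by ring
  have e2 : D' I (D' J (σ f)) = ∑ L, D' I (Q L J) * σ (D L f) +
      ∑ a, ∑ b, Q a I * Q b J * σ (D a (D b f)) := by
    rw [hchain J, map_sum]
    simp only [leibniz, hchain, smul_eq_mul, sum_add_distrib, mul_sum]
    rw [add_comm, sum_comm (γ := ι)]
    congr 1
    · exact sum_ext fun _ => by ring
    · exact sum_ext₂ fun _ _ => by ring
  have e3 : ∑ L, ∑ a, ∑ b, Q a I * Q b J * σ (aChr D G L a b) * σ (D L f) =
      ∑ a, ∑ b, Q a I * Q b J * ∑ L, σ (aChr D G L a b) * σ (D L f) := by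
    rw [sum_comm]
    refine sum_ext fun a => ?_
    rw [sum_comm]
    refine sum_ext fun b => ?_
    rw [mul_sum]
    exact sum_ext fun _ => by ring
  unfold aHess
  rw [show ∑ K, aChr D' (pullMat σ Q G) K I J * (D' K) (σ f) = _ from e1, e2, e3]
  simp only [map_sub, map_sum, map_mul, mul_sub, sum_sub_distrib]
  ring

include hchain hQs in
/-- Naturality of the weighted tensor. -/
lemma aP_pullMat (hD' : ∀ I J a, D' I (D' J a) = D' J (D' I a)) (hG : G.IsSymm) (hu : IsUnit G.det)
    (hQ : IsUnit Q.det) (f : A) (lam : ℝ) (I J : ι) :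
    aP D' (pullMat σ Q G) (σ f) lam I J = ∑ a, ∑ b, Q a I * Q b J * σ (aP D G f lam a b) := by
  unfold aP
  rw [aRic_pullMat hchain hQs hD' hG hu hQ, aHess_pullMat hchain hQs hG hu hQ, pullMat_apply]
  simp only [map_add, map_sub, map_mul, mul_add, mul_sub, sum_add_distrib, sum_sub_distrib, mul_sum]
  congr 1
  exact sum_ext₂ fun _ _ => by rw [AlgHom.commutes]; ring

lemma inv_pullMat (hQ : IsUnit Q.det) : Q * (pullMat σ Q G)⁻¹ * Q.transpose = (G.map σ)⁻¹ := by
  have q1 : Q * Q⁻¹ = 1 := mul_nonsing_inv _ hQ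
  have hQt : IsUnit Q.transpose.det := by rwa [Matrix.det_transpose]
  unfold pullMat
  rw [Matrix.mul_inv_rev, Matrix.mul_inv_rev, ← mul_assoc, q1, one_mul, mul_assoc,
    nonsing_inv_mul _ hQt, mul_one]

lemma sum_inv_pullMat (hQ : IsUnit Q.det) (F : ι → ι → B) : ∑ I, ∑ J, (pullMat σ Q G)⁻¹ I J * ∑ a, ∑
    b, Q a I * Q b J * F a b = ∑ a, ∑ b, (G.map σ)⁻¹ a b * F a b := by
  rw [← inv_pullMat hQ]
  simp only [mul_app, Matrix.transpose_apply, sum_mul, mul_sum]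
  have c : ∀ H : ι → ι → ι → ι → B, ∑ I, ∑ J, ∑ a, ∑ b, H I J a b =
      ∑ a, ∑ b, ∑ J, ∑ I, H I J a b := by
    intro H
    calc _ = ∑ I, ∑ a, ∑ J, ∑ b, H I J a b := sum_ext fun I => sum_comm
      _ = ∑ a, ∑ I, ∑ J, ∑ b, H I J a b := sum_comm
      _ = ∑ a, ∑ I, ∑ b, ∑ J, H I J a b := sum_ext₂ fun a I => sum_comm
      _ = ∑ a, ∑ b, ∑ I, ∑ J, H I J a b := sum_ext fun a => sum_comm
      _ = _ := sum_ext₂ fun a b => sum_comm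
  rw [c]
  exact sum_ext₂ fun _ _ => sum_ext₂ fun _ _ => by ring

include hchain hQs in
/-- Naturality of the weighted function. -/
lemma aF_pullMat (hG : G.IsSymm) (hu : IsUnit G.det) (hQ : IsUnit Q.det) (f : A) (lam : ℝ) :
    aF D' (pullMat σ Q G) (σ f) lam = σ (aF D G f lam) := by
  have h1 : aLap D' (pullMat σ Q G) (σ f) = σ (aLap D G f) := by
    unfold aLap
    simp only [aHess_pullMat hchain hQs hG hu hQ]
    rw [sum_inv_pullMat hQ]
    simp [map_sum, ← map_inv_map hu]
  have h2 : aGradSq D' (pullMat σ Q G) (σ f) = σ (aGradSq D G f) := by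
    have : ∀ I J, D' I (σ f) * D' J (σ f) = ∑ a, ∑ b, Q a I * Q b J * (σ (D a f) * σ (D b f)) := by
      intro I J
      rw [hchain, hchain, Finset.sum_mul_sum]
      exact sum_ext₂ fun _ _ => by ring
    unfold aGradSq
    simp only [mul_assoc _ (D' _ _) (D' _ _), this]
    rw [sum_inv_pullMat hQ]
    simp [map_sum, ← map_inv_map hu, mul_assoc]
  unfold aF
  rw [h1, h2]
  simp [map_ofNat]

end Naturality

end Algebraic

end

section

/-! ### Congruence modulo a differential ideal -/

section Congruence

variable {A : Type*} [CommRing A] [Algebra ℝ A]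
variable {ι : Type*} [Fintype ι] [DecidableEq ι]
variable {D : ι → Derivation ℝ A A} {G₁ G₂ : Matrix ι ι A} {T : Ideal A}

lemma inv_congr (h₁ : IsUnit G₁.det) (h₂ : IsUnit G₂.det) (h : ∀ i j, G₁ i j - G₂ i j ∈ T)
    (i j : ι) : G₁⁻¹ i j - G₂⁻¹ i j ∈ T := by
  have e : G₁⁻¹ - G₂⁻¹ = G₁⁻¹ * (G₂ - G₁) * G₂⁻¹ := by
    rw [mul_sub, sub_mul, nonsing_inv_mul _ h₁, mul_assoc, mul_nonsing_inv _ h₂, one_mul, mul_one]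
  rw [← Matrix.sub_apply, e]
  simp only [mul_app, Matrix.sub_apply]
  refine sum_mem fun k _ => T.mul_mem_right _ (sum_mem fun l _ => T.mul_mem_left _ ?_)
  rw [← neg_sub]; exact T.neg_mem (h l k)

variable (hT : ∀ i, ∀ a ∈ T, D i a ∈ T)

include hT in
lemma mk_derivation {a b : A} (h : Ideal.Quotient.mk T a = Ideal.Quotient.mk T b) (i : ι) :
    Ideal.Quotient.mk T (D i a) = Ideal.Quotient.mk T (D i b) := by
  rw [Ideal.Quotient.eq] at h ⊢
  rw [← map_sub]; exact hT i _ h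

include hT in
lemma aChr_congr (h₁ : IsUnit G₁.det) (h₂ : IsUnit G₂.det) (h : ∀ i j, G₁ i j - G₂ i j ∈ T)
    (K I J : ι) :
    Ideal.Quotient.mk T (aChr D G₁ K I J) = Ideal.Quotient.mk T (aChr D G₂ K I J) := by
  have hi : ∀ i j, Ideal.Quotient.mk T (G₁⁻¹ i j) = Ideal.Quotient.mk T (G₂⁻¹ i j) :=
    fun i j => Ideal.Quotient.eq.2 (inv_congr h₁ h₂ h i j)
  have hd : ∀ k i j, Ideal.Quotient.mk T (D k (G₁ i j)) = Ideal.Quotient.mk T (D k (G₂ i j)) :=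
    fun k i j => mk_derivation hT (Ideal.Quotient.eq.2 (h i j)) k
  simp only [aChr, map_mul, map_sum, map_add, map_sub, hi, hd]

include hT in
lemma aRic_congr (h₁ : IsUnit G₁.det) (h₂ : IsUnit G₂.det) (h : ∀ i j, G₁ i j - G₂ i j ∈ T)
    (I J : ι) : Ideal.Quotient.mk T (aRic D G₁ I J) = Ideal.Quotient.mk T (aRic D G₂ I J) := by
  have hc := aChr_congr hT h₁ h₂ h
  have hd : ∀ i K I J, Ideal.Quotient.mk T (D i (aChr D G₁ K I J)) =
      Ideal.Quotient.mk T (D i (aChr D G₂ K I J)) := fun i K I J => mk_derivation hT (hc K I J) i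
  simp only [aRic, map_mul, map_sum, map_add, map_sub, hc, hd]

include hT in
lemma aHess_congr (h₁ : IsUnit G₁.det) (h₂ : IsUnit G₂.det) (h : ∀ i j, G₁ i j - G₂ i j ∈ T)
    {f₁ f₂ : A} (hf : f₁ - f₂ ∈ T) (I J : ι) :
    Ideal.Quotient.mk T (aHess D G₁ f₁ I J) = Ideal.Quotient.mk T (aHess D G₂ f₂ I J) := by
  have hc := aChr_congr hT h₁ h₂ h
  have hd := mk_derivation hT (Ideal.Quotient.eq.2 hf)
  have hdd := fun i => mk_derivation hT (hd i)
  simp only [aHess, map_mul, map_sum, map_sub, hc, hd, hdd]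

include hT in
lemma aP_congr (h₁ : IsUnit G₁.det) (h₂ : IsUnit G₂.det) (h : ∀ i j, G₁ i j - G₂ i j ∈ T)
    {f₁ f₂ : A} (hf : f₁ - f₂ ∈ T) (lam : ℝ) (I J : ι) :
    Ideal.Quotient.mk T (aP D G₁ f₁ lam I J) = Ideal.Quotient.mk T (aP D G₂ f₂ lam I J) := by
  simp only [aP, map_add, map_sub, map_mul, aRic_congr hT h₁ h₂ h, aHess_congr hT h₁ h₂ h hf,
    Ideal.Quotient.eq.2 (h I J)]

include hT in
lemma aF_congr (h₁ : IsUnit G₁.det) (h₂ : IsUnit G₂.det) (h : ∀ i j, G₁ i j - G₂ i j ∈ T)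
    {f₁ f₂ : A} (hf : f₁ - f₂ ∈ T) (lam : ℝ) :
    Ideal.Quotient.mk T (aF D G₁ f₁ lam) = Ideal.Quotient.mk T (aF D G₂ f₂ lam) := by
  have hi : ∀ i j, Ideal.Quotient.mk T (G₁⁻¹ i j) = Ideal.Quotient.mk T (G₂⁻¹ i j) :=
    fun i j => Ideal.Quotient.eq.2 (inv_congr h₁ h₂ h i j)
  have hd := mk_derivation hT (Ideal.Quotient.eq.2 hf)
  simp only [aF, aLap, aGradSq, map_add, map_sub, map_mul, map_sum,
    aHess_congr hT h₁ h₂ h hf, hi, hd, Ideal.Quotient.eq.2 hf]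

end Congruence

/-! ### Images under homomorphisms that commute with the derivations -/

section Hom

variable {A B : Type*} [CommRing A] [Algebra ℝ A] [CommRing B] [Algebra ℝ B]
variable {ι : Type*} [Fintype ι] [DecidableEq ι]
variable {D : ι → Derivation ℝ A A} {D' : ι → Derivation ℝ B B} (σ : A →ₐ[ℝ] B)
  (hσ : ∀ i a, σ (D i a) = D' i (σ a)) {G : Matrix ι ι A} (hu : IsUnit G.det)

include hσ hu in
lemma map_aChr (K I J : ι) : σ (aChr D G K I J) = aChr D' (G.map σ) K I J := by
  simp only [aChr, half, map_mul, map_sum, map_add, map_sub, hσ, ← map_inv_map hu,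
    map_apply, AlgHom.commutes]

include hσ hu in
lemma map_aRic (I J : ι) : σ (aRic D G I J) = aRic D' (G.map σ) I J := by
  simp only [aRic, map_mul, map_sum, map_add, map_sub, hσ, map_aChr σ hσ hu]

include hσ hu in
lemma map_aHess (f : A) (I J : ι) : σ (aHess D G f I J) = aHess D' (G.map σ) (σ f) I J := by
  simp only [aHess, map_mul, map_sum, map_sub, hσ, map_aChr σ hσ hu]

include hσ hu in
lemma map_aP (f : A) (lam : ℝ) (I J : ι) :
    σ (aP D G f lam I J) = aP D' (G.map σ) (σ f) lam I J := by
  simp only [aP, map_mul, map_add, map_sub, map_aRic σ hσ hu, map_aHess σ hσ hu, AlgHom.commutes,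
    map_apply]

include hσ hu in
lemma map_aF (f : A) (lam : ℝ) : σ (aF D G f lam) = aF D' (G.map σ) (σ f) lam := by
  simp only [aF, aLap, aGradSq, map_mul, map_sum, map_add, map_sub, map_aHess σ hσ hu, hσ,
    ← map_inv_map hu, map_apply, AlgHom.commutes, map_ofNat]

end Hom

/-! ### Formal neighbourhoods of a hypersurface -/

/-- A differential ring that is separated for the order of vanishing along `X = 0`: the ring of
formal power series in `X` whose coefficients are functions on the hypersurface. -/
structure FormalRing (A : Type*) [CommRing A] [Algebra ℝ A] (ι : Type*) [DecidableEq ι]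
    (iu : ι) where
  /-- The coordinate derivations. -/
  D : ι → Derivation ℝ A A
  comm : ∀ I J a, D I (D J a) = D J (D I a)
  /-- The ideal of the hypersurface. -/
  m : Ideal A
  tangential : ∀ I, I ≠ iu → ∀ a ∈ m, D I a ∈ m
  /-- The defining coordinate of the hypersurface. -/
  X : A
  X_mem : X ∈ m
  D_X : ∀ I, D I X = if I = iu then 1 else 0
  separated : ∀ a, (∀ k, (D iu)^[k] a ∈ m) → a = 0
  isUnit_of : ∀ a b, a * b - 1 ∈ m → IsUnit a

namespace FormalRing

variable {A : Type*} [CommRing A] [Algebra ℝ A] {ι : Type*} [DecidableEq ι] {iu : ι}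
variable (Φ : FormalRing A ι iu)

lemma forall_lt_succ_iff {a : A} {k : ℕ} :
    (∀ j < k + 1, (Φ.D iu)^[j] a ∈ Φ.m) ↔ a ∈ Φ.m ∧ ∀ j < k, (Φ.D iu)^[j] (Φ.D iu a) ∈ Φ.m := by
  constructor
  · exact fun h => ⟨h 0 (Nat.succ_pos _), fun j hj => h (j + 1) (by omega)⟩
  · rintro ⟨h0, h⟩ (_ | j) hj
    · exact h0
    · exact h j (by omega)

lemma iterate_zero' (k : ℕ) : (Φ.D iu)^[k] 0 = 0 := Function.iterate_fixed (map_zero _) k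

lemma iterate_add' (k : ℕ) (a b : A) :
    (Φ.D iu)^[k] (a + b) = (Φ.D iu)^[k] a + (Φ.D iu)^[k] b := iterate_map_add (Φ.D iu) k a b

/-- The ideal of elements vanishing to order `k`. -/
def V (k : ℕ) : Ideal A where
  carrier := {a | ∀ j < k, (Φ.D iu)^[j] a ∈ Φ.m}
  add_mem' ha hb j hj := by rw [iterate_add']; exact Φ.m.add_mem (ha j hj) (hb j hj)
  zero_mem' j _ := by rw [iterate_zero']; exact Φ.m.zero_mem
  smul_mem' c a ha := by
    simp only [Set.mem_ofPred_eq, smul_eq_mul] at ha ⊢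
    induction k generalizing c a with
    | zero => simp
    | succ k ih =>
      have ha' : ∀ j < k, (Φ.D iu)^[j] a ∈ Φ.m := fun j hj => ha j (by omega)
      rw [forall_lt_succ_iff] at ha ⊢
      refine ⟨Φ.m.mul_mem_left _ ha.1, fun j hj => ?_⟩
      rw [leibniz, iterate_add', smul_eq_mul, smul_eq_mul, mul_comm a]
      exact Φ.m.add_mem (ih c _ ha.2 j hj) (ih _ _ ha' j hj)

variable {Φ}

lemma mem_V_succ {a : A} {k : ℕ} : a ∈ Φ.V (k + 1) ↔ a ∈ Φ.m ∧ Φ.D iu a ∈ Φ.V k :=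
  Φ.forall_lt_succ_iff

@[simp] lemma mem_V_zero (a : A) : a ∈ Φ.V 0 := fun j hj => by omega

lemma V_one : Φ.V 1 = Φ.m := by ext a; rw [mem_V_succ]; simp

lemma V_anti {j k : ℕ} (h : j ≤ k) : Φ.V k ≤ Φ.V j := fun _ ha i hi => ha i (by omega)

lemma mem_m_of_mem_V {a : A} {k : ℕ} (hk : 1 ≤ k) (h : a ∈ Φ.V k) : a ∈ Φ.m := by
  rw [← V_one (Φ := Φ)]; exact V_anti hk h

lemma eq_zero_of_forall_mem {a : A} (h : ∀ k, a ∈ Φ.V k) : a = 0 :=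
  Φ.separated a fun k => h (k + 1) k (by omega)

lemma eq_zero_of_forall_mem_succ {a : A} (h : ∀ k, a ∈ Φ.V (k + 1)) : a = 0 :=
  eq_zero_of_forall_mem fun k => V_anti (Nat.le_succ k) (h k)

lemma D_mem {a : A} {k : ℕ} (I : ι) (hI : I ≠ iu) (h : a ∈ Φ.V k) : Φ.D I a ∈ Φ.V k := by
  induction k generalizing a with
  | zero => simp
  | succ k ih =>
    rw [mem_V_succ] at h ⊢
    exact ⟨Φ.tangential I hI _ h.1, by rw [Φ.comm]; exact ih h.2⟩

lemma Du_mem {a : A} {k : ℕ} (h : a ∈ Φ.V (k + 1)) : Φ.D iu a ∈ Φ.V k := (mem_V_succ.1 h).2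

lemma D_mem_pred {a : A} {k : ℕ} (I : ι) (h : a ∈ Φ.V (k + 1)) : Φ.D I a ∈ Φ.V k := by
  by_cases hI : I = iu
  · subst hI; exact Du_mem h
  · exact V_anti (Nat.le_succ k) (D_mem I hI h)

lemma mul_mem_V {a b : A} {j k : ℕ} (ha : a ∈ Φ.V j) (hb : b ∈ Φ.V k) : a * b ∈ Φ.V (j + k) := by
  induction hn : j + k using Nat.strong_induction_on generalizing a b j k with
  | _ n ih =>
  subst hn
  rcases j with _ | j
  · rw [zero_add]; exact mul_mem_left _ _ hb
  rcases k with _ | k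
  · exact mul_mem_right _ _ ha
  rw [show j + 1 + (k + 1) = (j + 1 + k) + 1 by ring, mem_V_succ]
  refine ⟨mul_mem_right _ _ (mem_V_succ.1 ha).1, ?_⟩
  rw [leibniz, smul_eq_mul, smul_eq_mul]
  refine add_mem (ih _ (by omega) ha (Du_mem hb) rfl) ?_
  exact ih _ (by omega) hb (Du_mem ha) (by ring)

lemma X_pow_mem (k : ℕ) : Φ.X ^ k ∈ Φ.V k := by
  induction k with
  | zero => simp
  | succ k ih =>
    rw [pow_succ]
    exact mul_mem_V ih (by rw [V_one]; exact Φ.X_mem)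

lemma X_pow_mul_mem (k : ℕ) (a : A) : Φ.X ^ k * a ∈ Φ.V k := mul_mem_right _ _ (X_pow_mem k)

lemma Du_X_pow_mul (k : ℕ) (a : A) :
    Φ.D iu (Φ.X ^ (k + 1) * a) = Φ.X ^ k * ((k + 1 : ℕ) * a) + Φ.X ^ (k + 1) * Φ.D iu a := by
  rw [leibniz, Derivation.leibniz_pow, Φ.D_X]
  simp only [if_true, smul_eq_mul, nsmul_eq_mul, mul_one, Nat.add_sub_cancel]
  ring

lemma iterate_X_pow_mul (k : ℕ) (a : A) :
    (Φ.D iu)^[k] (Φ.X ^ k * a) - (k.factorial : A) * a ∈ Φ.m := by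
  induction k generalizing a with
  | zero => simp
  | succ k ih =>
    rw [iterate_succ_apply, Du_X_pow_mul, iterate_add']
    have h1 := ih ((k + 1 : ℕ) * a)
    have h2 : (Φ.D iu)^[k] (Φ.X ^ (k + 1) * Φ.D iu a) ∈ Φ.m :=
      X_pow_mul_mem (Φ := Φ) (k + 1) (Φ.D iu a) k (by omega)
    have := Φ.m.add_mem h1 h2
    convert this using 1
    rw [Nat.factorial_succ]; push_cast; ring

lemma expand_mem {a : A} {k : ℕ} (h : a ∈ Φ.V k) :
    a - Φ.X ^ k * (algebraMap ℝ A (k.factorial : ℝ)⁻¹ * (Φ.D iu)^[k] a) ∈ Φ.V (k + 1) := by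
  intro j hj
  rw [sub_eq_add_neg, ← mul_neg, iterate_add']
  rcases Nat.lt_succ_iff_lt_or_eq.1 hj with hj | rfl
  · exact Φ.m.add_mem (h j hj) (X_pow_mul_mem (Φ := Φ) k _ j hj)
  · have := iterate_X_pow_mul (Φ := Φ) j (-(algebraMap ℝ A (j.factorial : ℝ)⁻¹ * (Φ.D iu)^[j] a))
    convert this using 1
    have e : (j.factorial : A) * algebraMap ℝ A (j.factorial : ℝ)⁻¹ = 1 := by
      rw [← map_natCast (algebraMap ℝ A), ← map_mul, mul_inv_cancel₀, map_one]
      exact_mod_cast Nat.factorial_ne_zero j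
    linear_combination -(Φ.D iu)^[j] a * e

variable (Φ) in
/-- Every formal power series in `X` is realized. -/
def Complete : Prop := ∀ c : ℕ → A, ∃ y, ∀ k, y - ∑ j ∈ Finset.range k, c j * Φ.X ^ j ∈ Φ.V k

/-- `Q` preserves congruences to every order, on the elements with initial value `y₀`. -/
def Causal (Φ : FormalRing A ι iu) {κ : Type*} (y₀ : κ → A) (Q : (κ → A) → κ → A) : Prop :=
  ∀ k y z, (∀ i, y i - y₀ i ∈ Φ.m) → (∀ i, z i - y₀ i ∈ Φ.m) →
    (∀ i, y i - z i ∈ Φ.V k) → ∀ i, Q y i - Q z i ∈ Φ.V k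

/-- Uniqueness of formal solutions of differential equations in `X`. -/
lemma ode_unique {κ : Type*} {y₀ : κ → A} {Q : (κ → A) → κ → A} (hQ : Φ.Causal y₀ Q) {y z : κ → A}
    (hy : ∀ i, y i - y₀ i ∈ Φ.m) (hz : ∀ i, z i - y₀ i ∈ Φ.m) (ey : ∀ i, Φ.D iu (y i) = Q y i)
    (ez : ∀ i, Φ.D iu (z i) = Q z i) : y = z := by
  have h : ∀ k i, y i - z i ∈ Φ.V k := by
    intro k
    induction k with
    | zero => simp
    | succ k ih =>
      intro i
      rw [mem_V_succ]
      refine ⟨?_, ?_⟩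
      · have := Φ.m.sub_mem (hy i) (hz i)
        convert this using 1; ring
      · rw [map_sub, ey, ez]; exact hQ k y z hy hz ih i
  funext i
  exact sub_eq_zero.1 (eq_zero_of_forall_mem fun k => h k i)

/-- Existence of formal solutions of differential equations in `X`. -/
lemma ode_exists (hΦ : Φ.Complete) {κ : Type*} {y₀ : κ → A} {Q : (κ → A) → κ → A}
    (hQ : Φ.Causal y₀ Q) : ∃ y : κ → A, (∀ i, y i - y₀ i ∈ Φ.m) ∧ ∀ i, Φ.D iu (y i) = Q y i := by
  let corr : ℕ → (κ → A) → κ → A := fun k y i =>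
    -(algebraMap ℝ A ((k + 1).factorial : ℝ)⁻¹ * (Φ.D iu)^[k] (Φ.D iu (y i) - Q y i))
  let Y : ℕ → κ → A := fun k => Nat.rec y₀ (fun k y i => y i + corr k y i * Φ.X ^ (k + 1)) k
  have Y0 : Y 0 = y₀ := rfl
  have Ys : ∀ k i, Y (k + 1) i = Y k i + corr k (Y k) i * Φ.X ^ (k + 1) := fun _ _ => rfl
  have hstep : ∀ k i, Y (k + 1) i - Y k i ∈ Φ.V (k + 1) := by
    intro k i
    rw [Ys, add_sub_cancel_left, mul_comm]; exact X_pow_mul_mem _ _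
  have hinit : ∀ k i, Y k i - y₀ i ∈ Φ.m := by
    intro k
    induction k with
    | zero => intro i; simp [Y0]
    | succ k ih =>
      intro i
      have := Φ.m.add_mem (mem_m_of_mem_V (by omega) (hstep k i)) (ih i)
      convert this using 1; ring
  have herr : ∀ k i, Φ.D iu (Y k i) - Q (Y k) i ∈ Φ.V k := by
    intro k
    induction k with
    | zero => simp
    | succ k ih =>
      intro i
      set E := Φ.D iu (Y k i) - Q (Y k) i with hE
      have h1 := expand_mem (ih i)
      have h2 := hQ (k + 1) _ _ (hinit (k + 1)) (hinit k) (hstep k) i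
      have h3 : Φ.D iu (Y (k + 1) i) = Φ.D iu (Y k i) -
          Φ.X ^ k * (algebraMap ℝ A (k.factorial : ℝ)⁻¹ * (Φ.D iu)^[k] E) +
          Φ.X ^ (k + 1) * Φ.D iu (corr k (Y k) i) := by
        rw [Ys, map_add, mul_comm (corr _ _ _), Du_X_pow_mul]
        have e : ((k + 1 : ℕ) : A) * algebraMap ℝ A ((k + 1).factorial : ℝ)⁻¹ =
            algebraMap ℝ A (k.factorial : ℝ)⁻¹ := by
          rw [← map_natCast (algebraMap ℝ A), ← map_mul]
          congr 1
          rw [Nat.factorial_succ]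
          have : (k.factorial : ℝ) ≠ 0 := by exact_mod_cast Nat.factorial_ne_zero k
          push_cast
          field_simp
        rw [← e]
        simp only [corr, ← hE]
        ring
      have h4 := add_mem (sub_mem h1 h2)
        (X_pow_mul_mem (Φ := Φ) (k + 1) (Φ.D iu (corr k (Y k) i)))
      convert h4 using 1
      rw [h3, hE]; ring
  choose y hy using fun i => hΦ fun j => if j = 0 then y₀ i else corr (j - 1) (Y (j - 1)) i
  have hsum : ∀ k i, ∑ j ∈ Finset.range (k + 1),
      (if j = 0 then y₀ i else corr (j - 1) (Y (j - 1)) i) * Φ.X ^ j = Y k i := by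
    intro k i
    induction k with
    | zero => simp [Y0]
    | succ k ih => rw [Finset.sum_range_succ, ih, Ys]; simp
  have hyY : ∀ k i, y i - Y k i ∈ Φ.V (k + 1) := fun k i => by rw [← hsum]; exact hy i (k + 1)
  have hy0 : ∀ i, y i - y₀ i ∈ Φ.m := fun i => by
    have := hyY 0 i
    rwa [V_one] at this
  refine ⟨y, hy0, fun i => sub_eq_zero.1 (eq_zero_of_forall_mem (Φ := Φ) fun k => ?_)⟩
  have h1 := Du_mem (hyY k i)
  have h2 := hQ k y (Y k) hy0 (hinit k) (fun i => V_anti (Nat.le_succ k) (hyY k i)) i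
  have := add_mem (sub_mem h1 h2) (herr k i)
  convert this using 1
  rw [map_sub]; ring

lemma isUnit_of_congr {a b : A} (hb : IsUnit b) (h : a - b ∈ Φ.m) : IsUnit a := by
  obtain ⟨c, hc⟩ := hb.exists_right_inv
  refine Φ.isUnit_of a c ?_
  have := Φ.m.mul_mem_right c h
  rwa [sub_mul, hc] at this

lemma det_congr {κ : Type*} [Fintype κ] [DecidableEq κ] {G₁ G₂ : Matrix κ κ A}
    (h : ∀ i j, G₁ i j - G₂ i j ∈ Φ.m) : G₁.det - G₂.det ∈ Φ.m := by
  rw [← Ideal.Quotient.eq, RingHom.map_det, RingHom.map_det]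
  congr 1
  ext i j
  exact Ideal.Quotient.eq.2 (h i j)

end FormalRing

end

section

/-! ### Weighted ambient metrics in a formal ring -/

/-- The index of the coordinate `xⁱ`. -/
abbrev idxX {n : ℕ} (i : Fin n) : Idx n := Sum.inr (Sum.inl i)

lemma sum_idx {n : ℕ} {A : Type*} [AddCommMonoid A] (F : Idx n → A) :
    ∑ I, F I = F iV + (∑ i, F (idxX i) + F iU) := by simp [Fintype.sum_sum_type]

lemma idx_cases {n : ℕ} {p : Idx n → Prop} (hv : p iV) (hx : ∀ i, p (idxX i)) (hu : p iU)
    (I : Idx n) : p I := by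
  rcases I with ⟨⟩ | i | ⟨⟩
  exacts [hv, hx i, hu]

section General

variable {A : Type*} [CommRing A] [Algebra ℝ A] {ι : Type*} [Fintype ι] [DecidableEq ι]
  {D : ι → Derivation ℝ A A} {G : Matrix ι ι A}

lemma derivation_inv_eq_zero (hu : IsUnit G.det) {d : Derivation ℝ A A} (hd : ∀ i j, d (G i j) = 0)
    (i j : ι) : d (G⁻¹ i j) = 0 := by
  have h0 : dMat d G = 0 := by ext a b; exact hd a b
  have h : dMat d G⁻¹ * G + G⁻¹ * dMat d G = 0 := by rw [← dMat_mul, nonsing_inv_mul _ hu, dMat_one]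
  rw [h0, mul_zero, add_zero] at h
  have := congrArg (· * G⁻¹) h
  simp only [mul_assoc, mul_nonsing_inv _ hu, mul_one, zero_mul] at this
  exact congrFun (congrFun this i) j

lemma derivation_aChr_eq_zero (hu : IsUnit G.det) {d : Derivation ℝ A A}
    (hc : ∀ I a, d (D I a) = D I (d a)) (hd : ∀ i j, d (G i j) = 0) (K I J : ι) :
    d (aChr D G K I J) = 0 := by simp [aChr, derivation_half, hc, hd, derivation_inv_eq_zero hu hd]

lemma derivation_aRic_eq_zero (hu : IsUnit G.det) {d : Derivation ℝ A A}
    (hc : ∀ I a, d (D I a) = D I (d a)) (hd : ∀ i j, d (G i j) = 0) (I J : ι) :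
    d (aRic D G I J) = 0 := by simp [aRic, hc, derivation_aChr_eq_zero hu hc hd]

/-- Lowering an index of `∇_I ∂_I`. -/
lemma derivation_metric_of_geodesic (hu : IsUnit G.det) (I : ι) (h : ∀ K, aChr D G K I I = 0)
    (M : ι) : 2 * D I (G I M) - D M (G I I) = 0 := by
  have := sum_mul_aChr (D := D) hu M I I
  simp only [h, mul_zero, sum_const_zero] at this
  linear_combination (-2) * this - (2 * D I (G I M) - D M (G I I)) * two_mul_half (A := A)

end General

section Ambient

variable {n : ℕ} {A : Type*} [CommRing A] [Algebra ℝ A] {Φ : FormalRing A (Idx n) iU}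
  {G : Matrix (Idx n) (Idx n) A} {f : A} {lam : ℝ}

open FormalRing

lemma isUnit_lam_X_sub_one (Ψ : FormalRing A (Idx n) iU) (lam : ℝ) :
    IsUnit (algebraMap ℝ A lam * Ψ.X - 1) := by
  refine isUnit_of_congr (Φ := Ψ) (b := -1) isUnit_one.neg ?_
  have := Ψ.m.mul_mem_left (algebraMap ℝ A lam) Ψ.X_mem
  convert this using 1; ring

lemma eq_zero_of_D_eq_zero {ι : Type*} [DecidableEq ι] {iu : ι} {Ψ : FormalRing A ι iu} {a : A}
    (h0 : a ∈ Ψ.m) (h : Ψ.D iu a = 0) : a = 0 := Ψ.separated a fun k => by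
    rcases k with _ | k
    · exact h0
    · rw [iterate_succ_apply, h, Ψ.iterate_zero']; exact Ψ.m.zero_mem

/-- If the `u`-lines are geodesics, with the normal initial values, the metric is normal. -/
lemma normal_of_geodesic (hu : IsUnit G.det) (h : ∀ K, aChr Φ.D G K iU iU = 0)
    (h0 : ∀ I, G iU I - (if I = iV then 1 else 0) ∈ Φ.m) (I : Idx n) :
    G iU I = if I = iV then 1 else 0 := by
  have e := derivation_metric_of_geodesic hu _ h
  have huu : G iU iU = 0 := by
    refine eq_zero_of_D_eq_zero (Ψ := Φ) (by simpa using h0 iU) ?_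
    linear_combination e iU
  have e' : Φ.D iU (G iU I) = 0 := by
    have := e I
    rw [huu, map_zero, sub_zero] at this
    exact eq_zero_of_two_mul this
  refine sub_eq_zero.1 (eq_zero_of_D_eq_zero (Ψ := Φ) (h0 I) ?_)
  rw [map_sub, e']
  split_ifs <;> simp

lemma geodesic_of_normal (h : ∀ I, G iU I = if I = iV then 1 else 0) (K : Idx n) :
    aChr Φ.D G K iU iU = 0 := by
  have : ∀ I J, Φ.D J (G iU I) = 0 := by intro I J; rw [h]; split_ifs <;> simp
  simp [aChr, this]

/-! #### The differential of `u` is parallel when `λ ≠ 0` -/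

variable (hDv : ∀ I J, Φ.D iV (G I J) = 0) (hfv : Φ.D iV f = algebraMap ℝ A lam * Φ.X - 1)

lemma D_lam_X (J : Idx n) : Φ.D J (algebraMap ℝ A lam * Φ.X - 1) =
    if J = iU then algebraMap ℝ A lam else 0 := by rw [map_sub, leibniz, Φ.D_X]; simp

include hfv in
lemma D_v_D (J : Idx n) : Φ.D iV (Φ.D J f) = if J = iU then algebraMap ℝ A lam else 0 := by
  rw [Φ.comm, hfv, D_lam_X]

include hDv hfv in
lemma D_v_hess (hu : IsUnit G.det) (I J : Idx n) :
    Φ.D iV (aHess Φ.D G f I J) = -(algebraMap ℝ A lam * aChr Φ.D G iU I J) := by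
  have h1 : Φ.D iV (Φ.D I (Φ.D J f)) = 0 := by rw [Φ.comm, D_v_D hfv]; split_ifs <;> simp
  have h2 := derivation_aChr_eq_zero (D := Φ.D) hu (fun I a => Φ.comm iV I a) hDv
  simp [aHess, h1, h2, D_v_D hfv]
  ring

include hDv hfv in
lemma gamma_u_eq_zero (hu : IsUnit G.det) (hlam : lam ≠ 0) (hP : ∀ I J, aP Φ.D G f lam I J = 0)
    (I J : Idx n) : aChr Φ.D G iU I J = 0 := by
  have h1 : Φ.D iV (aP Φ.D G f lam I J) = 0 := by rw [hP]; simp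
  rw [aP, map_sub, map_add, D_v_hess hDv hfv hu,
    derivation_aRic_eq_zero hu (fun I a => Φ.comm iV I a) hDv, leibniz, hDv] at h1
  have h2 : IsUnit (algebraMap ℝ A lam) := (IsUnit.mk0 lam hlam).map _
  rw [← h2.mul_right_eq_zero]
  simpa using h1

include hDv hfv in
lemma grad_u_eq (hG : G.IsSymm) (hu : IsUnit G.det) (hlam : lam ≠ 0)
    (hP : ∀ I J, aP Φ.D G f lam I J = 0) (hF : aF Φ.D G f lam = 0) :
    ∑ I, G⁻¹ iU I * Φ.D I f = Φ.D iV f := by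
  have hinv := derivation_inv_eq_zero hu (d := Φ.D iV) hDv
  have h1 : Φ.D iV (aF Φ.D G f lam) = 0 := by rw [hF]; simp
  have hL : Φ.D iV (aLap Φ.D G f) = 0 := by
    simp [aLap, hinv, D_v_hess hDv hfv hu, gamma_u_eq_zero hDv hfv hu hlam hP]
  have hg : Φ.D iV (aGradSq Φ.D G f) = 2 * (algebraMap ℝ A lam * ∑ I, G⁻¹ iU I * Φ.D I f) := by
    have e1 : ∀ I J, Φ.D iV (G⁻¹ I J * Φ.D I f * Φ.D J f) =
        (if J = iU then algebraMap ℝ A lam * (G⁻¹ I J * Φ.D I f) else 0) +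
        (if I = iU then algebraMap ℝ A lam * (G⁻¹ I J * Φ.D J f) else 0) := by
      intro I J
      simp only [leibniz, hinv, D_v_D hfv, smul_eq_mul]
      split_ifs <;> ring
    simp only [aGradSq, map_sum, e1, sum_add_distrib, sum_ite_eq', mem_univ, if_true]
    have e2 : ∑ x, ∑ y, (if x = iU then algebraMap ℝ A lam * (G⁻¹ x y * Φ.D y f) else 0) =
        ∑ y, algebraMap ℝ A lam * (G⁻¹ iU y * Φ.D y f) := by
      rw [sum_comm]
      simp
    rw [e2, two_mul, mul_sum]
    congr 1
    exact sum_ext fun I => by rw [(inv_isSymm hG).apply]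
  have h2 : Φ.D iV (2 * algebraMap ℝ A lam * f) = 2 * algebraMap ℝ A lam * Φ.D iV f := by
    rw [← map_ofNat (algebraMap ℝ A) 2, ← map_mul, leibniz, Derivation.map_algebraMap,
      smul_zero, add_zero, smul_eq_mul]
  rw [aF, map_sub, map_add, map_sub, hL, hg, h2, Derivation.map_algebraMap] at h1
  have h3 : IsUnit (algebraMap ℝ A lam) := (IsUnit.mk0 lam hlam).map _
  have h4 : algebraMap ℝ A lam * (∑ I, G⁻¹ iU I * Φ.D I f - Φ.D iV f) = 0 :=
    eq_zero_of_two_mul (by linear_combination -h1)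
  exact sub_eq_zero.1 ((h3.mul_right_eq_zero).1 h4)

lemma inv_u_mem (hu : IsUnit G.det) (h0 : ∀ I, I ≠ iU → G iV I ∈ Φ.m) :
    G iV iU * G⁻¹ iU iV - 1 ∈ Φ.m ∧ ∀ K, K ≠ iV → G⁻¹ iU K ∈ Φ.m := by
  have key : ∀ K, G iV iU * G⁻¹ iU K - (1 : Matrix _ _ A) (idxV n) K ∈ Φ.m := by
    intro K
    have := congrFun (congrFun (mul_nonsing_inv _ hu) iV) K
    rw [← this, mul_app, sum_idx]
    have h1 := Φ.m.mul_mem_right (G⁻¹ iV K) (h0 iV (by simp))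
    have h2 : ∑ i, G iV (idxX i) * G⁻¹ (idxX i) K ∈ Φ.m :=
      sum_mem fun i _ => Φ.m.mul_mem_right _ (h0 _ (by simp))
    convert Φ.m.neg_mem (Φ.m.add_mem h1 h2) using 1
    ring
  have k1 := key iV
  rw [Matrix.one_apply_eq] at k1
  refine ⟨k1, fun K hK => ?_⟩
  have k2 := key K
  rw [Matrix.one_apply_ne hK.symm, sub_zero] at k2
  have := Φ.m.sub_mem (Φ.m.mul_mem_right (G⁻¹ iU iV) k2)
    (Φ.m.mul_mem_right (G⁻¹ iU K) k1)
  convert this using 1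
  ring

include hDv hfv in
/-- When `λ ≠ 0`, the vector field `∂_v` is the gradient of `u`. -/
lemma metric_v_eq (hG : G.IsSymm) (hu : IsUnit G.det) (hlam : lam ≠ 0)
    (h0 : ∀ I, I ≠ iU → G iV I ∈ Φ.m) (hP : ∀ I J, aP Φ.D G f lam I J = 0) (hF : aF Φ.D G f lam = 0)
    (I : Idx n) : G iV I = if I = iU then 1 else 0 := by
  have hΓ := gamma_u_eq_zero hDv hfv hu hlam hP
  obtain ⟨hm1, hm2⟩ := inv_u_mem hu h0
  set z : Idx n → A := fun K => G⁻¹ iU K - if K = iV then 1 else 0 with hz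
  have hq : ∀ L, ∑ K, G L K * G⁻¹ iU K = if L = iU then 1 else 0 := by
    intro L
    have := congrFun (congrFun (mul_nonsing_inv _ hu) L) iU
    rw [mul_app, one_app] at this
    rw [← this]
    exact sum_ext fun K => by rw [(inv_isSymm hG).apply]
  have hα : ∀ L, G iV L = (if L = iU then 1 else 0) - ∑ K, G L K * z K := by
    intro L
    simp only [hz, mul_sub, sum_sub_distrib, hq, mul_ite, mul_one, mul_zero,
      sum_ite_eq', mem_univ, if_true]
    rw [hG.apply]; ring
  have hz1 : ∀ K, z K ∈ Φ.m := by
    intro K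
    by_cases hK : K = iV
    · subst hK
      have h1 := grad_u_eq hDv hfv hG hu hlam hP hF
      rw [sum_idx, hfv] at h1
      have h2 : ∑ i, G⁻¹ iU (idxX i) * Φ.D (idxX i) f ∈ Φ.m :=
        sum_mem fun i _ => Φ.m.mul_mem_right _ (hm2 _ (by simp))
      have h3 := Φ.m.mul_mem_right (Φ.D iU f) (hm2 iU (by simp))
      have h4 : (algebraMap ℝ A lam * Φ.X - 1) * z iV ∈ Φ.m := by
        have := Φ.m.neg_mem (Φ.m.add_mem h2 h3)
        convert this using 1
        simp only [hz, if_true]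
        linear_combination h1
      exact (Ideal.unit_mul_mem_iff_mem _ (isUnit_lam_X_sub_one Φ lam)).1 h4
    · simpa [hz, hK] using hm2 K hK
  have hDz : ∀ K, Φ.D iU (z K) = -∑ L, G⁻¹ iU L * aChr Φ.D G K iU L := by
    intro K
    have h1 := congrFun (congrFun (dMat_inv (D := Φ.D) hG hu iU) iU) K
    simp only [dMat_apply, Matrix.neg_apply, add_app, mul_app, conn,
      Matrix.transpose_apply, of_apply, hΓ, zero_mul, sum_const_zero, add_zero] at h1
    simp only [hz, map_sub, h1]
    split_ifs <;> simp
  have hzk : ∀ k K, z K ∈ Φ.V (k + 1) := by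
    intro k
    induction k with
    | zero => intro K; rw [zero_add, V_one]; exact hz1 K
    | succ k ih =>
      intro K
      rw [mem_V_succ]
      refine ⟨hz1 K, ?_⟩
      set T := Φ.V (k + 1) with hT
      set π := Ideal.Quotient.mk T with hπ
      have hπz : ∀ K, π (z K) = 0 := fun K => Ideal.Quotient.eq_zero_iff_mem.2 (ih K)
      set ζ : Idx n → A ⧸ T := fun K => π (Φ.D iU (z K)) with hζ
      set t := ∑ M, π (G iU M) * ζ M with ht
      have hlow : ∀ L, π (Φ.D iU (∑ K, G L K * z K)) = ∑ M, π (G L M) * ζ M := by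
        intro L
        simp only [map_sum, leibniz, smul_eq_mul, map_add, map_mul, hπz, zero_mul, add_zero, hζ]
      have hlow' : ∀ L, L ≠ iU → π (Φ.D L (∑ K, G iU K * z K)) = 0 := by
        intro L hL
        refine Ideal.Quotient.eq_zero_iff_mem.2 (D_mem L hL ?_)
        exact sum_mem fun K _ => mul_mem_left _ _ (ih K)
      have hβ : ∀ L, π (Φ.D iU (G iV L) - Φ.D L (G iV iU)) =
          -∑ M, π (G L M) * ζ M + if L = iU then t else 0 := by
        intro L
        have c1 : Φ.D iU (if L = iU then (1 : A) else 0) = 0 := by split_ifs <;> simp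
        rw [hα L, hα iU, map_sub (Φ.D iU), map_sub (Φ.D L), c1, if_pos rfl,
          Derivation.map_one_eq_zero]
        simp only [zero_sub, sub_neg_eq_add, map_add, map_neg, hlow]
        by_cases hL : L = iU
        · rw [if_pos hL, hL, hlow]
        · rw [if_neg hL, hlow' L hL]
      have hπhalf : (2 : A ⧸ T) * π (half A) = 1 := by
        rw [← map_ofNat π 2, ← map_mul, two_mul_half, map_one]
      have hB : ∀ K, π (aChr Φ.D G K iU iV) = π (half A) * (-ζ K + π (G⁻¹ iU K) * t) := by
        intro K
        have e1 : aChr Φ.D G K iU iV = half A * ∑ L, G⁻¹ K L *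
            (Φ.D iU (G iV L) - Φ.D L (G iV iU)) := by
          unfold aChr
          simp only [hDv, add_zero, hG.apply iV iU]
        have e2 : ∑ L, π (G⁻¹ K L) * ∑ M, π (G L M) * ζ M = ζ K := by
          have : ∀ M, ∑ L, π (G⁻¹ K L) * π (G L M) = if K = M then 1 else 0 := by
            intro M
            have := congrFun (congrFun (nonsing_inv_mul _ hu) K) M
            rw [mul_app, one_app] at this
            simp only [← map_mul, ← map_sum, this]
            split_ifs <;> simp
          simp only [mul_sum, ← mul_assoc]
          rw [sum_comm]
          simp only [← sum_mul, this]
          simp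
        rw [e1]
        simp only [map_mul, map_sum, hβ, mul_add, mul_neg, sum_add_distrib, sum_neg_distrib, e2]
        simp only [mul_ite, mul_zero, sum_ite_eq', mem_univ, if_true]
        rw [(inv_isSymm hG).apply]
      have hmain : ∀ K, ζ K = -(π (G⁻¹ iU K) * t) := by
        intro K
        have e1 : ζ K = -π (aChr Φ.D G K iU iV) := by
          have : ∀ L, π (G⁻¹ iU L) = if L = iV then 1 else 0 := by
            intro L
            have h := hπz L
            simp only [hz, map_sub, sub_eq_zero] at h
            rw [h]; split_ifs <;> simp
          simp only [hζ, hDz, map_neg, map_sum, map_mul, this]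
          simp
        rw [hB] at e1
        linear_combination 2 * e1 + (-ζ K + π (G⁻¹ iU K) * t) * (-hπhalf)
      have ht0 : t = 0 := by
        have e1 : t = -t := by
          conv_lhs => rw [ht]
          simp only [hmain, mul_neg, ← mul_assoc, sum_neg_distrib, ← sum_mul,
            ← map_mul, ← map_sum, hq, if_true, map_one, one_mul]
        linear_combination π (half A) * e1 - t * hπhalf
      have : ζ K = 0 := by rw [hmain, ht0, mul_zero, neg_zero]
      exact Ideal.Quotient.eq_zero_iff_mem.1 this
  have hz0 : ∀ K, z K = 0 := fun K => eq_zero_of_forall_mem_succ fun k => hzk k K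
  rw [hα]; simp [hz0]

end Ambient

end

section

section Normal

variable {n : ℕ} {A : Type*} [CommRing A] [Algebra ℝ A] {Φ : FormalRing A (Idx n) iU}
  {G : Matrix (Idx n) (Idx n) A} {f : A} {lam : ℝ}

open FormalRing

/-! #### Normal metrics are plane-fronted -/

variable (hDv : ∀ I J, Φ.D iV (G I J) = 0) (hfv : Φ.D iV f = algebraMap ℝ A lam * Φ.X - 1)
  (hN : ∀ I, G iU I = if I = iV then 1 else 0)

include hN in
lemma normal_inv_v (hu : IsUnit G.det) (J : Idx n) : G⁻¹ iV J = if J = iU then 1 else 0 := by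
  have := congrFun (congrFun (mul_nonsing_inv _ hu) iU) J
  rw [mul_app, one_app] at this
  simpa [hN, eq_comm] using this

include hN in
lemma normal_inv_u_x (hG : G.IsSymm) (hu : IsUnit G.det) (i : Fin n) :
    G⁻¹ iU (idxX i) = -∑ j, G iV (idxX j) * G⁻¹ (idxX j) (idxX i) := by
  have := congrFun (congrFun (mul_nonsing_inv _ hu) iV) (idxX i)
  rw [mul_app, one_app, sum_idx, normal_inv_v hN hu, ← hG.apply iV iU, hN] at this
  simp at this
  linear_combination this

include hN in
lemma normal_inv_u_u (hG : G.IsSymm) (hu : IsUnit G.det) :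
    G⁻¹ iU iU = -(G iV iV + ∑ j, G iV (idxX j) * G⁻¹ iU (idxX j)) := by
  have := congrFun (congrFun (mul_nonsing_inv _ hu) iV) iU
  rw [mul_app, one_app, sum_idx, normal_inv_v hN hu, ← hG.apply iV iU, hN] at this
  have e : ∀ j, G⁻¹ iU (idxX j) = G⁻¹ (idxX j) iU := fun j => (inv_isSymm hG).apply _ _
  simp only [e]
  simp at this
  linear_combination this

include hDv in
lemma gamma_v_eq (K J : Idx n) :
    aChr Φ.D G K iV J = half A * ∑ L, G⁻¹ K L * (Φ.D J (G iV L) - Φ.D L (G iV J)) := by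
  unfold aChr
  simp only [hDv, zero_add]

include hDv in
lemma trace_gamma_v (hG : G.IsSymm) : ∑ K, aChr Φ.D G K iV K = 0 := by
  have h := two_mul_sum_aChr (D := Φ.D) hG iV
  have h0 : dMat (Φ.D iV) G = 0 := by ext a b; exact hDv a b
  rw [h0] at h
  exact eq_zero_of_two_mul (by simpa using h)

include hDv hfv in
/-- The components `P_{vJ}` are linear in the covariant derivative of the Killing field `∂_v`. -/
lemma aP_v_eq (hG : G.IsSymm) (J : Idx n) : aP Φ.D G f lam iV J = ∑ K, Φ.D K (aChr Φ.D G K iV J) + ∑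
    L, (∑ K, aChr Φ.D G K K L) * aChr Φ.D G L iV J - ∑ K, ∑ L, aChr Φ.D G K J L * aChr Φ.D G L iV K
    + (if J = iU then algebraMap ℝ A lam else 0) - ∑ K, aChr Φ.D G K iV J * Φ.D K f - algebraMap ℝ A
    lam * G iV J := by
  have h1 : ∑ K, Φ.D J (aChr Φ.D G K iV K) = 0 := by rw [← map_sum, trace_gamma_v hDv hG, map_zero]
  have h2 : ∑ K, ∑ L, aChr Φ.D G K K L * aChr Φ.D G L iV J =
      ∑ L, (∑ K, aChr Φ.D G K K L) * aChr Φ.D G L iV J := by rw [sum_comm]; simp only [sum_mul]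
  rw [aP, aRic, aHess, D_v_D hfv]
  simp only [sum_sub_distrib, h1, h2]
  ring

section Orders

variable {k : ℕ} (hG : G.IsSymm) (hu : IsUnit G.det) (ha : G iV iV ∈ Φ.V (k + 1))
  (hb : ∀ i, G iV (idxX i) ∈ Φ.V k)

include hN hG hu hb in
lemma inv_u_x_mem (i : Fin n) : G⁻¹ iU (idxX i) ∈ Φ.V k := by
  rw [normal_inv_u_x hN hG hu]
  exact Ideal.neg_mem_iff _ |>.2 (sum_mem fun j _ => mul_mem_right _ _ (hb j))

include hN hG hu ha hb in
lemma inv_u_u_mem (hk : 1 ≤ k) : G⁻¹ iU iU ∈ Φ.V (k + 1) := by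
  rw [normal_inv_u_u hN hG hu]
  refine Ideal.neg_mem_iff _ |>.2 (add_mem ha (sum_mem fun j _ => ?_))
  exact V_anti (by omega) (mul_mem_V (hb j) (inv_u_x_mem hN hG hu hb j))

include hN hG in
lemma D_normal (J : Idx n) : Φ.D J (G iV iU) = 0 := by rw [← hG.apply, hN]; simp

include hDv hN hG hu in
lemma gamma_v_v (J : Idx n) : aChr Φ.D G iV iV J = -(half A * Φ.D iU (G iV J)) := by
  rw [gamma_v_eq hDv]
  simp only [normal_inv_v hN hu, ite_mul, zero_mul, one_mul, sum_ite_eq', mem_univ,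
    if_true, D_normal hN hG]
  ring

include hDv hN hG hu hb ha in
lemma gamma_v_x_mem (i : Fin n) (J : Idx n) (hJ : J ≠ iU) : aChr Φ.D G (idxX i) iV J ∈ Φ.V k := by
  rw [gamma_v_eq hDv, sum_idx]
  have hi : G⁻¹ (idxX i) iU ∈ Φ.V k := by
    rw [← (inv_isSymm hG).apply]; exact inv_u_x_mem hN hG hu hb i
  have hi' : G⁻¹ (idxX i) iV = 0 := by rw [← (inv_isSymm hG).apply, normal_inv_v hN hu]; simp
  have hα : ∀ J, J ≠ iU → G iV J ∈ Φ.V k :=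
    idx_cases (fun _ => V_anti (Nat.le_succ k) ha) (fun i _ => hb i) (fun h => absurd rfl h)
  refine mul_mem_left _ _ (add_mem ?_ (add_mem ?_ ?_))
  · rw [hi', zero_mul]; exact zero_mem _
  · refine sum_mem fun j _ => mul_mem_left _ _ (sub_mem ?_ ?_)
    · exact D_mem J hJ (hb j)
    · exact D_mem _ (by simp) (hα J hJ)
  · exact mul_mem_right _ _ hi

include hDv hN hG hu hb ha in
lemma gamma_v_u_mem (hk : 1 ≤ k) (J : Idx n) : aChr Φ.D G iU iV J ∈ Φ.V k := by
  rw [gamma_v_eq hDv, sum_idx]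
  have hi := inv_u_u_mem hN hG hu ha hb hk
  have hii := inv_u_x_mem hN hG hu hb
  have hDa : Φ.D J (G iV iV) ∈ Φ.V k := D_mem_pred J ha
  refine mul_mem_left _ _ (add_mem ?_ (add_mem ?_ ?_))
  · rw [hDv, sub_zero]; exact mul_mem_left _ _ hDa
  · exact sum_mem fun j _ => mul_mem_right _ _ (hii j)
  · exact mul_mem_right _ _ (V_anti (Nat.le_succ k) hi)

include hDv hN hG hu hb ha in
lemma gamma_v_u_x_mem (hk : 1 ≤ k) (i : Fin n) : aChr Φ.D G iU iV (idxX i) ∈ Φ.V (k + 1) := by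
  rw [gamma_v_eq hDv, sum_idx]
  have hi := inv_u_u_mem hN hG hu ha hb hk
  have hii := inv_u_x_mem hN hG hu hb
  refine mul_mem_left _ _ (add_mem ?_ (add_mem ?_ ?_))
  · rw [hDv, sub_zero]; exact mul_mem_left _ _ (D_mem _ (by simp) ha)
  · refine sum_mem fun j _ => V_anti (by omega : k + 1 ≤ k + k) (mul_mem_V (hii j) ?_)
    exact sub_mem (D_mem _ (by simp) (hb j)) (D_mem _ (by simp) (hb i))
  · exact mul_mem_right _ _ hi

include hDv hN hG hu hb ha in
lemma gamma_u_x_x_mem (hk : 1 ≤ k) (i j : Fin n) : aChr Φ.D G iU (idxX i) (idxX j) ∈ Φ.V k := by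
  have hi := inv_u_u_mem hN hG hu ha hb hk
  have hii := inv_u_x_mem hN hG hu hb
  unfold aChr
  rw [sum_idx]
  refine mul_mem_left _ _ (add_mem ?_ (add_mem ?_ ?_))
  · rw [hDv, sub_zero, ← hG.apply, ← hG.apply (idxX i)]
    exact mul_mem_left _ _
      (add_mem (D_mem _ (by simp) (hb j)) (D_mem _ (by simp) (hb i)))
  · exact sum_mem fun j _ => mul_mem_right _ _ (hii j)
  · exact mul_mem_right _ _ (V_anti (Nat.le_succ k) hi)

lemma half_mul_mem {T : Ideal A} {a e : A} (he : IsUnit e) (h : half A * a * e ∈ T) : a ∈ T := by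
  have h1 : half A * a ∈ T := (Ideal.mul_unit_mem_iff_mem T he).1 h
  have h2 := T.mul_mem_left 2 h1
  rwa [← mul_assoc, two_mul_half, one_mul] at h2

include hDv hfv hN hG hu hb ha in
lemma order_x_succ (hk : 1 ≤ k) (hP : ∀ J, aP Φ.D G f lam iV J = 0) (i : Fin n) :
    G iV (idxX i) ∈ Φ.V (k + 1) := by
  rw [mem_V_succ]
  refine ⟨mem_m_of_mem_V hk (hb i), ?_⟩
  have hv := trace_gamma_v hDv hG
  have hvv := gamma_v_v hDv hN hG hu
  have hx := gamma_v_x_mem hDv hN hG hu ha hb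
  have hU := gamma_v_u_mem hDv hN hG hu ha hb hk
  have hUx := gamma_v_u_x_mem hDv hN hG hu ha hb hk
  have hUxx := gamma_u_x_x_mem hDv hN hG hu ha hb hk
  have hDa : Φ.D iU (G iV iV) ∈ Φ.V k := Du_mem ha
  have key := aP_v_eq hDv hfv hG (idxX i)
  rw [hP] at key
  have m1 : ∑ K, Φ.D K (aChr Φ.D G K iV (idxX i)) ∈ Φ.V k := by
    refine sum_mem fun K _ => ?_
    refine idx_cases (p := fun K => Φ.D K (aChr Φ.D G K iV (idxX i)) ∈ Φ.V k)
      ?_ ?_ ?_ K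
    · rw [derivation_aChr_eq_zero hu (fun I a => Φ.comm iV I a) hDv]; exact zero_mem _
    · exact fun j => D_mem _ (by simp) (hx j _ (by simp))
    · exact Du_mem (hUx i)
  have m2 : ∑ L, (∑ K, aChr Φ.D G K K L) * aChr Φ.D G L iV (idxX i) ∈ Φ.V k := by
    refine sum_mem fun L _ => ?_
    refine idx_cases (p := fun L => (∑ K, aChr Φ.D G K K L) * aChr Φ.D G L iV (idxX i) ∈
      Φ.V k) ?_ ?_ ?_ L
    · simp only [aChr_symm hG _ _ iV, hv, zero_mul, Ideal.zero_mem]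
    · exact fun j => mul_mem_left _ _ (hx j _ (by simp))
    · exact mul_mem_left _ _ (hU _)
  have m3 : ∑ K, ∑ L, aChr Φ.D G K (idxX i) L * aChr Φ.D G L iV K ∈ Φ.V k := by
    refine sum_mem fun K _ => sum_mem fun L _ => ?_
    refine idx_cases (p := fun L => aChr Φ.D G K (idxX i) L * aChr Φ.D G L iV K ∈ Φ.V k)
      ?_ ?_ ?_ L
    · rw [hvv]
      refine idx_cases (p := fun K => aChr Φ.D G K (idxX i) iV *
        -(half A * Φ.D iU (G iV K)) ∈ Φ.V k) ?_ ?_ ?_ K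
      · exact mul_mem_left _ _ (Ideal.neg_mem_iff _ |>.2 (mul_mem_left _ _ hDa))
      · intro j
        rw [aChr_symm hG]
        exact mul_mem_right _ _ (hx j _ (by simp))
      · rw [D_normal hN hG]; simp
    · intro j
      by_cases hK : K = iU
      · subst hK
        exact mul_mem_right _ _ (hUxx i j)
      · exact mul_mem_left _ _ (hx j _ hK)
    · exact mul_mem_left _ _ (hU _)
  have m4 : ∑ K, aChr Φ.D G K iV (idxX i) * Φ.D K f +
      half A * Φ.D iU (G iV (idxX i)) * (algebraMap ℝ A lam * Φ.X - 1) ∈ Φ.V k := by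
    rw [sum_idx, hvv, hfv]
    have h1 : ∑ j, aChr Φ.D G (idxX j) iV (idxX i) * Φ.D (idxX j) f ∈ Φ.V k :=
      sum_mem fun j _ => mul_mem_right _ _ (hx j _ (by simp))
    have h2 := mul_mem_right (Φ.D iU f) _ (hU (idxX i))
    convert add_mem h1 h2 using 1
    ring
  have m5 := mul_mem_left _ (algebraMap ℝ A lam) (hb i)
  refine half_mul_mem (isUnit_lam_X_sub_one Φ lam) ?_
  have := add_mem (add_mem (sub_mem m3 (add_mem m1 m2)) m4) m5
  convert this using 1
  rw [if_neg (by simp)] at key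
  linear_combination -key

include hDv hfv hN hG hu ha in
lemma order_v_succ (hk : 1 ≤ k) (hb' : ∀ i, G iV (idxX i) ∈ Φ.V (k + 1))
    (hP : ∀ J, aP Φ.D G f lam iV J = 0) : G iV iV ∈ Φ.V (k + 2) := by
  rw [mem_V_succ]
  refine ⟨mem_m_of_mem_V (by omega) ha, ?_⟩
  have hb : ∀ i, G iV (idxX i) ∈ Φ.V k := fun i => V_anti (Nat.le_succ k) (hb' i)
  have hv := trace_gamma_v hDv hG
  have hvv := gamma_v_v hDv hN hG hu
  have hU := gamma_v_u_mem hDv hN hG hu ha hb hk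
  have hDa : Φ.D iU (G iV iV) ∈ Φ.V k := Du_mem ha
  have hi := inv_u_u_mem hN hG hu ha hb hk
  have hii := inv_u_x_mem hN hG hu hb'
  have hx : ∀ i, aChr Φ.D G (idxX i) iV iV ∈ Φ.V (k + 1) := by
    intro i
    rw [gamma_v_eq hDv]
    refine mul_mem_left _ _ (sum_mem fun L _ => ?_)
    rw [hDv, zero_sub]
    refine idx_cases (p := fun L => G⁻¹ (idxX i) L * -Φ.D L (G iV iV) ∈ Φ.V (k + 1))
      ?_ ?_ ?_ L
    · rw [hDv]; simp
    · exact fun j => mul_mem_left _ _ (Ideal.neg_mem_iff _ |>.2 (D_mem _ (by simp) ha))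
    · rw [(inv_isSymm hG).apply]
      exact mul_mem_right _ _ (hii i)
  have hUv : aChr Φ.D G iU iV iV ∈ Φ.V (k + 2) := by
    rw [gamma_v_eq hDv]
    refine mul_mem_left _ _ (sum_mem fun L _ => ?_)
    rw [hDv, zero_sub]
    refine idx_cases (p := fun L => G⁻¹ iU L * -Φ.D L (G iV iV) ∈ Φ.V (k + 2))
      ?_ ?_ ?_ L
    · rw [hDv]; simp
    · exact fun j => V_anti (by omega) (mul_mem_V (hii j)
        (Ideal.neg_mem_iff _ |>.2 (D_mem (idxX j) (by simp) ha)))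
    · exact V_anti (by omega) (mul_mem_V hi (Ideal.neg_mem_iff _ |>.2 hDa))
  have hall : ∀ K L, aChr Φ.D G K iV L ∈ Φ.V k := by
    intro K L
    refine idx_cases (p := fun K => aChr Φ.D G K iV L ∈ Φ.V k) ?_ ?_ ?_ K
    · rw [hvv]
      refine Ideal.neg_mem_iff _ |>.2 (mul_mem_left _ _ ?_)
      refine idx_cases (p := fun L => Φ.D iU (G iV L) ∈ Φ.V k) hDa
        (fun i => Du_mem (hb' i)) ?_ L
      rw [D_normal hN hG]; exact zero_mem _
    · intro i
      by_cases hL : L = iU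
      · subst hL
        rw [gamma_v_eq hDv]
        refine mul_mem_left _ _ (sum_mem fun L _ => mul_mem_left _ _ ?_)
        rw [D_normal hN hG, sub_zero]
        refine idx_cases (p := fun L => Φ.D iU (G iV L) ∈ Φ.V k) hDa
          (fun i => Du_mem (hb' i)) ?_ L
        rw [D_normal hN hG]; exact zero_mem _
      · exact gamma_v_x_mem hDv hN hG hu ha hb i L hL
    · exact hU L
  have key := aP_v_eq hDv hfv hG iV
  rw [hP] at key
  have m1 : ∑ K, Φ.D K (aChr Φ.D G K iV iV) ∈ Φ.V (k + 1) := by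
    refine sum_mem fun K _ => ?_
    refine idx_cases (p := fun K => Φ.D K (aChr Φ.D G K iV iV) ∈ Φ.V (k + 1))
      ?_ ?_ ?_ K
    · rw [derivation_aChr_eq_zero hu (fun I a => Φ.comm iV I a) hDv]; exact zero_mem _
    · exact fun j => D_mem _ (by simp) (hx j)
    · exact Du_mem hUv
  have m2 : ∑ L, (∑ K, aChr Φ.D G K K L) * aChr Φ.D G L iV iV ∈ Φ.V (k + 1) := by
    refine sum_mem fun L _ => ?_
    refine idx_cases (p := fun L => (∑ K, aChr Φ.D G K K L) * aChr Φ.D G L iV iV ∈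
      Φ.V (k + 1)) ?_ ?_ ?_ L
    · simp only [aChr_symm hG _ _ iV, hv, zero_mul, Ideal.zero_mem]
    · exact fun j => mul_mem_left _ _ (hx j)
    · exact mul_mem_left _ _ (V_anti (by omega) hUv)
  have m3 : ∑ K, ∑ L, aChr Φ.D G K iV L * aChr Φ.D G L iV K ∈ Φ.V (k + 1) :=
    sum_mem fun K _ => sum_mem fun L _ => V_anti (by omega) (mul_mem_V (hall K L) (hall L K))
  have m4 : ∑ K, aChr Φ.D G K iV iV * Φ.D K f +
      half A * Φ.D iU (G iV iV) * (algebraMap ℝ A lam * Φ.X - 1) ∈ Φ.V (k + 1) := by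
    rw [sum_idx, hvv, hfv]
    have h1 : ∑ j, aChr Φ.D G (idxX j) iV iV * Φ.D (idxX j) f ∈ Φ.V (k + 1) :=
      sum_mem fun j _ => mul_mem_right _ _ (hx j)
    have h2 := mul_mem_right (Φ.D iU f) _ (V_anti (Nat.le_succ (k + 1)) hUv)
    convert add_mem h1 h2 using 1
    ring
  have m5 := mul_mem_left _ (algebraMap ℝ A lam) ha
  refine half_mul_mem (isUnit_lam_X_sub_one Φ lam) ?_
  have := add_mem (add_mem (sub_mem m3 (add_mem m1 m2)) m4) m5
  convert this using 1
  rw [if_neg (by simp)] at key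
  linear_combination -key

end Orders

include hDv hfv hN in
/-- A normal weighted ambient metric is plane-fronted: `g_{vv} = 0` and `g_{vi} = 0`. -/
lemma plane_fronted_of_normal (hG : G.IsSymm) (hu : IsUnit G.det) (ha : G iV iV ∈ Φ.V 2)
    (hb : ∀ i, G iV (idxX i) ∈ Φ.m) (hP : ∀ J, aP Φ.D G f lam iV J = 0) :
    G iV iV = 0 ∧ ∀ i, G iV (idxX i) = 0 := by
  have h : ∀ k, G iV iV ∈ Φ.V (k + 2) ∧ ∀ i, G iV (idxX i) ∈ Φ.V (k + 1) := by
    intro k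
    induction k with
    | zero => exact ⟨ha, fun i => by rw [zero_add, V_one]; exact hb i⟩
    | succ k ih =>
      have h1 := order_x_succ hDv hfv hN hG hu ih.1 ih.2 (by omega) hP
      exact ⟨order_v_succ hDv hfv hN hG hu ih.1 (by omega) h1 hP, h1⟩
  exact ⟨eq_zero_of_forall_mem fun k => V_anti (by omega) (h k).1,
    fun i => eq_zero_of_forall_mem fun k => V_anti (by omega) ((h k).2 i)⟩

end Normal

end

section

open FormalRing

/-! #### Plane-fronted metrics `2 du dv + g` -/

section PlaneFronted

variable {n : ℕ} {A : Type*} [CommRing A] [Algebra ℝ A]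

/-- The matrix of `2 du dv + g`. -/
def ppMat (g : Matrix (Fin n) (Fin n) A) : Matrix (Idx n) (Idx n) A
  | Sum.inl _, Sum.inr (Sum.inr _) => 1
  | Sum.inr (Sum.inr _), Sum.inl _ => 1
  | Sum.inr (Sum.inl i), Sum.inr (Sum.inl j) => g i j
  | _, _ => 0

variable (g : Matrix (Fin n) (Fin n) A)

@[simp] lemma ppMat_v_v : ppMat g iV iV = 0 := rfl
@[simp] lemma ppMat_v_x (i : Fin n) : ppMat g iV (idxX i) = 0 := rfl
@[simp] lemma ppMat_v_u : ppMat g iV iU = 1 := rfl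
@[simp] lemma ppMat_x_v (i : Fin n) : ppMat g (idxX i) iV = 0 := rfl
@[simp] lemma ppMat_x_x (i j : Fin n) : ppMat g (idxX i) (idxX j) = g i j := rfl
@[simp] lemma ppMat_x_u (i : Fin n) : ppMat g (idxX i) iU = 0 := rfl
@[simp] lemma ppMat_u_v : ppMat g iU iV = 1 := rfl
@[simp] lemma ppMat_u_x (i : Fin n) : ppMat g iU (idxX i) = 0 := rfl
@[simp] lemma ppMat_u_u : ppMat g iU iU = 0 := rfl

variable {g}

lemma ppMat_isSymm (hg : g.IsSymm) : (ppMat g).IsSymm := by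
  refine Matrix.IsSymm.ext fun I J => ?_
  revert I J
  refine idx_cases (idx_cases rfl (fun _ => rfl) rfl) (fun i => idx_cases rfl (fun j => ?_) rfl)
    (idx_cases rfl (fun _ => rfl) rfl)
  exact hg.apply i j

lemma ppMat_mul_inv (hu : IsUnit g.det) : ppMat g * ppMat g⁻¹ = 1 := by
  have h := mul_nonsing_inv g hu
  ext I J
  rw [mul_app, sum_idx]
  revert I J
  refine idx_cases (idx_cases ?_ (fun _ => ?_) ?_) (fun i => idx_cases ?_ (fun j => ?_) ?_)
    (idx_cases ?_ (fun _ => ?_) ?_)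
  all_goals try simp
  rw [← mul_app, h]
  simp [one_app]

lemma isUnit_det_ppMat (hu : IsUnit g.det) : IsUnit (ppMat g).det :=
  Matrix.isUnit_det_of_right_inverse (ppMat_mul_inv hu)

lemma ppMat_inv (hu : IsUnit g.det) : (ppMat g)⁻¹ = ppMat g⁻¹ :=
  Matrix.inv_eq_right_inv (ppMat_mul_inv hu)

variable {Φ : FormalRing A (Idx n) iU} {f : A} {lam : ℝ}

lemma D_ppMat_v (J L : Idx n) : Φ.D J (ppMat g iV L) = 0 := by
  revert L; exact idx_cases (by simp) (by simp) (by simp)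

lemma D_ppMat_v' (J L : Idx n) : Φ.D J (ppMat g L iV) = 0 := by
  revert L; exact idx_cases (by simp) (by simp) (by simp)

lemma D_ppMat_u (J L : Idx n) : Φ.D J (ppMat g iU L) = 0 := by
  revert L; exact idx_cases (by simp) (by simp) (by simp)

variable (hDv : ∀ i j, Φ.D iV (g i j) = 0) (hu : IsUnit g.det)

include hDv in
lemma D_v_ppMat (I J : Idx n) : Φ.D iV (ppMat g I J) = 0 := by
  revert I J
  exact idx_cases (D_ppMat_v _) (fun i => idx_cases (by simp) (fun j => hDv i j) (by simp))
    (D_ppMat_u _)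

include hDv in
lemma aChr_ppMat_v (K J : Idx n) : aChr Φ.D (ppMat g) K iV J = 0 := by
  simp [aChr, D_ppMat_v, D_v_ppMat hDv]

include hDv in
lemma aChr_ppMat_v' (K J : Idx n) : aChr Φ.D (ppMat g) K J iV = 0 := by
  simp only [aChr, D_ppMat_v, D_v_ppMat hDv, D_ppMat_v']; simp

include hDv hu in
lemma aChr_ppMat_u (I J : Idx n) : aChr Φ.D (ppMat g) iU I J = 0 := by
  rw [aChr, ppMat_inv hu, sum_idx]
  simp only [ppMat_u_v, D_ppMat_v', D_v_ppMat hDv, ppMat_u_x, ppMat_u_u]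
  simp

include hu in
lemma aChr_ppMat_x (k i j : Fin n) :
    aChr Φ.D (ppMat g) (idxX k) (idxX i) (idxX j) = aChr (fun i => Φ.D (idxX i)) g k i j := by
  rw [aChr, ppMat_inv hu, sum_idx, aChr]
  simp

include hu in
lemma aChr_ppMat_v_x (i j : Fin n) :
    aChr Φ.D (ppMat g) iV (idxX i) (idxX j) = -(half A * Φ.D iU (g i j)) := by
  rw [aChr, ppMat_inv hu, sum_idx]
  simp

include hDv hu in
lemma aRic_ppMat_x (i j : Fin n) :
    aRic Φ.D (ppMat g) (idxX i) (idxX j) = aRic (fun i => Φ.D (idxX i)) g i j := by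
  simp only [aRic, sum_idx, aChr_ppMat_v hDv, aChr_ppMat_v' hDv, aChr_ppMat_u hDv hu,
    aChr_ppMat_x hu,
    derivation_aChr_eq_zero (isUnit_det_ppMat hu) (fun I a => Φ.comm iV I a) (D_v_ppMat hDv)]
  simp

include hu in
lemma aHess_ppMat_x (hDv : ∀ i j, Φ.D iV (g i j) = 0) (i j : Fin n) : aHess Φ.D (ppMat g) f (idxX i)
    (idxX j) = aHess (fun i => Φ.D (idxX i)) g f i j + half A * Φ.D iU (g i j) * Φ.D iV f := by
  simp only [aHess, sum_idx, aChr_ppMat_v_x hu, aChr_ppMat_u hDv hu, aChr_ppMat_x hu]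
  ring

include hDv hu in
lemma aP_ppMat_x (i j : Fin n) : aP Φ.D (ppMat g) f lam (idxX i) (idxX j) = aP
    (fun i => Φ.D (idxX i)) g f lam i j + half A * Φ.D iU (g i j) * Φ.D iV f := by
  simp only [aP, aRic_ppMat_x hDv hu, aHess_ppMat_x hu hDv, ppMat_x_x]
  ring

lemma card_idx : Fintype.card (Idx n) = n + 2 := by simp; omega

include hDv hu in
lemma aF_ppMat (hfv : Φ.D iV f = algebraMap ℝ A lam * Φ.X - 1) : aF Φ.D (ppMat g) f lam = aF
    (fun i => Φ.D (idxX i)) g f lam + Φ.D iV f *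
    (half A * (∑ i, ∑ j, g⁻¹ i j * Φ.D iU (g i j)) - 2 * Φ.D iU f) := by
  have huv : aHess Φ.D (ppMat g) f iU iV = algebraMap ℝ A lam := by
    simp only [aHess, aChr_ppMat_v' hDv, zero_mul, sum_const_zero, sub_zero]
    rw [Φ.comm, D_v_D hfv, if_pos rfl]
  have hvu : aHess Φ.D (ppMat g) f iV iU = algebraMap ℝ A lam := by
    simp only [aHess, aChr_ppMat_v hDv, zero_mul, sum_const_zero, sub_zero]
    rw [D_v_D hfv, if_pos rfl]
  have hL : aLap Φ.D (ppMat g) f = 2 * algebraMap ℝ A lam + aLap (fun i => Φ.D (idxX i)) g f +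
      Φ.D iV f * (half A * (∑ i, ∑ j, g⁻¹ i j * Φ.D iU (g i j))) := by
    have e : ∑ i, ∑ j, g⁻¹ i j * (half A * Φ.D iU (g i j) * Φ.D iV f) =
        Φ.D iV f * (half A * (∑ i, ∑ j, g⁻¹ i j * Φ.D iU (g i j))) := by
      simp only [mul_sum]
      exact sum_ext₂ fun _ _ => by ring
    rw [← e]
    simp only [aLap, ppMat_inv hu, sum_idx, ppMat_v_v, ppMat_v_x, ppMat_v_u, ppMat_x_v, ppMat_x_x,
      ppMat_x_u, ppMat_u_v, ppMat_u_x, ppMat_u_u, huv, hvu, aHess_ppMat_x hu hDv, mul_add,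
      sum_add_distrib, zero_mul, one_mul, sum_const_zero]
    ring
  have hg : aGradSq Φ.D (ppMat g) f = 2 * Φ.D iV f * Φ.D iU f +
      aGradSq (fun i => Φ.D (idxX i)) g f := by
    simp only [aGradSq, ppMat_inv hu, sum_idx, ppMat_v_v, ppMat_v_x, ppMat_v_u, ppMat_x_v,
      ppMat_x_x, ppMat_x_u, ppMat_u_v, ppMat_u_x, ppMat_u_u, zero_mul, one_mul, sum_const_zero]
    ring_nf
  have hc : algebraMap ℝ A (((n + 2 : ℕ) : ℝ) * lam) =
      algebraMap ℝ A ((n : ℝ) * lam) + 2 * algebraMap ℝ A lam := by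
    rw [Nat.cast_add, add_mul, map_add, map_mul _ ((2 : ℕ) : ℝ), map_natCast]; simp
  rw [aF, aF, hL, hg, card_idx, Fintype.card_fin, hc]
  ring

end PlaneFronted

/-! #### The evolution equations -/

section Flow

variable {n : ℕ} {A : Type*} [CommRing A] [Algebra ℝ A]

/-- The symmetric matrix part of the unknowns. -/
def symMat (y : (Fin n × Fin n) ⊕ Unit → A) : Matrix (Fin n) (Fin n) A :=
  of fun i j => half A * (y (Sum.inl (i, j)) + y (Sum.inl (j, i)))

lemma symMat_isSymm (y : (Fin n × Fin n) ⊕ Unit → A) : (symMat y).IsSymm :=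
  Matrix.IsSymm.ext fun i j => by simp [symMat, add_comm]

/-- Right hand side of the evolution equation of the metric. -/
def flowG (d : Fin n → Derivation ℝ A A) (e : A) (lam : ℝ) (g : Matrix (Fin n) (Fin n) A) (f : A)
    (i j : Fin n) : A := -(2 * e * aP d g f lam i j)

/-- Right hand side of the evolution equation of the density. -/
def flowF (d : Fin n → Derivation ℝ A A) (e : A) (lam : ℝ) (g : Matrix (Fin n) (Fin n) A)
    (f : A) : A := half A * e * (aF d g f lam - ∑ i, ∑ j, g⁻¹ i j * aP d g f lam i j)

/-- The evolution operator on the unknowns. -/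
def flowQ (d : Fin n → Derivation ℝ A A) (e : A) (lam : ℝ) (y : (Fin n × Fin n) ⊕ Unit → A) :
    (Fin n × Fin n) ⊕ Unit → A :=
  Sum.elim (fun p => flowG d e lam (symMat y) (y (Sum.inr ())) p.1 p.2)
    (fun _ => flowF d e lam (symMat y) (y (Sum.inr ())))

variable {ι : Type*} [DecidableEq ι] {iu : ι} {Φ : FormalRing A ι iu} {emb : Fin n → ι}
  (hemb : ∀ i, emb i ≠ iu) {e : A} {lam : ℝ}

include hemb in
lemma flow_causal {y₀ : (Fin n × Fin n) ⊕ Unit → A} (h₀ : IsUnit (symMat y₀).det) :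
    Φ.Causal y₀ (flowQ (fun i => Φ.D (emb i)) e lam) := by
  intro k y z hy hz hyz
  have hsym : ∀ {T : Ideal A} {y z : (Fin n × Fin n) ⊕ Unit → A}, (∀ i, y i - z i ∈ T) →
      ∀ i j, symMat y i j - symMat z i j ∈ T := by
    intro T y z h i j
    have := T.mul_mem_left (half A) (T.add_mem (h (Sum.inl (i, j))) (h (Sum.inl (j, i))))
    convert this using 1
    simp only [symMat, of_apply]; ring
  have u1 : IsUnit (symMat y).det := isUnit_of_congr h₀ (det_congr (hsym hy))
  have u2 : IsUnit (symMat z).det := isUnit_of_congr h₀ (det_congr (hsym hz))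
  have hT : ∀ i : Fin n, ∀ a ∈ Φ.V k, Φ.D (emb i) a ∈ Φ.V k := fun i a ha =>
    D_mem (emb i) (hemb i) ha
  have hs := hsym hyz
  have hf := hyz (Sum.inr ())
  have hP := aP_congr (D := fun i => Φ.D (emb i)) hT u1 u2 hs hf lam
  have hF := aF_congr (D := fun i => Φ.D (emb i)) hT u1 u2 hs hf lam
  have hi : ∀ i j, Ideal.Quotient.mk (Φ.V k) ((symMat y)⁻¹ i j) =
      Ideal.Quotient.mk (Φ.V k) ((symMat z)⁻¹ i j) :=
    fun i j => Ideal.Quotient.eq.2 (inv_congr u1 u2 hs i j)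
  rintro (⟨i, j⟩ | _) <;> rw [← Ideal.Quotient.eq] <;>
    simp only [flowQ, Sum.elim_inl, Sum.elim_inr, flowG, flowF, map_neg, map_mul, map_sub, map_sum,
      hP, hF, hi]

lemma symMat_elim {g : Matrix (Fin n) (Fin n) A} (hg : g.IsSymm) (h : Unit → A) :
    symMat (Sum.elim (fun p : Fin n × Fin n => g p.1 p.2) h) = g := by
  ext i j
  simp only [symMat, of_apply, Sum.elim_inl, hg.apply i j]
  linear_combination g i j * two_mul_half (A := A)

include hemb in
/-- Uniqueness of the formal evolution. -/
lemma flow_unique {g₁ g₂ : Matrix (Fin n) (Fin n) A} {f₁ f₂ : A} (h₁ : g₁.IsSymm) (h₂ : g₂.IsSymm)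
    (hu : IsUnit g₁.det) (hg : ∀ i j, g₂ i j - g₁ i j ∈ Φ.m) (hf : f₂ - f₁ ∈ Φ.m)
    (eg₁ : ∀ i j, Φ.D iu (g₁ i j) = flowG (fun i => Φ.D (emb i)) e lam g₁ f₁ i j)
    (eg₂ : ∀ i j, Φ.D iu (g₂ i j) = flowG (fun i => Φ.D (emb i)) e lam g₂ f₂ i j)
    (ef₁ : Φ.D iu f₁ = flowF (fun i => Φ.D (emb i)) e lam g₁ f₁)
    (ef₂ : Φ.D iu f₂ = flowF (fun i => Φ.D (emb i)) e lam g₂ f₂) : g₁ = g₂ ∧ f₁ = f₂ := by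
  have key := ode_unique (Φ := Φ) (flow_causal (Φ := Φ) (e := e) (lam := lam) hemb
      (y₀ := Sum.elim (fun p : Fin n × Fin n => g₁ p.1 p.2) fun _ => f₁)
      (by rwa [symMat_elim h₁]))
    (y := Sum.elim (fun p : Fin n × Fin n => g₁ p.1 p.2) fun _ => f₁)
    (z := Sum.elim (fun p : Fin n × Fin n => g₂ p.1 p.2) fun _ => f₂)
    (by simp) (by rintro (p | _); exacts [hg _ _, hf])
    (by rintro (p | _) <;> simp [flowQ, symMat_elim h₁, eg₁, ef₁])
    (by rintro (p | _) <;> simp [flowQ, symMat_elim h₂, eg₂, ef₂])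
  refine ⟨?_, congrFun key (Sum.inr ())⟩
  ext i j
  exact congrFun key (Sum.inl (i, j))

include hemb in
/-- Existence of the formal evolution. -/
lemma flow_exists (hΦ : Φ.Complete) {g₀ : Matrix (Fin n) (Fin n) A} {f₀ : A} (h₀ : g₀.IsSymm)
    (hu : IsUnit g₀.det) : ∃ (g : Matrix (Fin n) (Fin n) A) (f : A), g.IsSymm ∧ IsUnit g.det ∧
    (∀ i j, g i j - g₀ i j ∈ Φ.m) ∧ f - f₀ ∈ Φ.m ∧
    (∀ i j, Φ.D iu (g i j) = flowG (fun i => Φ.D (emb i)) e lam g f i j) ∧ Φ.D iu f = flowF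
    (fun i => Φ.D (emb i)) e lam g f := by
  obtain ⟨y, hy, ey⟩ := ode_exists (Φ := Φ) hΦ (flow_causal (Φ := Φ) (e := e) (lam := lam) hemb
      (y₀ := Sum.elim (fun p : Fin n × Fin n => g₀ p.1 p.2) fun _ => f₀)
      (by rwa [symMat_elim h₀]))
  have hm : ∀ i j, symMat y i j - g₀ i j ∈ Φ.m := by
    intro i j
    have h1 : y (Sum.inl (i, j)) - g₀ i j ∈ Φ.m := hy (Sum.inl (i, j))
    have h2 : y (Sum.inl (j, i)) - g₀ j i ∈ Φ.m := hy (Sum.inl (j, i))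
    rw [h₀.apply] at h2
    have := Φ.m.mul_mem_left (half A) (Φ.m.add_mem h1 h2)
    convert this using 1
    simp only [symMat, of_apply]
    linear_combination g₀ i j * two_mul_half (A := A)
  have hus : IsUnit (symMat y).det := isUnit_of_congr hu (det_congr hm)
  have hPs : ∀ i j, aP (fun i => Φ.D (emb i)) (symMat y) (y (Sum.inr ())) lam i j =
      aP (fun i => Φ.D (emb i)) (symMat y) (y (Sum.inr ())) lam j i := by
    intro i j
    have hc : ∀ i j : Fin n, ∀ a, Φ.D (emb i) (Φ.D (emb j) a) = Φ.D (emb j) (Φ.D (emb i) a) :=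
      fun i j a => Φ.comm _ _ a
    unfold aP
    rw [aRic_symm hc (symMat_isSymm y) hus, aHess_symm hc (symMat_isSymm y),
      (symMat_isSymm y).apply]
  have hys : ∀ i j, y (Sum.inl (i, j)) = symMat y i j := by
    intro i j
    have e1 : y (Sum.inl (i, j)) - y (Sum.inl (j, i)) = 0 := by
      refine eq_zero_of_D_eq_zero (Ψ := Φ) ?_ ?_
      · have h1 : y (Sum.inl (i, j)) - g₀ i j ∈ Φ.m := hy (Sum.inl (i, j))
        have h2 : y (Sum.inl (j, i)) - g₀ j i ∈ Φ.m := hy (Sum.inl (j, i))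
        rw [h₀.apply] at h2
        convert Φ.m.sub_mem h1 h2 using 1
        ring
      · rw [map_sub, ey, ey]
        simp only [flowQ, Sum.elim_inl, flowG]
        rw [hPs]; ring
    simp only [symMat, of_apply]
    linear_combination half A * e1 - y (Sum.inl (i, j)) * two_mul_half (A := A)
  refine ⟨symMat y, y (Sum.inr ()), symMat_isSymm y, hus, hm, hy (Sum.inr ()), fun i j => ?_,
    ey (Sum.inr ())⟩
  rw [← hys]; exact ey (Sum.inl (i, j))

end Flow

/-! #### Formal weighted ambient metrics -/

section FormalAmbient

variable {n : ℕ} {A : Type*} [CommRing A] [Algebra ℝ A] {Φ : FormalRing A (Idx n) iU} {lam : ℝ}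

/-- Weighted ambient metrics with coefficients in a formal ring. -/
structure IsFormalAmbient (Φ : FormalRing A (Idx n) iU) (lam : ℝ)
    (G : Matrix (Idx n) (Idx n) A) (f : A) : Prop where
  symm : G.IsSymm
  unit : IsUnit G.det
  D_v : ∀ I J, Φ.D iV (G I J) = 0
  D_v_density : Φ.D iV f = algebraMap ℝ A lam * Φ.X - 1
  v_v_mem : G iV iV ∈ Φ.V 2
  v_x_mem : ∀ i, G iV (idxX i) ∈ Φ.m
  P_eq : ∀ I J, aP Φ.D G f lam I J = 0
  F_eq : aF Φ.D G f lam = 0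

/-- The flow equations hold for a normal weighted ambient metric. -/
lemma IsFormalAmbient.flow {G : Matrix (Idx n) (Idx n) A} {f e : A} (h : IsFormalAmbient Φ lam G f)
    (hN : ∀ I, G iU I = if I = iV then 1 else 0) (he : (algebraMap ℝ A lam * Φ.X - 1) * e = 1) : ∃ g
    : Matrix (Fin n) (Fin n) A, G = ppMat g ∧ g.IsSymm ∧ IsUnit g.det ∧
    (∀ i j, Φ.D iU (g i j) = flowG (fun i => Φ.D (idxX i)) e lam g f i j) ∧ Φ.D iU f = flowF
    (fun i => Φ.D (idxX i)) e lam g f := by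
  obtain ⟨hvv, hvx⟩ := plane_fronted_of_normal h.D_v h.D_v_density hN h.symm h.unit h.v_v_mem
    h.v_x_mem fun J => h.P_eq _ J
  set g : Matrix (Fin n) (Fin n) A := of fun i j => G (idxX i) (idxX j) with hg
  have hGg : G = ppMat g := by
    ext I J
    revert I J
    refine idx_cases (idx_cases hvv hvx ?_) (fun i => idx_cases ?_ (fun j => rfl) ?_)
      (idx_cases ?_ (fun _ => ?_) ?_)
    · rw [← h.symm.apply, hN]; simp
    · rw [← h.symm.apply, hvx]; simp
    · rw [← h.symm.apply, hN]; simp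
    all_goals rw [hN]; simp
  have hgs : g.IsSymm := Matrix.IsSymm.ext fun i j => h.symm.apply _ _
  have hgu : IsUnit g.det := by
    refine Matrix.isUnit_det_of_right_inverse (B := of fun i j => G⁻¹ (idxX i) (idxX j)) ?_
    ext i j
    have := congrFun (congrFun (mul_nonsing_inv _ h.unit) (idxX i)) (idxX j)
    rw [mul_app, sum_idx, ← h.symm.apply (idxX i) iV, hvx, ← h.symm.apply (idxX i) iU, hN] at this
    rw [mul_app]
    simpa [hg, one_app] using this
  refine ⟨g, hGg, hgs, hgu, ?_⟩
  have hDv : ∀ i j, Φ.D iV (g i j) = 0 := fun i j => h.D_v _ _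
  have hP := h.P_eq
  have hF := h.F_eq
  rw [hGg] at hP hF
  have eg : ∀ i j, Φ.D iU (g i j) = flowG (fun i => Φ.D (idxX i)) e lam g f i j := by
    intro i j
    have := hP (idxX i) (idxX j)
    rw [aP_ppMat_x hDv hgu, h.D_v_density] at this
    unfold flowG
    linear_combination 2 * e * this - Φ.D iU (g i j) * he -
      Φ.D iU (g i j) * (algebraMap ℝ A lam * Φ.X - 1) * e * two_mul_half (A := A)
  refine ⟨eg, ?_⟩
  rw [aF_ppMat hDv hgu h.D_v_density, h.D_v_density] at hF
  simp only [eg, flowG] at hF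
  have e2 : ∑ i, ∑ j, g⁻¹ i j * -(2 * e * aP (fun i => Φ.D (idxX i)) g f lam i j) =
      -(2 * e * ∑ i, ∑ j, g⁻¹ i j * aP (fun i => Φ.D (idxX i)) g f lam i j) := by
    simp only [mul_sum, ← sum_neg_distrib]
    exact sum_ext₂ fun _ _ => by ring
  rw [e2] at hF
  unfold flowF
  set T := ∑ i, ∑ j, g⁻¹ i j * aP (fun i => Φ.D (idxX i)) g f lam i j
  set W := aF (fun i => Φ.D (idxX i)) g f lam
  set q := algebraMap ℝ A lam * Φ.X - 1
  have e3 : W - T = 2 * q * Φ.D iU f := by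
    linear_combination hF + T * (q * e) * two_mul_half (A := A) + T * he
  rw [e3]
  linear_combination -Φ.D iU f * he - Φ.D iU f * (q * e) * two_mul_half (A := A)

/-- Normal weighted ambient metrics with the same initial values agree. -/
lemma IsFormalAmbient.unique {G₁ G₂ : Matrix (Idx n) (Idx n) A} {f₁ f₂ : A}
    (h₁ : IsFormalAmbient Φ lam G₁ f₁) (h₂ : IsFormalAmbient Φ lam G₂ f₂)
    (hN₁ : ∀ I, G₁ iU I = if I = iV then 1 else 0) (hN₂ : ∀ I, G₂ iU I = if I = iV then 1 else 0)
    (hg : ∀ i j, G₂ (idxX i) (idxX j) - G₁ (idxX i) (idxX j) ∈ Φ.m) (hf : f₂ - f₁ ∈ Φ.m) :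
    G₁ = G₂ ∧ f₁ = f₂ := by
  obtain ⟨e, he⟩ := (isUnit_lam_X_sub_one Φ lam).exists_right_inv
  obtain ⟨g₁, rfl, s1, u1, a1, b1⟩ := h₁.flow hN₁ he
  obtain ⟨g₂, rfl, s2, u2, a2, b2⟩ := h₂.flow hN₂ he
  obtain ⟨h, h'⟩ := flow_unique (Φ := Φ) (emb := fun i => idxX i) (fun i => by simp) s1 s2 u1 hg hf
    a1 a2 b1 b2
  exact ⟨by rw [h], h'⟩

/-- Solutions of the flow equations give weighted ambient metrics. -/
lemma isFormalAmbient_ppMat {g : Matrix (Fin n) (Fin n) A} {f e : A}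
    (he : (algebraMap ℝ A lam * Φ.X - 1) * e = 1) (hgs : g.IsSymm) (hgu : IsUnit g.det)
    (hDv : ∀ i j, Φ.D iV (g i j) = 0) (hfv : Φ.D iV f = algebraMap ℝ A lam * Φ.X - 1)
    (eg : ∀ i j, Φ.D iU (g i j) = flowG (fun i => Φ.D (idxX i)) e lam g f i j)
    (ef : Φ.D iU f = flowF (fun i => Φ.D (idxX i)) e lam g f) :
    IsFormalAmbient Φ lam (ppMat g) f := by
  have hG := ppMat_isSymm hgs
  have hu := isUnit_det_ppMat hgu
  have hxx : ∀ i j, aP Φ.D (ppMat g) f lam (idxX i) (idxX j) = 0 := by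
    intro i j
    rw [aP_ppMat_x hDv hgu, hfv, eg, flowG]
    linear_combination (-aP (fun i => Φ.D (idxX i)) g f lam i j) * (he +
      (algebraMap ℝ A lam * Φ.X - 1) * e * two_mul_half (A := A))
  have hF : aF Φ.D (ppMat g) f lam = 0 := by
    rw [aF_ppMat hDv hgu hfv, hfv, ef, flowF]
    have e2 : ∑ i, ∑ j, g⁻¹ i j * Φ.D iU (g i j) =
        -(2 * e * ∑ i, ∑ j, g⁻¹ i j * aP (fun i => Φ.D (idxX i)) g f lam i j) := by
      simp only [mul_sum, ← sum_neg_distrib, eg, flowG]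
      exact sum_ext₂ fun _ _ => by ring
    rw [e2]
    set T := ∑ i, ∑ j, g⁻¹ i j * aP (fun i => Φ.D (idxX i)) g f lam i j
    set W := aF (fun i => Φ.D (idxX i)) g f lam
    set q := algebraMap ℝ A lam * Φ.X - 1
    linear_combination (-W) * (he + q * e * two_mul_half (A := A))
  have hv : ∀ J, aP Φ.D (ppMat g) f lam iV J = 0 := by
    intro J
    rw [aP_v_eq (D_v_ppMat hDv) hfv hG]
    simp only [aChr_ppMat_v hDv, map_zero, sum_const_zero, mul_zero, zero_mul]
    revert J
    exact idx_cases (by simp) (by simp) (by simp)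
  have hsymm : ∀ I J, aP Φ.D (ppMat g) f lam I J = aP Φ.D (ppMat g) f lam J I := by
    intro I J
    unfold aP
    rw [aRic_symm Φ.comm hG hu, aHess_symm Φ.comm hG, hG.apply]
  have hmix : ∀ J I, (((ppMat g)⁻¹ * of (aP Φ.D (ppMat g) f lam)) J I : A) =
      ∑ i, ppMat g⁻¹ J (idxX i) * aP Φ.D (ppMat g) f lam (idxX i) I +
        ppMat g⁻¹ J iU * aP Φ.D (ppMat g) f lam iU I := by
    intro J I
    rw [mul_app, sum_idx, ppMat_inv hgu]
    simp [hv]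
  have hgrad : ∀ I, ∑ K, aP Φ.D (ppMat g) f lam K I * grad Φ.D (ppMat g) f K =
      ∑ i, aP Φ.D (ppMat g) f lam (idxX i) I * grad Φ.D (ppMat g) f (idxX i) +
        aP Φ.D (ppMat g) f lam iU I * (algebraMap ℝ A lam * Φ.X - 1) := by
    intro I
    rw [sum_idx, hv, zero_mul, zero_add]
    congr 2
    rw [grad, sum_idx, ppMat_inv hgu]
    simp [hfv]
  have htr : ∑ K, ∑ L, (ppMat g)⁻¹ K L * aP Φ.D (ppMat g) f lam K L = 0 := by
    rw [ppMat_inv hgu]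
    simp only [sum_idx, hv, hxx, hsymm _ iV]
    simp
  have hDvP : ∀ I J, Φ.D iV (aP Φ.D (ppMat g) f lam I J) = 0 := by
    intro I J
    rw [aP, map_sub, map_add, D_v_hess (D_v_ppMat hDv) hfv hu,
      derivation_aRic_eq_zero hu (fun I a => Φ.comm iV I a) (D_v_ppMat hDv),
      leibniz, D_v_ppMat hDv, aChr_ppMat_u hDv hgu]
    simp
  have hB : ∀ I, aP Φ.D (ppMat g) f lam iU I * (algebraMap ℝ A lam * Φ.X - 1) =
      divMixed Φ.D (ppMat g) ((ppMat g)⁻¹ * of (aP Φ.D (ppMat g) f lam)) I -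
        ∑ i, aP Φ.D (ppMat g) f lam (idxX i) I * grad Φ.D (ppMat g) f (idxX i) := by
    intro I
    have := weighted_bianchi Φ.comm hG hu f lam I
    rw [htr, hF, hgrad, add_zero, map_zero] at this
    have := eq_zero_of_two_mul this
    linear_combination -this
  have hunit := isUnit_lam_X_sub_one Φ lam
  have hx : ∀ i, aP Φ.D (ppMat g) f lam iU (idxX i) = 0 := by
    intro i
    refine hunit.mul_left_eq_zero.1 ?_
    rw [hB]
    simp only [divMixed, hmix, sum_idx, hxx, aChr_ppMat_v hDv, aChr_ppMat_v' hDv,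
      hsymm _ iV, hv, aChr_ppMat_u hDv hgu]
    simp [hDvP]
  have huu : aP Φ.D (ppMat g) f lam iU iU = 0 := by
    refine hunit.mul_left_eq_zero.1 ?_
    rw [hB]
    simp only [divMixed, hmix, sum_idx, hxx, aChr_ppMat_v hDv, aChr_ppMat_v' hDv,
      hsymm _ iV, hv, aChr_ppMat_u hDv hgu, hx, hsymm (idxX _) iU]
    simp [hDvP]
  refine ⟨hG, hu, D_v_ppMat hDv, hfv, by simp, by simp, ?_, hF⟩
  refine idx_cases hv (fun i => idx_cases ?_ (hxx i) ?_) (idx_cases ?_ hx huu)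
  · rw [hsymm]; exact hv _
  · rw [hsymm]; exact hx i
  · rw [hsymm]; exact hv _

end FormalAmbient

end

section

/-! ### Functions of one variable that vanish to infinite order -/

section OneVariable

lemma exists_Ioo_of_eventually {P : ℝ → Prop} (h : ∀ᶠ t in 𝓝 (0 : ℝ), P t) :
    ∃ ε > 0, ∀ t ∈ Set.Ioo (-ε) ε, P t := by
  obtain ⟨ε, hε, H⟩ := Metric.eventually_nhds_iff.1 h
  refine ⟨ε, hε, fun t ht => H ?_⟩
  rw [Real.dist_eq, sub_zero, abs_lt]; exact ht

lemma isLittleO_sub_of_iteratedDeriv {F : ℝ → ℝ} (hF : ∀ᶠ t in 𝓝 (0 : ℝ), ContDiffAt ℝ ∞ F t)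
    (N : ℕ) (h : ∀ k < N, iteratedDeriv k F 0 = 0) :
    (fun t => F t - ((N.factorial : ℝ)⁻¹ * t ^ N) * iteratedDeriv N F 0) =o[𝓝 0] fun t => t ^ N :=
    by
  obtain ⟨ε, hε, H⟩ := exists_Ioo_of_eventually hF
  have h0 : (0 : ℝ) ∈ Set.Ioo (-ε) ε := ⟨by linarith, hε⟩
  have hc : ContDiffOn ℝ N F (Set.Ioo (-ε) ε) := fun t ht =>
    ((H t ht).of_le (by exact_mod_cast le_top)).contDiffWithinAt
  have := taylor_isLittleO (convex_Ioo (-ε) ε) h0 hc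
  rw [isOpen_Ioo.nhdsWithin_eq h0] at this
  simp only [sub_zero] at this
  refine this.congr_left fun t => ?_
  congr 1
  rw [taylor_within_apply, Finset.sum_range_succ, sum_eq_zero, zero_add]
  · rw [iteratedDerivWithin_of_isOpen isOpen_Ioo h0, sub_zero, smul_eq_mul]
  · intro k hk
    rw [iteratedDerivWithin_of_isOpen isOpen_Ioo h0, h k (Finset.mem_range.1 hk), smul_zero]

lemma oInfty_iff {F : ℝ → ℝ} (hF : ∀ᶠ t in 𝓝 (0 : ℝ), ContDiffAt ℝ ∞ F t) :
    OInfty F ↔ ∀ k, iteratedDeriv k F 0 = 0 := by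
  constructor
  · intro h k
    induction k using Nat.strong_induction_on with
    | _ k ih =>
    have h1 := isLittleO_sub_of_iteratedDeriv hF k ih
    have h2 : F =o[𝓝 0] fun t => t ^ k :=
      (h (k + 1)).trans_isLittleO (Asymptotics.isLittleO_pow_pow (Nat.lt_succ_self k))
    have h3 := (h2.sub h1).mono (nhdsWithin_le_nhds (s := {0}ᶜ))
    simp only [sub_sub_cancel] at h3
    rw [Asymptotics.isLittleO_iff_tendsto'] at h3
    · have h4 : Tendsto (fun _ : ℝ => (k.factorial : ℝ)⁻¹ * iteratedDeriv k F 0)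
          (𝓝[≠] 0) (𝓝 0) := by
        refine h3.congr' ?_
        filter_upwards [self_mem_nhdsWithin] with t ht
        have : t ^ k ≠ 0 := pow_ne_zero _ ht
        field_simp
      have h5 := tendsto_nhds_unique h4 tendsto_const_nhds
      have : (k.factorial : ℝ)⁻¹ ≠ 0 := inv_ne_zero (by exact_mod_cast k.factorial_ne_zero)
      exact (mul_eq_zero.1 h5.symm).resolve_left this
    · filter_upwards [self_mem_nhdsWithin] with t ht h0
      exact absurd h0 (pow_ne_zero _ ht)
  · intro h N
    have := isLittleO_sub_of_iteratedDeriv hF N fun k _ => h k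
    simp only [h N, mul_zero, sub_zero] at this
    exact this.isBigO

end OneVariable

/-! ### Directional derivatives -/

section Directional

variable {W : Type*} [NormedAddCommGroup W] [NormedSpace ℝ W]

/-- The derivative in the direction of a fixed vector. -/
def dirD (w : W) (f : W → ℝ) (p : W) : ℝ := fderiv ℝ f p w

/-- Smoothness near a point. -/
abbrev SmoothAt {Y : Type*} [NormedAddCommGroup Y] [NormedSpace ℝ Y] (f : W → Y) (p : W) : Prop :=
  ∀ᶠ q in 𝓝 p, ContDiffAt ℝ ∞ f q

lemma contDiffAt_dirD {f : W → ℝ} {p : W} (h : ContDiffAt ℝ ∞ f p) (w : W) :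
    ContDiffAt ℝ ∞ (dirD w f) p := (h.fderiv_right (m := ∞) (by simp)).clm_apply contDiffAt_const

lemma SmoothAt.dirD {f : W → ℝ} {p : W} (h : SmoothAt f p) (w : W) :
    SmoothAt (dirD w f) p := h.mono fun _ hq => contDiffAt_dirD hq w

lemma SmoothAt.iterate_dirD {f : W → ℝ} {p : W} (h : SmoothAt f p) (w : W) (k : ℕ) :
    SmoothAt ((WeightedAmbient.dirD w)^[k] f) p := by
  induction k generalizing f with
  | zero => exact h
  | succ k ih => exact ih (h.dirD w)

lemma dirD_congr {f g : W → ℝ} {p : W} (h : f =ᶠ[𝓝 p] g) (w : W) : dirD w f =ᶠ[𝓝 p] dirD w g := by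
  filter_upwards [h.eventually_nhds] with q hq
  simp only [dirD, Filter.EventuallyEq.fderiv_eq hq]

lemma iterate_dirD_congr {f g : W → ℝ} {p : W} (h : f =ᶠ[𝓝 p] g) (w : W) (k : ℕ) :
    (dirD w)^[k] f =ᶠ[𝓝 p] (dirD w)^[k] g := by
  induction k generalizing f g with
  | zero => exact h
  | succ k ih => exact ih (dirD_congr h w)

lemma differentiableAt_of_smooth {Y : Type*} [NormedAddCommGroup Y] [NormedSpace ℝ Y]
    {f : W → Y} {p : W} (h : ContDiffAt ℝ ∞ f p) :
    DifferentiableAt ℝ f p := h.differentiableAt (by simp)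

lemma dirD_add {f g : W → ℝ} {p : W} (hf : SmoothAt f p) (hg : SmoothAt g p) (w : W) :
    dirD w (f + g) =ᶠ[𝓝 p] dirD w f + dirD w g := by
  filter_upwards [hf, hg] with q h1 h2
  simp [dirD, fderiv_add (differentiableAt_of_smooth h1) (differentiableAt_of_smooth h2)]

lemma dirD_mul {f g : W → ℝ} {p : W} (hf : SmoothAt f p) (hg : SmoothAt g p) (w : W) :
    dirD w (f * g) =ᶠ[𝓝 p] f * dirD w g + g * dirD w f := by
  filter_upwards [hf, hg] with q h1 h2
  simp [dirD, fderiv_mul (differentiableAt_of_smooth h1) (differentiableAt_of_smooth h2)]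

lemma dirD_comm {f : W → ℝ} {p : W} (hf : SmoothAt f p) (w w' : W) :
    dirD w (dirD w' f) =ᶠ[𝓝 p] dirD w' (dirD w f) := by
  filter_upwards [hf] with q hq
  have hd : DifferentiableAt ℝ (fderiv ℝ f) q :=
    differentiableAt_of_smooth (hq.fderiv_right (m := ∞) (by simp))
  have key : ∀ a b : W, dirD a (dirD b f) q = fderiv ℝ (fderiv ℝ f) q a b := by
    intro a b
    change fderiv ℝ (fun y => fderiv ℝ f y b) q a = _
    rw [fderiv_clm_apply hd (differentiableAt_const b)]
    simp
  rw [key, key]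
  exact (hq.isSymmSndFDerivAt (by simp only [minSmoothness_of_isRCLikeNormedField]; exact WithTop.coe_le_coe.2 (le_top : (2 : ℕ∞) ≤ ⊤))).eq w w'

lemma dirD_iterate_comm {f : W → ℝ} {p : W} (hf : SmoothAt f p) (w w' : W) (k : ℕ) :
    (dirD w)^[k] (dirD w' f) =ᶠ[𝓝 p] dirD w' ((dirD w)^[k] f) := by
  induction k generalizing f with
  | zero => rfl
  | succ k ih =>
    exact (iterate_dirD_congr (dirD_comm hf w w') w k).trans (ih (hf.dirD w))

lemma smoothAt_line {f : W → ℝ} {p : W} (hf : SmoothAt f p) (w : W) :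
    ∀ᶠ t in 𝓝 (0 : ℝ), ContDiffAt ℝ ∞ (fun t : ℝ => f (p + t • w)) t := by
  have hc : Tendsto (fun t : ℝ => p + t • w) (𝓝 0) (𝓝 p) := by
    have : Continuous fun t : ℝ => p + t • w := by fun_prop
    simpa using this.tendsto 0
  filter_upwards [hc.eventually hf] with t ht
  exact ht.comp t (by fun_prop)

lemma iteratedDeriv_line {f : W → ℝ} {p : W} (hf : SmoothAt f p) (w : W) (k : ℕ) :
    iteratedDeriv k (fun t : ℝ => f (p + t • w)) 0 = (dirD w)^[k] f p := by
  induction k generalizing f with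
  | zero => simp
  | succ k ih =>
    rw [iteratedDeriv_succ', iterate_succ_apply, ← ih (hf.dirD w)]
    apply Filter.EventuallyEq.iteratedDeriv_eq
    have hc : Tendsto (fun t : ℝ => p + t • w) (𝓝 0) (𝓝 p) := by
      have : Continuous fun t : ℝ => p + t • w := by fun_prop
      simpa using this.tendsto 0
    filter_upwards [hc.eventually hf] with t ht
    have h1 : HasDerivAt (fun t : ℝ => p + t • w) w t := by
      simpa using ((hasDerivAt_id t).smul_const w).const_add p
    exact ((differentiableAt_of_smooth ht).hasFDerivAt.comp_hasDerivAt t h1).deriv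

lemma oInfty_line_iff {f : W → ℝ} {p : W} (hf : SmoothAt f p) (w : W) :
    OInfty (fun t : ℝ => f (p + t • w)) ↔ ∀ k, (dirD w)^[k] f p = 0 := by
  rw [oInfty_iff (smoothAt_line hf w)]
  simp only [iteratedDeriv_line hf w]

end Directional

/-! ### Jets along a piece of a hyperplane -/

/-- A subset of a hyperplane, equal to the closure of its interior there, and coordinate
vectors. -/
structure Slab (W : Type*) [NormedAddCommGroup W] [NormedSpace ℝ W] (ι : Type*) [Fintype ι]
    [DecidableEq ι] (iu : ι) where
  /-- The coordinate vectors. -/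
  e : ι → W
  /-- The coordinates. -/
  co : ι → W →L[ℝ] ℝ
  co_sum : ∀ w, ∑ I, co I w • e I = w
  ht_e : ∀ I, co iu (e I) = if I = iu then 1 else 0
  /-- The subset of the hyperplane. -/
  S : Set W
  ht_S : ∀ p ∈ S, co iu p = 0
  dense : S ⊆ closure {q | q ∈ S ∧ ∀ᶠ r in 𝓝 q, co iu r = 0 → r ∈ S}

namespace Slab

variable {W : Type*} [NormedAddCommGroup W] [NormedSpace ℝ W] {ι : Type*} [Fintype ι]
  [DecidableEq ι] {iu : ι} (B : Slab W ι iu)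

/-- Smoothness near the hypersurface. -/
def SmoothNear {Y : Type*} [NormedAddCommGroup Y] [NormedSpace ℝ Y] (f : W → Y) : Prop :=
  ∀ p ∈ B.S, SmoothAt f p

/-- The algebra of functions that are smooth near the hypersurface. -/
def smooth : Subalgebra ℝ (W → ℝ) where
  carrier := {f | B.SmoothNear f}
  mul_mem' hf hg p hp := by filter_upwards [hf p hp, hg p hp] with q h1 h2 using h1.mul h2
  add_mem' hf hg p hp := by filter_upwards [hf p hp, hg p hp] with q h1 h2 using h1.add h2
  algebraMap_mem' r p _ := .of_forall fun _ => contDiffAt_const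

lemma vanish_dirD {f : W → ℝ} (hf : B.SmoothNear f) (h : ∀ p ∈ B.S, f p = 0) {w : W}
    (hw : B.co iu w = 0) : ∀ p ∈ B.S, dirD w f p = 0 := by
  have hdir : ∀ q, q ∈ B.S → (∀ᶠ r in 𝓝 q, B.co iu r = 0 → r ∈ B.S) → dirD w f q = 0 := by
    intro q hq hr
    have hs := hf q hq
    rw [← Function.iterate_one (dirD w), ← iteratedDeriv_line hs w 1]
    have hc : Tendsto (fun t : ℝ => q + t • w) (𝓝 0) (𝓝 q) := by
      have : Continuous fun t : ℝ => q + t • w := by fun_prop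
      simpa using this.tendsto 0
    have : (fun t : ℝ => f (q + t • w)) =ᶠ[𝓝 0] fun _ => 0 := by
      filter_upwards [hc.eventually hr] with t ht
      refine h _ (ht ?_)
      rw [map_add, map_smul, hw, smul_zero, add_zero, B.ht_S q hq]
    rw [this.iteratedDeriv_eq]; simp
  intro p hp
  have hcont : ContinuousAt (dirD w f) p := (contDiffAt_dirD (hf p hp).self_of_nhds w).continuousAt
  have hmem := B.dense hp
  rw [mem_closure_iff_frequently] at hmem
  by_contra hne
  have := hcont.eventually_ne hne
  obtain ⟨q, ⟨hq, hq'⟩, hq2⟩ := (hmem.and_eventually this).exists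
  exact hq2 (hdir q hq hq')

lemma SmoothNear.dirD {B : Slab W ι iu} {f : W → ℝ} (h : B.SmoothNear f) (w : W) :
    B.SmoothNear (dirD w f) := fun p hp => (h p hp).dirD w

lemma SmoothNear.iterate_dirD {B : Slab W ι iu} {f : W → ℝ} (h : B.SmoothNear f) (w : W)
    (k : ℕ) : B.SmoothNear ((WeightedAmbient.dirD w)^[k] f) := fun p hp => (h p hp).iterate_dirD w k

/-- The ideal of functions that vanish to infinite order on the hypersurface. -/
def flat : Ideal B.smooth where
  carrier := {f | ∀ p ∈ B.S, OInfty fun t => f.1 (p + t • B.e iu)}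
  add_mem' hf hg p hp N := (hf p hp N).add (hg p hp N)
  zero_mem' p _ N := Asymptotics.isBigO_zero _ _
  smul_mem' c f hf p hp N := by
    have h1 : (fun t : ℝ => c.1 (p + t • B.e iu)) =O[𝓝 0] fun _ => (1 : ℝ) := by
      have := (smoothAt_line (c.2 p hp) (B.e iu)).self_of_nhds.continuousAt
      exact this.isBigO_one ℝ
    have := h1.mul (hf p hp N)
    simpa using this

lemma mem_flat_iff {f : B.smooth} : f ∈ B.flat ↔ ∀ k, ∀ p ∈ B.S, (dirD (B.e iu))^[k] f.1 p = 0 := by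
  constructor
  · exact fun h k p hp => (oInfty_line_iff (f.2 p hp) _).1 (h p hp) k
  · exact fun h p hp => (oInfty_line_iff (f.2 p hp) _).2 fun k => h k p hp

/-- The derivative of a smooth function in the direction of a coordinate vector. -/
def dS (I : ι) (f : B.smooth) : B.smooth := ⟨dirD (B.e I) f.1, SmoothNear.dirD f.2 _⟩

lemma mem_flat_of_eq {f : B.smooth} (h : ∀ p ∈ B.S, f.1 =ᶠ[𝓝 p] 0) : f ∈ B.flat := by
  rw [mem_flat_iff]
  intro k p hp
  rw [(iterate_dirD_congr (h p hp) (B.e iu) k).self_of_nhds]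
  induction k with
  | zero => rfl
  | succ k ih =>
    rw [iterate_succ_apply]
    convert ih using 2
    funext q
    simp [dirD, Pi.zero_def]

lemma dS_mem_flat (I : ι) {f : B.smooth} (hf : f ∈ B.flat) : B.dS I f ∈ B.flat := by
  rw [mem_flat_iff] at hf ⊢
  intro k p hp
  by_cases hI : I = iu
  · subst hI; exact hf (k + 1) p hp
  · change (dirD (B.e iu))^[k] (dirD (B.e I) f.1) p = 0
    rw [(dirD_iterate_comm (f.2 p hp) _ _ k).self_of_nhds]
    exact B.vanish_dirD (SmoothNear.iterate_dirD f.2 _ k) (hf k) (by rw [B.ht_e, if_neg hI]) p hp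

/-- The ring of jets. -/
def Jet := B.smooth ⧸ B.flat

instance : CommRing B.Jet := inferInstanceAs (CommRing (B.smooth ⧸ B.flat))

instance : Algebra ℝ B.Jet := inferInstanceAs (Algebra ℝ (B.smooth ⧸ B.flat))

/-- The jet of a function. -/
def jet : B.smooth →ₐ[ℝ] B.Jet := Ideal.Quotient.mkₐ ℝ B.flat

lemma jet_surjective : Surjective B.jet := Ideal.Quotient.mkₐ_surjective ℝ B.flat

lemma jet_eq_iff {f g : B.smooth} : B.jet f = B.jet g ↔ f - g ∈ B.flat := Ideal.Quotient.eq

lemma jet_eq_zero_iff {f : B.smooth} : B.jet f = 0 ↔ f ∈ B.flat := Ideal.Quotient.eq_zero_iff_mem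

lemma jet_eq_of_eventuallyEq {f g : B.smooth} (h : ∀ p ∈ B.S, f.1 =ᶠ[𝓝 p] g.1) :
    B.jet f = B.jet g := by
  rw [jet_eq_iff]
  refine B.mem_flat_of_eq fun p hp => ?_
  filter_upwards [h p hp] with q hq
  simp [hq]

lemma jet_dS_eq (I : ι) {f g : B.smooth} (h : B.jet f = B.jet g) :
    B.jet (B.dS I f) = B.jet (B.dS I g) := by
  have h2 := (B.jet_eq_zero_iff).2 (B.dS_mem_flat I (B.jet_eq_iff.1 h))
  have e : B.jet (B.dS I f) = B.jet (B.dS I (f - g) + B.dS I g) := by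
    refine B.jet_eq_of_eventuallyEq fun p hp => ?_
    have := dirD_add ((f - g).2 p hp) (g.2 p hp) (B.e I)
    have e2 : (f - g).1 + g.1 = f.1 := by funext r; simp
    rwa [e2] at this
  rw [e, map_add, h2, zero_add]

/-- The derivative of a jet along a coordinate. -/
def derivJet (I : ι) (a : B.Jet) : B.Jet := B.jet (B.dS I (Function.surjInv B.jet_surjective a))

lemma derivJet_jet (I : ι) (f : B.smooth) : B.derivJet I (B.jet f) = B.jet (B.dS I f) :=
  B.jet_dS_eq I (Function.surjInv_eq _ _)

lemma derivJet_add (I : ι) (a b : B.Jet) :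
    B.derivJet I (a + b) = B.derivJet I a + B.derivJet I b := by
  obtain ⟨f, rfl⟩ := B.jet_surjective a
  obtain ⟨g, rfl⟩ := B.jet_surjective b
  rw [← map_add, derivJet_jet, derivJet_jet, derivJet_jet, ← map_add]
  exact B.jet_eq_of_eventuallyEq fun p hp => dirD_add (f.2 p hp) (g.2 p hp) _

lemma derivJet_mul (I : ι) (a b : B.Jet) :
    B.derivJet I (a * b) = a * B.derivJet I b + b * B.derivJet I a := by
  obtain ⟨f, rfl⟩ := B.jet_surjective a
  obtain ⟨g, rfl⟩ := B.jet_surjective b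
  rw [← map_mul, derivJet_jet, derivJet_jet, derivJet_jet, ← map_mul, ← map_mul, ← map_add]
  exact B.jet_eq_of_eventuallyEq fun p hp => dirD_mul (f.2 p hp) (g.2 p hp) _

lemma derivJet_algebraMap (I : ι) (r : ℝ) : B.derivJet I (algebraMap ℝ B.Jet r) = 0 := by
  rw [← AlgHom.commutes B.jet, derivJet_jet, ← map_zero B.jet]
  refine B.jet_eq_of_eventuallyEq fun p hp => .of_forall fun q => ?_
  change fderiv ℝ (fun _ => r) q (B.e I) = 0
  simp

/-- The derivation of jets along a coordinate. -/
def dJ (I : ι) : Derivation ℝ B.Jet B.Jet := Derivation.mk' (R := ℝ)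
    { toFun := B.derivJet I
      map_add' := B.derivJet_add I
      map_smul' := fun r a => by
        rw [Algebra.smul_def, derivJet_mul, derivJet_algebraMap, mul_zero, add_zero,
          RingHom.id_apply, Algebra.smul_def] }
    (fun a b => B.derivJet_mul I a b)

lemma dJ_jet (I : ι) (f : B.smooth) : B.dJ I (B.jet f) = B.jet (B.dS I f) := B.derivJet_jet I f

/-- Evaluation of jets at a point of the hypersurface. -/
def ev (p : B.S) : B.Jet →+* ℝ := Ideal.Quotient.lift B.flat
    ((Pi.evalRingHom (fun _ : W => ℝ) p.1).comp B.smooth.val.toRingHom) (by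
      intro f hf
      exact (mem_flat_iff B).1 hf 0 p.1 p.2)

lemma ev_jet (p : B.S) (f : B.smooth) : B.ev p (B.jet f) = f.1 p.1 := rfl

/-- The ideal of jets that vanish on the hypersurface. -/
def ideal : Ideal B.Jet := ⨅ p : B.S, RingHom.ker (B.ev p)

lemma jet_mem_ideal {f : B.smooth} : B.jet f ∈ B.ideal ↔ ∀ p ∈ B.S, f.1 p = 0 := by
  simp only [ideal, Ideal.mem_iInf, RingHom.mem_ker, ev_jet, Subtype.forall]

lemma iterate_dJ_jet (k : ℕ) (f : B.smooth) :
    (B.dJ iu)^[k] (B.jet f) = B.jet ⟨(dirD (B.e iu))^[k] f.1, SmoothNear.iterate_dirD f.2 _ k⟩ := by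
  induction k generalizing f with
  | zero => rfl
  | succ k ih => rw [iterate_succ_apply, dJ_jet, ih]; rfl

/-- The jets along a hypersurface form a formal ring. -/
def formal : FormalRing B.Jet ι iu where
  D := B.dJ
  comm I J a := by
    obtain ⟨f, rfl⟩ := B.jet_surjective a
    rw [dJ_jet, dJ_jet, dJ_jet, dJ_jet]
    exact B.jet_eq_of_eventuallyEq fun p hp => dirD_comm (f.2 p hp) _ _
  m := B.ideal
  tangential I hI a ha := by
    obtain ⟨f, rfl⟩ := B.jet_surjective a
    rw [jet_mem_ideal] at ha
    rw [dJ_jet, jet_mem_ideal]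
    exact B.vanish_dirD f.2 ha (by rw [B.ht_e, if_neg hI])
  X := B.jet ⟨B.co iu, fun p _ => .of_forall fun q => (B.co iu).contDiff.contDiffAt⟩
  X_mem := (jet_mem_ideal B).2 B.ht_S
  D_X I := by
    rw [dJ_jet]
    have : (if I = iu then (1 : B.Jet) else 0) = algebraMap ℝ B.Jet (B.co iu (B.e I)) := by
      rw [B.ht_e]; split_ifs <;> simp
    rw [this, ← AlgHom.commutes B.jet]
    refine B.jet_eq_of_eventuallyEq fun p hp => .of_forall fun q => ?_
    change fderiv ℝ (B.co iu) q (B.e I) = B.co iu (B.e I)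
    rw [(B.co iu).fderiv]
  separated a ha := by
    obtain ⟨f, rfl⟩ := B.jet_surjective a
    rw [jet_eq_zero_iff, mem_flat_iff]
    intro k
    have := ha k
    rwa [iterate_dJ_jet, jet_mem_ideal] at this
  isUnit_of a b h := by
    obtain ⟨f, rfl⟩ := B.jet_surjective a
    obtain ⟨g, rfl⟩ := B.jet_surjective b
    rw [← map_mul, ← map_one B.jet, ← map_sub, jet_mem_ideal] at h
    have hne : ∀ p ∈ B.S, ∀ᶠ q in 𝓝 p, f.1 q ≠ 0 := by
      intro p hp
      have h0 : f.1 p ≠ 0 := by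
        intro h0
        have := h p hp
        simp [h0] at this
      exact (f.2 p hp).self_of_nhds.continuousAt.eventually_ne h0
    let k : B.smooth := ⟨fun q => (f.1 q)⁻¹, fun p hp => by
      filter_upwards [f.2 p hp, hne p hp] with q h1 h2 using h1.inv h2⟩
    refine IsUnit.of_mul_eq_one (B.jet k) ?_
    rw [← map_mul, ← map_one B.jet]
    refine B.jet_eq_of_eventuallyEq fun p hp => ?_
    filter_upwards [hne p hp] with q hq
    exact mul_inv_cancel₀ hq

end Slab

end

section

namespace Slab

section HasJet

variable {W : Type*} [NormedAddCommGroup W] [NormedSpace ℝ W] {ι : Type*} [Fintype ι]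
  [DecidableEq ι] {iu : ι} (B : Slab W ι iu)

/-- The function `f` is smooth near the hypersurface and has the jet `a`. -/
def HasJet (f : W → ℝ) (a : B.Jet) : Prop := ∃ h : B.SmoothNear f, B.jet ⟨f, h⟩ = a

lemma exists_hasJet (a : B.Jet) : ∃ f, B.HasJet f a := by
  obtain ⟨f, rfl⟩ := B.jet_surjective a
  exact ⟨f.1, f.2, rfl⟩

variable {B}

lemma SmoothNear.hasJet {f : W → ℝ} (h : B.SmoothNear f) : B.HasJet f (B.jet ⟨f, h⟩) := ⟨h, rfl⟩

namespace HasJet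

variable {f g : W → ℝ} {a b : B.Jet}

lemma smooth (h : B.HasJet f a) : B.SmoothNear f := h.1

lemma add (hf : B.HasJet f a) (hg : B.HasJet g b) : B.HasJet (fun p => f p + g p) (a + b) := by
  obtain ⟨h1, rfl⟩ := hf
  obtain ⟨h2, rfl⟩ := hg
  exact ⟨B.smooth.add_mem h1 h2, by rw [← map_add]; rfl⟩

lemma mul (hf : B.HasJet f a) (hg : B.HasJet g b) : B.HasJet (fun p => f p * g p) (a * b) := by
  obtain ⟨h1, rfl⟩ := hf
  obtain ⟨h2, rfl⟩ := hg
  exact ⟨B.smooth.mul_mem h1 h2, by rw [← map_mul]; rfl⟩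

lemma sub (hf : B.HasJet f a) (hg : B.HasJet g b) : B.HasJet (fun p => f p - g p) (a - b) := by
  obtain ⟨h1, rfl⟩ := hf
  obtain ⟨h2, rfl⟩ := hg
  exact ⟨B.smooth.sub_mem h1 h2, by rw [← map_sub]; rfl⟩

variable (B) in
lemma const (r : ℝ) : B.HasJet (fun _ => r) (algebraMap ℝ B.Jet r) :=
  ⟨B.smooth.algebraMap_mem r, by rw [← AlgHom.commutes B.jet]; rfl⟩

variable (B) in
lemma one : B.HasJet (fun _ => 1) 1 := by simpa using const B 1

variable (B) in
lemma zero : B.HasJet (fun _ => 0) 0 := by simpa using const B 0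

lemma sum {κ : Type*} {s : Finset κ} {F : κ → W → ℝ} {A : κ → B.Jet}
    (h : ∀ i ∈ s, B.HasJet (F i) (A i)) : B.HasJet (fun p => ∑ i ∈ s, F i p) (∑ i ∈ s, A i) := by
  classical
  induction s using Finset.induction_on with
  | empty => simpa using zero B
  | insert i s hi ih =>
    simp only [Finset.sum_insert hi]
    exact (h i (Finset.mem_insert_self _ _)).add
      (ih fun j hj => h j (Finset.mem_insert_of_mem hj))

lemma dirD (hf : B.HasJet f a) (I : ι) : B.HasJet (dirD (B.e I) f) (B.dJ I a) := by
  obtain ⟨h1, rfl⟩ := hf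
  exact ⟨h1.dirD _, by rw [dJ_jet]; rfl⟩

lemma congr (hf : B.HasJet f a) (h : ∀ p ∈ B.S, f =ᶠ[𝓝 p] g) : B.HasJet g a := by
  obtain ⟨h1, rfl⟩ := hf
  have h2 : B.SmoothNear g := fun p hp => by
    filter_upwards [h1 p hp, (h p hp).eventually_nhds] with q hq hq'
    exact hq.congr_of_eventuallyEq (Filter.EventuallyEq.symm hq')
  exact ⟨h2, (B.jet_eq_of_eventuallyEq h).symm⟩

lemma oInfty (hf : B.HasJet f a) (hg : B.HasJet g a) (p : W) (hp : p ∈ B.S) :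
    OInfty fun t => f (p + t • B.e iu) - g (p + t • B.e iu) := by
  obtain ⟨h1, rfl⟩ := hf
  obtain ⟨h2, h3⟩ := hg
  exact B.jet_eq_iff.1 h3.symm p hp

lemma eq_of_oInfty (hf : B.HasJet f a) (hg : B.HasJet g b)
    (h : ∀ p ∈ B.S, OInfty fun t => f (p + t • B.e iu) - g (p + t • B.e iu)) : a = b := by
  obtain ⟨h1, rfl⟩ := hf
  obtain ⟨h2, rfl⟩ := hg
  exact B.jet_eq_iff.2 h

lemma unique (hf : B.HasJet f a) (hg : B.HasJet f b) : a = b := by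
  obtain ⟨h1, rfl⟩ := hf
  obtain ⟨h2, rfl⟩ := hg
  rfl

lemma mem_ideal_iff (hf : B.HasJet f a) : a ∈ B.formal.m ↔ ∀ p ∈ B.S, f p = 0 := by
  obtain ⟨h1, rfl⟩ := hf
  exact B.jet_mem_ideal

variable (B) in
lemma X : B.HasJet (B.co iu) B.formal.X := ⟨_, rfl⟩

end HasJet

variable (B) in
/-- The jet of a coordinate. -/
def coordJet (I : ι) : B.Jet := B.jet ⟨B.co I, fun _ _ =>
    .of_forall fun _ => (B.co I).contDiff.contDiffAt⟩

lemma hasJet_coord (I : ι) : B.HasJet (B.co I) (B.coordJet I) := ⟨_, rfl⟩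

lemma coordJet_iu : B.coordJet iu = B.formal.X := rfl

end HasJet

/-! ### Composition with smooth maps -/

section Composition

variable {W₁ W₂ : Type*} [NormedAddCommGroup W₁] [NormedSpace ℝ W₁] [NormedAddCommGroup W₂]
  [NormedSpace ℝ W₂] {ι₁ ι₂ : Type*} [Fintype ι₁] [DecidableEq ι₁] [Fintype ι₂] [DecidableEq ι₂]
  {i₁ : ι₁} {i₂ : ι₂}

/-- A map between hypersurfaces that is smooth near the first one. -/
structure JetMap (B₁ : Slab W₁ ι₁ i₁) (B₂ : Slab W₂ ι₂ i₂) (y : W₁ → W₂) : Prop where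
  smooth : B₁.SmoothNear y
  maps : ∀ p ∈ B₁.S, y p ∈ B₂.S

variable {B₁ : Slab W₁ ι₁ i₁} {B₂ : Slab W₂ ι₂ i₂} {y z : W₁ → W₂}

namespace JetMap

lemma tendsto (h : JetMap B₁ B₂ y) {p : W₁} (hp : p ∈ B₁.S) :
    Tendsto y (𝓝 p) (𝓝 (y p)) := (h.smooth p hp).self_of_nhds.continuousAt

lemma smoothNear_comp (h : JetMap B₁ B₂ y) {f : W₂ → ℝ} (hf : B₂.SmoothNear f) :
    B₁.SmoothNear (f ∘ y) := by
  intro p hp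
  filter_upwards [h.smooth p hp, (h.tendsto hp).eventually (hf _ (h.maps p hp))] with q h1 h2
  exact h2.comp q h1

lemma smoothNear_co (h : JetMap B₁ B₂ y) (L : ι₂) : B₁.SmoothNear (fun p => B₂.co L (y p)) :=
  h.smoothNear_comp (f := B₂.co L) (hasJet_coord L).smooth

/-- The composition of smooth functions with the map. -/
def compSmooth (h : JetMap B₁ B₂ y) : B₂.smooth →ₐ[ℝ] B₁.smooth where
  toFun f := ⟨f.1 ∘ y, h.smoothNear_comp f.2⟩
  map_one' := rfl
  map_mul' _ _ := rfl
  map_zero' := rfl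
  map_add' _ _ := rfl
  commutes' _ := rfl

lemma dirD_comp (h : JetMap B₁ B₂ y) {f : W₂ → ℝ} (hf : B₂.SmoothNear f) (w : W₁) {p : W₁}
    (hp : p ∈ B₁.S) : dirD w (f ∘ y) =ᶠ[𝓝 p] fun q => ∑ L, dirD w (fun q => B₂.co L (y q)) q * dirD
    (B₂.e L) f (y q) := by
  filter_upwards [h.smooth p hp, (h.tendsto hp).eventually (hf _ (h.maps p hp))] with q h1 h2
  have d1 := differentiableAt_of_smooth h1
  have d2 := differentiableAt_of_smooth h2
  simp only [dirD]
  rw [fderiv_comp q d2 d1, ContinuousLinearMap.comp_apply]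
  conv_lhs => rw [← B₂.co_sum (fderiv ℝ y q w), map_sum]
  refine sum_ext fun L => ?_
  rw [map_smul, smul_eq_mul]
  congr 1
  have : HasFDerivAt (fun q => B₂.co L (y q)) ((B₂.co L).comp (fderiv ℝ y q)) q :=
    (B₂.co L).hasFDerivAt.comp q d1.hasFDerivAt
  rw [this.fderiv]; rfl

lemma dJ_compSmooth (h : JetMap B₁ B₂ y) (I : ι₁) (f : B₂.smooth) : B₁.dJ I
    (B₁.jet (h.compSmooth f)) = ∑ L, B₁.dJ I (B₁.jet ⟨_, h.smoothNear_co L⟩) * B₁.jet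
    (h.compSmooth (B₂.dS L f)) := by
  have h1 : B₁.HasJet (dirD (B₁.e I) (f.1 ∘ y)) (B₁.dJ I (B₁.jet (h.compSmooth f))) :=
    HasJet.dirD ⟨_, rfl⟩ I
  have h2 : B₁.HasJet (fun q =>
      ∑ L, dirD (B₁.e I) (fun q => B₂.co L (y q)) q * dirD (B₂.e L) f.1 (y q))
      (∑ L, B₁.dJ I (B₁.jet ⟨_, h.smoothNear_co L⟩) * B₁.jet (h.compSmooth (B₂.dS L f))) :=
    HasJet.sum fun L _ => HasJet.mul (HasJet.dirD ⟨_, rfl⟩ I) ⟨_, rfl⟩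
  exact (h1.congr fun p hp => h.dirD_comp f.2 _ hp).unique h2

lemma jet_compSmooth_eq_zero (h : JetMap B₁ B₂ y) {f : B₂.smooth} (hf : f ∈ B₂.flat) :
    B₁.jet (h.compSmooth f) = 0 := by
  refine FormalRing.eq_zero_of_forall_mem (Φ := B₁.formal) fun k => ?_
  induction k generalizing f with
  | zero => simp
  | succ k ih =>
    rw [FormalRing.mem_V_succ]
    refine ⟨B₁.jet_mem_ideal.2 fun p hp => ?_, ?_⟩
    · exact (B₂.mem_flat_iff.1 hf) 0 _ (h.maps p hp)
    · change B₁.dJ i₁ _ ∈ _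
      rw [dJ_compSmooth]
      exact sum_mem fun L _ => mul_mem_left _ _ (ih (B₂.dS_mem_flat L hf))

/-- The pullback of jets. -/
def pull (h : JetMap B₁ B₂ y) : B₂.Jet →ₐ[ℝ] B₁.Jet :=
  Ideal.Quotient.liftₐ B₂.flat (B₁.jet.comp h.compSmooth) fun _ hf => h.jet_compSmooth_eq_zero hf

lemma hasJet_pull (h : JetMap B₁ B₂ y) {f : W₂ → ℝ} {a : B₂.Jet} (hf : B₂.HasJet f a) :
    B₁.HasJet (f ∘ y) (h.pull a) := by
  obtain ⟨h1, rfl⟩ := hf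
  exact ⟨_, rfl⟩

lemma chain (h : JetMap B₁ B₂ y) (I : ι₁) (a : B₂.Jet) : B₁.formal.D I (h.pull a) = ∑ L, B₁.formal.D
    I (h.pull (B₂.coordJet L)) * h.pull (B₂.formal.D L a) := by
  obtain ⟨f, rfl⟩ := B₂.jet_surjective a
  have e : ∀ L, B₂.formal.D L (B₂.jet f) = B₂.jet (B₂.dS L f) := fun L => B₂.dJ_jet L f
  simp only [e]
  exact h.dJ_compSmooth I f

lemma pull_mem_ideal (h : JetMap B₁ B₂ y) {a : B₂.Jet} (ha : a ∈ B₂.formal.m) :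
    h.pull a ∈ B₁.formal.m := by
  obtain ⟨f, hf⟩ := B₂.exists_hasJet a
  rw [(h.hasJet_pull hf).mem_ideal_iff]
  exact fun p hp => hf.mem_ideal_iff.1 ha _ (h.maps p hp)

lemma pull_mem_V (h : JetMap B₁ B₂ y) {k : ℕ} {a : B₂.Jet} (ha : a ∈ B₂.formal.V k) :
    h.pull a ∈ B₁.formal.V k := by
  induction k generalizing a with
  | zero => simp
  | succ k ih =>
    rw [FormalRing.mem_V_succ]
    refine ⟨h.pull_mem_ideal (FormalRing.mem_V_succ.1 ha).1, ?_⟩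
    rw [chain]
    refine sum_mem fun L _ => ?_
    by_cases hL : L = i₂
    · subst hL; exact mul_mem_left _ _ (ih (FormalRing.Du_mem ha))
    · rcases k with _ | k
      · simp
      · exact mul_mem_left _ _ (ih (FormalRing.V_anti (Nat.le_succ _) (FormalRing.D_mem L hL ha)))

/-- The pullback of jets preserves congruences of maps. -/
lemma pull_sub_pull_mem (hy : JetMap B₁ B₂ y) (hz : JetMap B₁ B₂ z) {k : ℕ}
    (h : ∀ L, hy.pull (B₂.coordJet L) - hz.pull (B₂.coordJet L) ∈ B₁.formal.V k) (a : B₂.Jet) :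
    hy.pull a - hz.pull a ∈ B₁.formal.V k := by
  induction k generalizing a with
  | zero => simp
  | succ k ih =>
    rw [FormalRing.mem_V_succ]
    refine ⟨?_, ?_⟩
    · obtain ⟨f, hf⟩ := B₂.exists_hasJet a
      rw [((hy.hasJet_pull hf).sub (hz.hasJet_pull hf)).mem_ideal_iff]
      intro p hp
      have : y p = z p := by
        rw [← B₂.co_sum (y p), ← B₂.co_sum (z p)]
        refine sum_ext fun L => ?_
        have h1 := ((hy.hasJet_pull (hasJet_coord L)).sub (hz.hasJet_pull (hasJet_coord L))).mem_ideal_iff.1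
          (FormalRing.mem_V_succ.1 (h L)).1 p hp
        congr 1
        exact sub_eq_zero.1 h1
      simp [this]
    · rw [map_sub, chain, chain, ← sum_sub_distrib]
      refine sum_mem fun L _ => ?_
      have h1 := FormalRing.Du_mem (h L)
      rw [map_sub] at h1
      have h2 := ih (fun L => FormalRing.V_anti (Nat.le_succ k) (h L)) (B₂.formal.D L a)
      have := add_mem (mul_mem_right (hy.pull (B₂.formal.D L a)) _ h1)
        (mul_mem_left _ (B₁.formal.D i₁ (hz.pull (B₂.coordJet L))) h2)
      convert this using 1
      ring

lemma pull_congr (hy : JetMap B₁ B₂ y) (hz : JetMap B₁ B₂ z)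
    (h : ∀ L, hy.pull (B₂.coordJet L) = hz.pull (B₂.coordJet L)) (a : B₂.Jet) :
    hy.pull a = hz.pull a := by
  refine sub_eq_zero.1 (FormalRing.eq_zero_of_forall_mem (Φ := B₁.formal) fun k => ?_)
  exact pull_sub_pull_mem hy hz (fun L => by rw [h L, sub_self]; exact zero_mem _) a

end JetMap

end Composition

end Slab

end

section

namespace Slab

/-! ### Jets of curvature -/

section Curvature

variable {W : Type*} [NormedAddCommGroup W] [NormedSpace ℝ W] {ι : Type*} [Fintype ι]
  [DecidableEq ι] {iu : ι} {B : Slab W ι iu}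

/-- A matrix of functions has a matrix of jets. -/
def HasJets {κ κ' : Type*} (B : Slab W ι iu) (G : W → Matrix κ κ' ℝ) (A : Matrix κ κ' B.Jet) :
    Prop := ∀ i j, B.HasJet (fun y => G y i j) (A i j)

lemma HasJet.isUnit {f : W → ℝ} {a : B.Jet} (h : B.HasJet f a) (h0 : ∀ p ∈ B.S, f p ≠ 0) :
    IsUnit a ∧ ∀ b, a * b = 1 → B.HasJet (fun y => (f y)⁻¹) b := by
  have hs : B.SmoothNear fun y => (f y)⁻¹ := fun p hp => by
    filter_upwards [h.smooth p hp, (h.smooth p hp).self_of_nhds.continuousAt.eventually_ne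
      (h0 p hp)] with q h1 h2 using h1.inv h2
  have h1 : a * B.jet ⟨_, hs⟩ = 1 := by
    refine ((h.mul hs.hasJet).congr fun p hp => ?_).unique (HasJet.one B)
    filter_upwards [(h.smooth p hp).self_of_nhds.continuousAt.eventually_ne (h0 p hp)] with q h2
    exact mul_inv_cancel₀ h2
  refine ⟨IsUnit.of_mul_eq_one _ h1, fun b hb => ?_⟩
  have : b = B.jet ⟨_, hs⟩ := by
    calc b = (a * B.jet ⟨_, hs⟩) * b := by rw [h1, one_mul]
      _ = (a * b) * B.jet ⟨_, hs⟩ := by ring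
      _ = _ := by rw [hb, one_mul]
  rw [this]; exact hs.hasJet

lemma HasJet.ne_zero {f : W → ℝ} {a : B.Jet} (h : B.HasJet f a) (hu : IsUnit a) :
    ∀ p ∈ B.S, f p ≠ 0 := by
  intro p hp h0
  obtain ⟨h1, rfl⟩ := h
  have := (hu.map (B.ev ⟨p, hp⟩)).ne_zero
  exact this h0

variable {G : W → Matrix ι ι ℝ} {A : Matrix ι ι B.Jet}

lemma HasJets.exists_lift (h : B.HasJets G A) :
    ∃ M : Matrix ι ι B.smooth, (∀ y, M.map (fun f => f.1 y) = G y) ∧ M.map B.jet = A := by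
  refine ⟨of fun i j => ⟨fun y => G y i j, (h i j).smooth⟩, fun y => rfl, ?_⟩
  ext i j
  obtain ⟨_, h2⟩ := h i j
  exact h2

lemma HasJets.det_adjugate (h : B.HasJets G A) :
    B.HasJet (fun y => (G y).det) A.det ∧ B.HasJets (fun y => (G y).adjugate) A.adjugate := by
  obtain ⟨M, h1, rfl⟩ := h.exists_lift
  have ev : ∀ y : W, ∀ N : Matrix ι ι B.smooth, N.map (fun f => f.1 y) =
      ((Pi.evalRingHom (fun _ : W => ℝ) y).comp B.smooth.val.toRingHom).mapMatrix N :=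
    fun _ _ => rfl
  have evj : M.map B.jet = B.jet.toRingHom.mapMatrix M := rfl
  constructor
  · rw [evj, ← RingHom.map_det]
    refine ⟨?_, ?_⟩
    · have : (fun y => (G y).det) = M.det.1 := by
        funext y
        rw [← h1, ev, ← RingHom.map_det]; rfl
      rw [this]; exact M.det.2
    · refine congrArg B.jet (Subtype.ext ?_)
      funext y
      change (G y).det = _
      rw [← h1, ev, ← RingHom.map_det]; rfl
  · intro i j
    rw [evj, ← RingHom.map_adjugate]
    have : (fun y => (G y).adjugate i j) = (M.adjugate i j).1 := by
      funext y
      rw [← h1, ev, ← RingHom.map_adjugate]; rfl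
    simp only [this]
    exact ⟨(M.adjugate i j).2, rfl⟩

lemma HasJets.isUnit_det (h : B.HasJets G A) (h0 : ∀ p ∈ B.S, (G p).det ≠ 0) : IsUnit A.det :=
  (h.det_adjugate.1.isUnit h0).1

lemma HasJets.det_ne_zero (h : B.HasJets G A) (hu : IsUnit A.det) :
    ∀ p ∈ B.S, (G p).det ≠ 0 := h.det_adjugate.1.ne_zero hu

lemma HasJets.inv (h : B.HasJets G A) (hu : IsUnit A.det) : B.HasJets (fun y => (G y)⁻¹) A⁻¹ := by
  obtain ⟨b, hb⟩ := hu.exists_right_inv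
  have hd := (h.det_adjugate.1.isUnit (h.det_ne_zero hu)).2 b hb
  have e : A⁻¹ = b • A.adjugate := by
    refine Matrix.inv_eq_right_inv ?_
    rw [Matrix.mul_smul, Matrix.mul_adjugate, smul_smul, mul_comm, hb, one_smul]
  intro i j
  rw [e]
  have := hd.mul (h.det_adjugate.2 i j)
  simpa only [Matrix.inv_def, Ring.inverse_eq_inv', Matrix.smul_apply, smul_eq_mul] using this

lemma HasJets.christoffel (h : B.HasJets G A) (hu : IsUnit A.det) (K I J : ι) :
    B.HasJet (christoffel B.e G K I J) (aChr B.formal.D A K I J) :=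
  (HasJet.const B (1 / 2)).mul (HasJet.sum fun L _ => (h.inv hu K L).mul
    (((h J L).dirD I |>.add ((h I L).dirD J)).sub ((h I J).dirD L)))

lemma HasJets.ricci (h : B.HasJets G A) (hu : IsUnit A.det) (I J : ι) :
    B.HasJet (ricci B.e G I J) (aRic B.formal.D A I J) := by
  have hc := h.christoffel hu
  exact (HasJet.sum fun K _ => ((hc K I J).dirD K).sub ((hc K I K).dirD J)).add
    (HasJet.sum fun K _ => HasJet.sum fun L _ =>
      ((hc K K L).mul (hc L I J)).sub ((hc K J L).mul (hc L I K)))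

variable {f : W → ℝ} {a : B.Jet}

lemma HasJets.hessian (h : B.HasJets G A) (hu : IsUnit A.det) (hf : B.HasJet f a) (I J : ι) :
    B.HasJet (hessian B.e G f I J) (aHess B.formal.D A a I J) :=
  ((hf.dirD J).dirD I).sub (HasJet.sum fun K _ => (h.christoffel hu K I J).mul (hf.dirD K))

lemma HasJets.weightedP (h : B.HasJets G A) (hu : IsUnit A.det) (hf : B.HasJet f a) (lam : ℝ)
    (I J : ι) : B.HasJet (weightedP B.e G f lam I J) (aP B.formal.D A a lam I J) :=
  ((h.ricci hu I J).add (h.hessian hu hf I J)).sub ((HasJet.const B lam).mul (h I J))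

lemma HasJets.weightedF (h : B.HasJets G A) (hu : IsUnit A.det) (hf : B.HasJet f a) (lam : ℝ) :
    B.HasJet (weightedF B.e G f lam) (aF B.formal.D A a lam) := by
  have h2 : B.HasJet (fun _ => (2 : ℝ)) 2 := by simpa only [map_ofNat] using HasJet.const B 2
  refine HasJet.sub (HasJet.add (HasJet.sub ?_ ?_) ((h2.mul (HasJet.const B lam)).mul hf))
    (HasJet.const B _)
  · exact HasJet.sum fun I _ => HasJet.sum fun J _ => (h.inv hu I J).mul (h.hessian hu hf I J)
  · exact HasJet.sum fun I _ => HasJet.sum fun J _ =>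
      ((h.inv hu I J).mul (hf.dirD I)).mul (hf.dirD J)

end Curvature

end Slab

/-! ### The slabs over a ball -/

section Ball

variable (n : ℕ)

/-- The coordinate functions of `(v, x¹, …, xⁿ, u)`. -/
def coordFun : Idx n → Coord n →L[ℝ] ℝ := Sum.elim (fun _ => fstL ℝ _ _)
    (Sum.elim (fun i => (EuclideanSpace.proj i).comp
      ((fstL ℝ _ _).comp (sndL ℝ _ _)))
      (fun _ => (sndL ℝ _ _).comp (sndL ℝ _ _)))

variable {n}

@[simp] lemma coordFun_v (y : Coord n) : coordFun n iV y = y.1 := rfl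
@[simp] lemma coordFun_x (i : Fin n) (y : Coord n) : coordFun n (idxX i) y = y.2.1 i := rfl
@[simp] lemma coordFun_u (y : Coord n) : coordFun n iU y = y.2.2 := rfl
@[simp] lemma coordVec_v : coordVec n iV = (1, 0, 0) := rfl
@[simp] lemma coordVec_x (i : Fin n) :
    coordVec n (idxX i) = (0, EuclideanSpace.single i 1, 0) := rfl
@[simp] lemma coordVec_u : coordVec n iU = (0, 0, 1) := rfl

lemma sum_single (x : 𝔼 n) : ∑ i, x i • EuclideanSpace.single i (1 : ℝ) = x := by
  ext j
  simp [Finset.sum_apply, Pi.single_apply]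

lemma sum_coordFun (w : Coord n) : ∑ I, coordFun n I w • coordVec n I = w := by
  rw [sum_idx]
  simp only [coordFun_v, coordFun_x, coordFun_u, coordVec_v, coordVec_x, coordVec_u, Prod.smul_mk,
    smul_zero, smul_eq_mul, mul_one, mul_zero]
  have : ∑ i, ((0 : ℝ), w.2.1 i • EuclideanSpace.single i (1 : ℝ), (0 : ℝ)) =
      ((0 : ℝ), w.2.1, (0 : ℝ)) := by
    refine Prod.ext ?_ (Prod.ext ?_ ?_)
    · simp [Prod.fst_sum]
    · simp only [Prod.snd_sum, Prod.fst_sum]; exact sum_single _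
    · simp [Prod.snd_sum]
  rw [this]
  refine Prod.ext ?_ (Prod.ext ?_ ?_) <;> simp

lemma coordFun_coordVec (I J : Idx n) : coordFun n I (coordVec n J) = if I = J then 1 else 0 := by
  rcases I with ⟨⟩ | i | ⟨⟩ <;> rcases J with ⟨⟩ | j | ⟨⟩ <;>
    simp [coordFun, coordVec]

/-- The points with `u = 0` over a ball. -/
def slab (c : 𝔼 n) (r : ℝ) (hr : 0 < r) : Slab (Coord n) (Idx n) iU where
  e := coordVec n
  co := coordFun n
  co_sum := sum_coordFun
  ht_e I := by rw [coordFun_coordVec]; simp [eq_comm]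
  S := {p | p.2.1 ∈ closedBall c r ∧ p.2.2 = 0}
  ht_S p hp := hp.2
  dense p hp := by
    obtain ⟨v, x, u⟩ := p
    obtain ⟨hx, rfl : u = 0⟩ := hp
    change x ∈ closedBall c r at hx
    rw [← closure_ball c hr.ne'] at hx
    have hc : Continuous fun z : 𝔼 n => ((v, z, 0) : Coord n) := by fun_prop
    refine (hc.continuousAt (x := x)).continuousWithinAt.mem_closure hx ?_
    intro z hz
    refine ⟨⟨ball_subset_closedBall hz, rfl⟩, ?_⟩
    have : ∀ᶠ q : Coord n in 𝓝 (v, z, 0), q.2.1 ∈ ball c r :=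
      (continuous_fst.comp continuous_snd).continuousAt.eventually
        (isOpen_ball.mem_nhds hz)
    filter_upwards [this] with q hq h0
    exact ⟨ball_subset_closedBall hq, h0⟩

/-- The points with `u = 0` over a ball, in the space of `(x¹, …, xⁿ, u)`. -/
def slabX (c : 𝔼 n) (r : ℝ) (hr : 0 < r) : Slab (𝔼 n × ℝ) (Idx n) iU where
  e I := (coordVec n I).2
  co I := (coordFun n I).comp (ContinuousLinearMap.inr ℝ ℝ _)
  co_sum w := by
    have := congrArg Prod.snd (sum_coordFun ((0, w) : Coord n))
    rw [Prod.snd_sum] at this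
    exact this
  ht_e I := by
    have : coordFun n iU (0, (coordVec n I).2) = coordFun n iU (coordVec n I) := rfl
    rw [ContinuousLinearMap.comp_apply, ContinuousLinearMap.inr_apply, this, coordFun_coordVec]
    simp [eq_comm]
  S := {p | p.1 ∈ closedBall c r ∧ p.2 = 0}
  ht_S p hp := hp.2
  dense p hp := by
    obtain ⟨x, u⟩ := p
    obtain ⟨hx, rfl : u = 0⟩ := hp
    change x ∈ closedBall c r at hx
    rw [← closure_ball c hr.ne'] at hx
    have hc : Continuous fun z : 𝔼 n => (z, (0 : ℝ)) := by fun_prop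
    refine (hc.continuousAt (x := x)).continuousWithinAt.mem_closure hx ?_
    intro z hz
    refine ⟨⟨ball_subset_closedBall hz, rfl⟩, ?_⟩
    have : ∀ᶠ q : 𝔼 n × ℝ in 𝓝 (z, 0), q.1 ∈ ball c r :=
      continuous_fst.continuousAt.eventually (isOpen_ball.mem_nhds hz)
    filter_upwards [this] with q hq h0
    exact ⟨ball_subset_closedBall hq, h0⟩

variable {c : 𝔼 n} {r : ℝ} {hr : 0 < r}

lemma mem_slab {p : Coord n} : p ∈ (slab c r hr).S ↔ p.2.1 ∈ closedBall c r ∧ p.2.2 = 0 := Iff.rfl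

lemma mem_slabX {p : 𝔼 n × ℝ} : p ∈ (slabX c r hr).S ↔ p.1 ∈ closedBall c r ∧ p.2 = 0 := Iff.rfl

lemma jetMap_snd : Slab.JetMap (slab c r hr) (slabX c r hr) Prod.snd :=
  ⟨fun _ _ => .of_forall fun _ => contDiff_snd.contDiffAt, fun _ hp => hp⟩

lemma pull_snd_D (I : Idx n) (a : (slabX c r hr).Jet) :
    (jetMap_snd (c := c) (r := r) (hr := hr)).pull ((slabX c r hr).formal.D I a) =
    (slab c r hr).formal.D I ((jetMap_snd (c := c) (r := r) (hr := hr)).pull a) := by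
  obtain ⟨f, hf⟩ := (slabX c r hr).exists_hasJet a
  have h1 := jetMap_snd.hasJet_pull (hf.dirD I)
  have h2 := (jetMap_snd.hasJet_pull hf).dirD I
  refine (h1.congr fun p hp => ?_).unique h2
  filter_upwards [(jetMap_snd.tendsto hp).eventually (hf.smooth _ (jetMap_snd.maps p hp))] with q hq
  simp only [dirD, comp_apply]
  have d := differentiableAt_of_smooth hq
  have e := fderiv_comp q d (differentiableAt_snd (𝕜 := ℝ))
  rw [e, fderiv_snd]; rfl

lemma pull_snd_X : (jetMap_snd (c := c) (r := r) (hr := hr)).pull (slabX c r hr).formal.X =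
    (slab c r hr).formal.X :=
  (jetMap_snd.hasJet_pull (Slab.HasJet.X (slabX c r hr))).unique (Slab.HasJet.X (slab c r hr))

lemma slab_oInfty {f g : Coord n → ℝ} {a : (slab c r hr).Jet} (hf : (slab c r hr).HasJet f a)
    (hg : (slab c r hr).HasJet g a) (v : ℝ) {x : 𝔼 n} (hx : x ∈ closedBall c r) :
    OInfty fun u => f (v, x, u) - g (v, x, u) := by
  have := hf.oInfty hg (v, x, 0) ⟨hx, rfl⟩
  simpa [slab] using this

lemma slab_eq_of_oInfty {f g : Coord n → ℝ} {a b : (slab c r hr).Jet}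
    (hf : (slab c r hr).HasJet f a) (hg : (slab c r hr).HasJet g b)
    (h : ∀ v, ∀ x ∈ closedBall c r, OInfty fun u => f (v, x, u) - g (v, x, u)) : a = b := by
  refine hf.eq_of_oInfty hg ?_
  rintro ⟨v, x, u⟩ ⟨hx, rfl : u = 0⟩
  simpa [slab] using h v x hx

end Ball

end

section

/-! ### Borel's lemma -/

section Borel

variable {W : Type*} [NormedAddCommGroup W] [NormedSpace ℝ W]

lemma exists_bound_iteratedFDeriv {f : W → ℝ} (hf : ContDiff ℝ ∞ f) (hs : HasCompactSupport f)
    (k : ℕ) : ∃ C, ∀ x, ‖iteratedFDeriv ℝ k f x‖ ≤ C :=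
  (hs.iteratedFDeriv k).exists_bound_of_continuous
    (hf.continuous_iteratedFDeriv (by exact_mod_cast le_top))

lemma iterate_dirD_eq_iteratedFDeriv {f : W → ℝ} (hf : ContDiff ℝ ∞ f) (w : W) (k : ℕ) :
    (dirD w)^[k] f = fun x => iteratedFDeriv ℝ k f x fun _ => w := by
  induction k with
  | zero => funext x; simp
  | succ k ih =>
    rw [Function.iterate_succ_apply', ih]
    funext x
    have hd : DifferentiableAt ℝ (iteratedFDeriv ℝ k f) x :=
      (hf.differentiable_iteratedFDeriv (m := k) (by exact_mod_cast WithTop.coe_lt_top k)) x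
    rw [iteratedFDeriv_succ_apply_left, dirD, fderiv_continuousMultilinear_apply_const_apply hd]
    rfl

/-- A compactly supported function times a cut-off power, with small derivatives. -/
lemma exists_small_term {a : W → ℝ} (ha : ContDiff ℝ ∞ a) (hs : HasCompactSupport a)
    (ht : W →L[ℝ] ℝ) (j : ℕ) {ε : ℝ} (hε : 0 < ε) : ∃ T : W → ℝ, ContDiff ℝ ∞ T ∧
    (∀ p, ht p = 0 → T =ᶠ[𝓝 p] fun x => a x * ht x ^ j) ∧
    (∀ k < j, ∀ x, ‖iteratedFDeriv ℝ k T x‖ ≤ ε) ∧ ∀ k, ∃ C, ∀ x, ‖iteratedFDeriv ℝ k T x‖ ≤ C := by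
  let χ : ContDiffBump (0 : ℝ) := ⟨1, 2, one_pos, one_lt_two⟩
  let θ : ℝ → ℝ := fun s => χ s * s ^ j
  have hθ : ContDiff ℝ ∞ θ := χ.contDiff.mul (contDiff_id.pow j)
  have hθs : HasCompactSupport θ := χ.hasCompactSupport.mul_right
  choose A hA using exists_bound_iteratedFDeriv ha hs
  choose Θ hΘ using exists_bound_iteratedFDeriv hθ hθs
  have hA0 : ∀ k, 0 ≤ A k := fun k => (norm_nonneg _).trans (hA k 0)
  have hΘ0 : ∀ k, 0 ≤ Θ k := fun k => (norm_nonneg _).trans (hΘ k 0)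
  let Mb : ℕ → ℝ := fun k => ∑ i ∈ Finset.range (k + 1),
    (k.choose i : ℝ) * A i * (Θ (k - i) * ‖ht‖ ^ (k - i))
  have hM0 : ∀ k, 0 ≤ Mb k := fun k => Finset.sum_nonneg fun i _ => by
    have := hA0 i; have := hΘ0 (k - i); positivity
  set τ : ℝ := 1 + ∑ k ∈ Finset.range j, Mb k / ε with hτ
  have hsum0 : 0 ≤ ∑ k ∈ Finset.range j, Mb k / ε :=
    Finset.sum_nonneg fun k _ => div_nonneg (hM0 k) hε.le
  have hτ1 : 1 ≤ τ := by linarith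
  have hτ0 : 0 < τ := by linarith
  let T₀ : W → ℝ := fun x => a x * (θ ∘ (τ • ht)) x
  have hg : ContDiff ℝ ∞ (θ ∘ (τ • ht)) := hθ.comp (τ • ht).contDiff
  have hT₀ : ContDiff ℝ ∞ T₀ := ha.mul hg
  have hgb : ∀ i x, ‖iteratedFDeriv ℝ i (θ ∘ (τ • ht)) x‖ ≤ Θ i * (τ * ‖ht‖) ^ i := by
    intro i x
    rw [(τ • ht).iteratedFDeriv_comp_right hθ x (by exact_mod_cast le_top)]
    refine (ContinuousMultilinearMap.norm_compContinuousLinearMap_le _ _).trans ?_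
    rw [Finset.prod_const, Finset.card_univ, Fintype.card_fin, norm_smul, Real.norm_eq_abs,
      abs_of_pos hτ0]
    gcongr
    exact hΘ i _
  have hb : ∀ k x, ‖iteratedFDeriv ℝ k T₀ x‖ ≤ τ ^ k * Mb k := by
    intro k x
    refine (norm_iteratedFDeriv_mul_le ha hg x (n := k) (by exact_mod_cast le_top)).trans ?_
    rw [mul_sum]
    refine Finset.sum_le_sum fun i hi => ?_
    have h1 := hA i x
    have h2 := hgb (k - i) x
    have h3 : τ ^ (k - i) ≤ τ ^ k := pow_le_pow_right₀ hτ1 (Nat.sub_le _ _)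
    have h4 := hA0 i
    have h5 := hΘ0 (k - i)
    calc (k.choose i : ℝ) * ‖iteratedFDeriv ℝ i a x‖ * ‖iteratedFDeriv ℝ (k - i) (θ ∘ (τ • ht)) x‖
        ≤ (k.choose i : ℝ) * A i * (Θ (k - i) * (τ * ‖ht‖) ^ (k - i)) := by gcongr
      _ = τ ^ (k - i) * ((k.choose i : ℝ) * A i * (Θ (k - i) * ‖ht‖ ^ (k - i))) := by
        rw [mul_pow]; ring
      _ ≤ _ := by gcongr
  have hsm : ∀ k x, ‖iteratedFDeriv ℝ k (fun x => (τ ^ j)⁻¹ • T₀ x) x‖ ≤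
      (τ ^ j)⁻¹ * (τ ^ k * Mb k) := by
    intro k x
    have e : iteratedFDeriv ℝ k (fun x => (τ ^ j)⁻¹ • T₀ x) x =
        (τ ^ j)⁻¹ • iteratedFDeriv ℝ k T₀ x :=
      iteratedFDeriv_const_smul_apply' (hT₀.of_le (by exact_mod_cast le_top)).contDiffAt
    rw [e, norm_smul, Real.norm_eq_abs, abs_of_pos (by positivity)]
    gcongr
    exact hb k x
  refine ⟨fun x => (τ ^ j)⁻¹ • T₀ x, contDiff_const.mul hT₀, ?_, ?_, fun k => ⟨_, hsm k⟩⟩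
  · intro p hp
    have hc : ContinuousAt (fun x => τ • ht x) p := by fun_prop
    have h0 : ∀ᶠ s in 𝓝 (τ • ht p), χ s = 1 := by rw [hp, smul_zero]; exact χ.eventuallyEq_one
    filter_upwards [hc.eventually h0] with x hx
    change (τ ^ j)⁻¹ * (a x * (χ (τ • ht x) * (τ • ht x) ^ j)) = _
    rw [hx, smul_eq_mul, mul_pow]
    field_simp
  · intro k hk x
    refine (hsm k x).trans ?_
    have h1 : Mb k / ε ≤ τ := by
      have := Finset.single_le_sum (f := fun k => Mb k / ε)
        (fun k _ => div_nonneg (hM0 k) hε.le) (Finset.mem_range.2 hk)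
      linarith
    have h2 : Mb k ≤ τ * ε := by rwa [div_le_iff₀ hε] at h1
    have h3 : τ ^ k * τ ≤ τ ^ j := by rw [← pow_succ]; exact pow_le_pow_right₀ hτ1 hk
    rw [inv_mul_le_iff₀ (by positivity)]
    calc τ ^ k * Mb k ≤ τ ^ k * (τ * ε) := by gcongr
      _ = τ ^ k * τ * ε := by ring
      _ ≤ τ ^ j * ε := by gcongr

variable [FiniteDimensional ℝ W] {ι : Type*} [Fintype ι] [DecidableEq ι] {iu : ι} {B : Slab W ι iu}

lemma exists_compactlySupported (hS : IsCompact B.S) {f : W → ℝ} (hf : B.SmoothNear f) :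
    ∃ a : W → ℝ, ContDiff ℝ ∞ a ∧ HasCompactSupport a ∧ ∀ p ∈ B.S, a =ᶠ[𝓝 p] f := by
  let U : Set W := interior {q | ContDiffAt ℝ ∞ f q}
  have hSU : B.S ⊆ U := fun p hp => mem_interior_iff_mem_nhds.2 (hf p hp)
  obtain ⟨L, hL, hSL, hLU⟩ := exists_compact_between hS isOpen_interior hSU
  obtain ⟨ρ, hρ1, hρ0, -⟩ := exists_contMDiffMap_one_nhds_of_subset_interior (n := ⊤) 𝓘(ℝ, W)
    hS.isClosed hSL
  refine ⟨fun x => ρ x * f x, ?_, ?_, ?_⟩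
  · rw [contDiff_iff_contDiffAt]
    intro x
    by_cases hx : x ∈ L
    · have hx' : ContDiffAt ℝ ∞ f x := interior_subset (hLU hx)
      exact ρ.contMDiff.contDiff.contDiffAt.mul hx'
    · have : (fun x => ρ x * f x) =ᶠ[𝓝 x] fun _ => 0 := by
        filter_upwards [hL.isClosed.isOpen_compl.mem_nhds hx] with y hy
        rw [hρ0 y hy, zero_mul]
      exact contDiffAt_const.congr_of_eventuallyEq this
  · exact HasCompactSupport.intro hL fun x hx => by rw [hρ0 x hx, zero_mul]
  · intro p hp
    filter_upwards [nhds_le_nhdsSet hp hρ1] with x hx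
    rw [hx, one_mul]

/-- Borel's lemma: the ring of jets along a compact set is complete. -/
lemma complete_of_isCompact (hS : IsCompact B.S) : B.formal.Complete := by
  intro c
  choose f hf using fun j => B.exists_hasJet (c j)
  choose a ha hac haf using fun j => exists_compactlySupported hS (hf j).smooth
  choose T hT hTa hTs hTb using fun j => exists_small_term (ha j) (hac j) (B.co iu) j
    (ε := (1 / 2) ^ j) (by positivity)
  choose C hC using hTb
  have hC0 : ∀ j k, 0 ≤ C j k := fun j k => (norm_nonneg _).trans (hC j k 0)
  let u : ℕ → ℕ → ℝ := fun k j => if k < j then (1 / 2) ^ j else C j k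
  have hu : ∀ k, Summable (u k) := by
    intro k
    rw [← summable_nat_add_iff (k + 1)]
    have : (fun j => u k (j + (k + 1))) = fun j => (1 / 2 : ℝ) ^ (j + (k + 1)) := by
      funext j
      have : k < j + (k + 1) := by omega
      simp [u, this]
    rw [this]
    exact (summable_nat_add_iff (k + 1)).2 summable_geometric_two
  have hbd : ∀ k j x, ‖iteratedFDeriv ℝ k (T j) x‖ ≤ u k j := by
    intro k j x
    by_cases h : k < j
    · simpa [u, h] using hTs j k h x
    · simpa [u, h] using hC j k x
  have hTj : ∀ j, B.HasJet (T j) (c j * B.formal.X ^ j) := by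
    intro j
    have hX : B.HasJet (fun p => B.co iu p ^ j) (B.formal.X ^ j) := by
      induction j with
      | zero => simpa using Slab.HasJet.one B
      | succ j ih => simpa only [pow_succ] using ih.mul (Slab.HasJet.X B)
    refine ((hf j).mul hX).congr fun p hp => ?_
    filter_upwards [haf j p hp, hTa j p (B.ht_S p hp)] with x h1 h2
    rw [h2, h1]
  have hTv : ∀ k j, k < j → ∀ p ∈ B.S, iteratedFDeriv ℝ k (T j) p (fun _ => B.e iu) = 0 := by
    intro k j hkj p hp
    rw [← congrFun (iterate_dirD_eq_iteratedFDeriv (hT j) (B.e iu) k) p]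
    have h1 : c j * B.formal.X ^ j ∈ B.formal.V j := mul_mem_left _ _ (FormalRing.X_pow_mem j)
    obtain ⟨h2, h3⟩ := hTj j
    have h4 := h1 k hkj
    rw [← h3] at h4
    change (B.dJ iu)^[k] _ ∈ B.ideal at h4
    rw [Slab.iterate_dJ_jet, Slab.jet_mem_ideal] at h4
    exact h4 p hp
  have hsmooth : ∀ m, ContDiff ℝ ∞ fun x => ∑' j, T (j + m) x := fun m =>
    contDiff_tsum (N := ⊤) (v := fun k j => u k (j + m)) (fun j => hT (j + m))
      (fun k _ => (summable_nat_add_iff m).2 (hu k)) fun k j x _ => hbd k (j + m) x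
  have hsn : ∀ {g : W → ℝ}, ContDiff ℝ ∞ g → B.SmoothNear g := fun h _ _ =>
    .of_forall fun _ => h.contDiffAt
  refine ⟨B.jet ⟨_, hsn (hsmooth 0)⟩, fun m => ?_⟩
  have hsumm : ∀ x, Summable fun j => T j x := by
    intro x
    refine Summable.of_norm_bounded (hu 0) fun j => ?_
    have := hbd 0 j x
    rwa [norm_iteratedFDeriv_zero] at this
  have e : B.jet ⟨_, hsn (hsmooth 0)⟩ - ∑ j ∈ Finset.range m, c j * B.formal.X ^ j =
      B.jet ⟨_, hsn (hsmooth m)⟩ := by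
    have h1 := (hsn (hsmooth 0)).hasJet.sub (Slab.HasJet.sum (s := Finset.range m) fun j _ => hTj j)
    refine (h1.congr fun p hp => .of_forall fun x => ?_).unique
      (hsn (hsmooth m)).hasJet
    simp only [add_zero]
    rw [← (hsumm x).sum_add_tsum_nat_add m, add_sub_cancel_left]
  rw [e]
  intro k hk
  change (B.dJ iu)^[k] _ ∈ B.ideal
  rw [Slab.iterate_dJ_jet, Slab.jet_mem_ideal]
  intro p hp
  change (dirD (B.e iu))^[k] (fun x => ∑' j, T (j + m) x) p = 0
  rw [iterate_dirD_eq_iteratedFDeriv (hsmooth m)]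
  simp only
  rw [iteratedFDeriv_tsum_apply (N := ⊤) (v := fun k j => u k (j + m)) (fun j => hT (j + m))
      (fun k _ => (summable_nat_add_iff m).2 (hu k)) (fun k j x _ => hbd k (j + m) x) le_top]
  have hs2 : Summable fun j => iteratedFDeriv ℝ k (T (j + m)) p :=
    Summable.of_norm_bounded ((summable_nat_add_iff m).2 (hu k)) fun j => hbd k (j + m) p
  have := (ContinuousMultilinearMap.apply ℝ (fun _ : Fin k => W) ℝ fun _ => B.e iu).map_tsum hs2
  simp only [ContinuousMultilinearMap.apply_apply] at this
  rw [this]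
  have h0 : ∀ j, iteratedFDeriv ℝ k (T (j + m)) p (fun _ => B.e iu) = 0 := fun j =>
    hTv k (j + m) (by omega) p hp
  simp [h0]

end Borel

lemma slabX_complete {n : ℕ} {c : 𝔼 n} {r : ℝ} {hr : 0 < r} : (slabX c r hr).formal.Complete := by
  refine complete_of_isCompact ?_
  have : (slabX c r hr).S = closedBall c r ×ˢ {0} := by ext p; simp [mem_slabX]
  rw [this]
  exact (isCompact_closedBall c r).prod isCompact_singleton

end

section

/-! ### Smooth families of bilinear forms -/

section Forms

variable {E H : Type*} [NormedAddCommGroup E] [NormedSpace ℝ E] [FiniteDimensional ℝ E]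
  [TopologicalSpace H] {I : ModelWithCorners ℝ E H} {X : Type*} [TopologicalSpace X]
  [ChartedSpace H X]

lemma contMDiffAt_bilin_iff {f : X → E →L[ℝ] E →L[ℝ] ℝ} {p : X} : ContMDiffAt I
    𝓘(ℝ, E →L[ℝ] E →L[ℝ] ℝ) ∞ f p ↔ ∀ a b, ContMDiffAt I 𝓘(ℝ, ℝ) ∞ (fun q => f q a b) p := by
  constructor
  · intro h a b
    exact (h.clm_apply contMDiffAt_const).clm_apply contMDiffAt_const
  · intro h
    let b := Module.finBasis ℝ E
    let co := fun i => LinearMap.toContinuousLinearMap (b.coord i)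
    have e : f = fun q => ∑ i, ∑ j, f q (b i) (b j) • (co i).smulRight (co j) := by
      funext q
      ext x y
      conv_lhs => rw [← b.sum_repr x, ← b.sum_repr y]
      simp only [map_sum, map_smul, _root_.sum_apply, _root_.smul_apply,
        ContinuousLinearMap.smulRight_apply, smul_eq_mul, mul_sum]
      refine sum_swap fun i j => ?_
      simp only [co, LinearMap.coe_toContinuousLinearMap', Module.Basis.coord_apply]
      ring
    rw [e]
    refine contMDiffAt_finsetSum fun i _ => contMDiffAt_finsetSum fun j _ => ?_
    exact (h _ _).smul contMDiffAt_const

variable [IsManifold I ∞ X]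

set_option synthInstance.maxHeartbeats 200000 in
/-- Smoothness of a family of bilinear forms in terms of components. -/
lemma contMDiffAt_form_iff (h : TangentForm I X) {p₀ p : X} (hp : p ∈ (chartAt H p₀).source) :
    ContMDiffAt I (I.prod 𝓘(ℝ, E →L[ℝ] E →L[ℝ] ℝ)) ∞ (fun q => Bundle.TotalSpace.mk' (E →L[ℝ] E
    →L[ℝ] ℝ) (E := fun q : X => TangentSpace I q →L[ℝ] TangentSpace I q →L[ℝ] ℝ) q (h q)) p ↔ ∀ a b
    : E, ContMDiffAt I 𝓘(ℝ, ℝ) ∞ (fun q => h q ((trivializationAt E (TangentSpace I) p₀).symm q a)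
    ((trivializationAt E (TangentSpace I) p₀).symm q b)) p := by
  have hp' : p ∈ (trivializationAt E (TangentSpace I) p₀).baseSet := by simpa using hp
  rw [(trivializationAt (E →L[ℝ] E →L[ℝ] ℝ)
    (fun q : X => TangentSpace I q →L[ℝ] TangentSpace I q →L[ℝ] ℝ)
      p₀).contMDiffAt_section_iff (by simpa using hp), contMDiffAt_bilin_iff]
  refine forall₂_congr fun a b => ?_
  apply Filter.EventuallyEq.contMDiffAt_iff
  filter_upwards [(chartAt H p₀).open_source.mem_nhds hp] with q hq
  have hq' : q ∈ (trivializationAt E (TangentSpace I) p₀).baseSet := by simpa using hq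
  have := inCoordinates_apply_eq₂ (F₁ := E) (F₂ := E) (F₃ := ℝ) (E₁ := TangentSpace I)
    (E₂ := TangentSpace I) (E₃ := Bundle.Trivial X ℝ) (x₀ := p₀) (x := q) (ϕ := h q) (v := a)
    (w := b) hq' hq' (by simp)
  refine Eq.trans ?_ (this.trans ?_)
  · rfl
  · simp

end Forms

section Param

variable {n : ℕ} {M : Type*} [TopologicalSpace M] [ChartedSpace (𝔼 n) M]

variable (n) in
/-- The coordinates of `𝒳 M` given by the chart of `M` at `x₀`. -/
def coords (x₀ : M) (p : 𝒳 M) : Coord n := (p.1, 𝔠 n x₀ p.2.1, p.2.2)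

lemma extChartAt_symm_eq (x₀ : M) :
    ⇑(extChartAt (model n) ((0, x₀, 0) : 𝒳 M)).symm = param x₀ := rfl

lemma extChartAt_eq (x₀ : M) : ⇑(extChartAt (model n) ((0, x₀, 0) : 𝒳 M)) = coords n x₀ := rfl

lemma mem_chart_source {x₀ : M} {p : 𝒳 M} : p ∈
    (chartAt (ModelProd ℝ (ModelProd (𝔼 n) ℝ)) ((0, x₀, 0) : 𝒳 M)).source ↔ p.2.1 ∈ (𝔠 n x₀).source
    :=
  ⟨fun h => h.2.1, fun h => ⟨trivial, h, trivial⟩⟩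

variable [IsManifold (𝓡 n) ∞ M]

lemma contMDiffAt_param {x₀ : M} {y : Coord n} (hy : y.2.1 ∈ (𝔠 n x₀).target) :
    ContMDiffAt 𝓘(ℝ, Coord n) (model n) ∞ (param x₀) y := by
  rw [← extChartAt_symm_eq]
  refine (contMDiffOn_extChartAt_symm ((0, x₀, 0) : 𝒳 M)).contMDiffAt ?_
  refine (isOpen_extChartAt_target _).mem_nhds ?_
  rw [extChartAt_target, ModelWithCorners.range_eq_univ, Set.inter_univ]
  exact ⟨trivial, hy, trivial⟩

lemma contMDiffAt_coords {x₀ : M} {p : 𝒳 M} (hp : p.2.1 ∈ (𝔠 n x₀).source) :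
    ContMDiffAt (model n) 𝓘(ℝ, Coord n) ∞ (coords n x₀) p := by
  rw [← extChartAt_eq]
  exact contMDiffAt_extChartAt' (mem_chart_source.2 hp)

lemma param_coords {x₀ : M} {p : 𝒳 M} (hp : p.2.1 ∈ (𝔠 n x₀).source) :
    param x₀ (coords n x₀ p) = p := by
  obtain ⟨v, x, u⟩ := p
  simp only [param, coords]
  rw [(𝔠 n x₀).left_inv hp]

lemma coords_param {x₀ : M} {y : Coord n} (hy : y.2.1 ∈ (𝔠 n x₀).target) :
    coords n x₀ (param x₀ y) = y := by
  obtain ⟨v, x, u⟩ := y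
  simp only [param, coords]
  rw [(𝔠 n x₀).right_inv hy]

lemma param_mem_source {x₀ : M} {y : Coord n} (hy : y.2.1 ∈ (𝔠 n x₀).target) :
    (param x₀ y).2.1 ∈ (𝔠 n x₀).source := (𝔠 n x₀).map_target hy

lemma coords_mem_target {x₀ : M} {p : 𝒳 M} (hp : p.2.1 ∈ (𝔠 n x₀).source) :
    (coords n x₀ p).2.1 ∈ (𝔠 n x₀).target := (𝔠 n x₀).map_source hp

lemma eventually_mem_target {x₀ : M} {y : Coord n} (hy : y.2.1 ∈ (𝔠 n x₀).target) :
    ∀ᶠ z in 𝓝 y, z.2.1 ∈ (𝔠 n x₀).target :=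
  (continuous_fst.comp continuous_snd).continuousAt.eventually
    ((𝔠 n x₀).open_target.mem_nhds hy)

lemma eventually_mem_source {x₀ : M} {p : 𝒳 M} (hp : p.2.1 ∈ (𝔠 n x₀).source) :
    ∀ᶠ q in 𝓝 p, q.2.1 ∈ (𝔠 n x₀).source :=
  (continuous_fst.comp continuous_snd).continuousAt.eventually
    ((𝔠 n x₀).open_source.mem_nhds hp)

lemma symm_trivialization_eq {x₀ : M} {y : Coord n} (hy : y.2.1 ∈ (𝔠 n x₀).target) (a : Coord n) :
    (trivializationAt (Coord n) (TangentSpace (model n)) ((0, x₀, 0) : 𝒳 M)).symm (param x₀ y) a =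
    mfderiv 𝓘(ℝ, Coord n) (model n) (param x₀) y a := by
  have : IsManifold (model n) 1 (𝒳 M) := IsManifold.of_le (n := ∞) (by simp)
  have h := TangentBundle.symmL_trivializationAt (I := model n) (𝕜 := ℝ)
    (x₀ := ((0, x₀, 0) : 𝒳 M)) (mem_chart_source.2 (param_mem_source hy))
  rw [extChartAt_symm_eq, extChartAt_eq, coords_param hy, ModelWithCorners.range_eq_univ,
    mfderivWithin_univ] at h
  rw [← h]
  exact (Bundle.Trivialization.symmL_apply _ (R := ℝ) (mem_chart_source.2 (param_mem_source hy)) a).symm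

lemma contDiffAt_comp_param_iff {x₀ : M} {p : 𝒳 M} {f : 𝒳 M → ℝ} (hp : p.2.1 ∈ (𝔠 n x₀).source) :
    ContDiffAt ℝ ∞ (fun y => f (param x₀ y)) (coords n x₀ p) ↔ ContMDiffAt (model n) 𝓘(ℝ, ℝ) ∞ f p
    := by
  rw [← contMDiffAt_iff_contDiffAt]
  constructor
  · intro h
    have h1 : ContMDiffAt (model n) 𝓘(ℝ, ℝ) ∞ (fun q => f (param x₀ (coords n x₀ q))) p :=
      ContMDiffAt.comp (g := fun y => f (param x₀ y)) p h (contMDiffAt_coords hp)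
    refine h1.congr_of_eventuallyEq ?_
    filter_upwards [eventually_mem_source hp] with q hq
    rw [param_coords hq]
  · intro h
    have h2 := contMDiffAt_param (coords_mem_target hp)
    refine ContMDiffAt.comp (coords n x₀ p) ?_ h2
    rwa [param_coords hp]

lemma bilin_expand (β : Coord n →L[ℝ] Coord n →L[ℝ] ℝ) (a b : Coord n) :
    β a b = ∑ I, ∑ J, coordFun n I a * coordFun n J b * β (coordVec n I) (coordVec n J) := by
  conv_lhs => rw [← sum_coordFun a, ← sum_coordFun b]
  simp only [map_sum, _root_.sum_apply, map_smul, _root_.smul_apply, smul_eq_mul, mul_sum]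
  refine sum_swap fun I J => ?_
  ring

/-- The derivative of the parametrization. -/
def dparam (x₀ : M) (y : Coord n) : Coord n →L[ℝ] Coord n :=
  mfderiv 𝓘(ℝ, Coord n) (model n) (param x₀) y

/-- The bilinear form in the coordinates given by the chart at `x₀`. -/
def pullForm (h : 𝒯 n M) (x₀ : M) (y : Coord n) : Coord n →L[ℝ] Coord n →L[ℝ] ℝ :=
  ContinuousLinearMap.bilinearComp
    (show Coord n →L[ℝ] Coord n →L[ℝ] ℝ from h (param x₀ y)) (dparam x₀ y) (dparam x₀ y)

lemma components_eq_pullForm (h : 𝒯 n M) (x₀ : M) (y : Coord n)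
    (I J : Idx n) : components x₀ (fun p a b => h p a b) y I J =
      pullForm h x₀ y (coordVec n I) (coordVec n J) := rfl

/-- Smoothness of the metric in terms of its components. -/
lemma contMDiffAt_metric_iff (h : 𝒯 n M) {x₀ : M} {p : 𝒳 M} (hp : p.2.1 ∈ (𝔠 n x₀).source) :
    ContMDiffAt (model n) ((model n).prod 𝓘(ℝ, Coord n →L[ℝ] Coord n →L[ℝ] ℝ)) ∞
      (fun p => Bundle.TotalSpace.mk' (Coord n →L[ℝ] Coord n →L[ℝ] ℝ)
        (E := fun p : 𝒳 M =>
          TangentSpace (model n) p →L[ℝ] TangentSpace (model n) p →L[ℝ] ℝ) p (h p)) p ↔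
    ∀ I J, ContDiffAt ℝ ∞ (fun y => components x₀ (fun p a b => h p a b) y I J)
      (coords n x₀ p) := by
  rw [contMDiffAt_form_iff h (mem_chart_source.2 hp)]
  have key : ∀ a b : Coord n, ContMDiffAt (model n) 𝓘(ℝ, ℝ) ∞ (fun q =>
      h q ((trivializationAt (Coord n) (TangentSpace (model n)) ((0, x₀, 0) : 𝒳 M)).symm q a)
        ((trivializationAt (Coord n) (TangentSpace (model n)) ((0, x₀, 0) : 𝒳 M)).symm q b)) p ↔
      ContDiffAt ℝ ∞ (fun y => h (param x₀ y)
        (mfderiv 𝓘(ℝ, Coord n) (model n) (param x₀) y a)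
        (mfderiv 𝓘(ℝ, Coord n) (model n) (param x₀) y b)) (coords n x₀ p) := by
    intro a b
    rw [← contDiffAt_comp_param_iff hp]
    have : (fun y => h (param x₀ y)
        ((trivializationAt (Coord n) (TangentSpace (model n))
          ((0, x₀, 0) : 𝒳 M)).symm (param x₀ y) a)
        ((trivializationAt (Coord n) (TangentSpace (model n))
          ((0, x₀, 0) : 𝒳 M)).symm (param x₀ y) b)) =ᶠ[𝓝 (coords n x₀ p)]
        fun y => h (param x₀ y) (mfderiv 𝓘(ℝ, Coord n) (model n) (param x₀) y a)
          (mfderiv 𝓘(ℝ, Coord n) (model n) (param x₀) y b) := by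
      filter_upwards [eventually_mem_target (coords_mem_target hp)] with y hy
      rw [symm_trivialization_eq hy, symm_trivialization_eq hy]
    exact ⟨fun H => H.congr_of_eventuallyEq this.symm, fun H => H.congr_of_eventuallyEq this⟩
  simp only [key]
  constructor
  · exact fun H I J => H _ _
  · intro H a b
    have e : (fun y => h (param x₀ y)
        (mfderiv 𝓘(ℝ, Coord n) (model n) (param x₀) y a)
        (mfderiv 𝓘(ℝ, Coord n) (model n) (param x₀) y b)) = fun y => ∑ I, ∑ J,
          coordFun n I a * coordFun n J b * components x₀ (fun p a b => h p a b) y I J := by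
      funext y
      exact bilin_expand (pullForm h x₀ y) a b
    rw [e]
    exact ContDiffAt.sum fun I _ => ContDiffAt.sum fun J _ => contDiffAt_const.mul (H I J)

end Param

end

section

section Derivatives

variable {n : ℕ} {M : Type*} [TopologicalSpace M] [ChartedSpace (𝔼 n) M]

lemma mfderiv_translation (s : ℝ) (p : 𝒳 M) (a : Coord n) :
    mfderiv (model n) (model n) (translation s) p a = a := by
  have h1 : HasMFDerivAt (model n) 𝓘(ℝ, ℝ) (fun q : 𝒳 M => q.1 + s) p
      (fstL ℝ ℝ (𝔼 n × ℝ)) := by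
    have h : HasMFDerivAt 𝓘(ℝ, ℝ) 𝓘(ℝ, ℝ) (fun t : ℝ => t + s) p.1 (ContinuousLinearMap.id ℝ ℝ) :=
      ((hasFDerivAt_id p.1).add_const s).hasMFDerivAt
    exact h.comp p (hasMFDerivAt_fst p)
  have h2 := h1.prodMk (hasMFDerivAt_snd (I := 𝓘(ℝ, ℝ)) (I' := (𝓡 n).prod 𝓘(ℝ, ℝ)) p)
  have h3 : mfderiv (model n) (model n) (translation s) p = _ := h2.mfderiv
  rw [h3]
  rfl

lemma mfderiv_inclusion (z : ℝ × M) (a : ℝ × 𝔼 n) : mfderiv (𝓘(ℝ, ℝ).prod (𝓡 n)) (model n)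
    (fun w : ℝ × M => (w.1, w.2, (0 : ℝ))) z a = (a.1, a.2, (0 : ℝ)) := by
  have h1 := hasMFDerivAt_fst (I := 𝓘(ℝ, ℝ)) (I' := 𝓡 n) z
  have h2 := hasMFDerivAt_snd (I := 𝓘(ℝ, ℝ)) (I' := 𝓡 n) z
  have h3 := h1.prodMk (h2.prodMk
    (hasMFDerivAt_const (I := 𝓘(ℝ, ℝ).prod (𝓡 n)) (I' := 𝓘(ℝ, ℝ)) (0 : ℝ) z))
  have h4 : mfderiv (𝓘(ℝ, ℝ).prod (𝓡 n)) (model n) (fun w : ℝ × M => (w.1, w.2, (0 : ℝ))) z = _ :=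
    h3.mfderiv
  rw [h4]
  rfl

lemma mfderiv_snd_form (z : ℝ × M) (a : ℝ × 𝔼 n) :
    mfderiv (𝓘(ℝ, ℝ).prod (𝓡 n)) (𝓡 n) (fun w : ℝ × M => w.2) z a = a.2 := by
  have h := (hasMFDerivAt_snd (I := 𝓘(ℝ, ℝ)) (I' := 𝓡 n) z).mfderiv
  have h' : mfderiv (𝓘(ℝ, ℝ).prod (𝓡 n)) (𝓡 n) (fun w : ℝ × M => w.2) z = _ := h
  rw [h']; rfl

lemma mfderiv_mid (p : 𝒳 M) (a : Coord n) :
    mfderiv (model n) (𝓡 n) (fun q : 𝒳 M => q.2.1) p a = a.2.1 := by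
  have h1 := hasMFDerivAt_snd (I := 𝓘(ℝ, ℝ)) (I' := (𝓡 n).prod 𝓘(ℝ, ℝ)) p
  have h2 := hasMFDerivAt_fst (I := 𝓡 n) (I' := 𝓘(ℝ, ℝ)) p.2
  have h3 : mfderiv (model n) (𝓡 n) (fun q : 𝒳 M => q.2.1) p = _ := (h2.comp p h1).mfderiv
  rw [h3]; rfl

lemma differential_fst (p : 𝒳 M) (a : Coord n) :
    differential (n := n) (fun q : 𝒳 M => q.1) p a = a.1 := by
  have h : mfderiv (model n) 𝓘(ℝ, ℝ) (fun q : 𝒳 M => q.1) p = _ :=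
    (hasMFDerivAt_fst (I := 𝓘(ℝ, ℝ)) (I' := (𝓡 n).prod 𝓘(ℝ, ℝ)) p).mfderiv
  change mfderiv (model n) 𝓘(ℝ, ℝ) (fun q : 𝒳 M => q.1) p a = _
  rw [h]; rfl

lemma differential_last (p : 𝒳 M) (a : Coord n) :
    differential (n := n) (fun q : 𝒳 M => q.2.2) p a = a.2.2 := by
  have h1 := hasMFDerivAt_snd (I := 𝓘(ℝ, ℝ)) (I' := (𝓡 n).prod 𝓘(ℝ, ℝ)) p
  have h2 := hasMFDerivAt_snd (I := 𝓡 n) (I' := 𝓘(ℝ, ℝ)) p.2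
  have h3 : mfderiv (model n) 𝓘(ℝ, ℝ) (fun q : 𝒳 M => q.2.2) p = _ := (h2.comp p h1).mfderiv
  change mfderiv (model n) 𝓘(ℝ, ℝ) (fun q : 𝒳 M => q.2.2) p a = _
  rw [h3]; rfl

variable [IsManifold (𝓡 n) ∞ M]

/-- The derivative of the inverse chart at `x₀`. -/
def dchart (x₀ : M) (ξ : 𝔼 n) : 𝔼 n →L[ℝ] 𝔼 n := mfderiv 𝓘(ℝ, 𝔼 n) (𝓡 n) (𝔠 n x₀).symm ξ

lemma dparam_apply {x₀ : M} {y : Coord n} (hy : y.2.1 ∈ (𝔠 n x₀).target) (a : Coord n) :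
    dparam x₀ y a = (a.1, dchart x₀ y.2.1 a.2.1, a.2.2) := by
  have h1 : HasMFDerivAt 𝓘(ℝ, Coord n) 𝓘(ℝ, ℝ) (fun q : Coord n => q.1) y
      (fstL ℝ ℝ (𝔼 n × ℝ)) := (fstL ℝ ℝ (𝔼 n × ℝ)).hasFDerivAt.hasMFDerivAt
  have h2 : HasMFDerivAt 𝓘(ℝ, Coord n) 𝓘(ℝ, ℝ) (fun q : Coord n => q.2.2) y
      ((sndL ℝ _ _).comp (sndL ℝ ℝ (𝔼 n × ℝ))) := ((sndL ℝ _ _).comp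
        (sndL ℝ ℝ (𝔼 n × ℝ))).hasFDerivAt.hasMFDerivAt
  have h3 : HasMFDerivAt 𝓘(ℝ, Coord n) 𝓘(ℝ, 𝔼 n) (fun q : Coord n => q.2.1) y
      ((fstL ℝ _ _).comp (sndL ℝ ℝ (𝔼 n × ℝ))) := ((fstL ℝ _ _).comp
        (sndL ℝ ℝ (𝔼 n × ℝ))).hasFDerivAt.hasMFDerivAt
  have h4 : MDifferentiableAt 𝓘(ℝ, 𝔼 n) (𝓡 n)
      (𝔠 n x₀).symm y.2.1 := (contMDiffOn_chart_symm (I := 𝓡 n) (n := ∞) (x := x₀)).contMDiffAt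
      ((𝔠 n x₀).open_target.mem_nhds hy) |>.mdifferentiableAt (by simp)
  have h5 := h1.prodMk ((h4.hasMFDerivAt.comp y h3).prodMk h2)
  have h6 : mfderiv 𝓘(ℝ, Coord n) (model n) (param x₀) y = _ := h5.mfderiv
  rw [dparam, h6]
  rfl

lemma injective_dchart {x₀ : M} {ξ : 𝔼 n} (hξ : ξ ∈ (𝔠 n x₀).target) : Injective (dchart x₀ ξ) := by
  have h4 : MDifferentiableAt 𝓘(ℝ, 𝔼 n) (𝓡 n)
      (𝔠 n x₀).symm ξ := (contMDiffOn_chart_symm (I := 𝓡 n) (n := ∞) (x := x₀)).contMDiffAt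
      ((𝔠 n x₀).open_target.mem_nhds hξ) |>.mdifferentiableAt (by simp)
  have h5 : MDifferentiableAt (𝓡 n) 𝓘(ℝ, 𝔼 n)
      (𝔠 n x₀)
      ((𝔠 n x₀).symm ξ) := (contMDiffOn_chart (I := 𝓡 n) (n := ∞) (x := x₀)).contMDiffAt
      ((𝔠 n x₀).open_source.mem_nhds ((𝔠 n x₀).map_target hξ)) |>.mdifferentiableAt (by simp)
  have h6 := h5.hasMFDerivAt.comp ξ h4.hasMFDerivAt
  have h7 : HasMFDerivAt 𝓘(ℝ, 𝔼 n) 𝓘(ℝ, 𝔼 n) id ξ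
      (ContinuousLinearMap.id ℝ _) := hasMFDerivAt_id ξ
  have h8 : (𝔠 n x₀ ∘ (𝔠 n x₀).symm) =ᶠ[𝓝 ξ] id := by
    filter_upwards [(𝔠 n x₀).open_target.mem_nhds hξ] with z hz
    exact (𝔠 n x₀).right_inv hz
  have h9 := hasMFDerivAt_unique h6 (h7.congr_of_eventuallyEq h8)
  intro a b hab
  have h10 := DFunLike.congr_fun h9
  let N : 𝔼 n →L[ℝ] 𝔼 n := mfderiv (𝓡 n) 𝓘(ℝ, 𝔼 n) (𝔠 n x₀)
      ((𝔠 n x₀).symm ξ)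
  have h11 : N (dchart x₀ ξ a) = N (dchart x₀ ξ b) := congrArg N hab
  exact (h10 a).symm.trans (Eq.trans h11 (h10 b))

/-- The derivative of a map is compatible with the derivative of its coordinate expression. -/
lemma mfderiv_dparam {x₀ x₁ : M} {ψ : 𝒳 M → 𝒳 M} {y : Coord n} (hy : y.2.1 ∈ (𝔠 n x₀).target)
    (hψ : MDifferentiableAt (model n) (model n) ψ (param x₀ y))
    (hy' : (ψ (param x₀ y)).2.1 ∈ (𝔠 n x₁).source) (a : Coord n) : mfderiv (model n) (model n) ψ
    (param x₀ y) (dparam x₀ y a) = dparam x₁ (coords n x₁ (ψ (param x₀ y)))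
    (fderiv ℝ (fun z => coords n x₁ (ψ (param x₀ z))) y a) := by
  have h1 : MDifferentiableAt 𝓘(ℝ, Coord n) (model n) (param x₀) y :=
    (contMDiffAt_param hy).mdifferentiableAt (by simp)
  have h2 := hψ.hasMFDerivAt.comp y h1.hasMFDerivAt
  have h3 : MDifferentiableAt (model n) 𝓘(ℝ, Coord n) (coords n x₁) (ψ (param x₀ y)) :=
    (contMDiffAt_coords hy').mdifferentiableAt (by simp)
  have h4 := h3.hasMFDerivAt.comp y h2
  have h5 : MDifferentiableAt 𝓘(ℝ, Coord n) (model n) (param x₁) (coords n x₁ (ψ (param x₀ y))) :=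
    (contMDiffAt_param (coords_mem_target hy')).mdifferentiableAt (by simp)
  have h6 := h5.hasMFDerivAt.comp y h4
  have h7 : (param x₁ ∘ coords n x₁ ∘ ψ ∘ param x₀) =ᶠ[𝓝 y] ψ ∘ param x₀ := by
    have : ∀ᶠ z in 𝓝 y, (ψ (param x₀ z)).2.1 ∈ (𝔠 n x₁).source :=
      h2.continuousAt.eventually (eventually_mem_source hy')
    filter_upwards [this] with z hz
    exact param_coords hz
  have h8 := hasMFDerivAt_unique (h2.congr_of_eventuallyEq h7) h6
  have h9 : fderiv ℝ (fun z => coords n x₁ (ψ (param x₀ z))) y = _ :=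
    mfderiv_eq_fderiv.symm.trans h4.mfderiv
  rw [h9]
  exact DFunLike.congr_fun h8 a

end Derivatives

end

section

open FormalRing

/-! ### Pullback of formal weighted ambient metrics -/

section FormalPull

variable {n : ℕ} {A₀ A₁ : Type*} [CommRing A₀] [Algebra ℝ A₀] [CommRing A₁] [Algebra ℝ A₁]

/-- The matrix of partial derivatives of a formal map. -/
def jacobian (Φ : FormalRing A₀ (Idx n) iU) (y : Idx n → A₀) : Matrix (Idx n) (Idx n) A₀ :=
  of fun L I => Φ.D I (y L)

@[simp] lemma jacobian_apply (Φ : FormalRing A₀ (Idx n) iU) (y : Idx n → A₀) (L I : Idx n) :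
    jacobian Φ y L I = Φ.D I (y L) := rfl

/-- Formal maps of the form `(v, x, u) ↦ (v + y⁰(x, u), yⁱ(x, u), y^∞(x, u))` that preserve
`u = 0` and `λ u`. -/
structure IsFormalMap (Φ₀ : FormalRing A₀ (Idx n) iU) (Φ₁ : FormalRing A₁ (Idx n) iU)
    (lam : ℝ) (σ : A₁ →ₐ[ℝ] A₀) (y : Idx n → A₀) : Prop where
  chain : ∀ I a, Φ₀.D I (σ a) = ∑ L, Φ₀.D I (y L) * σ (Φ₁.D L a)
  mem_V : ∀ k, ∀ a ∈ Φ₁.V k, σ a ∈ Φ₀.V k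
  D_v : ∀ L, Φ₀.D iV (y L) = if L = iV then 1 else 0
  map_X : σ Φ₁.X = y iU
  lam_u : algebraMap ℝ A₀ lam * y iU = algebraMap ℝ A₀ lam * Φ₀.X
  unit : IsUnit (jacobian Φ₀ y).det

variable {Φ₀ : FormalRing A₀ (Idx n) iU} {Φ₁ : FormalRing A₁ (Idx n) iU} {lam : ℝ} {σ : A₁ →ₐ[ℝ] A₀}
  {y : Idx n → A₀} {G : Matrix (Idx n) (Idx n) A₁} {f : A₁}

namespace IsFormalMap

lemma D_v_pull (h : IsFormalMap Φ₀ Φ₁ lam σ y) (a : A₁) : Φ₀.D iV (σ a) = σ (Φ₁.D iV a) := by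
  rw [h.chain]
  simp [h.D_v]

lemma D_v_jacobian (h : IsFormalMap Φ₀ Φ₁ lam σ y) (L I : Idx n) :
    Φ₀.D iV (jacobian Φ₀ y L I) = 0 := by
  rw [jacobian_apply, Φ₀.comm, h.D_v]
  split_ifs <;> simp

lemma u_mem (h : IsFormalMap Φ₀ Φ₁ lam σ y) : y iU ∈ Φ₀.m := by
  rw [← h.map_X, ← V_one]
  exact h.mem_V 1 _ (by rw [V_one]; exact Φ₁.X_mem)

lemma chain' (h : IsFormalMap Φ₀ Φ₁ lam σ y) (I : Idx n) (a : A₁) :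
    Φ₀.D I (σ a) = ∑ L, jacobian Φ₀ y L I * σ (Φ₁.D L a) := h.chain I a

lemma jacobian_symm (I J L : Idx n) :
    Φ₀.D I (jacobian Φ₀ y L J) = Φ₀.D J (jacobian Φ₀ y L I) := Φ₀.comm I J _

end IsFormalMap

lemma pullMat_v (h : IsFormalMap Φ₀ Φ₁ lam σ y) (J : Idx n) :
    pullMat σ (jacobian Φ₀ y) G iV J = ∑ b, Φ₀.D J (y b) * σ (G iV b) := by
  rw [pullMat_apply]
  simp [h.D_v]

/-- The pullback of a formal weighted ambient metric. -/
lemma IsFormalAmbient.pull (hG : IsFormalAmbient Φ₁ lam G f) (h : IsFormalMap Φ₀ Φ₁ lam σ y) :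
    IsFormalAmbient Φ₀ lam (pullMat σ (jacobian Φ₀ y) G) (σ f) where
  symm := pullMat_isSymm hG.symm
  unit := isUnit_det_pullMat hG.unit h.unit
  D_v I J := by
    rw [pullMat_apply]
    simp only [map_sum, leibniz, h.D_v_jacobian, h.D_v_pull, hG.D_v, map_zero, smul_zero,
      add_zero, sum_const_zero]
  D_v_density := by
    rw [h.D_v_pull, hG.D_v_density, map_sub, map_mul, AlgHom.commutes, map_one, h.map_X, h.lam_u]
  v_v_mem := by
    rw [pullMat_v h]
    have : ∑ b, Φ₀.D iV (y b) * σ (G iV b) = σ (G iV iV) := by simp [h.D_v]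
    rw [this]
    exact h.mem_V 2 _ hG.v_v_mem
  v_x_mem i := by
    rw [pullMat_v h, sum_idx]
    have hm : ∀ a ∈ Φ₁.m, σ a ∈ Φ₀.m := by
      intro a ha
      have := h.mem_V 1 a (by rwa [V_one])
      rwa [V_one] at this
    refine add_mem (mul_mem_left _ _ (hm _ (mem_m_of_mem_V (by omega) hG.v_v_mem)))
      (add_mem (sum_mem fun j _ => mul_mem_left _ _ (hm _ (hG.v_x_mem j)))
        (mul_mem_right _ _ (Φ₀.tangential _ (by simp) _ h.u_mem)))
  P_eq I J := by
    rw [aP_pullMat h.chain' IsFormalMap.jacobian_symm Φ₀.comm hG.symm hG.unit h.unit]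
    simp [hG.P_eq]
  F_eq := by
    rw [aF_pullMat h.chain' IsFormalMap.jacobian_symm hG.symm hG.unit h.unit, hG.F_eq, map_zero]

/-- A formal map that fixes the coordinates `u` and `v` preserves normal form. -/
lemma normal_pull (hN : ∀ I, G iU I = if I = iV then 1 else 0)
    (hu : ∀ L, Φ₀.D iU (y L) = if L = iU then 1 else 0)
    (hv : ∀ I, Φ₀.D I (y iV) = if I = iV then 1 else 0) (I : Idx n) :
    pullMat σ (jacobian Φ₀ y) G iU I = if I = iV then 1 else 0 := by
  rw [pullMat_apply]
  simp only [jacobian_apply, hu]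
  simp only [ite_mul, one_mul, zero_mul, Finset.sum_ite_irrel, sum_const_zero,
    sum_ite_eq', mem_univ, if_true, hN]
  simp [apply_ite σ, hv]

end FormalPull

/-! ### Jets of maps in coordinates -/

section JetsOfMaps

open Slab

variable {n : ℕ} {M : Type*} [TopologicalSpace M] [ChartedSpace (𝔼 n) M] [IsManifold (𝓡 n) ∞ M]

/-- The expression of a map in the coordinates given by the charts at `x₀` and `x₁`. -/
def localExpr (x₀ x₁ : M) (ψ : 𝒳 M → 𝒳 M) (y : Coord n) : Coord n := coords n x₁ (ψ (param x₀ y))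

lemma contDiffAt_localExpr {x₀ x₁ : M} {ψ : 𝒳 M → 𝒳 M} {y : Coord n} (hy : y.2.1 ∈ (𝔠 n x₀).target)
    (hψ : ContMDiffAt (model n) (model n) ∞ ψ (param x₀ y))
    (hy' : (ψ (param x₀ y)).2.1 ∈ (𝔠 n x₁).source) : ContDiffAt ℝ ∞ (localExpr x₀ x₁ ψ) y := by
  rw [← contMDiffAt_iff_contDiffAt]
  have h1 : ContMDiffAt 𝓘(ℝ, Coord n) (model n) ∞ (ψ ∘ param x₀) y :=
    ContMDiffAt.comp y hψ (contMDiffAt_param hy)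
  exact ContMDiffAt.comp (g := coords n x₁) (f := ψ ∘ param x₀) y (contMDiffAt_coords hy') h1

variable {x₀ x₁ : M} {c₀ c₁ : 𝔼 n} {r₀ r₁ : ℝ} {h₀ : 0 < r₀} {h₁ : 0 < r₁} {ψ : 𝒳 M → 𝒳 M}

/-- The map `ψ` is smooth near `u = 0` over the first ball, which it maps to the second one. -/
structure IsLocalMap (x₀ x₁ : M) (c₀ c₁ : 𝔼 n) {r₀ r₁ : ℝ} (h₀ : 0 < r₀)
    (h₁ : 0 < r₁) (ψ : 𝒳 M → 𝒳 M) : Prop where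
  subset : closedBall c₀ r₀ ⊆ (𝔠 n x₀).target
  smooth : ∀ y ∈ (slab c₀ r₀ h₀).S, ∀ᶠ p in 𝓝 (param x₀ y), ContMDiffAt (model n) (model n) ∞ ψ p
  source : ∀ y ∈ (slab c₀ r₀ h₀).S, (ψ (param x₀ y)).2.1 ∈ (𝔠 n x₁).source
  maps : ∀ y ∈ (slab c₀ r₀ h₀).S, localExpr x₀ x₁ ψ y ∈ (slab c₁ r₁ h₁).S

lemma IsLocalMap.eventually (h : IsLocalMap x₀ x₁ c₀ c₁ h₀ h₁ ψ) {y : Coord n}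
    (hy : y ∈ (slab c₀ r₀ h₀).S) : ∀ᶠ z in 𝓝 y, z.2.1 ∈ (𝔠 n x₀).target ∧ ContMDiffAt (model n)
    (model n) ∞ ψ (param x₀ z) ∧ (ψ (param x₀ z)).2.1 ∈ (𝔠 n x₁).source := by
  have ht := h.subset hy.1
  have hc : ContinuousAt (param x₀) y := (contMDiffAt_param ht).continuousAt
  have h1 := hc.eventually (h.smooth y hy)
  have h2 : ContinuousAt (fun z => ψ (param x₀ z)) y :=
    ContinuousAt.comp (h.smooth y hy).self_of_nhds.continuousAt hc
  filter_upwards [eventually_mem_target ht, h1,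
    h2.eventually (eventually_mem_source (h.source y hy))] with z a b d using ⟨a, b, d⟩

lemma IsLocalMap.jetMap (h : IsLocalMap x₀ x₁ c₀ c₁ h₀ h₁ ψ) :
    JetMap (slab c₀ r₀ h₀) (slab c₁ r₁ h₁) (localExpr x₀ x₁ ψ) where
  smooth _ hy := (h.eventually hy).mono fun _ hz => contDiffAt_localExpr hz.1 hz.2.1 hz.2.2
  maps := h.maps

/-- The coordinates of a map, as jets. -/
def IsLocalMap.coordJets (h : IsLocalMap x₀ x₁ c₀ c₁ h₀ h₁ ψ) (L : Idx n) :
    (slab c₀ r₀ h₀).Jet := h.jetMap.pull ((slab c₁ r₁ h₁).coordJet L)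

lemma IsLocalMap.hasJet_coordJets (h : IsLocalMap x₀ x₁ c₀ c₁ h₀ h₁ ψ) (L : Idx n) :
    (slab c₀ r₀ h₀).HasJet (fun y => coordFun n L (localExpr x₀ x₁ ψ y)) (h.coordJets L) :=
  h.jetMap.hasJet_pull (hasJet_coord (B := slab c₁ r₁ h₁) L)

/-- A form on `𝒳 M` at a point, on the model space. -/
def formAt (k : 𝒯 n M) (p : 𝒳 M) : Coord n →L[ℝ] Coord n →L[ℝ] ℝ := k p

lemma formAt_congr {k : 𝒯 n M} {q q' : 𝒳 M}
    {a a' b b' : Coord n} (hq : q = q') (ha : a = a') (hb : b = b') :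
    formAt k q a b = formAt k q' a' b' := by subst hq ha hb; rfl

lemma pullback_dparam (k : 𝒯 n M) {y : Coord n} (hy : y.2.1 ∈ (𝔠 n x₀).target)
    (hψ : MDifferentiableAt (model n) (model n) ψ (param x₀ y))
    (hy' : (ψ (param x₀ y)).2.1 ∈ (𝔠 n x₁).source) (a b : Coord n) : pullback (model n) (model n) ψ
    k (param x₀ y) (dparam x₀ y a) (dparam x₀ y b) = pullForm k x₁ (localExpr x₀ x₁ ψ y)
    (fderiv ℝ (localExpr x₀ x₁ ψ) y a) (fderiv ℝ (localExpr x₀ x₁ ψ) y b) := by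
  have e : ∀ a : Coord n, (show Coord n from mfderiv (model n) (model n) ψ (param x₀ y)
      (dparam x₀ y a)) = dparam x₁ (localExpr x₀ x₁ ψ y) (fderiv ℝ (localExpr x₀ x₁ ψ) y a) :=
    fun a => mfderiv_dparam hy hψ hy' a
  have e' : ψ (param x₀ y) = param x₁ (localExpr x₀ x₁ ψ y) := (param_coords hy').symm
  have := formAt_congr (k := k) e' (e a) (e b)
  exact this

/-- The components of the pullback of a form. -/
lemma IsLocalMap.hasJets_pull (h : IsLocalMap x₀ x₁ c₀ c₁ h₀ h₁ ψ) {k k' : 𝒯 n M}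
    {G : Matrix (Idx n) (Idx n) (slab c₁ r₁ h₁).Jet}
    (hG : (slab c₁ r₁ h₁).HasJets (components x₁ fun p a b => k p a b) G) (hk : ∀ y ∈ (slab c₀ r₀
    h₀).S, ∀ᶠ p in 𝓝 (param x₀ y), ∀ a b : TangentSpace (model n) p, k' p a b = pullback (model n)
    (model n) ψ k p a b) : (slab c₀ r₀ h₀).HasJets (components x₀ fun p a b => k' p a b)
    (pullMat h.jetMap.pull (jacobian (slab c₀ r₀ h₀).formal h.coordJets) G) := by
  intro I J
  rw [pullMat_apply]
  have h1 : (slab c₀ r₀ h₀).HasJet (fun y => ∑ a, ∑ b,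
      dirD (coordVec n I) (fun y => coordFun n a (localExpr x₀ x₁ ψ y)) y *
      dirD (coordVec n J) (fun y => coordFun n b (localExpr x₀ x₁ ψ y)) y *
      components x₁ (fun p a b => k p a b) (localExpr x₀ x₁ ψ y) a b) _ :=
    HasJet.sum fun a _ => HasJet.sum fun b _ => (((h.hasJet_coordJets a).dirD I).mul
      ((h.hasJet_coordJets b).dirD J)).mul (h.jetMap.hasJet_pull (hG a b))
  refine h1.congr fun y hy => ?_
  have hc : ContinuousAt (param x₀) y := (contMDiffAt_param (h.subset hy.1)).continuousAt
  filter_upwards [h.eventually hy, hc.eventually (hk y hy)] with z hz hkz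
  have hd := differentiableAt_of_smooth (contDiffAt_localExpr hz.1 hz.2.1 hz.2.2)
  have e1 := fun a => mfderiv_dparam hz.1 (hz.2.1.mdifferentiableAt (by simp)) hz.2.2 a
  have e2 : components x₀ (fun p a b => k' p a b) z I J =
      pullForm k x₁ (localExpr x₀ x₁ ψ z) (fderiv ℝ (localExpr x₀ x₁ ψ) z (coordVec n I))
        (fderiv ℝ (localExpr x₀ x₁ ψ) z (coordVec n J)) :=
    (hkz _ _).trans (pullback_dparam k hz.1 (hz.2.1.mdifferentiableAt (by simp)) hz.2.2 _ _)
  rw [e2, bilin_expand]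
  refine (sum_ext₂ fun a b => ?_)
  have e5 : ∀ L w, dirD w (fun y => coordFun n L (localExpr x₀ x₁ ψ y)) z =
      coordFun n L (fderiv ℝ (localExpr x₀ x₁ ψ) z w) := by
    intro L w
    have := (coordFun n L).hasFDerivAt.comp z hd.hasFDerivAt
    have e6 : fderiv ℝ (fun y => coordFun n L (localExpr x₀ x₁ ψ y)) z = _ := this.fderiv
    rw [dirD, e6]; rfl
  rw [e5, e5, components_eq_pullForm]

end JetsOfMaps

end

section

open FormalRing Slab

lemma fderiv_eq_of_affine {W : Type*} [NormedAddCommGroup W] [NormedSpace ℝ W] {F : W → ℝ} {z w : W}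
    {c : ℝ} (hF : DifferentiableAt ℝ F z) (h : ∀ t : ℝ, F (z + t • w) = F z + t * c) :
    fderiv ℝ F z w = c := by
  have h1 := hF.hasFDerivAt.hasLineDerivAt w
  have h2 : HasLineDerivAt ℝ F c z w := by
    have : HasDerivAt (fun t : ℝ => F z + t * c) c 0 := by
      simpa using ((hasDerivAt_id (0 : ℝ)).mul_const c).const_add (F z)
    simpa only [HasLineDerivAt, h] using this
  exact h1.unique h2

section LinearAlgebra

variable {n : ℕ}

lemma coordFun_sum (w : Idx n → ℝ) (I : Idx n) : coordFun n I (∑ J, w J • coordVec n J) = w I := by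
  simp only [map_sum, map_smul, coordFun_coordVec, smul_eq_mul, mul_ite, mul_one, mul_zero,
    Finset.sum_ite_eq, mem_univ, if_true]

lemma eq_zero_of_coordFun {a : Coord n} (h : ∀ I, coordFun n I a = 0) : a = 0 := by
  rw [← sum_coordFun a]; simp [h]

/-- The matrix of an injective linear map is invertible. -/
lemma det_ne_zero_of_injective (T : Coord n →L[ℝ] Coord n) (h : ∀ a, T a = 0 → a = 0) :
    (of fun L I => coordFun n L (T (coordVec n I)) : Matrix (Idx n) (Idx n) ℝ).det ≠ 0 := by
  intro h0
  obtain ⟨w, hw, hw'⟩ := Matrix.exists_mulVec_eq_zero_iff.2 h0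
  apply hw
  have h1 : T (∑ J, w J • coordVec n J) = 0 := by
    refine eq_zero_of_coordFun fun L => ?_
    have := congrFun hw' L
    simp only [mulVec, dotProduct, of_apply, Pi.zero_apply] at this
    rw [map_sum, map_sum, ← this]
    refine sum_ext fun J => ?_
    rw [map_smul, map_smul, smul_eq_mul, mul_comm]
  funext I
  rw [← coordFun_sum w I, h _ h1, map_zero, Pi.zero_apply]

/-- The Gram matrix of a nondegenerate form is invertible. -/
lemma det_ne_zero_of_nondegenerate (β : Coord n →L[ℝ] Coord n →L[ℝ] ℝ)
    (h : ∀ a, (∀ b, β a b = 0) → a = 0) :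
    (of fun I J => β (coordVec n I) (coordVec n J) : Matrix (Idx n) (Idx n) ℝ).det ≠ 0 := by
  intro h0
  obtain ⟨w, hw, hw'⟩ := Matrix.exists_vecMul_eq_zero_iff.2 h0
  apply hw
  have h1 : ∑ J, w J • coordVec n J = 0 := by
    refine h _ fun b => ?_
    rw [bilin_expand]
    simp only [coordFun_sum]
    rw [sum_comm]
    refine sum_eq_zero fun J _ => ?_
    have := congrFun hw' J
    simp only [Matrix.vecMul, dotProduct, of_apply, Pi.zero_apply] at this
    rw [show ∑ I, w I * coordFun n J b * β (coordVec n I) (coordVec n J) =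
      coordFun n J b * ∑ I, w I * β (coordVec n I) (coordVec n J) by
        rw [mul_sum]; exact sum_ext fun I => by ring, this, mul_zero]
  funext I
  rw [← coordFun_sum w I, h1, map_zero, Pi.zero_apply]

lemma symm_of_orthogonal_basis {V ι : Type*} [AddCommGroup V] [Module ℝ V] [TopologicalSpace V]
    [Fintype ι] [DecidableEq ι] (β : V →L[ℝ] V →L[ℝ] ℝ) (b : Module.Basis ι ℝ V) {d : ι → ℝ}
    (h : ∀ i j, β (b i) (b j) = if i = j then d i else 0) (x y : V) : β x y = β y x := by
  rw [← b.sum_repr x, ← b.sum_repr y]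
  simp only [map_sum, map_smul, _root_.sum_apply, _root_.smul_apply, h, smul_eq_mul, mul_ite,
    mul_zero, sum_ite_eq', mem_univ, if_true]
  exact sum_ext fun i => by ring

lemma nondegenerate_of_orthogonal_basis {V ι : Type*} [AddCommGroup V] [Module ℝ V]
    [TopologicalSpace V] [Fintype ι] [DecidableEq ι] (β : V →L[ℝ] V →L[ℝ] ℝ)
    (b : Module.Basis ι ℝ V) {d : ι → ℝ} (hd : ∀ i, d i ≠ 0)
    (h : ∀ i j, β (b i) (b j) = if i = j then d i else 0) (x : V) (hx : ∀ y, β x y = 0) :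
    x = 0 := by
  rw [← b.sum_repr x]
  refine sum_eq_zero fun i _ => ?_
  have := hx (b i)
  rw [← b.sum_repr x] at this
  simp only [map_sum, map_smul, _root_.sum_apply, _root_.smul_apply, h, smul_eq_mul, mul_ite,
    mul_zero, sum_ite_eq', mem_univ, if_true] at this
  rw [(mul_eq_zero.1 this).resolve_right (hd i), zero_smul]

end LinearAlgebra

variable {n : ℕ} {M : Type*} [TopologicalSpace M] [ChartedSpace (𝔼 n) M]

lemma IsLorentzianAt.symm {p : 𝒳 M} {k : 𝒯 n M} (h : IsLorentzianAt p (k p)) (a b : Coord n) :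
    formAt k p a b = formAt k p b a := by
  obtain ⟨e, he⟩ := h
  exact symm_of_orthogonal_basis (k p) e he a b

lemma IsLorentzianAt.nondegenerate {p : 𝒳 M} {k : 𝒯 n M} (h : IsLorentzianAt p (k p)) (a : Coord n)
    (ha : ∀ b, formAt k p a b = 0) : a = 0 := by
  obtain ⟨e, he⟩ := h
  exact nondegenerate_of_orthogonal_basis (k p) e (fun i => by split_ifs <;> norm_num) he a ha

variable [IsManifold (𝓡 n) ∞ M]

lemma dparam_injective {x₀ : M} {y : Coord n} (hy : y.2.1 ∈ (𝔠 n x₀).target) {a : Coord n}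
    (h : dparam x₀ y a = 0) : a = 0 := by
  rw [dparam_apply hy] at h
  obtain ⟨a1, a2, a3⟩ := a
  simp only [Prod.mk_eq_zero] at h
  obtain ⟨rfl, h2, rfl⟩ := h
  rw [injective_dchart hy (h2.trans (map_zero _).symm)]
  rfl

lemma dparam_surjective {x₀ : M} {y : Coord n} (hy : y.2.1 ∈ (𝔠 n x₀).target) :
    Surjective (dparam x₀ y) := by
  have : Injective (dparam x₀ y : Coord n →ₗ[ℝ] Coord n) :=
    (injective_iff_map_eq_zero _).2 fun a => dparam_injective hy
  exact LinearMap.injective_iff_surjective.1 this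

/-- The map `(v, q) ↦ (v + Θ⁰(q), Θ'(q))` of `𝒳 M`. -/
def fiberMap (Θ : M × ℝ → 𝒳 M) (p : 𝒳 M) : 𝒳 M := (p.1 + (Θ p.2).1, (Θ p.2).2)

variable {x₀ x₁ : M} {c₀ c₁ : 𝔼 n} {r₀ r₁ : ℝ} {h₀ : 0 < r₀} {h₁ : 0 < r₁} {Θ : M × ℝ → 𝒳 M}
  {lam : ℝ}

lemma localExpr_fiberMap_add (x₀ x₁ : M) (Θ : M × ℝ → 𝒳 M) (z : Coord n) (t : ℝ) : localExpr x₀ x₁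
    (fiberMap Θ) (z + t • coordVec n iV) = localExpr x₀ x₁ (fiberMap Θ) z + t • coordVec n iV := by
  have e : (param x₀ (z + t • coordVec n iV)).2 = (param x₀ z).2 := by simp [param, coordVec]
  have e' : (param x₀ (z + t • coordVec n iV)).1 = (param x₀ z).1 + t := by simp [param, coordVec]
  simp only [localExpr, fiberMap, e, e', coords]
  ext <;> simp [coordVec]
  ring

lemma dirD_coordFun_comp {F : Coord n → Coord n} {z : Coord n} (hF : DifferentiableAt ℝ F z)
    (L : Idx n) (w : Coord n) :
    dirD w (fun y => coordFun n L (F y)) z = coordFun n L (fderiv ℝ F z w) := by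
  have := (coordFun n L).hasFDerivAt.comp z hF.hasFDerivAt
  have e6 : fderiv ℝ (fun y => coordFun n L (F y)) z = _ := this.fderiv
  rw [dirD, e6]; rfl

lemma fderiv_fiberMap_v {z : Coord n} (hF : DifferentiableAt ℝ (localExpr x₀ x₁ (fiberMap Θ)) z)
    (L : Idx n) : dirD (coordVec n iV) (fun y => coordFun n L (localExpr x₀ x₁ (fiberMap Θ) y)) z =
    if L = iV then 1 else 0 := by
  refine fderiv_eq_of_affine (DifferentiableAt.comp z (coordFun n L).differentiableAt hF)
    fun t => ?_
  rw [localExpr_fiberMap_add, map_add, map_smul, coordFun_coordVec, smul_eq_mul]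

/-- The jet of a local map is a formal map. -/
lemma IsLocalMap.isFormalMap (h : IsLocalMap x₀ x₁ c₀ c₁ h₀ h₁ (fiberMap Θ))
    (hlam : ∀ y ∈ (slab c₀ r₀ h₀).S, ∀ᶠ p in 𝓝 (param x₀ y), lam * (Θ p.2).2.2 = lam * p.2.2) (hinj
    : ∀ y ∈ (slab c₀ r₀ h₀).S, ∀ a : Coord n, fderiv ℝ (localExpr x₀ x₁ (fiberMap Θ)) y a = 0 → a =
    0) :
    IsFormalMap (slab c₀ r₀ h₀).formal (slab c₁ r₁ h₁).formal lam h.jetMap.pull h.coordJets where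
  chain I a := by
    rw [h.jetMap.chain]
    exact sum_ext fun L => by congr 2
  mem_V k a ha := h.jetMap.pull_mem_V ha
  D_v L := by
    have h1 := (h.hasJet_coordJets L).dirD iV
    refine h1.unique ?_
    have h2 : (slab c₀ r₀ h₀).HasJet (fun _ => if L = iV then 1 else 0)
        (if L = iV then 1 else 0) := by
      split_ifs
      exacts [HasJet.one _, HasJet.zero _]
    refine h2.congr fun p hp => ?_
    filter_upwards [h.jetMap.smooth p hp] with z hz
    exact (fderiv_fiberMap_v (differentiableAt_of_smooth hz) L).symm
  map_X := by rw [← coordJet_iu]; rfl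
  lam_u := by
    have h1 := (HasJet.const (slab c₀ r₀ h₀) lam).mul (h.hasJet_coordJets iU)
    refine h1.unique (((HasJet.const (slab c₀ r₀ h₀) lam).mul (HasJet.X _)).congr fun p hp => ?_)
    have hc : ContinuousAt (param x₀) p := (contMDiffAt_param (h.subset hp.1)).continuousAt
    filter_upwards [hc.eventually (hlam p hp)] with z hz
    exact hz.symm
  unit := by
    have h1 : (slab c₀ r₀ h₀).HasJets (fun y => of fun L I => dirD (coordVec n I)
        (fun y => coordFun n L (localExpr x₀ x₁ (fiberMap Θ) y)) y)
        (jacobian (slab c₀ r₀ h₀).formal h.coordJets) := fun L I => (h.hasJet_coordJets L).dirD I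
    refine h1.isUnit_det fun p hp => ?_
    have hd := differentiableAt_of_smooth (h.jetMap.smooth p hp).self_of_nhds
    simp only [dirD_coordFun_comp hd]
    exact det_ne_zero_of_injective _ (hinj p hp)

/-- The metric `k` and the density `d` have the jets `G` and `f` over a ball in the chart at `x₀`,
and these form a formal weighted ambient metric. -/
structure HasFormal (lam : ℝ) (k : 𝒯 n M) (d : 𝒳 M → ℝ) (x₀ : M)
    (c : 𝔼 n) {r : ℝ} (hr : 0 < r)
    (G : Matrix (Idx n) (Idx n) (slab c r hr).Jet) (f : (slab c r hr).Jet) : Prop where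
  subset : closedBall c r ⊆ (𝔠 n x₀).target
  metric : (slab c r hr).HasJets (components x₀ fun p a b => k p a b) G
  density : (slab c r hr).HasJet (fun y => d (param x₀ y)) f
  ambient : IsFormalAmbient (slab c r hr).formal lam G f

section PreAmbient

variable {g : RiemannianMetric n M} {φ : C^∞⟮𝓡 n, M; ℝ⟯} {A : AmbientData n M}

lemma IsPreAmbient.translate_mem (hA : IsPreAmbient g φ lam A) {p : 𝒳 M} (hp : p ∈ A.carrier)
    (t : ℝ) : (p.1 + t, p.2) ∈ A.carrier := by
  obtain ⟨h1, h2⟩ := hA.invariant p hp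
  have := h2 ((lam * p.2.2 - 1) * t)
  rwa [dilation, inv_mul_cancel_left₀ (sub_ne_zero.2 h1)] at this

lemma IsPreAmbient.density_translate (hA : IsPreAmbient g φ lam A) {p : 𝒳 M} (hp : p ∈ A.carrier)
    (t : ℝ) : A.density (p.1 + t, p.2) = A.density p + t * (lam * p.2.2 - 1) := by
  obtain ⟨h1, h2⟩ := hA.invariant p hp
  have := hA.density_homogeneous ((lam * p.2.2 - 1) * t) p hp
  rwa [dilation, inv_mul_cancel_left₀ (sub_ne_zero.2 h1), mul_comm _ t] at this

lemma IsPreAmbient.metric_translate (hA : IsPreAmbient g φ lam A) {p : 𝒳 M} (hp : p ∈ A.carrier)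
    (t : ℝ) (a b : Coord n) : formAt A.metric (p.1 + t, p.2) a b = formAt A.metric p a b := by
  have h1 : formAt A.metric (translation t p) (show Coord n from
      mfderiv (model n) (model n) (translation t) p a) (show Coord n from
      mfderiv (model n) (model n) (translation t) p b) = formAt A.metric p a b :=
    hA.metric_homogeneous t p hp a b
  rw [← h1]
  exact formAt_congr rfl (mfderiv_translation t p a).symm (mfderiv_translation t p b).symm

lemma IsPreAmbient.metric_zero (hA : IsPreAmbient g φ lam A) (v : ℝ) (x : M) (a b : ℝ × 𝔼 n) :
    formAt A.metric (v, x, 0) (a.1, a.2, 0) (b.1, b.2, 0) = g.inner x a.2 b.2 := by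
  have h := hA.initial_metric (v, x) a b
  have h1 : formAt A.metric (v, x, 0) (show Coord n from mfderiv (𝓘(ℝ, ℝ).prod (𝓡 n)) (model n)
      (fun w : ℝ × M => (w.1, w.2, (0 : ℝ))) (v, x) a) (show Coord n from
      mfderiv (𝓘(ℝ, ℝ).prod (𝓡 n)) (model n)
      (fun w : ℝ × M => (w.1, w.2, (0 : ℝ))) (v, x) b) = _ := h
  refine (formAt_congr rfl (mfderiv_inclusion (v, x) a).symm
    (mfderiv_inclusion (v, x) b).symm).trans (h1.trans ?_)
  exact congrArg₂ (fun s t : 𝔼 n => g.inner x s t)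
    (mfderiv_snd_form (v, x) a) (mfderiv_snd_form (v, x) b)

lemma IsPreAmbient.eventually_mem (hA : IsPreAmbient g φ lam A) {y : Coord n}
    (hy : y.2.1 ∈ (𝔠 n x₀).target) (h0 : y.2.2 = 0) :
    ∀ᶠ z in 𝓝 y, z.2.1 ∈ (𝔠 n x₀).target ∧ param x₀ z ∈ A.carrier := by
  refine (eventually_mem_target hy).and ?_
  refine (contMDiffAt_param hy).continuousAt.eventually (hA.isOpen.mem_nhds ?_)
  rw [param, h0]
  exact hA.zero_mem _ _

lemma IsPreAmbient.smoothAt (hA : IsPreAmbient g φ lam A) {y : Coord n}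
    (hy : y.2.1 ∈ (𝔠 n x₀).target) (hp : param x₀ y ∈ A.carrier) :
    (∀ I J, ContDiffAt ℝ ∞ (fun z => A.matrix x₀ z I J) y) ∧ ContDiffAt ℝ ∞
    (fun z => A.density (param x₀ z)) y := by
  have hs := param_mem_source hy
  have h1 := (contMDiffAt_metric_iff A.metric hs).1
    (hA.smooth_metric.contMDiffAt (hA.isOpen.mem_nhds hp))
  have h2 := (contDiffAt_comp_param_iff hs).2
    (hA.smooth_density.contMDiffAt (hA.isOpen.mem_nhds hp))
  rw [coords_param hy] at h1 h2
  exact ⟨h1, h2⟩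

lemma matrix_eq (A : AmbientData n M) (x₀ : M) (y : Coord n) (I J : Idx n) :
    A.matrix x₀ y I J = formAt A.metric (param x₀ y) (dparam x₀ y (coordVec n I))
      (dparam x₀ y (coordVec n J)) := rfl

lemma IsPreAmbient.matrix_zero (hA : IsPreAmbient g φ lam A) {y : Coord n}
    (hy : y.2.1 ∈ (𝔠 n x₀).target) (h0 : y.2.2 = 0) {I J : Idx n} (hI : I ≠ iU) (hJ : J ≠ iU) :
    A.matrix x₀ y I J = g.inner (param x₀ y).2.1 (dchart x₀ y.2.1 (coordVec n I).2.1)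
    (dchart x₀ y.2.1 (coordVec n J).2.1) := by
  have e : ∀ I : Idx n, I ≠ iU → (coordVec n I).2.2 = 0 := by
    intro I hI
    rcases I with ⟨⟩ | i | ⟨⟩
    · rfl
    · rfl
    · exact absurd rfl hI
  have h1 := hA.metric_zero y.1 (param x₀ y).2.1
    ((coordVec n I).1, dchart x₀ y.2.1 (coordVec n I).2.1)
    ((coordVec n J).1, dchart x₀ y.2.1 (coordVec n J).2.1)
  rw [matrix_eq, ← h1]
  refine formAt_congr ?_ ?_ ?_
  · rw [param, h0]
  · rw [dparam_apply hy, e I hI]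
  · rw [dparam_apply hy, e J hJ]

lemma IsPreAmbient.det_ne_zero (hA : IsPreAmbient g φ lam A) {y : Coord n}
    (hy : y.2.1 ∈ (𝔠 n x₀).target) (hp : param x₀ y ∈ A.carrier) : (A.matrix x₀ y).det ≠ 0 := by
  refine det_ne_zero_of_nondegenerate (pullForm A.metric x₀ y) fun a ha => dparam_injective hy ?_
  refine (hA.signature _ hp).nondegenerate _ fun b => ?_
  obtain ⟨b, rfl⟩ := dparam_surjective hy b
  exact ha b

lemma param_add (x₀ : M) (z : Coord n) (t : ℝ) :
    param x₀ (z + t • coordVec n iV) = ((param x₀ z).1 + t, (param x₀ z).2) := by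
  simp [param, coordVec]

lemma IsPreAmbient.matrix_add (hA : IsPreAmbient g φ lam A) {z : Coord n}
    (hz : z.2.1 ∈ (𝔠 n x₀).target) (hp : param x₀ z ∈ A.carrier) (t : ℝ) (I J : Idx n) :
    A.matrix x₀ (z + t • coordVec n iV) I J = A.matrix x₀ z I J := by
  rw [matrix_eq, matrix_eq, ← hA.metric_translate hp t]
  have e : (z + t • coordVec n iV).2 = z.2 := by simp [coordVec]
  have e2 : ∀ a, dparam x₀ (z + t • coordVec n iV) a = dparam x₀ z a := by
    intro a
    rw [dparam_apply hz, dparam_apply (by rwa [e]), e]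
  exact formAt_congr (param_add x₀ z t) (e2 _) (e2 _)

/-- The jets of a weighted ambient space. -/
lemma IsWeightedAmbient.hasFormal (hA : IsWeightedAmbient g φ lam A) (x₀ : M) {c : 𝔼 n} {r : ℝ}
    (hr : 0 < r) (hc : closedBall c r ⊆ (𝔠 n x₀).target) :
    ∃ G f, HasFormal lam A.metric A.density x₀ c hr G f := by
  set B := slab c r hr with hB
  have hP := hA.toIsPreAmbient
  have hev : ∀ y ∈ B.S, ∀ᶠ z in 𝓝 y, z.2.1 ∈ (𝔠 n x₀).target ∧
      param x₀ z ∈ A.carrier := fun y hy => hP.eventually_mem (hc hy.1) hy.2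
  have hs : ∀ I J, B.SmoothNear fun z => A.matrix x₀ z I J := fun I J y hy =>
    (hev y hy).mono fun z hz => (hP.smoothAt hz.1 hz.2).1 I J
  have hd : B.SmoothNear fun z => A.density (param x₀ z) := fun y hy =>
    (hev y hy).mono fun z hz => (hP.smoothAt hz.1 hz.2).2
  let G : Matrix (Idx n) (Idx n) B.Jet := of fun I J => B.jet ⟨_, hs I J⟩
  have hG : B.HasJets (A.matrix x₀) G := fun I J => (hs I J).hasJet
  have hf := hd.hasJet
  have hu : IsUnit G.det := hG.isUnit_det fun y hy =>
    hP.det_ne_zero (hev y hy).self_of_nhds.1 (hev y hy).self_of_nhds.2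
  have hDv : ∀ I J, B.formal.D iV (G I J) = 0 := by
    intro I J
    refine ((hG I J).dirD iV).unique ((HasJet.zero B).congr fun y hy => ?_)
    filter_upwards [hev y hy] with z hz
    refine (fderiv_eq_of_affine (differentiableAt_of_smooth ((hP.smoothAt hz.1 hz.2).1 I J))
      fun t => ?_).symm
    rw [mul_zero, add_zero]
    exact hP.matrix_add hz.1 hz.2 t I J
  have hm : ∀ I, I ≠ iU → G iV I ∈ B.formal.m := by
    intro I hI
    refine (hG iV I).mem_ideal_iff.2 fun y hy => ?_
    rw [hP.matrix_zero (hc hy.1) hy.2 (by simp) hI]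
    have : (coordVec n iV).2.1 = 0 := rfl
    rw [this, map_zero]
    exact congrArg (fun L : 𝔼 n →L[ℝ] ℝ => L _) (map_zero (g.inner _))
  refine ⟨G, _, hc, hG, hf, ?_, hu, hDv, ?_, ?_, fun i => hm _ (by simp), fun I J => ?_, ?_⟩
  · ext I J
    refine (hG J I).unique ((hG I J).congr fun y hy => ?_)
    filter_upwards [hev y hy] with z hz
    exact (hP.signature _ hz.2).symm _ _
  · refine (hf.dirD iV).unique ((((HasJet.const B lam).mul (HasJet.X B)).sub
      (HasJet.one B)).congr fun y hy => ?_)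
    filter_upwards [hev y hy] with z hz
    refine (fderiv_eq_of_affine (differentiableAt_of_smooth (hP.smoothAt hz.1 hz.2).2)
      fun t => ?_).symm
    rw [hB, slab, param_add]
    exact hP.density_translate hz.2 t
  · rw [mem_V_succ, V_one]
    refine ⟨hm _ (by simp), ?_⟩
    have h1 : ∀ K, aChr B.formal.D G K iV iV ∈ B.formal.m := fun K =>
      (hG.christoffel hu K iV iV).mem_ideal_iff.2 fun y hy => by
        obtain ⟨v, ξ, u⟩ := y
        obtain ⟨h2, rfl : u = 0⟩ := hy
        exact hP.straight x₀ v ξ (hc h2) K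
    have h2 := sum_mul_aChr (D := B.formal.D) hu iU iV iV
    rw [hDv, add_zero, zero_sub] at h2
    have h3 : half B.Jet * -B.formal.D iU (G iV iV) ∈ B.formal.m := by
      rw [← h2]
      exact sum_mem fun K _ => mul_mem_left _ _ (h1 K)
    have h4 := B.formal.m.mul_mem_left (-2) h3
    convert h4 using 1
    linear_combination (-B.formal.D iU (G iV iV)) * two_mul_half (A := B.Jet)
  · refine slab_eq_of_oInfty (hG.weightedP hu hf lam I J) (HasJet.zero _) fun v x hx => ?_
    simp only [sub_zero]
    exact hA.tildeP_vanishes x₀ v x (hc hx) I J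
  · refine slab_eq_of_oInfty (hG.weightedF hu hf lam) (HasJet.zero _) fun v x hx => ?_
    simp only [sub_zero]
    exact hA.tildeF_vanishes x₀ v x (hc hx)

lemma exists_closedBall_subset {x₀ : M} {ξ : 𝔼 n} (hξ : ξ ∈ (𝔠 n x₀).target) :
    ∃ r > 0, closedBall ξ r ⊆ (𝔠 n x₀).target := Metric.nhds_basis_closedBall.mem_iff.1
    ((𝔠 n x₀).open_target.mem_nhds hξ)

/-- The metric in normal form along `u = 0`. -/
lemma IsNormal.metric_zero (hN : IsNormal g A) (v : ℝ) (x : M) (a b : Coord n) :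
    formAt A.metric (v, x, 0) a b = g.inner x a.2.1 b.2.1 + (a.2.2 * b.1 + a.1 * b.2.2) := by
  refine (hN.initial v x a b).trans ?_
  refine congrArg₂ (· + ·) ?_ (congrArg₂ (· + ·) (congrArg₂ (· * ·) ?_ ?_)
    (congrArg₂ (· * ·) ?_ ?_))
  · exact congrArg₂ (fun s t : 𝔼 n => g.inner x s t)
      (mfderiv_mid (v, x, 0) a) (mfderiv_mid (v, x, 0) b)
  · exact differential_last _ a
  · exact differential_fst _ b
  · exact differential_fst _ a
  · exact differential_last _ b

lemma IsNormal.jets (hN : IsNormal g A) (hP : IsPreAmbient g φ lam A) {c : 𝔼 n} {r : ℝ} {hr : 0 < r}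
    {G : Matrix (Idx n) (Idx n) (slab c r hr).Jet} {f : (slab c r hr).Jet}
    (h : HasFormal lam A.metric A.density x₀ c hr G f) (I : Idx n) :
    G iU I = if I = iV then 1 else 0 := by
  refine normal_of_geodesic (Φ := (slab c r hr).formal) h.ambient.unit (fun K => ?_) (fun I => ?_) I
  · refine (h.metric.christoffel h.ambient.unit K iU iU).unique
      ((HasJet.zero _).congr fun y hy => ?_)
    filter_upwards [hP.eventually_mem (h.subset hy.1) hy.2] with z hz
    exact (hN.geodesic x₀ z hz.1 hz.2 K).symm
  · have h2 : (slab c r hr).HasJet (fun _ => if I = iV then 1 else 0)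
        (if I = iV then 1 else 0) := by
      split_ifs
      exacts [HasJet.one _, HasJet.zero _]
    refine ((h.metric iU I).sub h2).mem_ideal_iff.2 fun y hy => ?_
    rw [sub_eq_zero]
    have hy' := h.subset hy.1
    have e : formAt A.metric (param x₀ y) (dparam x₀ y (coordVec n iU))
        (dparam x₀ y (coordVec n I)) = _ := (formAt_congr (by rw [param, hy.2]) (dparam_apply hy' _)
          (dparam_apply hy' _)).trans (hN.metric_zero y.1 (param x₀ y).2.1 _ _)
    refine e.trans ?_
    have e1 : (coordVec n iU) = (0, 0, 1) := rfl
    rw [e1]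
    simp only [map_zero, one_mul, zero_mul, add_zero]
    have e2 : (g.inner (param x₀ y).2.1 (0 : 𝔼 n))
        (dchart x₀ y.2.1 (coordVec n I).2.1) = 0 :=
      congrArg (fun L : 𝔼 n →L[ℝ] ℝ => L _) (map_zero (g.inner _))
    refine (congrArg (· + _) e2).trans ?_
    rw [zero_add]
    rcases I with ⟨⟩ | i | ⟨⟩ <;> simp [coordVec]

/-- Two normal forms agree to infinite order. -/
lemma normal_unique {A₁ A₂ : AmbientData n M} (h₁ : IsWeightedAmbient g φ lam A₁)
    (hN₁ : IsNormal g A₁) (h₂ : IsWeightedAmbient g φ lam A₂) (hN₂ : IsNormal g A₂) : FormOInfty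
    (fun p a b => A₁.metric p a b - A₂.metric p a b) ∧ FunOInfty
    (fun p => A₁.density p - A₂.density p) := by
  have key : ∀ x₀ : M, ∀ ξ ∈ (𝔠 n x₀).target, ∃ r, ∃ hr : 0 < r,
      ∃ G f, HasFormal lam A₁.metric A₁.density x₀ ξ hr G f ∧
        HasFormal lam A₂.metric A₂.density x₀ ξ hr G f := by
    intro x₀ ξ hξ
    obtain ⟨r, hr, hc⟩ := exists_closedBall_subset hξ
    obtain ⟨G₁, f₁, H₁⟩ := h₁.hasFormal x₀ hr hc
    obtain ⟨G₂, f₂, H₂⟩ := h₂.hasFormal x₀ hr hc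
    obtain ⟨rfl, rfl⟩ := IsFormalAmbient.unique H₁.ambient H₂.ambient
      (hN₁.jets h₁.toIsPreAmbient H₁) (hN₂.jets h₂.toIsPreAmbient H₂) (fun i j => by
        refine ((H₂.metric _ _).sub (H₁.metric _ _)).mem_ideal_iff.2 fun y hy => ?_
        rw [sub_eq_zero]
        exact (h₂.matrix_zero (hc hy.1) hy.2 (by simp) (by simp)).trans
          (h₁.matrix_zero (hc hy.1) hy.2 (by simp) (by simp)).symm) (by
        refine (H₂.density.sub H₁.density).mem_ideal_iff.2 fun y hy => ?_
        rw [param, hy.2, h₁.initial_density, h₂.initial_density, sub_self])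
    exact ⟨r, hr, _, _, H₁, H₂⟩
  constructor
  · intro x₀ v ξ hξ I J
    obtain ⟨r, hr, G, f, H₁, H₂⟩ := key x₀ ξ hξ
    exact slab_oInfty (H₁.metric I J) (H₂.metric I J) v (mem_closedBall_self hr.le)
  · intro v x
    obtain ⟨r, hr, G, f, H₁, H₂⟩ := key x _ (mem_chart_target (𝔼 n) x)
    have := slab_oInfty H₁.density H₂.density v (mem_closedBall_self hr.le)
    simpa [param] using this

end PreAmbient

end

section

open FormalRing Slab

/-! ### Formal solutions from solutions of the evolution equations -/

section Flow

variable {A B : Type*} [CommRing A] [Algebra ℝ A] [CommRing B] [Algebra ℝ B] {n : ℕ}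

lemma aP_add_const {d : Fin n → Derivation ℝ A A} {g : Matrix (Fin n) (Fin n) A} {f s : A}
    (hs : ∀ i, d i s = 0) (lam : ℝ) (i j : Fin n) : aP d g (f + s) lam i j = aP d g f lam i j := by
  simp [aP, aHess, hs]

lemma aF_add_const {d : Fin n → Derivation ℝ A A} {g : Matrix (Fin n) (Fin n) A} {f s : A}
    (hs : ∀ i, d i s = 0) (lam : ℝ) :
    aF d g (f + s) lam = aF d g f lam + 2 * algebraMap ℝ A lam * s := by
  simp only [aF, aLap, aHess, aGradSq, map_add, hs, add_zero]
  ring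

/-- A solution of the evolution equations on `(x, u)`-space gives a formal weighted ambient metric
in normal form. -/
lemma isFormalAmbient_of_flow {Φ' : FormalRing A (Idx n) iU} {Φ : FormalRing B (Idx n) iU}
    (σ : A →ₐ[ℝ] B) (hσ : ∀ I a, σ (Φ'.D I a) = Φ.D I (σ a)) (hX : σ Φ'.X = Φ.X)
    (hv : ∀ a, Φ'.D iV a = 0) {w : B} (hw : ∀ I, Φ.D I w = if I = iV then 1 else 0) {lam : ℝ}
    {e : A} (he : (algebraMap ℝ A lam * Φ'.X - 1) * e = 1) {g : Matrix (Fin n) (Fin n) A} {f : A}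
    (hgs : g.IsSymm) (hgu : IsUnit g.det)
    (eg : ∀ i j, Φ'.D iU (g i j) = flowG (fun i => Φ'.D (idxX i)) e lam g f i j)
    (ef : Φ'.D iU f = flowF (fun i => Φ'.D (idxX i)) e lam g f) :
    IsFormalAmbient Φ lam (ppMat (g.map σ)) (σ f + w * (algebraMap ℝ B lam * Φ.X - 1)) := by
  set s := w * (algebraMap ℝ B lam * Φ.X - 1) with hs
  have hDs : ∀ I, Φ.D I s = (if I = iV then algebraMap ℝ B lam * Φ.X - 1 else 0) +
      if I = iU then algebraMap ℝ B lam * w else 0 := by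
    intro I
    rw [hs, leibniz, map_sub, leibniz, Derivation.map_algebraMap, hw, Φ.D_X]
    simp only [Derivation.map_one_eq_zero, smul_eq_mul]
    split_ifs <;> ring
  have hsx : ∀ i : Fin n, Φ.D (idxX i) s = 0 := fun i => by rw [hDs]; simp
  have he' : (algebraMap ℝ B lam * Φ.X - 1) * σ e = 1 := by
    have := congrArg σ he
    simpa [hX] using this
  have hP : ∀ i j, σ (aP (fun i => Φ'.D (idxX i)) g f lam i j) =
      aP (fun i => Φ.D (idxX i)) (g.map σ) (σ f) lam i j :=
    fun i j => map_aP σ (fun i a => hσ (idxX i) a) hgu f lam i j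
  refine isFormalAmbient_ppMat he' (hgs.map _) ?_ (fun i j => ?_) ?_ (fun i j => ?_) ?_
  · have : (g.map σ).det = σ g.det := (AlgHom.map_det σ g).symm
    rw [this]; exact hgu.map σ
  · rw [map_apply, ← hσ, hv, map_zero]
  · rw [map_add, ← hσ, hv, map_zero, zero_add, hDs]; simp
  · rw [map_apply, ← hσ, eg, flowG, flowG, aP_add_const hsx, ← hP]
    simp [map_ofNat]
  · rw [map_add, ← hσ, ef, hDs, flowF, flowF, aF_add_const hsx]
    simp only [aP_add_const hsx, ← hP]
    rw [map_mul, map_mul, map_sub, map_aF σ (fun i a => hσ (idxX i) a) hgu, map_sum]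
    simp only [map_sum, map_mul, ← map_inv_map hgu (σ := σ), map_apply]
    have h2 : σ (half A) = half B := by simp [half]
    rw [h2]
    simp only [reduceCtorEq, if_false, if_true]
    linear_combination (-(algebraMap ℝ B lam * w)) * he' +
      (-algebraMap ℝ B lam * s * σ e) * two_mul_half (A := B)

end Flow

/-! ### Change of charts -/

section ChartChange

variable {n : ℕ} {M : Type*} [TopologicalSpace M] [ChartedSpace (𝔼 n) M] [IsManifold (𝓡 n) ∞ M]

lemma hasJet_ite {W ι : Type*} [NormedAddCommGroup W] [NormedSpace ℝ W] [Fintype ι] [DecidableEq ι]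
    {iu : ι} (B : Slab W ι iu) (P : Prop) [Decidable P] :
    B.HasJet (fun _ => if P then 1 else 0) (if P then 1 else 0) := by
  split_ifs
  exacts [HasJet.one _, HasJet.zero _]

lemma fiberMap_id : fiberMap (fun q : M × ℝ => (0, q)) = id := by funext p; simp [fiberMap]

lemma pullback_id (k : 𝒯 n M) (p : 𝒳 M) (a b : TangentSpace (model n) p) :
    pullback (model n) (model n) id k p a b = k p a b := by
  have e : ∀ a : Coord n, (show Coord n from mfderiv (model n) (model n) (id : 𝒳 M → _) p a)
      = a := by intro a; rw [mfderiv_id]; rfl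
  exact formAt_congr (k := k) rfl (e a) (e b)

lemma isLocalMap_id {x₀ x₁ x : M} {c₁ : 𝔼 n} {r₁ : ℝ} (h₁ : 0 < r₁) (hx₀ : x ∈ (𝔠 n x₀).source)
    (hx₁ : x ∈ (𝔠 n x₁).source) (hx : 𝔠 n x₁ x ∈ ball c₁ r₁) : ∃ R > 0, ∀ r, ∀ hr : 0 < r, r ≤ R →
    IsLocalMap x₀ x₁ (𝔠 n x₀ x) c₁ hr h₁ (fiberMap fun q : M × ℝ => (0, q)) := by
  set κ₀ := 𝔠 n x₀
  set κ₁ := 𝔠 n x₁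
  have hξ := κ₀.map_source hx₀
  have h1 : ∀ᶠ ξ in 𝓝 (κ₀ x), ξ ∈ κ₀.target := κ₀.open_target.mem_nhds hξ
  have hc : ContinuousAt κ₀.symm (κ₀ x) := κ₀.continuousAt_symm hξ
  have h2 : ∀ᶠ ξ in 𝓝 (κ₀ x), κ₀.symm ξ ∈ κ₁.source :=
    hc.eventually (by rw [κ₀.left_inv hx₀]; exact κ₁.open_source.mem_nhds hx₁)
  have h3 : ∀ᶠ ξ in 𝓝 (κ₀ x), κ₁ (κ₀.symm ξ) ∈ ball c₁ r₁ := by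
    have : ContinuousAt (fun ξ => κ₁ (κ₀.symm ξ)) (κ₀ x) :=
      ContinuousAt.comp (by rw [κ₀.left_inv hx₀]; exact κ₁.continuousAt hx₁) hc
    refine this.eventually ?_
    beta_reduce
    rw [κ₀.left_inv hx₀]; exact isOpen_ball.mem_nhds hx
  obtain ⟨R, hR, H⟩ := Metric.nhds_basis_closedBall.mem_iff.1 (h1.and (h2.and h3))
  refine ⟨R, hR, fun r hr hrR => ⟨?_, ?_, ?_, ?_⟩⟩
  · exact fun ξ hξ => (H (closedBall_subset_closedBall hrR hξ)).1
  · intro y _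
    rw [fiberMap_id]
    exact .of_forall fun p => contMDiffAt_id
  · intro y hy
    rw [fiberMap_id]
    exact (H (closedBall_subset_closedBall hrR hy.1)).2.1
  · intro y hy
    rw [fiberMap_id]
    exact ⟨ball_subset_closedBall (H (closedBall_subset_closedBall hrR hy.1)).2.2, hy.2⟩

variable {k : 𝒯 n M} {d : 𝒳 M → ℝ} {lam : ℝ}

/-- Formal weighted ambient metrics in another chart. -/
lemma HasFormal.change {x₀ x₁ : M} {c₀ c₁ : 𝔼 n} {r₀ r₁ : ℝ} {h₀ : 0 < r₀} {h₁ : 0 < r₁} {G f}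
    (h : HasFormal lam k d x₁ c₁ h₁ G f)
    (hL : IsLocalMap x₀ x₁ c₀ c₁ h₀ h₁ (fiberMap fun q : M × ℝ => (0, q)))
    (hN : ∀ I, G iU I = if I = iV then 1 else 0) :
    ∃ G' f', HasFormal lam k d x₀ c₀ h₀ G' f' ∧ ∀ I, G' iU I = if I = iV then 1 else 0 := by
  set Θ : M × ℝ → 𝒳 M := fun q => (0, q) with hΘ
  have hid : fiberMap Θ = id := fiberMap_id
  have hloc : ∀ z, localExpr x₀ x₁ (fiberMap Θ) z = coords n x₁ (param x₀ z) := by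
    intro z; rw [hid]; rfl
  have hF : IsFormalMap (slab c₀ r₀ h₀).formal (slab c₁ r₁ h₁).formal lam hL.jetMap.pull
      hL.coordJets := by
    refine hL.isFormalMap (fun y _ => .of_forall fun p => rfl) fun y hy a ha => ?_
    refine dparam_injective (hL.subset hy.1) ?_
    have e := mfderiv_dparam (hL.eventually hy).self_of_nhds.1
      ((hL.eventually hy).self_of_nhds.2.1.mdifferentiableAt (by simp))
      (hL.eventually hy).self_of_nhds.2.2 a
    have e2 : fderiv ℝ (fun z => coords n x₁ (fiberMap Θ (param x₀ z))) y a = 0 := ha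
    rw [e2, map_zero] at e
    have e3 : ∀ (p : 𝒳 M) (b : Coord n), (show Coord n from
        mfderiv (model n) (model n) (fiberMap Θ) p b) = b := by intro p b; rw [hid, mfderiv_id]; rfl
    exact (e3 _ _).symm.trans e
  refine ⟨_, _, ⟨hL.subset, hL.hasJets_pull h.metric fun y _ => Eventually.of_forall
    fun p a b => ?_, ?_, h.ambient.pull hF⟩, normal_pull hN (fun L => ?_) (fun I => ?_)⟩
  · rw [hid]; exact (pullback_id k p a b).symm
  · refine (hL.jetMap.hasJet_pull h.density).congr fun y hy => ?_
    filter_upwards [hL.eventually hy] with z hz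
    have : (param x₀ z).2.1 ∈ (𝔠 n x₁).source := by
      have := hz.2.2
      rwa [hid] at this
    change d (param x₁ (localExpr x₀ x₁ (fiberMap Θ) z)) = _
    rw [hloc, param_coords this]
  · refine ((hL.hasJet_coordJets L).dirD iU).unique ((hasJet_ite _ _).congr fun y hy => ?_)
    filter_upwards [hL.jetMap.smooth y hy] with z hz
    refine (fderiv_eq_of_affine (DifferentiableAt.comp z (coordFun n L).differentiableAt
      (differentiableAt_of_smooth hz)) fun t => ?_).symm
    have : localExpr x₀ x₁ (fiberMap Θ) (z + t • coordVec n iU) =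
        localExpr x₀ x₁ (fiberMap Θ) z + t • coordVec n iU := by
      rw [hloc, hloc]
      ext <;> simp [coords, param, coordVec]
    change coordFun n L (localExpr x₀ x₁ (fiberMap Θ) (z + t • coordVec n iU)) = _
    rw [this, map_add, map_smul, coordFun_coordVec, smul_eq_mul]
    rfl
  · refine ((hL.hasJet_coordJets iV).dirD I).unique ((hasJet_ite _ _).congr fun y hy => ?_)
    filter_upwards with z
    have : (fun y => coordFun n iV (localExpr x₀ x₁ (fiberMap Θ) y)) = coordFun n iV := by
      funext y; rw [hloc]; rfl
    change _ = fderiv ℝ (fun y => coordFun n iV (localExpr x₀ x₁ (fiberMap Θ) y)) z (coordVec n I)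
    rw [this, (coordFun n iV).fderiv, coordFun_coordVec]
    simp [eq_comm]

end ChartChange

end

section

open FormalRing Slab

variable {n : ℕ} {M : Type*} [TopologicalSpace M] [ChartedSpace (𝔼 n) M]

/-! ### Metrics in normal form -/

/-- The projection of tangent vectors to `M`. -/
def projX (n : ℕ) : Coord n →L[ℝ] 𝔼 n := (fstL ℝ _ _).comp (sndL ℝ _ _)

/-- The metric `h_u + 2 du dv`. -/
def ppForm (h : M × ℝ → 𝔼 n →L[ℝ] 𝔼 n →L[ℝ] ℝ) : 𝒯 n M := fun p =>
  show Coord n →L[ℝ] Coord n →L[ℝ] ℝ from (h p.2).bilinearComp (projX n) (projX n) +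
      ((coordFun n iU).smulRight (coordFun n iV) + (coordFun n iV).smulRight (coordFun n iU))

/-- The density `η - v + λ u v`. -/
def ppDensity (lam : ℝ) (η : M × ℝ → ℝ) (p : 𝒳 M) : ℝ := η p.2 + p.1 * (lam * p.2.2 - 1)

lemma ppForm_apply (h : M × ℝ → 𝔼 n →L[ℝ] 𝔼 n →L[ℝ] ℝ) (p : 𝒳 M) (a b : Coord n) :
    formAt (ppForm h) p a b = h p.2 a.2.1 b.2.1 + (a.2.2 * b.1 + a.1 * b.2.2) := rfl

variable [IsManifold (𝓡 n) ∞ M]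

/-- The matrix of a form on `M` that depends on `u`. -/
def hmat (x₀ : M) (h : M × ℝ → 𝔼 n →L[ℝ] 𝔼 n →L[ℝ] ℝ) (y : Coord n) : Matrix (Fin n) (Fin n) ℝ :=
  of fun i j => h (param x₀ y).2 (dchart x₀ y.2.1 (EuclideanSpace.single i 1))
    (dchart x₀ y.2.1 (EuclideanSpace.single j 1))

lemma components_ppForm {x₀ : M} (h : M × ℝ → 𝔼 n →L[ℝ] 𝔼 n →L[ℝ] ℝ) {y : Coord n}
    (hy : y.2.1 ∈ (𝔠 n x₀).target) (I J : Idx n) :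
    components x₀ (fun p a b => ppForm h p a b) y I J = ppMat (hmat x₀ h y) I J := by
  have e : components x₀ (fun p a b => ppForm h p a b) y I J =
      formAt (ppForm h) (param x₀ y) (dparam x₀ y (coordVec n I)) (dparam x₀ y (coordVec n J)) := rfl
  rw [e, dparam_apply hy, dparam_apply hy, ppForm_apply]
  rcases I with ⟨⟩ | i | ⟨⟩ <;> rcases J with ⟨⟩ | j | ⟨⟩ <;> simp [coordVec, ppMat, hmat]

/-- The derivative of the chart at `x₁`. -/
def dkappa (x₁ x : M) : 𝔼 n →L[ℝ] 𝔼 n := mfderiv (𝓡 n) 𝓘(ℝ, 𝔼 n) (𝔠 n x₁) x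

lemma dkappa_dchart {x₀ : M} {ξ : 𝔼 n} (hξ : ξ ∈ (𝔠 n x₀).target) (a : 𝔼 n) :
    dkappa x₀ ((𝔠 n x₀).symm ξ) (dchart x₀ ξ a) = a := by
  have h4 : MDifferentiableAt 𝓘(ℝ, 𝔼 n) (𝓡 n)
      (𝔠 n x₀).symm ξ := (contMDiffOn_chart_symm (I := 𝓡 n) (n := ∞) (x := x₀)).contMDiffAt
      ((𝔠 n x₀).open_target.mem_nhds hξ) |>.mdifferentiableAt (by simp)
  have h5 : MDifferentiableAt (𝓡 n) 𝓘(ℝ, 𝔼 n)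
      (𝔠 n x₀)
      ((𝔠 n x₀).symm ξ) := (contMDiffOn_chart (I := 𝓡 n) (n := ∞) (x := x₀)).contMDiffAt
      ((𝔠 n x₀).open_source.mem_nhds ((𝔠 n x₀).map_target hξ)) |>.mdifferentiableAt (by simp)
  have h6 := h5.hasMFDerivAt.comp ξ h4.hasMFDerivAt
  have h7 : HasMFDerivAt 𝓘(ℝ, 𝔼 n) 𝓘(ℝ, 𝔼 n) id ξ
      (ContinuousLinearMap.id ℝ _) := hasMFDerivAt_id ξ
  have h8 : (𝔠 n x₀ ∘ (𝔠 n x₀).symm) =ᶠ[𝓝 ξ] id := by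
    filter_upwards [(𝔠 n x₀).open_target.mem_nhds hξ] with z hz
    exact (𝔠 n x₀).right_inv hz
  have h9 := hasMFDerivAt_unique h6 (h7.congr_of_eventuallyEq h8)
  exact DFunLike.congr_fun h9 a

lemma dchart_surjective {x₀ : M} {ξ : 𝔼 n} (hξ : ξ ∈ (𝔠 n x₀).target) :
    Surjective (dchart x₀ ξ) := by
  have : Injective
      (dchart x₀ ξ : 𝔼 n →ₗ[ℝ] 𝔼 n) := injective_dchart hξ
  exact LinearMap.injective_iff_surjective.1 this

/-- The form with the components `γ` in the chart at `x₁`. -/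
def chartForm (x₁ : M) (γ : 𝔼 n × ℝ → Matrix (Fin n) (Fin n) ℝ)
    (q : M × ℝ) : 𝔼 n →L[ℝ] 𝔼 n →L[ℝ] ℝ := (∑ i, ∑ j, γ (𝔠 n x₁ q.1, q.2) i j •
    (EuclideanSpace.proj i : 𝔼 n →L[ℝ] ℝ).smulRight
      (EuclideanSpace.proj j : 𝔼 n →L[ℝ] ℝ)).bilinearComp
    (dkappa x₁ q.1) (dkappa x₁ q.1)

lemma chartForm_apply (x₁ : M) (γ : 𝔼 n × ℝ → Matrix (Fin n) (Fin n) ℝ)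
    (q : M × ℝ) (a b : 𝔼 n) : chartForm x₁ γ q a b = ∑ i, ∑ j, γ (𝔠 n x₁ q.1, q.2) i j *
        (dkappa x₁ q.1 a i * dkappa x₁ q.1 b j) := by simp [chartForm, _root_.sum_apply]

lemma chartForm_symm (x₁ : M) {γ : 𝔼 n × ℝ → Matrix (Fin n) (Fin n) ℝ} (hγ : ∀ z, (γ z).IsSymm)
    (q : M × ℝ) (a b : 𝔼 n) : chartForm x₁ γ q a b = chartForm x₁ γ q b a := by
  rw [chartForm_apply, chartForm_apply, sum_comm]
  refine sum_ext₂ fun i j => ?_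
  rw [(hγ _).apply]; ring

lemma hmat_chartForm {x₁ : M} (γ : 𝔼 n × ℝ → Matrix (Fin n) (Fin n) ℝ) {y : Coord n}
    (hy : y.2.1 ∈ (𝔠 n x₁).target) : hmat x₁ (chartForm x₁ γ) y = γ y.2 := by
  ext i j
  have e : (param x₁ y).2.1 = (𝔠 n x₁).symm y.2.1 := rfl
  simp only [hmat, of_apply, chartForm_apply]
  simp only [e, dkappa_dchart hy, (𝔠 n x₁).right_inv hy]
  simp [param, PiLp.single_apply]

/-- A form on `M` is determined by its components. -/
lemma form_eq_of_components {x₀ : M} {ξ : 𝔼 n} (hξ : ξ ∈ (𝔠 n x₀).target)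
    {β β' : 𝔼 n →L[ℝ] 𝔼 n →L[ℝ] ℝ} (h : ∀ i j, β (dchart x₀ ξ (EuclideanSpace.single i 1)) (dchart
    x₀ ξ (EuclideanSpace.single j 1)) = β' (dchart x₀ ξ (EuclideanSpace.single i 1)) (dchart x₀ ξ
    (EuclideanSpace.single j 1))) : β = β' := by
  ext a b
  obtain ⟨a, rfl⟩ := dchart_surjective hξ a
  obtain ⟨b, rfl⟩ := dchart_surjective hξ b
  conv_lhs => rw [← sum_single a, ← sum_single b]
  conv_rhs => rw [← sum_single a, ← sum_single b]
  simp only [map_sum, map_smul, _root_.sum_apply, _root_.smul_apply, h]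

/-- The matrix of a Riemannian metric in the chart at `x₀`. -/
def gmat (g : RiemannianMetric n M) (x₀ : M) (ξ : 𝔼 n) : Matrix (Fin n) (Fin n) ℝ :=
  of fun i j => g.inner ((𝔠 n x₀).symm ξ)
    (dchart x₀ ξ (EuclideanSpace.single i 1)) (dchart x₀ ξ (EuclideanSpace.single j 1))

lemma symm_trivialization_base {x₀ : M} {ξ : 𝔼 n} (hξ : ξ ∈ (𝔠 n x₀).target) (a : 𝔼 n) :
    (trivializationAt (𝔼 n) (TangentSpace (𝓡 n)) x₀).symm ((𝔠 n x₀).symm ξ) a = dchart x₀ ξ a := by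
  have : IsManifold (𝓡 n) 1 M := IsManifold.of_le (n := ∞) (by simp)
  have hs := (𝔠 n x₀).map_target hξ
  have h := TangentBundle.symmL_trivializationAt (I := 𝓡 n) (𝕜 := ℝ) (x₀ := x₀) hs
  have e1 : ⇑(extChartAt (𝓡 n) x₀).symm = (𝔠 n x₀).symm := by simp [extChartAt]
  have e2 : ⇑(extChartAt (𝓡 n) x₀) = (𝔠 n x₀) := by simp [extChartAt]
  rw [e1, e2, (𝔠 n x₀).right_inv hξ, ModelWithCorners.range_eq_univ, mfderivWithin_univ] at h
  rw [dchart, ← h]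
  exact (Bundle.Trivialization.symmL_apply _ (R := ℝ) hs a).symm

lemma contDiffAt_gmat (g : RiemannianMetric n M) {x₀ : M} {ξ : 𝔼 n} (hξ : ξ ∈ (𝔠 n x₀).target)
    (i j : Fin n) : ContDiffAt ℝ ∞ (fun ξ => gmat g x₀ ξ i j) ξ := by
  have hs := (𝔠 n x₀).map_target hξ
  have h := (contMDiffAt_form_iff (I := 𝓡 n) g.inner hs).1 g.contMDiff.contMDiffAt
    (EuclideanSpace.single i 1) (EuclideanSpace.single j 1)
  have h4 : ContMDiffAt 𝓘(ℝ, 𝔼 n) (𝓡 n) ∞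
      (𝔠 n x₀).symm ξ := (contMDiffOn_chart_symm (I := 𝓡 n) (n := ∞) (x := x₀)).contMDiffAt
      ((𝔠 n x₀).open_target.mem_nhds hξ)
  have h5 := ContMDiffAt.comp ξ h h4
  rw [← contMDiffAt_iff_contDiffAt]
  refine h5.congr_of_eventuallyEq ?_
  filter_upwards [(𝔠 n x₀).open_target.mem_nhds hξ] with z hz
  simp only [Function.comp]
  rw [symm_trivialization_base hz, symm_trivialization_base hz]
  rfl

lemma gmat_det_ne_zero (g : RiemannianMetric n M) {x₀ : M} {ξ : 𝔼 n} (hξ : ξ ∈ (𝔠 n x₀).target) :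
    (gmat g x₀ ξ).det ≠ 0 := by
  intro h0
  obtain ⟨w, hw, hw'⟩ := Matrix.exists_vecMul_eq_zero_iff.2 h0
  set β : 𝔼 n →L[ℝ] 𝔼 n →L[ℝ] ℝ := g.inner ((𝔠 n x₀).symm ξ) with hβ
  set a : 𝔼 n := ∑ i, w i • EuclideanSpace.single i (1 : ℝ) with ha
  have haw : ∀ i, a i = w i := by intro i; simp [ha, Finset.sum_apply, Pi.single_apply]
  have h1 : β (dchart x₀ ξ a) (dchart x₀ ξ a) = 0 := by
    conv_lhs => rw [ha]
    simp only [map_sum, map_smul, _root_.sum_apply, _root_.smul_apply, smul_eq_mul]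
    refine sum_eq_zero fun j _ => ?_
    have h2 := congrFun hw' j
    simp only [Matrix.vecMul, dotProduct, Pi.zero_apply, gmat, of_apply] at h2
    refine mul_eq_zero_of_right _ (Eq.trans ?_ h2)
    rfl
  have h2 : dchart x₀ ξ a = 0 := by
    by_contra hne
    exact absurd h1 (g.pos _ _ hne).ne'
  have h3 : a = 0 := injective_dchart hξ (h2.trans (map_zero _).symm)
  apply hw
  funext i
  rw [← haw, h3]; rfl

lemma gmat_isSymm (g : RiemannianMetric n M) (x₀ : M) (ξ : 𝔼 n) : (gmat g x₀ ξ).IsSymm := by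
  ext i j
  exact g.symm _ _ _

/-- Local solutions. -/
lemma exists_local_solution (g : RiemannianMetric n M) (φ : C^∞⟮𝓡 n, M; ℝ⟯) (lam : ℝ) (x₁ : M) : ∃
    (h : M × ℝ → 𝔼 n →L[ℝ] 𝔼 n →L[ℝ] ℝ) (η : M × ℝ → ℝ) (r : ℝ) (hr : 0 < r),
    (∀ q a b, h q a b = h q b a) ∧ (∀ x ∈ (𝔠 n x₁).source, 𝔠 n x₁ x ∈ closedBall (𝔠 n x₁ x₁) r → h
    (x, 0) = g.inner x ∧ η (x, 0) = φ x) ∧ ∃ G f, HasFormal lam (ppForm h) (ppDensity lam η) x₁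
    (𝔠 n x₁ x₁) hr G f ∧ ∀ I, G iU I = if I = iV then 1 else 0 := by
  set κ := 𝔠 n x₁ with hκ
  obtain ⟨r, hr, hc⟩ := exists_closedBall_subset (mem_chart_target (𝔼 n) x₁)
  set B := slabX (κ x₁) r hr with hB
  have hev : ∀ p ∈ B.S, ∀ᶠ z in 𝓝 p, z.1 ∈ κ.target := fun p hp =>
    continuous_fst.continuousAt.eventually (κ.open_target.mem_nhds (hc hp.1))
  have s1 : ∀ i j, B.SmoothNear fun z => gmat g x₁ z.1 i j := fun i j p hp =>
    (hev p hp).mono fun z hz => (contDiffAt_gmat g hz i j).comp z contDiffAt_fst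
  have s2 : B.SmoothNear fun z => φ (κ.symm z.1) := fun p hp => by
    filter_upwards [hev p hp] with z hz
    have h4 : ContMDiffAt 𝓘(ℝ, 𝔼 n) (𝓡 n) ∞ κ.symm z.1 :=
      (contMDiffOn_chart_symm (I := 𝓡 n) (n := ∞) (x := x₁)).contMDiffAt
        (κ.open_target.mem_nhds hz)
    have h5 : ContMDiffAt 𝓘(ℝ, 𝔼 n) 𝓘(ℝ, ℝ) ∞ (fun ξ => φ (κ.symm ξ)) z.1 :=
      ContMDiffAt.comp z.1 φ.contMDiff.contMDiffAt h4
    exact (contMDiffAt_iff_contDiffAt.1 h5).comp z contDiffAt_fst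
  let g₀ : Matrix (Fin n) (Fin n) B.Jet := of fun i j => B.jet ⟨_, s1 i j⟩
  have hg₀ : ∀ i j, B.HasJet (fun z => gmat g x₁ z.1 i j) (g₀ i j) := fun i j => (s1 i j).hasJet
  have hsymm : g₀.IsSymm := by
    ext i j
    refine (hg₀ j i).unique ?_
    convert hg₀ i j using 2 with z
    exact (gmat_isSymm g x₁ z.1).apply i j
  have hunit : IsUnit g₀.det := by
    have hD : B.HasJet (fun z => (gmat g x₁ z.1).det) g₀.det := by
      simp only [Matrix.det_apply']
      refine HasJet.sum fun τ _ => HasJet.mul ?_ ?_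
      · have := HasJet.const B ((τ.sign : ℤ) : ℝ)
        simpa using this
      · have : ∀ s : Finset (Fin n), B.HasJet (fun z => ∏ i ∈ s, gmat g x₁ z.1 (τ i) i)
            (∏ i ∈ s, g₀ (τ i) i) := by
          intro s
          induction s using Finset.induction_on with
          | empty => simpa using HasJet.one B
          | insert i s hi ih =>
            simp only [Finset.prod_insert hi]
            exact (hg₀ _ _).mul ih
        exact this _
    exact (hD.isUnit fun p hp => gmat_det_ne_zero g (hc hp.1)).1
  obtain ⟨e, he⟩ := (isUnit_lam_X_sub_one B.formal lam).exists_right_inv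
  obtain ⟨gs, f, h1, h2, h3, h4, h5, h6⟩ := flow_exists (Φ := B.formal) (emb := fun i => idxX i)
    (e := e) (lam := lam) (fun i => by simp) slabX_complete (f₀ := B.jet ⟨_, s2⟩) hsymm hunit
  choose γ₀ hγ₀ using fun i j => B.exists_hasJet (gs i j)
  obtain ⟨η₀, hη₀⟩ := B.exists_hasJet f
  let γ : 𝔼 n × ℝ → Matrix (Fin n) (Fin n) ℝ := fun z =>
    of fun i j => (1 / 2) * (γ₀ i j z + γ₀ j i z)
  have hγs : ∀ z, (γ z).IsSymm := by intro z; ext i j; simp [γ, add_comm]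
  have hγ : ∀ i j, B.HasJet (fun z => γ z i j) (gs i j) := by
    intro i j
    have := (HasJet.const B (1 / 2)).mul ((hγ₀ i j).add (hγ₀ j i))
    rw [h1.apply i j] at this
    have h2 : algebraMap ℝ B.Jet (1 / 2) * (gs i j + gs i j) = gs i j := by
      have h2 := two_mul_half (A := B.Jet)
      rw [half] at h2
      linear_combination (gs i j) * h2
    rwa [h2] at this
  refine ⟨chartForm x₁ γ, fun q => η₀ (κ q.1, q.2), r, hr, chartForm_symm x₁ hγs, ?_, ?_⟩
  · intro x hx hxr
    have hp : (κ x, (0 : ℝ)) ∈ B.S := ⟨hxr, rfl⟩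
    have hξ := κ.map_source hx
    constructor
    · refine form_eq_of_components (β' := g.inner x) hξ fun i j => ?_
      have e1 := ((hγ i j).sub (hg₀ i j)).mem_ideal_iff.1 (h3 i j) _ hp
      have e2 := congrFun (congrFun (hmat_chartForm (x₁ := x₁) γ (y := (0, κ x, 0)) hξ) i) j
      simp only [hmat, of_apply, param, hκ.symm, κ.left_inv hx] at e2
      rw [e2]
      rw [sub_eq_zero] at e1
      refine e1.trans ?_
      simp only [gmat, of_apply]
      rw [κ.left_inv hx]
      rfl
    · have e1 := (hη₀.sub s2.hasJet).mem_ideal_iff.1 h4 _ hp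
      rw [sub_eq_zero] at e1
      refine e1.trans ?_
      simp only [κ.left_inv hx]
  · have key := isFormalAmbient_of_flow (Φ' := B.formal) (Φ := (slab (κ x₁) r hr).formal)
      jetMap_snd.pull pull_snd_D pull_snd_X (fun a => ?_)
      (w := (slab (κ x₁) r hr).coordJet iV) (fun I => ?_) he h1 h2 h5 h6
    · refine ⟨_, _, ⟨hc, fun I J => ?_, ?_, key⟩, ?_⟩
      · have e : ∀ I J, (slab (κ x₁) r hr).HasJet (fun y => ppMat (γ y.2) I J)
            (ppMat (gs.map jetMap_snd.pull) I J) := by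
          intro I J
          rcases I with ⟨⟩ | i | ⟨⟩ <;> rcases J with ⟨⟩ | j | ⟨⟩
          all_goals first
            | exact HasJet.zero _
            | exact HasJet.one _
            | exact jetMap_snd.hasJet_pull (hγ i j)
        refine (e I J).congr fun y hy => ?_
        filter_upwards [eventually_mem_target (hc hy.1)] with z hz
        rw [components_ppForm _ hz, hmat_chartForm γ hz]
      · have e := (jetMap_snd.hasJet_pull hη₀).add ((hasJet_coord (B := slab (κ x₁) r hr)
          iV).mul (((HasJet.const _ lam).mul (HasJet.X _)).sub (HasJet.one _)))
        refine e.congr fun y hy => ?_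
        filter_upwards [eventually_mem_target (hc hy.1)] with z hz
        simp only [ppDensity, param, hκ.symm, κ.right_inv hz]
        rfl
      · intro I
        rcases I with ⟨⟩ | i | ⟨⟩ <;> simp [ppMat]
    · obtain ⟨F, hF⟩ := B.exists_hasJet a
      refine (hF.dirD iV).unique ((HasJet.zero _).congr fun y _ => ?_)
      filter_upwards with z
      have : B.e iV = 0 := rfl
      simp [dirD, this]
    · refine ((hasJet_coord (B := slab (κ x₁) r hr) iV).dirD I).unique
        ((hasJet_ite _ _).congr fun y _ => ?_)
      filter_upwards with z
      change _ = fderiv ℝ (coordFun n iV) z (coordVec n I)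
      rw [(coordFun n iV).fderiv, coordFun_coordVec]
      simp [eq_comm]

end

section

open FormalRing Slab

variable {n : ℕ} {M : Type*} [TopologicalSpace M] [ChartedSpace (𝔼 n) M] [IsManifold (𝓡 n) ∞ M]

lemma eventually_closedBall {x₀ x : M} (hx : x ∈ (𝔠 n x₀).source) {P : M → Prop}
    (h : ∀ᶠ x' in 𝓝 x, P x') : ∀ᶠ r in 𝓝[>] (0 : ℝ), ∀ ξ ∈ closedBall (𝔠 n x₀ x) r, ξ ∈
    (𝔠 n x₀).target ∧ P ((𝔠 n x₀).symm ξ) := by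
  set κ := 𝔠 n x₀
  have hξ := κ.map_source hx
  have h1 : ∀ᶠ ξ in 𝓝 (κ x), ξ ∈ κ.target := κ.open_target.mem_nhds hξ
  have h2 : ∀ᶠ ξ in 𝓝 (κ x), P (κ.symm ξ) :=
    (κ.continuousAt_symm hξ).eventually (by rwa [κ.left_inv hx])
  obtain ⟨R, hR, H⟩ := Metric.nhds_basis_closedBall.mem_iff.1 (h1.and h2)
  filter_upwards [Ioc_mem_nhdsGT hR] with r hr ξ hξ
  exact H (closedBall_subset_closedBall hr.2 hξ)

lemma ppForm_sum {ι : Type*} {s : Finset ι} {c : ι → ℝ} (hc : ∑ i ∈ s, c i = 1)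
    {H : ι → M × ℝ → 𝔼 n →L[ℝ] 𝔼 n →L[ℝ] ℝ} {h : M × ℝ → 𝔼 n →L[ℝ] 𝔼 n →L[ℝ] ℝ} {p : 𝒳 M}
    (hp : h p.2 = ∑ i ∈ s, c i • H i p.2) (a b : Coord n) :
    formAt (ppForm h) p a b = ∑ i ∈ s, c i * formAt (ppForm (H i)) p a b := by
  simp only [ppForm_apply, mul_add, sum_add_distrib, ← sum_mul, ← mul_assoc, hc,
    one_mul, hp, _root_.sum_apply, _root_.smul_apply, smul_eq_mul]

lemma components_ppForm_sum {ι : Type*} {s : Finset ι} {c : ι → ℝ} (hc : ∑ i ∈ s, c i = 1)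
    {H : ι → M × ℝ → 𝔼 n →L[ℝ] 𝔼 n →L[ℝ] ℝ}
    {h : M × ℝ → 𝔼 n →L[ℝ] 𝔼 n →L[ℝ] ℝ} {x₀ : M}
    {y : Coord n} (hp : h (param x₀ y).2 = ∑ i ∈ s, c i • H i (param x₀ y).2) (I J : Idx n) :
    components x₀ (fun p a b => ppForm h p a b) y I J =
      ∑ i ∈ s, c i * components x₀ (fun p a b => ppForm (H i) p a b) y I J := ppForm_sum hc hp _ _

variable [T2Space M] [SecondCountableTopology M]

set_option maxHeartbeats 1000000 in
/-- Global solutions. -/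
lemma exists_global_solution (g : RiemannianMetric n M) (φ : C^∞⟮𝓡 n, M; ℝ⟯) (lam : ℝ) : ∃
    (h : M × ℝ → 𝔼 n →L[ℝ] 𝔼 n →L[ℝ] ℝ) (η : M × ℝ → ℝ), (∀ q a b, h q a b = h q b a) ∧
    (∀ x, h (x, 0) = g.inner x) ∧ (∀ x, η (x, 0) = φ x) ∧ ∀ x₀, ∀ x ∈ (𝔠 n x₀).source, ∃ r, ∃ hr : 0
    < r, ∃ G f, HasFormal lam (ppForm h) (ppDensity lam η) x₀ (𝔠 n x₀ x) hr G f := by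
  have : LocallyCompactSpace M := Manifold.locallyCompact_of_finiteDimensional (𝓡 n)
  choose H N R hR hsymm hinit Gl fl hform hnorm using exists_local_solution g φ lam
  set U : M → Set M := fun i => (𝔠 n i).source ∩
    𝔠 n i ⁻¹'
      ball (𝔠 n i i) (R i) with hU
  have hUo : ∀ i, IsOpen (U i) := fun i => (𝔠 n i).isOpen_inter_preimage isOpen_ball
  obtain ⟨χ, hχ⟩ := SmoothPartitionOfUnity.exists_isSubordinate (𝓡 n) isClosed_univ U hUo
    (fun x _ => Set.mem_iUnion.2 ⟨x, _root_.mem_chart_source _ x, Metric.mem_ball_self (hR x)⟩)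
  have hin : ∀ i x, x ∈ U i → H i (x, 0) = g.inner x ∧ N i (x, 0) = φ x := fun i x hx =>
    hinit i x hx.1 (ball_subset_closedBall hx.2)
  have hsub : ∀ i x, i ∈ χ.fintsupport x → x ∈ U i := fun i x hi =>
    hχ i ((χ.mem_fintsupport_iff x i).1 hi)
  have hone : ∀ x, ∑ i ∈ χ.finsupport x, χ i x = 1 := fun x => χ.sum_finsupport x (Set.mem_univ x)
  have hzero : ∀ {x : M} {s : Finset M}, χ.finsupport x ⊆ s → ∀ i ∈ s, i ∉ χ.finsupport x →
      χ i x = 0 := by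
    intro x s _ i _ hi
    rw [SmoothPartitionOfUnity.mem_finsupport] at hi
    simpa using hi
  refine ⟨fun q => ∑ i ∈ χ.finsupport q.1, χ i q.1 • H i q,
    fun q => ∑ i ∈ χ.finsupport q.1, χ i q.1 * N i q, ?_, ?_, ?_, ?_⟩
  · intro q a b
    simp only [_root_.sum_apply, _root_.smul_apply, hsymm _ q a b]
  · intro x
    have : ∑ i ∈ χ.finsupport x, χ i x • H i (x, 0) = ∑ i ∈ χ.finsupport x, χ i x •
        (show 𝔼 n →L[ℝ] 𝔼 n →L[ℝ] ℝ from g.inner x) := sum_congr rfl fun i hi =>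
        congrArg _ (hin i x (hsub i x (χ.finsupport_subset_fintsupport x hi))).1
    refine this.trans ?_
    rw [← Finset.sum_smul, hone, one_smul]
  · intro x
    have : ∑ i ∈ χ.finsupport x, χ i x * N i (x, 0) = ∑ i ∈ χ.finsupport x, χ i x * φ x :=
      sum_congr rfl fun i hi =>
        congrArg _ (hin i x (hsub i x (χ.finsupport_subset_fintsupport x hi))).2
    refine this.trans ?_
    rw [← sum_mul, hone, one_mul]
  · intro x₀ x hx
    set κ := 𝔠 n x₀ with hκ
    set s := χ.fintsupport x with hs
    have hL : ∀ᶠ r in 𝓝[>] (0 : ℝ), ∀ i ∈ s, ∀ hr : 0 < r, IsLocalMap x₀ i (κ x)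
        (𝔠 n i i) hr (hR i) (fiberMap fun q : M × ℝ => (0, q)) := by
      refine (Filter.eventually_all_finset s).2 fun i hi => ?_
      obtain ⟨R', hR', HR'⟩ := isLocalMap_id (hR i) hx (hsub i x hi).1 (hsub i x hi).2
      filter_upwards [Ioc_mem_nhdsGT hR'] with r hr hr0 using HR' r hr0 hr.2
    have hnear : ∀ᶠ x' in 𝓝 x, ∀ᶠ x'' in 𝓝 x', χ.finsupport x'' ⊆ s :=
      eventually_eventually_nhds.2 (χ.eventually_finsupport_subset x)
    have hnear' : ∀ᶠ x' in 𝓝 x, ∀ i ∈ s, x' ∈ U i :=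
      (Filter.eventually_all_finset s).2 fun i hi => (hUo i).mem_nhds (hsub i x hi)
    obtain ⟨r, hL, hball, hr⟩ := ((hL.and ((eventually_closedBall (x₀ := x₀) hx
      (hnear.and hnear')).and self_mem_nhdsWithin))).exists
    have hr : 0 < r := hr
    set B := slab (κ x) r hr with hB
    have hform' : ∀ i ∈ s, ∃ G' f', HasFormal lam (ppForm (H i)) (ppDensity lam (N i)) x₀ (κ x) hr
        G' f' ∧ ∀ I, G' iU I = if I = iV then 1 else 0 := fun i hi =>
      (hform i).change (hL i hi hr) (hnorm i)
    choose! G f hGf hGN using hform'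
    have hev : ∀ y ∈ B.S, ∀ᶠ z in 𝓝 y, z.2.1 ∈ κ.target ∧ χ.finsupport (param x₀ z).2.1 ⊆ s := by
      intro y hy
      have ht := (hball y.2.1 hy.1).1
      have hc : ContinuousAt (fun z => (param x₀ z).2.1) y :=
        (continuous_fst.comp continuous_snd).continuousAt.comp (contMDiffAt_param ht).continuousAt
      exact (eventually_mem_target ht).and (hc.eventually (hball y.2.1 hy.1).2.1)
    have hinit' : ∀ i ∈ s, ∀ y ∈ B.S, H i (param x₀ y).2 = g.inner (param x₀ y).2.1 ∧
        N i (param x₀ y).2 = φ (param x₀ y).2.1 := by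
      intro i hi y hy
      have := hin i _ ((hball y.2.1 hy.1).2.2 i hi)
      rw [param, hy.2]
      exact this
    have hchi : ∀ i, B.SmoothNear fun y => χ i (param x₀ y).2.1 := by
      intro i y hy
      filter_upwards [hev y hy] with z hz
      have h1 : ContMDiffAt 𝓘(ℝ, Coord n) 𝓘(ℝ, ℝ) ∞ (fun y => χ i (param x₀ y).2.1) z := by
        have h2 := contMDiffAt_param (x₀ := x₀) hz.1
        have h3 : ContMDiffAt 𝓘(ℝ, Coord n) (𝓡 n) ∞ (fun y => (param x₀ y).2.1) z := h2.snd.fst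
        exact ContMDiffAt.comp z (χ i).contMDiff.contMDiffAt h3
      exact contMDiffAt_iff_contDiffAt.1 h1
    have hchi1 : ∑ i ∈ s, B.jet ⟨_, hchi i⟩ = 1 := by
      refine (HasJet.sum fun i _ => (hchi i).hasJet).unique ((HasJet.one B).congr fun y hy => ?_)
      filter_upwards [hev y hy] with z hz
      exact (χ.sum_finsupport' _ (Set.mem_univ _) hz.2).symm
    have hx1 : x ∈ (Set.univ : Set M) := trivial
    obtain ⟨j, hj⟩ : ∃ j, j ∈ s := by
      obtain ⟨j, hj⟩ := χ.exists_pos_of_mem hx1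
      exact ⟨j, χ.finsupport_subset_fintsupport x ((χ.mem_finsupport x).2 hj.ne')⟩
    have huniq : ∀ i ∈ s, G i = G j ∧ f i = f j := by
      intro i hi
      refine IsFormalAmbient.unique (hGf i hi).ambient (hGf j hj).ambient (hGN i hi) (hGN j hj)
        (fun a b => ?_) ?_
      · refine (((hGf j hj).metric _ _).sub ((hGf i hi).metric _ _)).mem_ideal_iff.2 fun y hy => ?_
        rw [components_ppForm _ (hball _ hy.1).1, components_ppForm _ (hball _ hy.1).1, ppMat_x_x,
          ppMat_x_x]
        simp only [hmat, of_apply]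
        rw [(hinit' i hi y hy).1, (hinit' j hj y hy).1, sub_self]
      · refine ((hGf j hj).density.sub (hGf i hi).density).mem_ideal_iff.2 fun y hy => ?_
        simp only [ppDensity]
        rw [(hinit' i hi y hy).2, (hinit' j hj y hy).2, sub_self]
    refine ⟨r, hr, G j, f j, ⟨fun ξ hξ => (hball ξ hξ).1, fun I J => ?_, ?_, (hGf j hj).ambient⟩⟩
    · have e : B.HasJet _ (∑ i ∈ s, B.jet ⟨_, hchi i⟩ * G j I J) :=
        HasJet.sum fun i hi => (hchi i).hasJet.mul (by
          have := (hGf i hi).metric I J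
          rwa [(huniq i hi).1] at this)
      rw [← sum_mul, hchi1, one_mul] at e
      refine e.congr fun y hy => ?_
      filter_upwards [hev y hy] with z hz
      refine Eq.symm (components_ppForm_sum (s := s) (c := fun i => χ i (param x₀ z).2.1) (H := H)
        (χ.sum_finsupport' _ (Set.mem_univ _) hz.2) ?_ I J)
      exact Finset.sum_subset hz.2 fun i hi hi' => by
        have : χ i (param x₀ z).2.1 = 0 := hzero hz.2 i hi hi'
        refine ContinuousLinearMap.ext fun a => ContinuousLinearMap.ext fun b => ?_
        rw [_root_.smul_apply, _root_.smul_apply, this]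
        exact zero_mul _
    · have e : B.HasJet _ (∑ i ∈ s, B.jet ⟨_, hchi i⟩ * f j) :=
        HasJet.sum fun i hi => (hchi i).hasJet.mul (by
          have := (hGf i hi).density
          rwa [(huniq i hi).2] at this)
      rw [← sum_mul, hchi1, one_mul] at e
      refine e.congr fun y hy => ?_
      filter_upwards [hev y hy] with z hz
      simp only [ppDensity, mul_add, sum_add_distrib, ← sum_mul]
      rw [χ.sum_finsupport' _ (Set.mem_univ _) hz.2, one_mul, add_left_inj]
      refine (Finset.sum_subset hz.2 fun i hi hi' => ?_).symm
      have : χ i (param x₀ z).2.1 = 0 := hzero hz.2 i hi hi'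
      rw [this, zero_mul]

end

section

open FormalRing Slab

variable {n : ℕ}

lemma exists_orthonormal {β : 𝔼 n →L[ℝ] 𝔼 n →L[ℝ] ℝ} (hs : ∀ a b, β a b = β b a)
    (hp : ∀ a, a ≠ 0 → 0 < β a a) :
    ∃ e : Fin n → 𝔼 n, ∀ i j, β (e i) (e j) = if i = j then 1 else 0 := by
  let B : LinearMap.BilinForm ℝ (𝔼 n) :=
    LinearMap.mk₂ ℝ (fun a b => β a b) (by simp) (by simp) (by simp) (by simp)
  obtain ⟨v, hv⟩ := LinearMap.BilinForm.exists_orthogonal_basis (B := B) ⟨fun a b => hs a b⟩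
  have hv' : ∀ i j, i ≠ j → β (v i) (v j) = 0 := fun i j hij => hv hij
  have hn : Module.finrank ℝ (𝔼 n) = n := by simp
  refine ⟨fun i => (√(β (v (Fin.cast hn.symm i)) (v (Fin.cast hn.symm i))))⁻¹ •
    v (Fin.cast hn.symm i), fun i j => ?_⟩
  simp only [map_smul, _root_.smul_apply, smul_eq_mul]
  split_ifs with hij
  · subst hij
    have h0 := hp _ (v.ne_zero (Fin.cast hn.symm i))
    have h1 := Real.mul_self_sqrt h0.le
    have h2 := (Real.sqrt_pos.2 h0).ne'
    set c := √(β (v (Fin.cast hn.symm i)) (v (Fin.cast hn.symm i)))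
    rw [← h1]
    field_simp
  · have : Fin.cast hn.symm i ≠ Fin.cast hn.symm j := fun h => hij (Fin.cast_injective _ h)
    rw [hv' _ _ this, mul_zero, mul_zero]

variable {M : Type*} [TopologicalSpace M] [ChartedSpace (𝔼 n) M]

variable [IsManifold (𝓡 n) ∞ M]

lemma isLorentzianAt_ppForm {h : M × ℝ → 𝔼 n →L[ℝ] 𝔼 n →L[ℝ] ℝ} {p : 𝒳 M}
    (hs : ∀ a b, h p.2 a b = h p.2 b a) (hp : ∀ a, a ≠ 0 → 0 < h p.2 a a) :
    IsLorentzianAt p (ppForm h p) := by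
  obtain ⟨e, he⟩ := exists_orthonormal hs hp
  let w : Fin (n + 2) → Coord n :=
    Fin.cons (1, 0, -1 / 2) (Fin.cons (1, 0, 1 / 2) fun i => (0, e i, 0))
  have hw : ∀ i j, formAt (ppForm h) p (w i) (w j) = if i = j then (if i = 0 then -1 else 1) else 0 := by
    intro i j
    rw [ppForm_apply]
    refine Fin.cases ?_ (fun i => ?_) i <;> refine Fin.cases ?_ (fun j => ?_) j
    · norm_num [w]
    · refine Fin.cases ?_ (fun j => ?_) j
      · norm_num [w]
      · simp [w, Fin.ext_iff]
    · refine Fin.cases ?_ (fun i => ?_) i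
      · norm_num [w]
      · simp [w, Fin.ext_iff]
    · refine Fin.cases ?_ (fun i => ?_) i <;> refine Fin.cases ?_ (fun j => ?_) j
      · norm_num [w]
      · simp [w, Fin.ext_iff]
      · simp [w, Fin.ext_iff]
      · simp [w, he, Fin.ext_iff]
  have hli : LinearIndependent ℝ w := by
    rw [Fintype.linearIndependent_iff]
    intro c hc i
    have h1 : formAt (ppForm h) p (∑ j, c j • w j) (w i) = 0 := by rw [hc]; simp
    simp only [map_sum, map_smul, _root_.sum_apply, _root_.smul_apply, hw, smul_eq_mul, mul_ite,
      mul_zero, sum_ite_eq', mem_univ, if_true] at h1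
    split_ifs at h1 <;> simpa using h1
  have hcard : Fintype.card (Fin (n + 2)) = Module.finrank ℝ (Coord n) := by
    simp [Module.finrank_prod]; ring
  refine ⟨basisOfLinearIndependentOfCardEqFinrank (ι := Fin (n + 2)) hli hcard, fun i j => ?_⟩
  have hb := coe_basisOfLinearIndependentOfCardEqFinrank hli hcard
  rw [← hw i j]
  exact formAt_congr (k := ppForm h) (q := p) rfl (congrFun hb i) (congrFun hb j)

/-- Smoothness of a metric at a point. -/
def SmoothFormAt (k : 𝒯 n M) (p : 𝒳 M) : Prop :=
  ContMDiffAt (model n) ((model n).prod 𝓘(ℝ, Coord n →L[ℝ] Coord n →L[ℝ] ℝ)) ∞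
      (fun p => Bundle.TotalSpace.mk' (Coord n →L[ℝ] Coord n →L[ℝ] ℝ)
        (E := fun p : 𝒳 M =>
          TangentSpace (model n) p →L[ℝ] TangentSpace (model n) p →L[ℝ] ℝ) p (k p)) p

variable {h : M × ℝ → 𝔼 n →L[ℝ] 𝔼 n →L[ℝ] ℝ} {η : M × ℝ → ℝ} {lam : ℝ}

lemma contDiffAt_translate {F : Coord n → ℝ} {y : Coord n} (hF : ContDiffAt ℝ ∞ F (0, y.2)) :
    ContDiffAt ℝ ∞ (fun z : Coord n => F (0, z.2)) y :=
  ContDiffAt.comp y (g := F) (f := fun z : Coord n => ((0 : ℝ), z.2)) hF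
    (contDiffAt_const.prodMk contDiffAt_snd)

lemma smoothFormAt_ppForm {p : 𝒳 M} (hp : SmoothFormAt (ppForm h) (0, p.2)) :
    SmoothFormAt (ppForm h) p := by
  have hs := _root_.mem_chart_source (𝔼 n) p.2.1
  refine (contMDiffAt_metric_iff _ (x₀ := p.2.1) hs).2 fun I J => ?_
  have h1 := (contMDiffAt_metric_iff _ (x₀ := p.2.1) (p := (0, p.2)) hs).1 hp I J
  have h2 : ContDiffAt ℝ ∞ (fun z : Coord n => components p.2.1 (fun p a b => ppForm h p a b)
    (0, z.2) I J) (coords n p.2.1 p) := contDiffAt_translate (y := coords n p.2.1 p) h1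
  refine h2.congr_of_eventuallyEq ?_
  filter_upwards [eventually_mem_target (coords_mem_target hs)] with z hz
  rw [components_ppForm h hz, components_ppForm h (y := (0, z.2)) hz]
  rfl

lemma contMDiffAt_ppDensity {p : 𝒳 M}
    (hp : ContMDiffAt (model n) 𝓘(ℝ, ℝ) ∞ (ppDensity lam η) (0, p.2)) :
    ContMDiffAt (model n) 𝓘(ℝ, ℝ) ∞ (ppDensity lam η) p := by
  have hs := _root_.mem_chart_source (𝔼 n) p.2.1
  rw [← contDiffAt_comp_param_iff hs]
  have h1 := (contDiffAt_comp_param_iff (x₀ := p.2.1) (p := (0, p.2)) hs).2 hp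
  have h2 : ContDiffAt ℝ ∞ (fun z : Coord n => ppDensity lam η (param p.2.1 ((0 : ℝ), z.2)))
    (coords n p.2.1 p) := contDiffAt_translate (y := coords n p.2.1 p)
      (F := fun z => ppDensity lam η (param p.2.1 z)) h1
  have h3 : ContDiffAt ℝ ∞ (fun z : Coord n => z.1 * (lam * z.2.2 - 1)) (coords n p.2.1 p) := by
    fun_prop
  refine (h2.add h3).congr_of_eventuallyEq (.of_forall fun z => ?_)
  simp [ppDensity, param]

/-- The points near which the data are regular. -/
def regularSet (h : M × ℝ → 𝔼 n →L[ℝ] 𝔼 n →L[ℝ] ℝ) (η : M × ℝ → ℝ) (lam : ℝ) : Set (M × ℝ) :=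
  {q | ∀ᶠ q' in 𝓝 q, SmoothFormAt (ppForm h) (0, q') ∧
    ContMDiffAt (model n) 𝓘(ℝ, ℝ) ∞ (ppDensity lam η) (0, q') ∧
    (∀ a, a ≠ 0 → 0 < h q' a a) ∧ lam * q'.2 ≠ 1}

lemma isOpen_regularSet : IsOpen (regularSet h η lam) :=
  isOpen_iff_mem_nhds.2 fun _ hq => eventually_eventually_nhds.2 hq

lemma eventually_pos {x₀ : M} {y : Coord n} (hy : y.2.1 ∈ (𝔠 n x₀).target)
    (hc : ∀ i j, ContinuousAt (fun z => hmat x₀ h z i j) y)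
    (hp : ∀ a, a ≠ 0 → 0 < h (param x₀ y).2 a a) :
    ∀ᶠ z in 𝓝 y, ∀ a, a ≠ 0 → 0 < h (param x₀ z).2 a a := by
  set Q : Coord n → 𝔼 n → ℝ := fun z a => ∑ i, ∑ j, a i * a j * hmat x₀ h z i j
    with hQ
  have key : ∀ z a, h (param x₀ z).2 (dchart x₀ z.2.1 a) (dchart x₀ z.2.1 a) = Q z a := by
    intro z a
    conv_lhs => rw [← sum_single a]
    simp only [map_sum, map_smul, _root_.sum_apply, _root_.smul_apply, smul_eq_mul, hQ, hmat,
      of_apply]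
    rw [sum_comm]
    refine sum_ext fun i => ?_
    rw [mul_sum]
    refine sum_ext fun j => by ring
  have h1 : ∀ᶠ z in 𝓝 y, ∀ a ∈ Metric.sphere (0 : 𝔼 n) 1, 0 < Q z a := by
    refine (isCompact_sphere _ _).eventually_forall_of_forall_eventually fun a ha => ?_
    have hcont : ContinuousAt (fun z : Coord n × 𝔼 n => Q z.1 z.2) (y, a) := by
      refine tendsto_finsetSum _ fun i _ => tendsto_finsetSum _ fun j _ => ?_
      refine ContinuousAt.mul (ContinuousAt.mul ?_ ?_) ?_
      · fun_prop
      · fun_prop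
      · exact ContinuousAt.comp (g := fun z => hmat x₀ h z i j) (hc i j) continuousAt_fst
    refine hcont.eventually (lt_mem_nhds ?_)
    have ha0 : a ≠ 0 := by rintro rfl; simp at ha
    change 0 < Q y a
    rw [← key]
    exact hp _ fun h0 => ha0 (injective_dchart hy (h0.trans (map_zero _).symm))
  filter_upwards [h1, eventually_mem_target hy] with z hz hzt a ha
  obtain ⟨a, rfl⟩ := dchart_surjective hzt a
  have ha0 : a ≠ 0 := by rintro rfl; simp at ha
  have h2 := hz (‖a‖⁻¹ • a) (by simp [norm_smul, ha0])
  have h3 : 0 < ‖a‖ := norm_pos_iff.2 ha0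
  rw [← key, map_smul, map_smul, map_smul, _root_.smul_apply, smul_eq_mul, smul_eq_mul] at h2
  have h4 : 0 < ‖a‖⁻¹ := inv_pos.2 h3
  exact (pos_iff_pos_of_mul_pos ((pos_iff_pos_of_mul_pos h2).1 h4)).1 h4

lemma mem_regularSet {g : RiemannianMetric n M} {x : M} (h0 : h (x, 0) = g.inner x) {r : ℝ}
    {hr : 0 < r} {G f} (hF : HasFormal lam (ppForm h) (ppDensity lam η) x (𝔠 n x x) hr G f) :
    (x, 0) ∈ regularSet h η lam := by
  set κ := 𝔠 n x with hκ
  have hx : x ∈ κ.source := _root_.mem_chart_source (𝔼 n) x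
  set y : Coord n := (0, κ x, 0) with hy
  have hyS : y ∈ (slab (κ x) r hr).S := ⟨mem_closedBall_self hr.le, rfl⟩
  have hyt : y.2.1 ∈ κ.target := κ.map_source hx
  have hpy : (param x y).2 = (x, 0) := by simp only [param, hy, hκ.symm, κ.left_inv hx]
  have hc : ContinuousAt (fun q : M × ℝ => coords n x (0, q)) (x, 0) := by
    have h1 : ContinuousAt (coords n x) ((0, x, 0) : 𝒳 M) :=
      (contMDiffAt_coords (x₀ := x) (p := ((0, x, 0) : 𝒳 M)) hx).continuousAt
    exact ContinuousAt.comp (g := coords n x) (f := fun q : M × ℝ => ((0 : ℝ), q)) h1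
      (by fun_prop)
  have hsrc : ∀ᶠ q : M × ℝ in 𝓝 (x, 0), q.1 ∈ κ.source :=
    continuous_fst.continuousAt.eventually (κ.open_source.mem_nhds hx)
  have hpos : ∀ᶠ z in 𝓝 y, ∀ a, a ≠ 0 → 0 < h (param x z).2 a a := by
    refine eventually_pos hyt (fun i j => ?_) ?_
    · have h1 := (hF.metric (idxX i) (idxX j)).smooth y hyS |>.self_of_nhds.continuousAt
      refine h1.congr ?_
      filter_upwards [eventually_mem_target hyt] with z hz
      rw [components_ppForm h hz, ppMat_x_x]
    · rw [hpy, h0]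
      exact fun a ha => g.pos x a ha
  have hs1 : ∀ᶠ z in 𝓝 y, ∀ I J, ContDiffAt ℝ ∞ (fun y => components x
      (fun p a b => ppForm h p a b) y I J) z :=
    Filter.eventually_all.2 fun I => Filter.eventually_all.2 fun J => (hF.metric I J).smooth y hyS
  have hs2 := hF.density.smooth y hyS
  have hlam : ∀ᶠ q : M × ℝ in 𝓝 (x, 0), lam * q.2 ≠ 1 := by
    have : ContinuousAt (fun q : M × ℝ => lam * q.2) (x, 0) := by fun_prop
    exact this.eventually_ne (by simp)
  filter_upwards [hc.eventually hs1, hc.eventually hs2, hc.eventually hpos, hsrc, hlam]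
    with q h1 h2 h3 h4 h5
  have e : param x (coords n x (0, q)) = (0, q) := param_coords (p := (0, q)) h4
  rw [e] at h3
  exact ⟨(contMDiffAt_metric_iff _ (x₀ := x) (p := (0, q)) h4).2 h1,
    (contDiffAt_comp_param_iff (x₀ := x) (p := (0, q)) h4).1 h2, h3, h5⟩

/-- The weighted ambient space given by a global solution. -/
def ppAmbient (h : M × ℝ → 𝔼 n →L[ℝ] 𝔼 n →L[ℝ] ℝ) (η : M × ℝ → ℝ) (lam : ℝ) : AmbientData n M where
  carrier := {p | ∀ t ∈ Set.Icc (0 : ℝ) 1, (p.2.1, t * p.2.2) ∈ regularSet h η lam}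
  metric := ppForm h
  density := ppDensity lam η

lemma mem_regularSet_of_mem_carrier {p : 𝒳 M} (hp : p ∈ (ppAmbient h η lam).carrier) :
    p.2 ∈ regularSet h η lam := by
  have := hp 1 ⟨zero_le_one, le_rfl⟩
  rwa [one_mul] at this

lemma ppAmbient_gamma {x₀ : M} {y : Coord n} (hy : y.2.1 ∈ (𝔠 n x₀).target) (K I : Idx n)
    (hI : ∀ g₁ g₂ : Matrix (Fin n) (Fin n) ℝ, ∀ J, ppMat g₁ I J = ppMat g₂ I J) :
    (ppAmbient h η lam).gamma x₀ K I I y = 0 := by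
  have e : ∀ J, (fun z => (ppAmbient h η lam).matrix x₀ z I J) =ᶠ[𝓝 y]
      fun _ => ppMat (0 : Matrix (Fin n) (Fin n) ℝ) I J := by
    intro J
    filter_upwards [eventually_mem_target hy] with z hz
    exact (components_ppForm h hz I J).trans (hI _ _ J)
  have e2 : ∀ J L, pd (coordVec n) L (fun z => (ppAmbient h η lam).matrix x₀ z I J) y = 0 := by
    intro J L
    rw [pd, (e J).fderiv_eq]; simp
  simp [AmbientData.gamma, christoffel, e2]

lemma isWeightedAmbient_ppAmbient {g : RiemannianMetric n M} {φ : C^∞⟮𝓡 n, M; ℝ⟯}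
    (hs : ∀ q a b, h q a b = h q b a) (h0 : ∀ x, h (x, 0) = g.inner x) (hη : ∀ x, η (x, 0) = φ x)
    (hF : ∀ x₀, ∀ x ∈ (𝔠 n x₀).source, ∃ r, ∃ hr : 0 < r, ∃ G f, HasFormal lam (ppForm h) (ppDensity
    lam η) x₀ (𝔠 n x₀ x) hr G f) :
    IsWeightedAmbient g φ lam (ppAmbient h η lam) ∧ IsNormal g (ppAmbient h η lam) := by
  have hreg : ∀ x, (x, (0 : ℝ)) ∈ regularSet h η lam := fun x => by
    obtain ⟨r, hr, G, f, H⟩ := hF x x (_root_.mem_chart_source _ x)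
    exact mem_regularSet (h0 x) H
  have hF' : ∀ x₀, ∀ ξ ∈ (𝔠 n x₀).target, ∃ r, ∃ hr : 0 < r, ∃ G f,
        HasFormal lam (ppForm h) (ppDensity lam η) x₀ ξ hr G f := by
    intro x₀ ξ hξ
    have := hF x₀ _ ((𝔠 n x₀).map_target hξ)
    rwa [(𝔠 n x₀).right_inv hξ] at this
  refine ⟨⟨⟨?_, ?_, ?_, ?_, ?_, ?_, ?_, ?_, ?_, ?_, ?_⟩, ?_, ?_⟩, ⟨?_, ?_, ?_⟩⟩
  · refine isOpen_iff_mem_nhds.2 fun p hp => ?_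
    refine isCompact_Icc.eventually_forall_of_forall_eventually fun t ht => ?_
    have hc : Continuous fun z : (𝒳 M) × ℝ => (z.1.2.1, z.2 * z.1.2.2) := by fun_prop
    exact hc.continuousAt.eventually (isOpen_regularSet.mem_nhds (hp t ht))
  · intro v x t _
    rw [mul_zero]; exact hreg x
  · intro p hp
    exact ⟨(mem_regularSet_of_mem_carrier hp).self_of_nhds.2.2.2, fun s => hp⟩
  · exact fun p hp => (smoothFormAt_ppForm
      (mem_regularSet_of_mem_carrier hp).self_of_nhds.1).contMDiffWithinAt
  · exact fun p hp => isLorentzianAt_ppForm (hs _)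
      (mem_regularSet_of_mem_carrier hp).self_of_nhds.2.2.1
  · exact fun p hp => (contMDiffAt_ppDensity
      (mem_regularSet_of_mem_carrier hp).self_of_nhds.2.1).contMDiffWithinAt
  · intro s p _ a b
    exact (formAt_congr (k := ppForm h) rfl (mfderiv_translation s p a)
      (mfderiv_translation s p b)).trans rfl
  · intro s p hp
    have hne := sub_ne_zero.2 (mem_regularSet_of_mem_carrier hp).self_of_nhds.2.2.2
    change η p.2 + (p.1 + (lam * p.2.2 - 1)⁻¹ * s) * (lam * p.2.2 - 1) =
      η p.2 + p.1 * (lam * p.2.2 - 1) + s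
    rw [add_mul, mul_comm (lam * p.2.2 - 1)⁻¹ s, mul_assoc s, inv_mul_cancel₀ hne]
    ring
  · intro z a b
    refine (formAt_congr (k := ppForm h) rfl (mfderiv_inclusion z a)
      (mfderiv_inclusion z b)).trans ?_
    refine Eq.trans ?_ (congrArg₂ (fun s t : 𝔼 n => g.inner z.2 s t)
      (mfderiv_snd_form z a) (mfderiv_snd_form z b)).symm
    rw [ppForm_apply]
    simp only [zero_mul, mul_zero, add_zero]
    rw [h0]; rfl
  · intro v x
    change η (x, 0) + v * (lam * 0 - 1) = φ x - v
    rw [hη]; ring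
  · intro x₀ v ξ hξ K
    exact ppAmbient_gamma hξ K _ fun g₁ g₂ J => by rcases J with ⟨⟩ | j | ⟨⟩ <;> rfl
  · intro x₀ v ξ hξ I J
    obtain ⟨r, hr, G, f, H⟩ := hF' x₀ ξ hξ
    have e := H.metric.weightedP H.ambient.unit H.density lam I J
    rw [H.ambient.P_eq] at e
    have := slab_oInfty e (HasJet.zero _) v (mem_closedBall_self hr.le)
    simp only [sub_zero] at this
    exact this
  · intro x₀ v ξ hξ
    obtain ⟨r, hr, G, f, H⟩ := hF' x₀ ξ hξ
    have e := H.metric.weightedF H.ambient.unit H.density lam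
    rw [H.ambient.F_eq] at e
    have := slab_oInfty e (HasJet.zero _) v (mem_closedBall_self hr.le)
    simp only [sub_zero] at this
    exact this
  · intro v x
    refine ⟨fun u₁ h₁ u₂ h₂ u hu t ht => ?_⟩
    have key : ∀ u', (v, x, u') ∈ (ppAmbient h η lam).carrier → ∀ s ∈ Set.Icc (0 : ℝ) 1, u = s * u' →
        (x, t * u) ∈ regularSet h η lam := by
      intro u' h' s hs e
      have := h' (t * s) ⟨mul_nonneg ht.1 hs.1, mul_le_one₀ ht.2 hs.1 hs.2⟩
      rw [e, ← mul_assoc]; exact this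
    rcases lt_trichotomy u 0 with h0 | rfl | h0
    · refine key u₁ h₁ (u / u₁) ⟨div_nonneg_of_nonpos h0.le (hu.1.trans h0.le), ?_⟩ ?_
      · rw [div_le_one_of_neg (hu.1.trans_lt h0)]; exact hu.1
      · rw [div_mul_cancel₀ _ (hu.1.trans_lt h0).ne]
    · rw [mul_zero]; exact hreg x
    · refine key u₂ h₂ (u / u₂) ⟨div_nonneg h0.le (h0.le.trans hu.2), ?_⟩ ?_
      · rw [div_le_one (h0.trans_le hu.2)]; exact hu.2
      · rw [div_mul_cancel₀ _ (h0.trans_le hu.2).ne']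
  · intro x₀ y hy _ K
    exact ppAmbient_gamma hy K _ fun g₁ g₂ J => by rcases J with ⟨⟩ | j | ⟨⟩ <;> rfl
  · intro v x a b
    refine (ppForm_apply h (v, x, 0) a b).trans ?_
    refine congrArg₂ (· + ·) ?_ (congrArg₂ (· + ·) (congrArg₂ (· * ·) ?_ ?_)
      (congrArg₂ (· * ·) ?_ ?_))
    · refine Eq.trans ?_ (congrArg₂ (fun s t : 𝔼 n => g.inner x s t)
        (mfderiv_mid (v, x, 0) a) (mfderiv_mid (v, x, 0) b)).symm
      change h (x, 0) _ _ = _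
      rw [h0]; rfl
    · exact (differential_last _ a).symm
    · exact (differential_fst _ b).symm
    · exact (differential_fst _ a).symm
    · exact (differential_last _ b).symm

/-- Existence of a weighted ambient space in normal form. -/
lemma exists_normal [T2Space M] [SecondCountableTopology M] (g : RiemannianMetric n M)
    (φ : C^∞⟮𝓡 n, M; ℝ⟯) (lam : ℝ) :
    ∃ A : AmbientData n M, IsWeightedAmbient g φ lam A ∧ IsNormal g A := by
  obtain ⟨h, η, h1, h2, h3, h4⟩ := exists_global_solution g φ lam
  exact ⟨_, isWeightedAmbient_ppAmbient h1 h2 h3 h4⟩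

end

section

open FormalRing Slab

/-! ### The geodesic equation of a formal map -/

section FormalGeodesic

variable {n : ℕ} {A₀ A₁ : Type*} [CommRing A₀] [Algebra ℝ A₀] [CommRing A₁] [Algebra ℝ A₁]

lemma mul_mul_sub_mem (I : Ideal A₀) {a a' b b' c c' : A₀} (ha : a - a' ∈ I) (hb : b - b' ∈ I)
    (hc : c - c' ∈ I) : a * b * c - a' * b' * c' ∈ I := by
  have e : a * b * c - a' * b' * c' = (a - a') * (b * c) + (b - b') * (a' * c) +
    (c - c') * (a' * b') := by ring
  rw [e]
  exact I.add_mem (I.add_mem (I.mul_mem_right _ ha) (I.mul_mem_right _ hb)) (I.mul_mem_right _ hc)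

/-- The Christoffel term `Γ^L_{ab} pᵃ pᵇ` of the geodesic equation. -/
def geoTerm (Φ₁ : FormalRing A₁ (Idx n) iU) (G : Matrix (Idx n) (Idx n) A₁) (τ : A₁ → A₀)
    (p : Idx n → A₀) (L : Idx n) : A₀ := ∑ a, ∑ b, p a * p b * τ (aChr Φ₁.D G L a b)

variable {Φ₀ : FormalRing A₀ (Idx n) iU} {Φ₁ : FormalRing A₁ (Idx n) iU} {lam : ℝ} {σ : A₁ →ₐ[ℝ] A₀}
  {y : Idx n → A₀} {G : Matrix (Idx n) (Idx n) A₁}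

lemma geoTerm_sub_mem (I : Ideal A₀) {τ τ' : A₁ → A₀} {p p' : Idx n → A₀} (hp : ∀ a, p a - p' a ∈ I)
    (hτ : ∀ a, τ a - τ' a ∈ I) (L : Idx n) : geoTerm Φ₁ G τ p L - geoTerm Φ₁ G τ' p' L ∈ I := by
  simp only [geoTerm, ← sum_sub_distrib]
  exact I.sum_mem fun a _ => I.sum_mem fun b _ => mul_mul_sub_mem I (hp a) (hp b) (hτ _)

/-- The `u`-lines are geodesics of the pullback if and only if their images are geodesics. -/
lemma IsFormalMap.geodesic_iff (h : IsFormalMap Φ₀ Φ₁ lam σ y) (hG : G.IsSymm) (hu : IsUnit G.det) :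
    (∀ K, aChr Φ₀.D (pullMat σ (jacobian Φ₀ y) G) K iU iU = 0) ↔ ∀ L, Φ₀.D iU (Φ₀.D iU (y L)) +
    geoTerm Φ₁ G σ (fun a => Φ₀.D iU (y a)) L = 0 := by
  set Q := jacobian Φ₀ y with hQ
  set R : Matrix (Idx n) (Idx n) A₀ := dMat (Φ₀.D iU) Q + pullConn σ Q (conn Φ₁.D G) iU * Q with hR
  have e : ∀ L, R L iU = Φ₀.D iU (Φ₀.D iU (y L)) + geoTerm Φ₁ G σ (fun a => Φ₀.D iU (y a)) L := by
    intro L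
    simp only [hR, add_app, dMat_apply, mul_app, pullConn_apply, hQ,
      jacobian_apply, geoTerm, conn, of_apply, sum_mul]
    congr 1
    exact sum_swap fun a b => by ring
  have e1 : ∀ K, aChr Φ₀.D (pullMat σ Q G) K iU iU = (Q⁻¹ * R) K iU := fun K =>
    aChr_pullMat h.chain' IsFormalMap.jacobian_symm hG hu h.unit K iU iU
  have e2 : Q * (Q⁻¹ * R) = R := Matrix.mul_nonsing_inv_cancel_left _ _ h.unit
  constructor
  · intro h1 L
    rw [← e, ← e2, mul_app]
    exact sum_eq_zero fun K _ => by rw [← e1, h1, mul_zero]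
  · intro h1 K
    rw [e1, mul_app]
    exact sum_eq_zero fun L _ => by rw [e, h1, mul_zero]

end FormalGeodesic

section LinearAlgebra

variable {n : ℕ}

/-- A null vector transverse to the hyperplane `du = 0`, on which the form degenerates along `∂_v`,
is determined by its products with the hyperplane. -/
lemma eq_of_null {β : Coord n →L[ℝ] Coord n →L[ℝ] ℝ} (hs : ∀ a b, β a b = β b a)
    (hn : ∀ a, (∀ b, β a b = 0) → a = 0) (hv : ∀ h : Coord n, h.2.2 = 0 → β (coordVec n iV) h = 0)
    {p q : Coord n} (hpv : β p (coordVec n iV) = 1) (hp : β p p = 0) (hq : β q q = 0)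
    (hpq : ∀ h : Coord n, h.2.2 = 0 → β p h = β q h) : p = q := by
  set e := coordVec n iV with he
  have hp0 : p.2.2 ≠ 0 := fun h0 => by
    have := hv p h0
    rw [hs, hpv] at this
    exact one_ne_zero this
  have h1 : p - q - β p (p - q) • e = 0 := by
    refine hn _ fun b => ?_
    have hb : b = (b - (b.2.2 / p.2.2) • p) + (b.2.2 / p.2.2) • p := by abel
    have h2 : (b - (b.2.2 / p.2.2) • p).2.2 = 0 := by simp [div_mul_cancel₀ _ hp0]
    have h3 : β e p = 1 := by rw [hs, hpv]
    rw [hb, map_add, map_smul]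
    simp only [map_sub, map_smul, _root_.sub_apply, _root_.smul_apply, smul_eq_mul] at hpq hv ⊢
    have h4 := hpq _ h2
    have h5 := hv _ h2
    simp only [map_sub, map_smul, smul_eq_mul] at h4 h5
    have h6 := hs q p
    linear_combination h4 - (β p p - β p q) * h5 + b.2.2 / p.2.2 * (- h6 - (β p p - β p q) * h3)
  have h2 : q = p - β p (p - q) • e := by rw [sub_eq_zero] at h1; rw [← h1]; abel
  have h3 : β e e = 0 := hv e rfl
  have h4 : β e p = 1 := by rw [hs, hpv]
  have h5 : β p (p - q) = 0 := by
    set t := β p (p - q)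
    have := hq
    rw [h2] at this
    simp only [map_sub, map_smul, _root_.sub_apply, _root_.smul_apply, smul_eq_mul, hp, hpv, h4, h3]
      at this
    linarith
  rw [h2, h5, zero_smul, sub_zero]

lemma fderiv_eq_of_line {W Y : Type*} [NormedAddCommGroup W] [NormedSpace ℝ W]
    [NormedAddCommGroup Y] [NormedSpace ℝ Y] {F F' : W → Y} {z w : W} (hF : DifferentiableAt ℝ F z)
    (hF' : DifferentiableAt ℝ F' z) (h : ∀ᶠ t : ℝ in 𝓝 0, F (z + t • w) = F' (z + t • w)) :
    fderiv ℝ F z w = fderiv ℝ F' z w := by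
  have h1 : HasDerivAt (fun t : ℝ => F (z + t • w)) (fderiv ℝ F z w) 0 :=
    hF.hasFDerivAt.hasLineDerivAt w
  have h2 : HasDerivAt (fun t : ℝ => F' (z + t • w)) (fderiv ℝ F' z w) 0 :=
    hF'.hasFDerivAt.hasLineDerivAt w
  exact (h2.congr_of_eventuallyEq h).unique h1 |>.symm

end LinearAlgebra

/-! ### Maps adapted to the dilations -/

variable {n : ℕ} {M : Type*} [TopologicalSpace M] [ChartedSpace (𝔼 n) M]

variable (n) in
/-- Near `x`, the map `fiberMap Θ` is smooth, commutes with dilations, and is `v ↦ v + w` along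
`u = 0`. -/
structure Adapted (lam : ℝ) (w : M → ℝ) (Θ : M × ℝ → 𝒳 M) (x : M) : Prop where
  smooth : ∀ᶠ q in 𝓝 (x, (0 : ℝ)), ContMDiffAt (𝓡₁ n) (model n) ∞ Θ q
  start : ∀ᶠ x' in 𝓝 x, Θ (x', 0) = (w x', x', 0)
  scale : ∀ᶠ q in 𝓝 (x, (0 : ℝ)), lam * (Θ q).2.2 = lam * q.2

/-- The differential of a map, on the model space. -/
def dmap (ψ : 𝒳 M → 𝒳 M) (p : 𝒳 M) : Coord n →L[ℝ] Coord n := mfderiv (model n) (model n) ψ p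

/-- The pullback as a family of continuous bilinear forms. -/
def pullbackForm (ψ : 𝒳 M → 𝒳 M) (k : 𝒯 n M) : 𝒯 n M := fun p =>
  show Coord n →L[ℝ] Coord n →L[ℝ] ℝ from
    ContinuousLinearMap.bilinearComp (formAt k (ψ p)) (dmap ψ p) (dmap ψ p)

lemma formAt_pullbackForm (ψ : 𝒳 M → 𝒳 M) (k : 𝒯 n M) (p : 𝒳 M) (a b : Coord n) :
    formAt (pullbackForm ψ k) p a b = formAt k (ψ p) (dmap ψ p a) (dmap ψ p b) := rfl

/-- The pullback of `k` is in normal form to infinite order at `x`. -/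
def NormalAt (k : 𝒯 n M) (Θ : M × ℝ → 𝒳 M) (x : M) : Prop :=
  ∀ (v : ℝ) (a : Coord n), OInfty fun u =>
    formAt (pullbackForm (fiberMap Θ) k) (v, x, u) (0, 0, 1) a - a.1

variable {lam : ℝ} {w : M → ℝ} {Θ Θ' : M × ℝ → 𝒳 M} {x : M} {k : 𝒯 n M}

lemma tendsto_line (x : M) : Tendsto (fun x' : M => (x', (0 : ℝ))) (𝓝 x) (𝓝 (x, 0)) :=
  (Continuous.prodMk_left (0 : ℝ)).tendsto x

lemma Adapted.congr (h : Adapted n lam w Θ x) (e : Θ' =ᶠ[𝓝 (x, 0)] Θ) : Adapted n lam w Θ' x where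
  smooth := by
    filter_upwards [h.smooth, e.eventuallyEq_nhds] with q h1 h2 using h1.congr_of_eventuallyEq h2
  start := by
    filter_upwards [h.start, (tendsto_line x).eventually e] with x' h1 h2
    rw [h2, h1]
  scale := by
    filter_upwards [h.scale, e] with q h1 h2
    rw [h2, h1]

lemma NormalAt.congr (h : NormalAt k Θ x) (e : Θ' =ᶠ[𝓝 (x, 0)] Θ) : NormalAt k Θ' x := by
  intro v a N
  refine (h v a N).congr' ?_ (Filter.EventuallyEq.refl _ _)
  have ht : Tendsto (fun u : ℝ => (v, x, u)) (𝓝 0) (𝓝 (v, x, 0)) :=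
    ((continuous_const.prodMk (continuous_const.prodMk continuous_id)).tendsto 0)
  have e1 : fiberMap Θ' =ᶠ[𝓝 (v, x, 0)] fiberMap Θ := by
    filter_upwards [(continuous_snd.tendsto ((v, x, 0) : 𝒳 M)).eventually e] with p hp
    rw [fiberMap, fiberMap, hp]
  filter_upwards [ht.eventually e1.eventuallyEq_nhds] with u hu
  have e2 : dmap (n := n) (fiberMap Θ') (v, x, u) = dmap (fiberMap Θ) (v, x, u) := hu.mfderiv_eq
  simp only [formAt_pullbackForm, e2, hu.eq_of_nhds]

variable [IsManifold (𝓡 n) ∞ M]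

section Local

variable {x₁ : M} {y : Coord n}

lemma contMDiffAt_fiberMap {Θ : M × ℝ → 𝒳 M} {p : 𝒳 M} (h : ContMDiffAt (𝓡₁ n) (model n) ∞ Θ p.2) :
    ContMDiffAt (model n) (model n) ∞ (fiberMap Θ) p := by
  have h1 : ContMDiffAt (model n) (model n) ∞ (fun p : 𝒳 M => Θ p.2) p :=
    ContMDiffAt.comp p h contMDiffAt_snd
  have h2 : ContMDiffAt (model n) 𝓘(ℝ, ℝ) ∞ (fun p : 𝒳 M => p.1 + (Θ p.2).1) p :=
    contMDiffAt_fst.add (contMDiffAt_fst.comp p h1)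
  exact h2.prodMk (contMDiffAt_snd.comp p h1)

/-- `Adapted` at the point of `M` below `y`, in the chart at `x₁`. -/
lemma Adapted.eventually_localExpr (h : Adapted n lam w Θ ((𝔠 n x₁).symm y.2.1))
    (hy : y.2.1 ∈ (𝔠 n x₁).target) : ∀ᶠ z in 𝓝 y, z.2.2 = 0 → localExpr x₁ x₁ (fiberMap Θ) z =
    (z.1 + w ((𝔠 n x₁).symm z.2.1), z.2.1, 0) := by
  have hc : ContinuousAt (fun z : Coord n => (𝔠 n x₁).symm z.2.1) y :=
    ContinuousAt.comp (f := fun z : Coord n => z.2.1)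
      ((𝔠 n x₁).continuousAt_symm hy) (by fun_prop)
  filter_upwards [hc.eventually h.start, eventually_mem_target hy] with z h1 h2 h0
  simp only [localExpr, fiberMap, coords, param, h0, h1, (𝔠 n x₁).right_inv h2]

variable {c : 𝔼 n} {r : ℝ} {hr : 0 < r}

lemma Adapted.isLocalMap (hc : closedBall c r ⊆ (𝔠 n x₁).target)
    (h : ∀ ξ ∈ closedBall c r, Adapted n lam w Θ ((𝔠 n x₁).symm ξ)) :
    IsLocalMap x₁ x₁ c c hr hr (fiberMap Θ) where
  subset := hc
  smooth y hy := by
    have h1 := (h _ hy.1).smooth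
    have e : (param x₁ y).2 = ((𝔠 n x₁).symm y.2.1, 0) := by rw [param, hy.2]
    rw [← e] at h1
    exact ((continuous_snd.tendsto (param x₁ y)).eventually h1).mono fun p hp =>
      contMDiffAt_fiberMap hp
  source y hy := by
    have h1 := (h _ hy.1).start.self_of_nhds
    simp only [fiberMap, param, hy.2, h1]
    exact (𝔠 n x₁).map_target (hc hy.1)
  maps y hy := by
    rw [((h _ hy.1).eventually_localExpr (hc hy.1)).self_of_nhds hy.2]
    exact ⟨hy.1, rfl⟩

lemma Adapted.scale_param (h : ∀ ξ ∈ closedBall c r, Adapted n lam w Θ ((𝔠 n x₁).symm ξ)) :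
    ∀ y ∈ (slab c r hr).S, ∀ᶠ p in 𝓝 (param x₁ y), lam * (Θ p.2).2.2 = lam * p.2.2 := by
  intro y hy
  have h1 := (h _ hy.1).scale
  have e : (param x₁ y).2 = ((𝔠 n x₁).symm y.2.1, 0) := by rw [param, hy.2]
  rw [← e] at h1
  exact (continuous_snd.tendsto (param x₁ y)).eventually h1

lemma fderiv_localExpr_v (hd : DifferentiableAt ℝ (localExpr x₁ x₁ (fiberMap Θ)) y) :
    fderiv ℝ (localExpr x₁ x₁ (fiberMap Θ)) y (coordVec n iV) = coordVec n iV := by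
  set F := localExpr (n := n) x₁ x₁ (fiberMap Θ)
  have h1 : HasFDerivAt (fun z => F y + (z - y)) (ContinuousLinearMap.id ℝ (Coord n)) y :=
    ((hasFDerivAt_id y).sub_const y).const_add (F y)
  refine (fderiv_eq_of_line hd h1.differentiableAt (.of_forall fun t => ?_)).trans
    (by rw [h1.fderiv]; rfl)
  rw [show F (y + t • _) = _ from localExpr_fiberMap_add x₁ x₁ Θ y t, add_sub_cancel_left]

lemma tendsto_ray (y a : Coord n) : Tendsto (fun t : ℝ => y + t • a) (𝓝 0) (𝓝 y) := by
  have : Continuous fun t : ℝ => y + t • a := by fun_prop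
  simpa using this.tendsto 0

lemma Adapted.fderiv_snd (h : Adapted n lam w Θ ((𝔠 n x₁).symm y.2.1))
    (hy : y.2.1 ∈ (𝔠 n x₁).target) (hy0 : y.2.2 = 0)
    (hd : DifferentiableAt ℝ (localExpr x₁ x₁ (fiberMap Θ)) y) {a : Coord n} (ha : a.2.2 = 0) :
    (fderiv ℝ (localExpr x₁ x₁ (fiberMap Θ)) y a).2 = a.2 := by
  set F := localExpr (n := n) x₁ x₁ (fiberMap Θ)
  have h1 : HasFDerivAt (fun z => (F z).2) ((sndL ℝ _ _).comp (fderiv ℝ F y)) y :=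
    (sndL ℝ ℝ (𝔼 n × ℝ)).hasFDerivAt.comp y hd.hasFDerivAt
  have h2 := fderiv_eq_of_line (w := a) h1.differentiableAt
    (differentiableAt_snd (𝕜 := ℝ) (p := y)) (by
      filter_upwards [(tendsto_ray y a).eventually (h.eventually_localExpr hy)] with t ht
      have h0 : (y + t • a).2.2 = 0 := by simp [hy0, ha]
      rw [show F (y + t • a) = _ from ht h0]
      exact Prod.ext rfl h0.symm)
  rw [h1.fderiv, _root_.fderiv_snd] at h2
  exact h2

lemma Adapted.fderiv_eq (h : Adapted n lam w Θ ((𝔠 n x₁).symm y.2.1))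
    (h' : Adapted n lam w Θ' ((𝔠 n x₁).symm y.2.1)) (hy : y.2.1 ∈ (𝔠 n x₁).target) (hy0 : y.2.2 = 0)
    (hd : DifferentiableAt ℝ (localExpr x₁ x₁ (fiberMap Θ)) y)
    (hd' : DifferentiableAt ℝ (localExpr x₁ x₁ (fiberMap Θ')) y) {a : Coord n} (ha : a.2.2 = 0) :
    fderiv ℝ (localExpr x₁ x₁ (fiberMap Θ)) y a = fderiv ℝ (localExpr x₁ x₁ (fiberMap Θ')) y a := by
  refine fderiv_eq_of_line hd hd' ?_
  filter_upwards [(tendsto_ray y a).eventually (h.eventually_localExpr hy),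
    (tendsto_ray y a).eventually (h'.eventually_localExpr hy)] with t ht ht'
  have h0 : (y + t • a).2.2 = 0 := by simp [hy0, ha]
  rw [ht h0, ht' h0]

variable {d : 𝒳 M → ℝ} {G : Matrix (Idx n) (Idx n) (slab c r hr).Jet} {f : (slab c r hr).Jet}

/-- The form of a formal weighted ambient metric along `u = 0`. -/
lemma HasFormal.form (h : HasFormal lam k d x₁ c hr G f) {z : Coord n} (hz : z ∈ (slab c r hr).S) :
    (∀ a b, pullForm k x₁ z a b = pullForm k x₁ z b a) ∧
    (∀ a, (∀ b, pullForm k x₁ z a b = 0) → a = 0) ∧ ∀ a : Coord n, a.2.2 = 0 → pullForm k x₁ z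
    (coordVec n iV) a = 0 := by
  have hm : ∀ I J, pullForm k x₁ z (coordVec n I) (coordVec n J) =
      components x₁ (fun p a b => k p a b) z I J := fun _ _ => rfl
  refine ⟨fun a b => ?_, fun a ha => ?_, fun a ha => ?_⟩
  · rw [bilin_expand, bilin_expand _ b a, sum_comm]
    refine sum_ext₂ fun J I => ?_
    have h1 := ((h.metric I J).sub (h.metric J I)).mem_ideal_iff.1
      (by rw [h.ambient.symm.apply, sub_self]; exact zero_mem _) z hz
    rw [hm, hm]
    linear_combination coordFun n I a * coordFun n J b * h1
  · have h1 := h.metric.det_ne_zero h.ambient.unit z hz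
    have h2 : Matrix.vecMul (fun I => coordFun n I a)
        (components x₁ (fun p a b => k p a b) z) = 0 := by
      funext J
      have := ha (coordVec n J)
      rw [bilin_expand] at this
      simp only [coordFun_coordVec, hm, mul_ite, mul_one, mul_zero, ite_mul, zero_mul,
        sum_ite_eq', mem_univ, if_true] at this
      exact this
    exact eq_zero_of_coordFun (congrFun (Matrix.eq_zero_of_vecMul_eq_zero h1 h2))
  · rw [bilin_expand]
    refine sum_eq_zero fun I _ => sum_eq_zero fun J _ => ?_
    rw [coordFun_coordVec, hm]
    by_cases hI : I = iV
    · subst hI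
      by_cases hJ : J = iU
      · subst hJ; rw [coordFun_u, ha]; ring
      · have : components x₁ (fun p a b => k p a b) z iV J = 0 := by
          refine (h.metric iV J).mem_ideal_iff.1 ?_ z hz
          induction J using idx_cases with
          | hv => exact mem_m_of_mem_V (by omega) h.ambient.v_v_mem
          | hx i => exact h.ambient.v_x_mem i
          | hu => exact absurd rfl hJ
        rw [this, mul_zero]
    · rw [if_neg hI]; ring

/-- The components of the pullback of a form by an adapted map. -/
lemma IsLocalMap.hasJets_pullbackForm (h : IsLocalMap x₁ x₁ c c hr hr (fiberMap Θ))
    (hk : HasFormal lam k d x₁ c hr G f) : (slab c r hr).HasJets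
    (components x₁ fun p a b => pullbackForm (fiberMap Θ) k p a b)
    (pullMat h.jetMap.pull (jacobian (slab c r hr).formal h.coordJets) G) :=
  h.hasJets_pull hk.metric fun _ _ => .of_forall fun _ _ _ => rfl

lemma pullForm_apply (k : 𝒯 n M) (x₁ : M) (y a b : Coord n) :
    pullForm k x₁ y a b = formAt k (param x₁ y) (dparam x₁ y a) (dparam x₁ y b) := rfl

lemma dparam_u (hy : y.2.1 ∈ (𝔠 n x₁).target) : dparam x₁ y (coordVec n iU) = (0, 0, 1) := by
  rw [dparam_apply hy, coordVec_u, map_zero]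

/-- Normal form in terms of jets. -/
lemma IsLocalMap.normalAt_iff (h : IsLocalMap x₁ x₁ c c hr hr (fiberMap Θ))
    (hk : HasFormal lam k d x₁ c hr G f) : (∀ I, pullMat h.jetMap.pull (jacobian (slab c r
    hr).formal h.coordJets) G iU I = if I = iV then 1 else 0) ↔ ∀ ξ ∈ closedBall c r, NormalAt k Θ
    ((𝔠 n x₁).symm ξ) := by
  set x' := fun ξ => (𝔠 n x₁).symm ξ
  have hJ := h.hasJets_pullbackForm hk
  unfold NormalAt
  generalize pullbackForm (fiberMap Θ) k = k' at hJ ⊢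
  have e : ∀ ξ ∈ closedBall c r, ∀ v u I, components x₁ (fun p a b => k' p a b) (v, ξ, u)
      iU I = formAt k' (v, x' ξ, u) (0, 0, 1) ((coordVec n I).1,
        dchart x₁ ξ (coordVec n I).2.1, (coordVec n I).2.2) := by
    intro ξ hξ v u I
    rw [components_eq_pullForm, pullForm_apply, dparam_u (y := (v, ξ, u)) (h.subset hξ),
      dparam_apply (y := (v, ξ, u)) (h.subset hξ)]
    rfl
  have e2 : ∀ I : Idx n, (coordVec n I).1 = if I = iV then 1 else 0 := fun I =>
    (coordFun_coordVec iV I).trans (by simp only [eq_comm])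
  constructor
  · intro hN ξ hξ v a
    have h1 : ∀ I, OInfty fun u => components x₁ (fun p a b => k' p a b) (v, ξ, u) iU I -
        (coordVec n I).1 := fun I => by
      have := slab_oInfty (hJ iU I) (g := fun _ => if I = iV then 1 else 0)
        (by rw [hN]; exact hasJet_ite _ _) v hξ
      simpa only [e2] using this
    obtain ⟨b, hb⟩ := dparam_surjective (y := (v, ξ, 0)) (h.subset hξ) a
    intro N
    have h2 : (fun u => ∑ I, coordFun n I b * (components x₁ (fun p a b => k' p a b) (v, ξ, u)
        iU I - (coordVec n I).1)) =O[𝓝 0] fun u : ℝ => u ^ N :=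
      Asymptotics.IsBigO.fun_sum fun I _ => (h1 I N).const_mul_left _
    refine h2.congr_left fun u => ?_
    have e3 : dparam x₁ (v, ξ, u) b = a := by
      rw [← hb, dparam_apply (y := (v, ξ, u)) (h.subset hξ),
        dparam_apply (y := (v, ξ, 0)) (h.subset hξ)]
    have e4 : ∑ I, coordFun n I b * (coordVec n I).1 = a.1 := by
      rw [← e3, dparam_apply (y := (v, ξ, u)) (h.subset hξ)]
      simp [e2]
    have e5 : ∑ I, coordFun n I b * components x₁ (fun p a b => k' p a b) (v, ξ, u) iU I =
        formAt k' (v, x' ξ, u) (0, 0, 1) a := by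
      have e6 : pullForm k' x₁ (v, ξ, u) (coordVec n iU) b =
          formAt k' (v, x' ξ, u) (0, 0, 1) a := by
        rw [pullForm_apply, dparam_u (y := (v, ξ, u)) (h.subset hξ), e3]
        rfl
      rw [← e6]
      conv_rhs => rw [← sum_coordFun b]
      rw [map_sum]
      exact sum_ext fun I => by rw [map_smul, smul_eq_mul]; rfl
    simp only [mul_sub, sum_sub_distrib]
    rw [e4, e5]
  · intro hN I
    refine slab_eq_of_oInfty (hJ iU I) (hasJet_ite _ (I = iV)) fun v ξ hξ => ?_
    have := hN ξ hξ v ((coordVec n I).1, dchart x₁ ξ (coordVec n I).2.1, (coordVec n I).2.2)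
    simp only [e ξ hξ, ← e2]
    exact this

end Local

end

section

open FormalRing Slab

/-! ### Uniqueness of normalizing maps -/

section Uniqueness

variable {n : ℕ} {M : Type*} [TopologicalSpace M] [ChartedSpace (𝔼 n) M] [IsManifold (𝓡 n) ∞ M]
  {lam : ℝ} {w : M → ℝ} {Θ Θ' : M × ℝ → 𝒳 M} {k : 𝒯 n M} {x₁ : M} {c : 𝔼 n} {r : ℝ} {hr : 0 < r}
  {d : 𝒳 M → ℝ} {G : Matrix (Idx n) (Idx n) (slab c r hr).Jet} {f : (slab c r hr).Jet}

lemma IsLocalMap.differentiableAt {x₀ : M} {c₀ c₁ : 𝔼 n} {r₀ r₁ : ℝ} {h₀ : 0 < r₀} {h₁ : 0 < r₁}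
    {ψ : 𝒳 M → 𝒳 M} (h : IsLocalMap x₀ x₁ c₀ c₁ h₀ h₁ ψ) {y : Coord n}
    (hy : y ∈ (slab c₀ r₀ h₀).S) : DifferentiableAt ℝ (localExpr x₀ x₁ ψ) y :=
  differentiableAt_of_smooth (h.jetMap.smooth y hy).self_of_nhds

/-- Normal form along `u = 0`. -/
lemma IsLocalMap.pullForm_u (h : IsLocalMap x₁ x₁ c c hr hr (fiberMap Θ))
    (hk : HasFormal lam k d x₁ c hr G f) (hN : ∀ I, pullMat h.jetMap.pull (jacobian (slab c r
    hr).formal h.coordJets) G iU I - (if I = iV then 1 else 0) ∈ (slab c r hr).formal.m)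
    {y : Coord n} (hy : y ∈ (slab c r hr).S) (a : Coord n) : pullForm k x₁
    (localExpr x₁ x₁ (fiberMap Θ) y) (fderiv ℝ (localExpr x₁ x₁ (fiberMap Θ)) y (coordVec n iU))
    (fderiv ℝ (localExpr x₁ x₁ (fiberMap Θ)) y a) = a.1 := by
  set F := localExpr (n := n) x₁ x₁ (fiberMap Θ) with hF
  have h1 : ∀ I, pullForm k x₁ (F y) (fderiv ℝ F y (coordVec n iU))
      (fderiv ℝ F y (coordVec n I)) = if I = iV then 1 else 0 := by
    intro I
    have h2 := ((h.hasJets_pullbackForm hk iU I).sub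
      (hasJet_ite _ (I = iV))).mem_ideal_iff.1 (hN I) y hy
    rw [sub_eq_zero] at h2
    rw [← h2]
    have hz := (h.eventually hy).self_of_nhds
    exact (pullback_dparam k hz.1 (hz.2.1.mdifferentiableAt (by simp)) hz.2.2 _ _).symm
  conv_lhs => rw [← sum_coordFun a]
  simp only [map_sum, map_smul, h1]
  simp

/-- A map which is in normal form along `u = 0` is a local diffeomorphism there. -/
lemma IsLocalMap.injective (h : IsLocalMap x₁ x₁ c c hr hr (fiberMap Θ))
    (hk : HasFormal lam k d x₁ c hr G f)
    (hΘ : ∀ ξ ∈ closedBall c r, Adapted n lam w Θ ((𝔠 n x₁).symm ξ)) (hN : ∀ I, pullMat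
    h.jetMap.pull (jacobian (slab c r hr).formal h.coordJets) G iU I - (if I = iV then 1 else 0) ∈
    (slab c r hr).formal.m) {y : Coord n} (hy : y ∈ (slab c r hr).S) (a : Coord n)
    (ha : fderiv ℝ (localExpr x₁ x₁ (fiberMap Θ)) y a = 0) : a = 0 := by
  have hd := h.differentiableAt hy
  have h1 := h.pullForm_u hk hN hy
  obtain ⟨hs, -, hv⟩ := hk.form (h.maps y hy)
  set T := fderiv ℝ (localExpr (n := n) x₁ x₁ (fiberMap Θ)) y
  have hTv : T (coordVec n iV) = coordVec n iV := fderiv_localExpr_v hd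
  have hT : ∀ b : Coord n, b.2.2 = 0 → (T b).2 = b.2 := fun b hb =>
    (hΘ _ hy.1).fderiv_snd (h.subset hy.1) hy.2 hd hb
  have ha1 : a.1 = 0 := by rw [← h1 a, ha, map_zero]
  set b := a - a.2.2 • coordVec n iU with hb
  have hb0 : b.2.2 = 0 := by simp [hb]
  have h2 := hv (T b) (by rw [hT b hb0, hb0])
  have h3 := h1 (coordVec n iV)
  rw [hTv, hs] at h3
  rw [hb, map_sub, ha, map_smul, zero_sub, map_neg, map_smul, h3, smul_eq_mul] at h2
  have hau : a.2.2 = 0 := by simpa using h2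
  have h4 := hT a hau
  rw [ha] at h4
  exact Prod.ext ha1 h4.symm

/-- An adapted map which is in normal form along `u = 0` is a formal map. -/
lemma IsLocalMap.isFormalMap_of_normal (h : IsLocalMap x₁ x₁ c c hr hr (fiberMap Θ))
    (hk : HasFormal lam k d x₁ c hr G f)
    (hΘ : ∀ ξ ∈ closedBall c r, Adapted n lam w Θ ((𝔠 n x₁).symm ξ)) (hN : ∀ I, pullMat
    h.jetMap.pull (jacobian (slab c r hr).formal h.coordJets) G iU I - (if I = iV then 1 else 0) ∈
    (slab c r hr).formal.m) :
    IsFormalMap (slab c r hr).formal (slab c r hr).formal lam h.jetMap.pull h.coordJets :=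
  h.isFormalMap (Adapted.scale_param hΘ) fun _ hy a => h.injective hk hΘ hN hy a

/-- Two adapted maps with pullbacks in normal form agree to infinite order. -/
lemma IsLocalMap.coordJets_eq (h : IsLocalMap x₁ x₁ c c hr hr (fiberMap Θ))
    (h' : IsLocalMap x₁ x₁ c c hr hr (fiberMap Θ')) (hk : HasFormal lam k d x₁ c hr G f)
    (hΘ : ∀ ξ ∈ closedBall c r, Adapted n lam w Θ ((𝔠 n x₁).symm ξ))
    (hΘ' : ∀ ξ ∈ closedBall c r, Adapted n lam w Θ' ((𝔠 n x₁).symm ξ))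
    (hN : ∀ ξ ∈ closedBall c r, NormalAt k Θ ((𝔠 n x₁).symm ξ))
    (hN' : ∀ ξ ∈ closedBall c r, NormalAt k Θ' ((𝔠 n x₁).symm ξ)) (L : Idx n) :
    h.coordJets L = h'.coordJets L := by
  set Φ := (slab c r hr).formal with hΦ
  have n1 := (h.normalAt_iff hk).2 hN
  have n2 := (h'.normalAt_iff hk).2 hN'
  have m1 := fun I => (sub_eq_zero.2 (n1 I)).symm ▸ Φ.m.zero_mem
  have m2 := fun I => (sub_eq_zero.2 (n2 I)).symm ▸ Φ.m.zero_mem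
  have f1 := h.isFormalMap_of_normal hk hΘ m1
  have f2 := h'.isFormalMap_of_normal hk hΘ' m2
  have g1 := (f1.geodesic_iff hk.ambient.symm hk.ambient.unit).1 (geodesic_of_normal n1)
  have g2 := (f2.geodesic_iff hk.ambient.symm hk.ambient.unit).1 (geodesic_of_normal n2)
  have e0 : ∀ y ∈ (slab c r hr).S, localExpr x₁ x₁ (fiberMap Θ) y =
      localExpr x₁ x₁ (fiberMap Θ') y := fun y hy => by
    rw [((hΘ _ hy.1).eventually_localExpr (h.subset hy.1)).self_of_nhds hy.2,
      ((hΘ' _ hy.1).eventually_localExpr (h.subset hy.1)).self_of_nhds hy.2]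
  have a0 : ∀ L, h.coordJets L - h'.coordJets L ∈ Φ.m := fun L =>
    ((h.hasJet_coordJets L).sub (h'.hasJet_coordJets L)).mem_ideal_iff.2 fun y hy => by
      rw [e0 y hy, sub_self]
  have a1 : ∀ L, Φ.D iU (h.coordJets L) - Φ.D iU (h'.coordJets L) ∈ Φ.m := by
    intro L
    refine (((h.hasJet_coordJets L).dirD iU).sub
      ((h'.hasJet_coordJets L).dirD iU)).mem_ideal_iff.2 fun y hy => ?_
    have d1 := h.differentiableAt hy
    have d2 := h'.differentiableAt hy
    have b1 := h.pullForm_u hk m1 hy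
    have b2 := h'.pullForm_u hk m2 hy
    rw [← e0 y hy] at b2
    obtain ⟨hs, hn, hv⟩ := hk.form (h.maps y hy)
    have hTv := fderiv_localExpr_v d1
    have hT2 : ∀ b : Coord n, b.2.2 = 0 → _ := fun b hb =>
      (hΘ _ hy.1).fderiv_eq (hΘ' _ hy.1) (h.subset hy.1) hy.2 d1 d2 hb
    have hT : ∀ b : Coord n, b.2.2 = 0 → _ := fun b hb =>
      (hΘ _ hy.1).fderiv_snd (h.subset hy.1) hy.2 d1 hb
    have key := eq_of_null hs hn hv (by rw [← hTv]; exact b1 _) (b1 (coordVec n iU))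
      (b2 (coordVec n iU)) (fun b hb => by
        set T := fderiv ℝ (localExpr (n := n) x₁ x₁ (fiberMap Θ)) y
        set b' := b - ((T b).1 - b.1) • coordVec n iV with hb'
        have hb0 : b'.2.2 = 0 := by simp [hb', hb]
        have e1 : T b' = b := by
          rw [hb', map_sub, map_smul, hTv]
          exact Prod.ext (by simp) (by simp [hT b hb])
        have e2 := b2 b'
        rw [← hT2 b' hb0, e1] at e2
        have e3 := b1 b'
        rw [e1] at e3
        exact e3.trans e2.symm)
    have e : (slab c r hr).e = coordVec n := rfl
    rw [e, dirD_coordFun_comp d1, dirD_coordFun_comp d2, key, sub_self]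
  have main : ∀ j L, h.coordJets L - h'.coordJets L ∈ Φ.V j ∧
      Φ.D iU (h.coordJets L) - Φ.D iU (h'.coordJets L) ∈ Φ.V j := by
    intro j
    induction j with
    | zero => simp
    | succ j ih =>
      intro L
      rw [mem_V_succ, mem_V_succ, map_sub, map_sub]
      refine ⟨⟨a0 L, (ih L).2⟩, a1 L, ?_⟩
      have := geoTerm_sub_mem (Φ₁ := Φ) (G := G) (Φ.V j) (fun a => (ih a).2)
        (h.jetMap.pull_sub_pull_mem h'.jetMap fun L => (ih L).1) L
      rw [show Φ.D iU (Φ.D iU (h.coordJets L)) -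
        Φ.D iU (Φ.D iU (h'.coordJets L)) = -(geoTerm Φ G h.jetMap.pull
          (fun a => Φ.D iU (h.coordJets a)) L - geoTerm Φ G h'.jetMap.pull
          (fun a => Φ.D iU (h'.coordJets a)) L) by linear_combination g1 L - g2 L]
      exact neg_mem this
  exact sub_eq_zero.1 (eq_zero_of_forall_mem (Φ := Φ) fun j => (main j L).1)

end Uniqueness

/-! ### Formal existence -/

section FormalExistence

variable {n : ℕ} {A : Type*} [CommRing A] [Algebra ℝ A]

/-- The null vector transverse to `u = 0` with prescribed products. -/
lemma exists_null (Φ : FormalRing A (Idx n) iU) {H : Matrix (Idx n) (Idx n) A} (hs : H.IsSymm)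
    (hu : IsUnit H.det) (hv : ∀ I, I ≠ iU → H iV I ∈ Φ.m) (η : Fin n → A) : ∃ N : Idx n → A, ∑ a, N
    a * H a iV - 1 ∈ Φ.m ∧ (∀ i, ∑ a, N a * H a (idxX i) + η i ∈ Φ.m) ∧ ∑ a, ∑ b, N a * N b * H a b
    ∈ Φ.m := by
  set α : Idx n → A := Sum.elim (fun _ => 1) (Sum.elim (fun i => -η i) (fun _ => 0)) with hα
  set q := H⁻¹.mulVec α with hq
  set t := -(half A * ∑ b, q b * α b) with ht
  have h1 : ∀ b, ∑ a, q a * H a b = α b := by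
    intro b
    have : H.mulVec q = α := by
      rw [hq, Matrix.mulVec_mulVec, mul_nonsing_inv _ hu, Matrix.one_mulVec]
    rw [← congrFun this b, mulVec, dotProduct]
    exact sum_ext fun a => by rw [hs.apply, mul_comm]
  have h2 : ∀ b, ∑ a, (q a + (if a = iV then t else 0)) * H a b = α b + t * H iV b := by
    intro b
    simp only [add_mul, sum_add_distrib, h1, ite_mul, zero_mul, sum_ite_eq', mem_univ, if_true]
  have hvv := hv iV (by simp)
  refine ⟨fun a => q a + if a = iV then t else 0, ?_, fun i => ?_, ?_⟩
  · rw [h2]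
    simpa [hα] using mul_mem_left _ t hvv
  · rw [h2]
    simpa [hα] using mul_mem_left _ t (hv (idxX i) (by simp))
  · have e : ∑ a, ∑ b, (q a + if a = iV then t else 0) * (q b + if b = iV then t else 0) *
        H a b = ∑ b, (q b + if b = iV then t else 0) * (α b + t * H iV b) := by
      rw [sum_comm]
      refine sum_ext fun b => ?_
      rw [← h2 b, mul_sum]
      exact sum_ext fun a => by ring
    have e2 : ∑ b, q b * (t * H iV b) = t := by
      have := h1 iV
      simp only [hα, Sum.elim_inl] at this
      rw [show ∑ b, q b * (t * H iV b) = t * ∑ b, q b * H b iV by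
        rw [mul_sum]
        exact sum_ext fun b => by rw [hs.apply]; ring, this, mul_one]
    rw [e]
    simp only [add_mul, mul_add, sum_add_distrib, ite_mul, zero_mul, sum_ite_eq',
      mem_univ, if_true, e2]
    have e3 : α iV = 1 := rfl
    have e4 : ∑ b, q b * α b + 2 * t = 0 := by
      rw [ht]; linear_combination (-∑ b, q b * α b) * two_mul_half (A := A)
    rw [e3]
    convert mul_mem_left _ (t * t) hvv using 1
    linear_combination e4

end FormalExistence

end

section

open FormalRing Slab

/-! ### Formal geodesics -/

section FormalGeodesics

variable {n : ℕ} {c : 𝔼 n} {r : ℝ} {hr : 0 < r}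

lemma D_coordJet (I L : Idx n) :
    (slab c r hr).formal.D I ((slab c r hr).coordJet L) = if L = I then 1 else 0 := by
  refine ((hasJet_coord (B := slab c r hr) L).dirD I).unique ((hasJet_ite _ (L = I)).congr
    fun p _ => .of_forall fun z => ?_)
  change _ = fderiv ℝ (coordFun n L) z (coordVec n I)
  rw [(coordFun n L).fderiv, coordFun_coordVec]

/-- The pullback by a map that commutes with the translations in `v`. -/
lemma pull_eq_pull_snd {F : 𝔼 n × ℝ → Coord n} {Ψ : Coord n → Coord n}
    (hF : JetMap (slabX c r hr) (slab c r hr) F) (hΨ : JetMap (slab c r hr) (slab c r hr) Ψ) (e : ∀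
    L, hΨ.pull ((slab c r hr).coordJet L) = (jetMap_snd (c := c) (r := r) (hr := hr)).pull (hF.pull
    ((slab c r hr).coordJet L)) + if L = iV then (slab c r hr).coordJet iV else 0)
    {a : (slab c r hr).Jet} (ha : (slab c r hr).formal.D iV a = 0) :
    hΨ.pull a = (jetMap_snd (c := c) (r := r) (hr := hr)).pull (hF.pull a) := by
  have hpt : ∀ p ∈ (slab c r hr).S, Ψ p = F p.2 + p.1 • coordVec n iV := by
    intro p hp
    rw [← sum_coordFun (Ψ p), ← sum_coordFun (F p.2 + _)]
    refine sum_ext fun L => congrArg (· • _) ?_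
    have h0 : (slab c r hr).HasJet (fun p => p.1 * if L = iV then 1 else 0)
        (if L = iV then (slab c r hr).coordJet iV else 0) := by
      split_ifs
      · simp only [mul_one]; exact hasJet_coord (B := slab c r hr) iV
      · simpa using HasJet.zero (slab c r hr)
    have h1 := ((hΨ.hasJet_pull (hasJet_coord L)).sub
      ((jetMap_snd.hasJet_pull (hF.hasJet_pull (hasJet_coord L))).add h0)).mem_ideal_iff.1
      (by rw [e, sub_self]; exact zero_mem _) p hp
    rw [map_add, map_smul, coordFun_coordVec, smul_eq_mul]
    exact sub_eq_zero.1 h1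
  refine sub_eq_zero.1 (eq_zero_of_forall_mem (Φ := (slab c r hr).formal) fun j => ?_)
  induction j generalizing a with
  | zero => simp
  | succ j ih =>
    rw [mem_V_succ]
    constructor
    · obtain ⟨f, hf⟩ := (slab c r hr).exists_hasJet a
      refine ((hΨ.hasJet_pull hf).sub
        (jetMap_snd.hasJet_pull (hF.hasJet_pull hf))).mem_ideal_iff.2 fun p hp => ?_
      have hS : ∀ t : ℝ, F p.2 + t • coordVec n iV ∈ (slab c r hr).S := fun t => by
        have := hF.maps p.2 hp
        rw [mem_slab] at this ⊢
        simpa using this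
      have h1 : ∀ t : ℝ, HasDerivAt (fun t : ℝ => f (F p.2 + t • coordVec n iV)) 0 t := by
        intro t
        have h2 := (differentiableAt_of_smooth (hf.smooth _ (hS t)).self_of_nhds).hasFDerivAt
        have h3 := (hf.dirD iV).mem_ideal_iff.1
          (by rw [show (slab c r hr).dJ iV a = 0 from ha]; exact zero_mem _) _ (hS t)
        have h4 : HasDerivAt (fun t : ℝ => F p.2 + t • coordVec n iV) (coordVec n iV) t := by
          simpa using ((hasDerivAt_id t).smul_const (coordVec n iV)).const_add (F p.2)
        have h5 := h2.comp_hasDerivAt t h4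
        rwa [show fderiv ℝ f (F p.2 + t • coordVec n iV) (coordVec n iV) = 0 from h3] at h5
      have h2 := is_const_of_deriv_eq_zero (fun t => (h1 t).differentiableAt)
        (fun t => (h1 t).deriv) p.1 0
      simp only [zero_smul, add_zero] at h2
      simp only [comp_apply, hpt p hp, h2, sub_self]
    · rw [map_sub, hΨ.chain, ← pull_snd_D, hF.chain, map_sum, ← sum_sub_distrib]
      refine sum_mem fun L _ => ?_
      have h1 : (slab c r hr).formal.D iU (hΨ.pull ((slab c r hr).coordJet L)) =
          (jetMap_snd (c := c) (r := r) (hr := hr)).pull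
            ((slabX c r hr).formal.D iU (hF.pull ((slab c r hr).coordJet L))) := by
        rw [e, map_add, pull_snd_D, apply_ite ((slab c r hr).formal.D iU), D_coordJet, map_zero]
        simp
      rw [h1, map_mul, ← mul_sub]
      exact mul_mem_left _ _ (ih (by rw [(slab c r hr).formal.comm, ha, map_zero]))

variable {F₀ F : 𝔼 n × ℝ → Coord n} {y : Idx n → (slabX c r hr).Jet}

lemma jetMap_of_hasJet (hF₀ : JetMap (slabX c r hr) (slab c r hr) F₀)
    (hF : ∀ L, (slabX c r hr).HasJet (fun z => coordFun n L (F z)) (y L))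
    (h0 : ∀ L, y L - hF₀.pull ((slab c r hr).coordJet L) ∈ (slabX c r hr).formal.m) :
    JetMap (slabX c r hr) (slab c r hr) F where
  smooth p hp := by
    have h1 : ∀ᶠ q in 𝓝 p, ∀ L, ContDiffAt ℝ ∞ (fun z => coordFun n L (F z)) q :=
      Filter.eventually_all.2 fun L => (hF L).smooth p hp
    filter_upwards [h1] with q hq
    have e : F = fun z => ∑ L, coordFun n L (F z) • coordVec n L :=
      funext fun z => (sum_coordFun _).symm
    rw [e]
    exact ContDiffAt.sum fun L _ => (hq L).smul contDiffAt_const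
  maps p hp := by
    have e : F p = F₀ p := by
      rw [← sum_coordFun (F p), ← sum_coordFun (F₀ p)]
      refine sum_ext fun L => congrArg (· • _) ?_
      exact sub_eq_zero.1 (((hF L).sub (hF₀.hasJet_pull (hasJet_coord L))).mem_ideal_iff.1 (h0 L) p hp)
    rw [e]
    exact hF₀.maps p hp

lemma pull_coordJet_eq (h : JetMap (slabX c r hr) (slab c r hr) F)
    (hF : ∀ L, (slabX c r hr).HasJet (fun z => coordFun n L (F z)) (y L)) (L : Idx n) :
    h.pull ((slab c r hr).coordJet L) = y L := (h.hasJet_pull (hasJet_coord L)).unique (hF L)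

lemma exists_hasJet_map (y : Idx n → (slabX c r hr).Jet) :
    ∃ F : 𝔼 n × ℝ → Coord n, ∀ L, (slabX c r hr).HasJet (fun z => coordFun n L (F z)) (y L) := by
  choose f hf using fun L => (slabX c r hr).exists_hasJet (y L)
  exact ⟨fun z => ∑ L, f L z • coordVec n L, fun L => by simpa only [coordFun_sum] using hf L⟩

/-- The pullback by a map with the given jet. -/
def jetComp (y : Idx n → (slabX c r hr).Jet) (a : (slab c r hr).Jet) : (slabX c r hr).Jet :=
  open Classical in
  if h : JetMap (slabX c r hr) (slab c r hr) (exists_hasJet_map y).choose then h.pull a else 0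

lemma jetComp_eq (h : JetMap (slabX c r hr) (slab c r hr) F)
    (hy : ∀ L, h.pull ((slab c r hr).coordJet L) = y L) (a : (slab c r hr).Jet) :
    jetComp y a = h.pull a := by
  have h2 := (exists_hasJet_map y).choose_spec
  have h1 := jetMap_of_hasJet h h2 fun L => by rw [hy, sub_self]; exact zero_mem _
  rw [jetComp, dif_pos h1]
  exact h1.pull_congr h (fun L => by rw [pull_coordJet_eq h1 h2, hy]) a

/-- Formal geodesics with given initial data. -/
lemma exists_formal_geodesic (hF₀ : JetMap (slabX c r hr) (slab c r hr) F₀)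
    (G : Matrix (Idx n) (Idx n) (slab c r hr).Jet) (N : Idx n → (slabX c r hr).Jet) : ∃ y p : Idx n
    → (slabX c r hr).Jet, (∀ L, y L - hF₀.pull ((slab c r hr).coordJet L) ∈ (slabX c r hr).formal.m)
    ∧ (∀ L, p L - N L ∈ (slabX c r hr).formal.m) ∧ (∀ L, (slabX c r hr).formal.D iU (y L) = p L) ∧ ∀
    L, (slabX c r hr).formal.D iU (p L) = -geoTerm (slab c r hr).formal G (jetComp y) p L := by
  set y₀ : Idx n ⊕ Idx n → (slabX c r hr).Jet :=
    Sum.elim (fun L => hF₀.pull ((slab c r hr).coordJet L)) N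
  set Q : (Idx n ⊕ Idx n → (slabX c r hr).Jet) → Idx n ⊕ Idx n → (slabX c r hr).Jet := fun Y =>
    Sum.elim (fun L => Y (Sum.inr L)) fun L => -geoTerm (slab c r hr).formal G
      (jetComp fun L => Y (Sum.inl L)) (fun L => Y (Sum.inr L)) L
  have hQ : (slabX c r hr).formal.Causal y₀ Q := by
    intro j Y Z hY hZ h i
    rcases i with L | L
    · exact h (Sum.inr L)
    · change -_ - -_ ∈ _
      rw [neg_sub_neg, ← neg_sub]
      refine neg_mem (geoTerm_sub_mem _ (fun a => h (Sum.inr a)) (fun a => ?_) L)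
      obtain ⟨F, hF⟩ := exists_hasJet_map fun L => Y (Sum.inl L)
      obtain ⟨F', hF'⟩ := exists_hasJet_map fun L => Z (Sum.inl L)
      have h1 := jetMap_of_hasJet hF₀ hF fun L => hY (Sum.inl L)
      have h2 := jetMap_of_hasJet hF₀ hF' fun L => hZ (Sum.inl L)
      rw [jetComp_eq h1 (pull_coordJet_eq h1 hF), jetComp_eq h2 (pull_coordJet_eq h2 hF')]
      refine h1.pull_sub_pull_mem h2 (fun L => ?_) a
      rw [pull_coordJet_eq h1 hF, pull_coordJet_eq h2 hF']
      exact h (Sum.inl L)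
  obtain ⟨Y, h1, h2⟩ := ode_exists slabX_complete hQ
  exact ⟨fun L => Y (Sum.inl L), fun L => Y (Sum.inr L), fun L => h1 (Sum.inl L),
    fun L => h1 (Sum.inr L), fun L => h2 (Sum.inl L), fun L => h2 (Sum.inr L)⟩

lemma hasJet_restrict {f : 𝔼 n × ℝ → ℝ} {b : (slabX c r hr).Jet} (hf : (slabX c r hr).HasJet f b)
    (hb : b ∈ (slabX c r hr).formal.m) : (slabX c r hr).HasJet (fun z => f (z.1, 0)) 0 := by
  have hρ : JetMap (slabX c r hr) (slabX c r hr) fun z => (z.1, (0 : ℝ)) :=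
    ⟨fun p _ => .of_forall fun q =>
      (contDiff_fst.prodMk contDiff_const).contDiffAt, fun p hp => ⟨hp.1, rfl⟩⟩
  have h1 := hρ.hasJet_pull hf
  have h2 := hρ.pull_mem_ideal hb
  rwa [eq_zero_of_D_eq_zero (Ψ := (slabX c r hr).formal) h2 ?_] at h1
  refine (h1.dirD iU).unique ((HasJet.zero _).congr fun p hp => ?_)
  filter_upwards [h1.smooth p hp] with z hz
  refine (fderiv_eq_of_affine (differentiableAt_of_smooth hz) fun t => ?_).symm
  have e : (slabX c r hr).e iU = (0, 1) := rfl
  simp [e]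

/-- A map with the given jet and the given values along `u = 0` that preserves `λ u`. -/
lemma exists_map (lam : ℝ) (hF₀ : JetMap (slabX c r hr) (slab c r hr) F₀)
    (h0 : ∀ L, y L - hF₀.pull ((slab c r hr).coordJet L) ∈ (slabX c r hr).formal.m)
    (hu : ∀ ξ, (F₀ (ξ, 0)).2.2 = 0) (hlam : lam ≠ 0 → y iU = (slabX c r hr).formal.X) : ∃ F : 𝔼 n ×
    ℝ → Coord n, (∀ L, (slabX c r hr).HasJet (fun z => coordFun n L (F z)) (y L)) ∧
    (∀ ξ, F (ξ, 0) = F₀ (ξ, 0)) ∧ ∀ z, lam * (F z).2.2 = lam * z.2 := by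
  obtain ⟨F₁, hF₁, hl⟩ : ∃ F : 𝔼 n × ℝ → Coord n,
      (∀ L, (slabX c r hr).HasJet (fun z => coordFun n L (F z)) (y L)) ∧
      ∀ z, lam * (F z).2.2 = lam * z.2 := by
    obtain ⟨F, hF⟩ := exists_hasJet_map y
    by_cases h : lam = 0
    · exact ⟨F, hF, by simp [h]⟩
    · refine ⟨fun z => ((F z).1, (F z).2.1, z.2), fun L => ?_, fun z => rfl⟩
      induction L using idx_cases with
      | hv => exact hF iV
      | hx i => exact hF (idxX i)
      | hu => rw [hlam h]; exact HasJet.X _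
  refine ⟨fun z => F₁ z - (F₁ (z.1, 0) - F₀ (z.1, 0)), fun L => ?_, fun ξ => by simp, fun z => ?_⟩
  · have h1 := hasJet_restrict ((hF₁ L).sub (hF₀.hasJet_pull (hasJet_coord L))) (h0 L)
    have h2 := (hF₁ L).sub h1
    rw [sub_zero] at h2
    simp only [map_sub]
    exact h2
  · have h1 := hl z
    have h2 := hl (z.1, 0)
    have h3 := hu z.1
    simp only [Prod.snd_sub, h3] at h2 ⊢
    linear_combination h1 - h2

end FormalGeodesics

end

section

open FormalRing Slab

/-! ### Local existence of normalizing maps -/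

variable {n : ℕ} {M : Type*} [TopologicalSpace M] [ChartedSpace (𝔼 n) M] [IsManifold (𝓡 n) ∞ M]
  {lam : ℝ} {k : 𝒯 n M} {x₁ : M} {c : 𝔼 n} {r : ℝ} {hr : 0 < r} {d : 𝒳 M → ℝ}
  {G : Matrix (Idx n) (Idx n) (slab c r hr).Jet} {f : (slab c r hr).Jet} {F : 𝔼 n × ℝ → Coord n}

/-- The map of `M × ℝ` with the expression `F` in the chart at `x₁`. -/
def chartMap (x₁ : M) (F : 𝔼 n × ℝ → Coord n) (q : M × ℝ) : 𝒳 M := param x₁ (F (𝔠 n x₁ q.1, q.2))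

lemma contMDiffAt_chartMap {q : M × ℝ} (hq : q.1 ∈ (𝔠 n x₁).source)
    (hF : ContDiffAt ℝ ∞ F (𝔠 n x₁ q.1, q.2)) (ht : (F (𝔠 n x₁ q.1, q.2)).2.1 ∈ (𝔠 n x₁).target) :
    ContMDiffAt (𝓡₁ n) (model n) ∞ (chartMap x₁ F) q := by
  have h1 : ContMDiffAt (𝓡₁ n) (model n) ∞ (fun q : M × ℝ => ((0 : ℝ), q)) q :=
    contMDiffAt_const.prodMk contMDiffAt_id
  have h2 : ContMDiffAt (model n) 𝓘(ℝ, Coord n) ∞ (coords n x₁) ((0 : ℝ), q) :=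
    contMDiffAt_coords hq
  have h3 : ContMDiffAt 𝓘(ℝ, Coord n) 𝓘(ℝ, Coord n) ∞ (fun y : Coord n => F y.2)
      (coords n x₁ ((0 : ℝ), q)) :=
    contMDiffAt_iff_contDiffAt.2 (ContDiffAt.comp (f := fun y : Coord n => y.2) _ hF contDiffAt_snd)
  have h4 : ContMDiffAt 𝓘(ℝ, Coord n) (model n) ∞ (param x₁) (F (coords n x₁ ((0 : ℝ), q)).2) :=
    contMDiffAt_param ht
  have h5 : ContMDiffAt (𝓡₁ n) 𝓘(ℝ, Coord n) ∞
      (fun q => coords n x₁ ((0 : ℝ), q)) q := h2.comp q h1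
  have h6 : ContMDiffAt (𝓡₁ n) 𝓘(ℝ, Coord n) ∞
      (fun q => F (coords n x₁ ((0 : ℝ), q)).2) q :=
    ContMDiffAt.comp (g := fun y : Coord n => F y.2) q h3 h5
  exact h4.comp q h6

/-- The expression of `chartMap` in the chart. -/
lemma localExpr_chartMap {y : Coord n} (hy : y.2.1 ∈ (𝔠 n x₁).target)
    (ht : (F y.2).2.1 ∈ (𝔠 n x₁).target) :
    localExpr x₁ x₁ (fiberMap (chartMap x₁ F)) y = F y.2 + y.1 • coordVec n iV := by
  have e : (𝔠 n x₁ ((𝔠 n x₁).symm y.2.1), y.2.2) = y.2 := by rw [(𝔠 n x₁).right_inv hy]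
  simp only [localExpr, fiberMap, chartMap, param, coords]
  rw [e, (𝔠 n x₁).right_inv ht]
  exact Prod.ext (by simp [add_comm]) (Prod.ext (by simp) (by simp))

lemma adapted_chartMap {w : M → ℝ} {x : M} (hx : x ∈ (𝔠 n x₁).source)
    (hF : ∀ᶠ z in 𝓝 (𝔠 n x₁ x, (0 : ℝ)), ContDiffAt ℝ ∞ F z)
    (h0 : ∀ᶠ ξ in 𝓝 (𝔠 n x₁ x), F (ξ, 0) = (w ((𝔠 n x₁).symm ξ), ξ, 0))
    (hl : ∀ᶠ z in 𝓝 (𝔠 n x₁ x, (0 : ℝ)), lam * (F z).2.2 = lam * z.2) :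
    Adapted n lam w (chartMap x₁ F) x := by
  set κ := 𝔠 n x₁
  have hκ : ContinuousAt κ x := κ.continuousAt hx
  have hc : Tendsto (fun q : M × ℝ => (κ q.1, q.2)) (𝓝 (x, 0)) (𝓝 (κ x, 0)) :=
    (ContinuousAt.comp (f := Prod.fst) (x := (x, (0 : ℝ))) hκ continuousAt_fst).prodMk
      continuousAt_snd
  have hs : ∀ᶠ q : M × ℝ in 𝓝 (x, 0), q.1 ∈ κ.source :=
    continuousAt_fst.eventually (κ.open_source.mem_nhds hx)
  have ht : ∀ᶠ z in 𝓝 (κ x, (0 : ℝ)), (F z).2.1 ∈ κ.target :=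
    (continuousAt_fst.comp (continuousAt_snd.comp hF.self_of_nhds.continuousAt)).eventually (by
      refine κ.open_target.mem_nhds ?_
      simp only [comp_apply, h0.self_of_nhds]
      exact κ.map_source hx)
  refine ⟨?_, ?_, ?_⟩
  · filter_upwards [hs, hc.eventually hF, hc.eventually ht] with q a1 a2 a3
    exact contMDiffAt_chartMap a1 a2 a3
  · filter_upwards [κ.open_source.mem_nhds hx, hκ.eventually h0] with x' a1 a2
    simp only [chartMap, param]
    rw [a2, κ.left_inv a1]
  · filter_upwards [hc.eventually hl] with q a1 using a1

/-- Local existence of normalizing maps. -/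
lemma HasFormal.exists_normal (hk : HasFormal lam k d x₁ c hr G f) (w : C^∞⟮𝓡 n, M; ℝ⟯) : ∃ Θ : M ×
    ℝ → 𝒳 M, ∀ ξ ∈ closedBall c r, Adapted n lam w Θ ((𝔠 n x₁).symm ξ) ∧ NormalAt k Θ
    ((𝔠 n x₁).symm ξ) := by
  set κ := 𝔠 n x₁ with hκ
  have hG := hk.ambient
  set W : 𝔼 n → ℝ := fun ξ => w (κ.symm ξ)
  have hW : ∀ ξ ∈ κ.target, ContDiffAt ℝ ∞ W ξ := by
    intro ξ hξ
    rw [← contMDiffAt_iff_contDiffAt]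
    exact ContMDiffAt.comp ξ w.contMDiff.contMDiffAt
      ((contMDiffOn_chart_symm (I := 𝓡 n) (n := ∞)).contMDiffAt (κ.open_target.mem_nhds hξ))
  have hF₀ : JetMap (slabX c r hr) (slab c r hr) fun z => (W z.1, z.1, z.2) := by
    refine ⟨fun p hp => ?_, fun p hp => hp⟩
    filter_upwards [continuousAt_fst.eventually (κ.open_target.mem_nhds (hk.subset hp.1))] with q hq
    exact (ContDiffAt.comp q (hW _ hq) contDiffAt_fst).prodMk
      (contDiffAt_fst.prodMk contDiffAt_snd)
  set y₀ : Idx n → (slabX c r hr).Jet := fun L => hF₀.pull ((slab c r hr).coordJet L) with hy₀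
  set H := G.map hF₀.pull with hH
  have hHs : H.IsSymm := by
    ext I J
    exact congrArg hF₀.pull (hG.symm.apply I J)
  have hGv : ∀ I, I ≠ iU → G iV I ∈ (slab c r hr).formal.m := fun I hI => by
    induction I using idx_cases with
    | hv => exact mem_m_of_mem_V (by omega) hG.v_v_mem
    | hx i => exact hG.v_x_mem i
    | hu => exact absurd rfl hI
  obtain ⟨N, N1, N2, N3⟩ := exists_null (slabX c r hr).formal hHs (isUnit_det_map hG.unit)
    (fun I hI => hF₀.pull_mem_ideal (hGv I hI)) (fun i => (slabX c r hr).formal.D (idxX i) (y₀ iV))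
  obtain ⟨y, p, y1, p1, yp, pp⟩ := exists_formal_geodesic hF₀ G N
  have hlam : lam ≠ 0 → y iU = (slabX c r hr).formal.X := by
    intro h0
    have hΓ := gamma_u_eq_zero hG.D_v hG.D_v_density hG.unit h0 hG.P_eq
    have hGu := metric_v_eq hG.D_v hG.D_v_density hG.symm hG.unit h0 hGv hG.P_eq hG.F_eq
    have e1 : N iU - 1 ∈ (slabX c r hr).formal.m := by
      have e : ∀ a, H a iV = if a = iU then 1 else 0 := fun a => by
        rw [hH, map_apply, hG.symm.apply, hGu]; split_ifs <;> simp
      simpa [e] using N1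
    have e2 : (slabX c r hr).formal.D iU (p iU) = 0 := by
      rw [pp, geoTerm]
      have e0 : jetComp y (0 : (slab c r hr).Jet) = 0 := by rw [jetComp]; split_ifs <;> simp
      simp [hΓ, e0]
    have e3 : p iU = 1 := by
      refine sub_eq_zero.1 (eq_zero_of_D_eq_zero (Ψ := (slabX c r hr).formal) ?_ (by rw [map_sub, e2]; simp))
      simpa using add_mem (p1 iU) e1
    refine sub_eq_zero.1 (eq_zero_of_D_eq_zero (Ψ := (slabX c r hr).formal) ?_
      (by rw [map_sub, yp, e3, (slabX c r hr).formal.D_X]; simp))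
    have e4 : hF₀.pull ((slab c r hr).coordJet iU) = (slabX c r hr).formal.X :=
      (hF₀.hasJet_pull (hasJet_coord iU)).unique (HasJet.X (slabX c r hr))
    have := y1 iU
    rwa [e4] at this
  obtain ⟨F, hFj, hF0, hFl⟩ := exists_map lam hF₀ y1 (fun _ => rfl) hlam
  have hF := jetMap_of_hasJet hF₀ hFj y1
  have hFy := pull_coordJet_eq hF hFj
  have hΘ : ∀ ξ ∈ closedBall c r, Adapted n lam w (chartMap x₁ F) (κ.symm ξ) := by
    intro ξ hξ
    have e := κ.right_inv (hk.subset hξ)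
    refine adapted_chartMap (κ.map_target (hk.subset hξ)) ?_
      (.of_forall fun ξ' => hF0 ξ') (Eventually.of_forall hFl)
    rw [← hκ, e]
    exact hF.smooth (ξ, 0) ⟨hξ, rfl⟩
  have hl : IsLocalMap x₁ x₁ c c hr hr (fiberMap (chartMap x₁ F)) := Adapted.isLocalMap hk.subset hΘ
  set σ := (jetMap_snd (c := c) (r := r) (hr := hr)).pull with hσ
  have hcj : ∀ L, hl.coordJets L = σ (y L) + if L = iV then (slab c r hr).coordJet iV else 0 := by
    intro L
    have h0 : (slab c r hr).HasJet (fun p => p.1 * if L = iV then 1 else 0)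
        (if L = iV then (slab c r hr).coordJet iV else 0) := by
      split_ifs
      · simp only [mul_one]; exact hasJet_coord  iV
      · simpa using HasJet.zero (slab c r hr)
    refine (hl.hasJet_coordJets L).unique (((jetMap_snd.hasJet_pull (hFj L)).add h0).congr
      fun z hz => ?_)
    have hz' := hk.subset hz.1
    have ht : ∀ᶠ z' in 𝓝 z, (F z'.2).2.1 ∈ κ.target :=
      ((continuousAt_fst.comp continuousAt_snd).comp ((hF.smooth z.2 hz).self_of_nhds.continuousAt.comp
        continuousAt_snd)).eventually (κ.open_target.mem_nhds (hk.subset (hF.maps z.2 hz).1))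
    filter_upwards [eventually_mem_target hz', ht] with z' a1 a2
    rw [localExpr_chartMap a1 a2, map_add, map_smul, coordFun_coordVec, smul_eq_mul]
    rfl
  have hinv : ∀ a, (slab c r hr).formal.D iV a = 0 → hl.jetMap.pull a = σ (hF.pull a) := fun a ha =>
    pull_eq_pull_snd hF hl.jetMap (fun L => (hcj L).trans (by rw [hFy])) ha
  have hDu : ∀ L, (slab c r hr).formal.D iU (hl.coordJets L) = σ (p L) := by
    intro L
    rw [hcj, map_add, ← pull_snd_D, yp, apply_ite ((slab c r hr).formal.D iU), D_coordJet, map_zero]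
    simp [hσ]
  have hσm : ∀ a ∈ (slabX c r hr).formal.m, σ a ∈ (slab c r hr).formal.m := fun a ha => jetMap_snd.pull_mem_ideal ha
  have hGm : ∀ a b, hl.jetMap.pull (G a b) - σ (H a b) ∈ (slab c r hr).formal.m := by
    intro a b
    rw [hinv _ (hG.D_v a b), ← map_sub]
    refine hσm _ ?_
    have := hF.pull_sub_pull_mem hF₀ (k := 1) (fun L => by rw [hFy, V_one]; exact y1 L) (G a b)
    rwa [V_one] at this
  -- the derivatives tangent to `u = 0`
  have hDt : ∀ I, I ≠ iU → ∀ L, (slab c r hr).formal.D I (hl.coordJets L) - ((if L = I then 1 else 0) +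
      if L = iV then σ ((slabX c r hr).formal.D I (y₀ iV)) else 0) ∈ (slab c r hr).formal.m := by
    intro I hI L
    have h1 : hl.coordJets L - ((slab c r hr).coordJet L + if L = iV then σ (y₀ iV) else 0) ∈
        (slab c r hr).formal.m := by
      rw [hcj]
      have h2 := hσm _ (y1 L)
      rw [map_sub] at h2
      by_cases hL : L = iV
      · subst hL
        simp only [if_true]
        convert h2 using 1
        ring
      · rw [if_neg hL, if_neg hL, add_zero, add_zero]
        have h3 : σ (hF₀.pull ((slab c r hr).coordJet L)) = (slab c r hr).coordJet L := by
          refine (jetMap_snd.hasJet_pull (hF₀.hasJet_pull (hasJet_coord L))).unique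
            ((hasJet_coord  L).congr fun z _ => .of_forall fun z' => ?_)
          induction L using idx_cases with
          | hv => exact absurd rfl hL
          | hx i => rfl
          | hu => rfl
        rwa [h3] at h2
    have h2 := (slab c r hr).formal.tangential I hI _ h1
    rwa [map_sub, map_add, D_coordJet, apply_ite ((slab c r hr).formal.D I), map_zero, ← pull_snd_D] at h2
  have hm : ∀ I, pullMat hl.jetMap.pull (jacobian (slab c r hr).formal hl.coordJets) G iU I -
      (if I = iV then 1 else 0) ∈ (slab c r hr).formal.m := by
    have h1 : ∀ I (q : Idx n → (slab c r hr).Jet), (∀ b, (slab c r hr).formal.D I (hl.coordJets b) - q b ∈ (slab c r hr).formal.m) →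
        pullMat hl.jetMap.pull (jacobian (slab c r hr).formal hl.coordJets) G iU I -
          ∑ a, ∑ b, σ (N a) * q b * σ (H a b) ∈ (slab c r hr).formal.m := by
      intro I q hq
      rw [pullMat_apply]
      simp only [← sum_sub_distrib, jacobian_apply]
      refine sum_mem fun a _ => sum_mem fun b _ => mul_mul_sub_mem _ ?_ (hq b) (hGm a b)
      rw [hDu, ← map_sub]
      exact hσm _ (p1 a)
    have h2 : ∀ I, I ≠ iU → ∑ a, ∑ b, σ (N a) * ((if b = I then 1 else 0) +
        if b = iV then σ ((slabX c r hr).formal.D I (y₀ iV)) else 0) * σ (H a b) =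
        σ (∑ a, N a * H a I + (slabX c r hr).formal.D I (y₀ iV) * ∑ a, N a * H a iV) := by
      intro I _
      rw [map_add, map_mul, map_sum, map_sum, mul_sum, ← sum_add_distrib]
      refine sum_ext fun a => ?_
      simp only [mul_add, add_mul, sum_add_distrib, mul_ite, ite_mul, mul_zero, zero_mul,
        mul_one, sum_ite_eq', mem_univ, if_true, map_mul]
      ring
    intro I
    by_cases hI : I = iU
    · subst hI
      have h3 := h1 iU (fun b => σ (N b)) fun b => by rw [hDu, ← map_sub]; exact hσm _ (p1 b)
      have h4 := hσm _ N3
      simp only [map_sum, map_mul] at h4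
      simpa using add_mem h3 h4
    · have h3 := h1 I _ (hDt I hI)
      rw [h2 I hI] at h3
      have h4 : ∑ a, N a * H a I + (slabX c r hr).formal.D I (y₀ iV) * ∑ a, N a * H a iV -
          (if I = iV then 1 else 0) ∈ (slabX c r hr).formal.m := by
        have hDv : (slabX c r hr).formal.D iV (y₀ iV) = 0 := by
          obtain ⟨g, hg⟩ := (slabX c r hr).exists_hasJet (y₀ iV)
          refine (hg.dirD iV).unique ((HasJet.zero _).congr fun z _ => .of_forall fun z' => ?_)
          exact (map_zero (fderiv ℝ g z')).symm
        induction I using idx_cases with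
        | hv => simpa [hDv] using N1
        | hx i =>
          have := add_mem (N2 i)
            (mul_mem_left _ ((slabX c r hr).formal.D (idxX i) (y₀ iV)) N1)
          convert this using 1
          simp only [reduceCtorEq, if_false]
          ring
        | hu => exact absurd rfl hI
      have h5 := add_mem h3 (hσm _ h4)
      rw [map_sub] at h5
      convert h5 using 1
      split_ifs <;> simp
  have hf := hl.isFormalMap_of_normal hk hΘ hm
  have hgeo := (hf.geodesic_iff hG.symm hG.unit).2 fun L => by
    rw [hDu, ← pull_snd_D, pp, ← hσ, map_neg, neg_add_eq_zero]
    simp only [geoTerm, map_sum, map_mul, hDu]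
    refine sum_ext₂ fun a b => ?_
    rw [jetComp_eq hF hFy, hinv _ (derivation_aChr_eq_zero hG.unit
      (fun I a => (slab c r hr).formal.comm iV I a) hG.D_v L a b)]
  have hN := (hl.normalAt_iff hk).1 (normal_of_geodesic (Φ := (slab c r hr).formal)
    (isUnit_det_pullMat hG.unit hf.unit) hgeo hm)
  exact ⟨chartMap x₁ F, fun ξ hξ => ⟨hΘ ξ hξ, hN ξ hξ⟩⟩

end

section

open FormalRing Slab

/-! ### Global existence of normalizing maps -/

variable {n : ℕ} {M : Type*} [TopologicalSpace M] [ChartedSpace (𝔼 n) M] [IsManifold (𝓡 n) ∞ M]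
  {lam : ℝ} {k : 𝒯 n M} {x₁ x : M} {w χ : M → ℝ} {Θ Θ₁ : M × ℝ → 𝒳 M}

lemma localExpr_zero (x₁ : M) (Θ : M × ℝ → 𝒳 M) (y : Coord n) : localExpr x₁ x₁ (fiberMap Θ) y =
    localExpr x₁ x₁ (fiberMap Θ) (0, y.2) + y.1 • coordVec n iV := by
  rw [← localExpr_fiberMap_add]
  congr 1
  exact Prod.ext (by simp) (by simp)

lemma param_localExpr {q : M × ℝ} (hq : q.1 ∈ (𝔠 n x₁).source) (hΘ : (Θ q).2.1 ∈ (𝔠 n x₁).source) :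
    param x₁ (localExpr x₁ x₁ (fiberMap Θ) (0, 𝔠 n x₁ q.1, q.2)) = Θ q := by
  have e : fiberMap Θ (param x₁ (0, 𝔠 n x₁ q.1, q.2)) = Θ q := by
    simp only [fiberMap, param, (𝔠 n x₁).left_inv hq, zero_add]
  rw [localExpr, e, param_coords hΘ]

/-- The expression in the chart at `x₁` of the average of two maps. -/
def mixExpr (x₁ : M) (χ : M → ℝ) (Θ Θ₁ : M × ℝ → 𝒳 M) (z : 𝔼 n × ℝ) : Coord n :=
  (1 - χ ((𝔠 n x₁).symm z.1)) •
      localExpr x₁ x₁ (fiberMap Θ) (0, z) +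
    χ ((𝔠 n x₁).symm z.1) • localExpr x₁ x₁ (fiberMap Θ₁) (0, z)

lemma Adapted.eventually_source (h : Adapted n lam w Θ x) (hx : x ∈ (𝔠 n x₁).source) :
    ∀ᶠ q : M × ℝ in 𝓝 (x, 0), q.1 ∈ (𝔠 n x₁).source ∧ (Θ q).2.1 ∈ (𝔠 n x₁).source := by
  have hs := (𝔠 n x₁).open_source
  refine (continuousAt_fst.eventually (hs.mem_nhds hx)).and
    ((continuousAt_fst.comp (continuousAt_snd.comp
      h.smooth.self_of_nhds.continuousAt)).eventually (hs.mem_nhds ?_))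
  simpa only [comp_apply, h.start.self_of_nhds] using hx

/-- The average of two adapted maps. -/
lemma mixExpr_facts (h : Adapted n lam w Θ x) (h₁ : Adapted n lam w Θ₁ x) (hx : x ∈ (𝔠 n x₁).source)
    (hχ : ContMDiff (𝓡 n) 𝓘(ℝ, ℝ) ∞ χ) :
    (∀ᶠ z in 𝓝 (𝔠 n x₁ x, (0 : ℝ)), ContDiffAt ℝ ∞ (mixExpr x₁ χ Θ Θ₁) z) ∧
    (∀ᶠ ξ in 𝓝 (𝔠 n x₁ x), mixExpr x₁ χ Θ Θ₁ (ξ, 0) = (w ((𝔠 n x₁).symm ξ), ξ, 0)) ∧ Adapted n lam w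
    (chartMap (n := n) x₁ (mixExpr x₁ χ Θ Θ₁)) x := by
  set κ := 𝔠 n x₁ with hκ
  have ht := κ.map_source hx
  have hl := κ.left_inv hx
  have hc : Tendsto (fun z : 𝔼 n × ℝ => (κ.symm z.1, z.2))
      (𝓝 (κ x, 0)) (𝓝 (x, 0)) := by
    have h1 := (ContinuousAt.comp (f := Prod.fst) (x := (κ x, (0 : ℝ))) (κ.continuousAt_symm ht)
      continuousAt_fst).prodMk (continuousAt_snd (X := 𝔼 n))
    simpa [ContinuousAt, hl] using h1
  have hs : ∀ {Θ : M × ℝ → 𝒳 M}, Adapted n lam w Θ x → ∀ᶠ z in 𝓝 (κ x, (0 : ℝ)),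
      ContDiffAt ℝ ∞ (fun z => localExpr x₁ x₁ (fiberMap Θ) (0, z)) z := by
    intro Θ h
    filter_upwards [hc.eventually h.smooth, hc.eventually (h.eventually_source hx),
      continuousAt_fst.eventually (κ.open_target.mem_nhds ht)] with z a1 a2 a3
    exact ContDiffAt.comp (g := localExpr x₁ x₁ (fiberMap Θ)) (f := fun z => ((0 : ℝ), z)) z
      (contDiffAt_localExpr (y := (0, z)) a3 (contMDiffAt_fiberMap a1) a2.2)
      (contDiffAt_const.prodMk contDiffAt_id)
  have hi : ∀ {Θ : M × ℝ → 𝒳 M}, Adapted n lam w Θ x → ∀ᶠ ξ in 𝓝 (κ x),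
      localExpr x₁ x₁ (fiberMap Θ) (0, ξ, 0) = (w (κ.symm ξ), ξ, 0) := by
    intro Θ h
    have h1 := Adapted.eventually_localExpr (y := (0, κ x, 0)) (x₁ := x₁) (by rwa [← hκ, hl]) ht
    have hc : Continuous fun ξ : 𝔼 n => ((0, ξ, 0) : Coord n) := by fun_prop
    filter_upwards [(hc.tendsto (κ x)).eventually h1] with ξ a
    simpa using a rfl
  have h1 : ∀ᶠ z in 𝓝 (κ x, (0 : ℝ)), ContDiffAt ℝ ∞ (mixExpr x₁ χ Θ Θ₁) z := by
    filter_upwards [hs h, hs h₁, continuousAt_fst.eventually (κ.open_target.mem_nhds ht)]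
      with z a1 a2 a3
    have a4 : ContDiffAt ℝ ∞ (fun z : 𝔼 n × ℝ => χ (κ.symm z.1)) z := by
      refine ContDiffAt.comp (g := fun ξ => χ (κ.symm ξ)) z ?_ contDiffAt_fst
      rw [← contMDiffAt_iff_contDiffAt]
      exact ContMDiffAt.comp z.1 hχ.contMDiffAt
        ((contMDiffOn_chart_symm (I := 𝓡 n) (n := ∞)).contMDiffAt (κ.open_target.mem_nhds a3))
    exact ((contDiffAt_const.sub a4).smul a1).add (a4.smul a2)
  have h2 : ∀ᶠ ξ in 𝓝 (κ x), mixExpr x₁ χ Θ Θ₁ (ξ, 0) = (w (κ.symm ξ), ξ, 0) := by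
    filter_upwards [hi h, hi h₁] with ξ a1 a2
    rw [mixExpr, a1, a2, ← add_smul, sub_add_cancel, one_smul]
  refine ⟨h1, h2, adapted_chartMap hx h1 h2 ?_⟩
  filter_upwards [hc.eventually h.scale, hc.eventually h₁.scale] with z a1 a2
  simp only [mixExpr, localExpr, fiberMap, coords, param, Prod.snd_add, Prod.smul_snd, smul_eq_mul]
  linear_combination (1 - χ (κ.symm z.1)) * a1 + χ (κ.symm z.1) * a2

/-- The average of two adapted maps with pullbacks in normal form. -/
lemma normalAt_mix {d : 𝒳 M → ℝ} {c : 𝔼 n} {r : ℝ} {hr : 0 < r}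
    {G : Matrix (Idx n) (Idx n) (slab c r hr).Jet} {f : (slab c r hr).Jet}
    (hk : HasFormal lam k d x₁ c hr G f) (hχ : ContMDiff (𝓡 n) 𝓘(ℝ, ℝ) ∞ χ) (h : ∀ ξ ∈ closedBall c
    r, (Adapted n lam w Θ ((𝔠 n x₁).symm ξ) ∧ NormalAt k Θ ((𝔠 n x₁).symm ξ)) ∧ Adapted n lam w Θ₁
    ((𝔠 n x₁).symm ξ) ∧ NormalAt k Θ₁ ((𝔠 n x₁).symm ξ)) : ∀ ξ ∈ closedBall c r, NormalAt k
    (chartMap (n := n) x₁ (mixExpr x₁ χ Θ Θ₁)) ((𝔠 n x₁).symm ξ) := by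
  set κ := 𝔠 n x₁ with hκ
  have ha := fun ξ (hξ : ξ ∈ closedBall c r) =>
    mixExpr_facts (h ξ hξ).1.1 (h ξ hξ).2.1 (κ.map_target (hk.subset hξ)) hχ
  have l := Adapted.isLocalMap (hr := hr) hk.subset fun ξ hξ => (h ξ hξ).1.1
  have l₁ := Adapted.isLocalMap (hr := hr) hk.subset fun ξ hξ => (h ξ hξ).2.1
  have l' := Adapted.isLocalMap (hr := hr) hk.subset fun ξ hξ => (ha ξ hξ).2.2
  have e := l.coordJets_eq l₁ hk (fun ξ hξ => (h ξ hξ).1.1) (fun ξ hξ => (h ξ hξ).2.1)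
    (fun ξ hξ => (h ξ hξ).1.2) (fun ξ hξ => (h ξ hξ).2.2)
  have hχs : (slab c r hr).SmoothNear fun y => χ (κ.symm y.2.1) := by
    intro y hy
    filter_upwards [eventually_mem_target (hk.subset hy.1)] with z hz
    rw [← contMDiffAt_iff_contDiffAt]
    exact ContMDiffAt.comp (g := χ) (f := fun y : Coord n => κ.symm y.2.1) z hχ.contMDiffAt
      (contMDiffAt_fst.comp z (contMDiffAt_snd.comp z (contMDiffAt_param hz)))
  have e' : ∀ L, l'.coordJets L = l.coordJets L := by
    intro L
    have h1 := ((((HasJet.one _).sub hχs.hasJet).mul (l.hasJet_coordJets L)).add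
      (hχs.hasJet.mul (l₁.hasJet_coordJets L)))
    rw [← e L, ← add_mul, sub_add_cancel, one_mul] at h1
    refine (l'.hasJet_coordJets L).unique (h1.congr fun y hy => ?_)
    have h2 : ∀ᶠ z in 𝓝 y, (mixExpr x₁ χ Θ Θ₁ z.2).2.1 ∈ κ.target := by
      obtain ⟨b1, b2, -⟩ := ha _ hy.1
      rw [← hκ, κ.right_inv (hk.subset hy.1)] at b1 b2
      have e2 : y.2 = (y.2.1, 0) := Prod.ext rfl hy.2
      rw [← e2] at b1
      refine ((continuousAt_fst.comp continuousAt_snd).comp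
        (b1.self_of_nhds.continuousAt.comp continuousAt_snd)).eventually
        (κ.open_target.mem_nhds ?_)
      simp only [comp_apply]
      rw [e2, b2.self_of_nhds]
      exact hk.subset hy.1
    filter_upwards [eventually_mem_target (hk.subset hy.1), h2] with z a1 a2
    rw [localExpr_chartMap a1 a2, localExpr_zero x₁ Θ z, localExpr_zero x₁ Θ₁ z, mixExpr]
    simp only [map_add, map_smul, smul_eq_mul]
    ring
  refine (l'.normalAt_iff hk).1 fun I => ?_
  rw [← (l.normalAt_iff hk).2 (fun ξ hξ => (h ξ hξ).1.2) I, pullMat_apply, pullMat_apply]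
  simp only [jacobian_apply, e', l'.jetMap.pull_congr l.jetMap e']

/-- Correction of an adapted map over the support of a cutoff function. -/
lemma exists_correction {d : 𝒳 M → ℝ} {U : Set M} (hk : ∀ (c : 𝔼 n) (r : ℝ) (hr : 0 < r), closedBall
    c r ⊆ (𝔠 n x₁).target → ∃ G f, HasFormal lam k d x₁ c hr G f) (hΘ : ∀ x, Adapted n lam w Θ x)
    (hχ : ContMDiff (𝓡 n) 𝓘(ℝ, ℝ) ∞ χ) (hU : IsOpen U) (hUs : U ⊆ (𝔠 n x₁).source)
    (hχU : tsupport χ ⊆ U) (h₁ : ∀ x ∈ U, Adapted n lam w Θ₁ x ∧ NormalAt k Θ₁ x) : ∃ Θ' : M × ℝ → 𝒳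
    M, (∀ x, Adapted n lam w Θ' x) ∧ (∀ q : M × ℝ, q.1 ∉ tsupport χ → Θ' q = Θ q) ∧ ∀ x,
    ((∀ᶠ x' in 𝓝 x, NormalAt k Θ x') ∨ χ =ᶠ[𝓝 x] 1) → ∀ᶠ x' in 𝓝 x, NormalAt k Θ' x' := by
  classical
  set κ := 𝔠 n x₁
  set Θ₂ := chartMap (n := n) x₁ (mixExpr x₁ χ Θ Θ₁) with hΘ₂
  set Θ' : M × ℝ → 𝒳 M := fun q => if q.1 ∈ tsupport χ then Θ₂ q else Θ q with hΘ'
  have e1 : ∀ x ∉ tsupport χ, Θ' =ᶠ[𝓝 (x, 0)] Θ := fun x hx => by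
    filter_upwards [continuousAt_fst.eventually ((isClosed_tsupport χ).isOpen_compl.mem_nhds hx)]
      with q hq
    exact if_neg hq
  have emix : ∀ q : M × ℝ, q.1 ∈ κ.source → Θ₂ q = param x₁ ((1 - χ q.1) •
      localExpr x₁ x₁ (fiberMap Θ) (0, κ q.1, q.2) +
      χ q.1 • localExpr x₁ x₁ (fiberMap Θ₁) (0, κ q.1, q.2)) := fun q hq => by
    simp only [hΘ₂, chartMap, mixExpr]
    rw [κ.left_inv hq]
  have e2 : ∀ x ∈ U, Θ' =ᶠ[𝓝 (x, 0)] Θ₂ := fun x hx => by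
    filter_upwards [(hΘ x).eventually_source (x₁ := x₁) (hUs hx)] with q hq
    simp only [hΘ']
    split_ifs with h
    · rfl
    · rw [emix q hq.1, image_eq_zero_of_notMem_tsupport h, sub_zero, one_smul, zero_smul, add_zero,
        param_localExpr hq.1 hq.2]
  refine ⟨Θ', fun x => ?_, fun q hq => if_neg hq, fun x hx => ?_⟩
  · by_cases h : x ∈ tsupport χ
    · exact (mixExpr_facts (hΘ x) (h₁ x (hχU h)).1 (hUs (hχU h)) hχ).2.2.congr (e2 x (hχU h))
    · exact (hΘ x).congr (e1 x h)
  · by_cases hs : x ∈ tsupport χ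
    · have hxU := hχU hs
      rcases hx with hx | hx
      · obtain ⟨r, hB, hr⟩ := ((eventually_closedBall (hUs hxU) (hx.and (hU.mem_nhds hxU))).and
          self_mem_nhdsWithin).exists
        replace hr : 0 < r := hr
        obtain ⟨G, f, hf⟩ := hk (κ x) r hr fun ξ hξ => (hB ξ hξ).1
        have h2 := normalAt_mix hf hχ fun ξ hξ => ⟨⟨hΘ _, (hB ξ hξ).2.1⟩, h₁ _ (hB ξ hξ).2.2⟩
        filter_upwards [κ.open_source.mem_nhds (hUs hxU), hU.mem_nhds hxU,
          (κ.continuousAt (hUs hxU)).eventually (Metric.closedBall_mem_nhds _ hr)] with x' a1 a2 a3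
        have := h2 _ a3
        rw [κ.left_inv a1] at this
        exact this.congr (e2 x' a2)
      · filter_upwards [hx.eventually_nhds, hU.mem_nhds hxU] with x' a1 a2
        refine (h₁ x' a2).2.congr ((e2 x' a2).trans ?_)
        filter_upwards [continuousAt_fst.eventually a1,
          (h₁ x' a2).1.eventually_source (x₁ := x₁) (hUs a2)] with q b1 b2
        rw [emix q b2.1, b1, Pi.one_apply, sub_self, zero_smul, one_smul, zero_add,
          param_localExpr b2.1 b2.2]
    · rcases hx with hx | hx
      · filter_upwards [hx, (isClosed_tsupport χ).isOpen_compl.mem_nhds hs] with x' a1 a2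
        exact a1.congr (e1 x' a2)
      · have := hx.self_of_nhds
        rw [image_eq_zero_of_notMem_tsupport hs] at this
        exact absurd this (by simp)

/-- Global existence of normalizing maps. -/
lemma IsWeightedAmbient.exists_normal [T2Space M] [SecondCountableTopology M]
    {g : RiemannianMetric n M} {φ : C^∞⟮𝓡 n, M; ℝ⟯} {A : AmbientData n M}
    (hA : IsWeightedAmbient g φ lam A) (w : C^∞⟮𝓡 n, M; ℝ⟯) :
    ∃ Θ : M × ℝ → 𝒳 M, ∀ x, Adapted n lam w Θ x ∧ NormalAt A.metric Θ x := by
  have : LocallyCompactSpace M := Manifold.locallyCompact_of_finiteDimensional (𝓡 n)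
  have hk := fun x₁ (c : 𝔼 n) (r : ℝ) (hr : 0 < r)
    (hc : closedBall c r ⊆ (𝔠 n x₁).target) => hA.hasFormal x₁ hr hc
  have hloc : ∀ x₁ : M, ∃ (U : Set M) (Θ₁ : M × ℝ → 𝒳 M), IsOpen U ∧ x₁ ∈ U ∧ U ⊆ (𝔠 n x₁).source ∧
      ∀ x ∈ U, Adapted n lam w Θ₁ x ∧ NormalAt A.metric Θ₁ x := by
    intro x₁
    set κ := 𝔠 n x₁
    have hx : x₁ ∈ κ.source := _root_.mem_chart_source _ x₁
    obtain ⟨r, hr, hc⟩ := exists_closedBall_subset (κ.map_source hx)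
    obtain ⟨G, f, hf⟩ := hk x₁ (κ x₁) r hr hc
    obtain ⟨Θ₁, h₁⟩ := hf.exists_normal w
    refine ⟨κ.source ∩ κ ⁻¹' ball (κ x₁) r, Θ₁, κ.isOpen_inter_preimage isOpen_ball,
      ⟨hx, Metric.mem_ball_self hr⟩, Set.inter_subset_left, fun x hx => ?_⟩
    have := h₁ (κ x) (ball_subset_closedBall hx.2)
    rwa [κ.left_inv hx.1] at this
  choose U Θ₁ hUo hUx hUs hΘ₁ using hloc
  obtain ⟨ι, χ, hχ⟩ := SmoothBumpCovering.exists_isSubordinate (𝓡 n) (isClosed_univ (X := M))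
    (U := U) fun x _ => (hUo x).mem_nhds (hUx x)
  have : Countable ι := Set.countable_univ_iff.1
    (χ.locallyFinite.countable_univ fun i => (χ i).nonempty_support)
  obtain ⟨e, he⟩ := Countable.exists_injective_nat ι
  let T := {Θ : M × ℝ → 𝒳 M // ∀ x, Adapted n lam w Θ x}
  have hstep : ∀ (j : ℕ) (Θ : T), ∃ Θ' : T,
      (∀ q : M × ℝ, (∀ i, e i = j → q.1 ∉ tsupport (χ i)) → Θ'.1 q = Θ.1 q) ∧
      ∀ x, ((∀ᶠ x' in 𝓝 x, NormalAt A.metric Θ.1 x') ∨ ∃ i, e i = j ∧ χ i =ᶠ[𝓝 x] 1) →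
        ∀ᶠ x' in 𝓝 x, NormalAt A.metric Θ'.1 x' := by
    rintro j ⟨Θ, hΘ⟩
    by_cases hj : ∃ i, e i = j
    · obtain ⟨i, rfl⟩ := hj
      obtain ⟨Θ', a1, a2, a3⟩ := exists_correction (hk (χ.c i)) hΘ (χ i).contMDiff
        (hUo (χ.c i)) (hUs (χ.c i)) (hχ i) (hΘ₁ (χ.c i))
      refine ⟨⟨Θ', a1⟩, fun q hq => a2 q (hq i rfl), fun x hx => a3 x (hx.imp_right ?_)⟩
      rintro ⟨i', h, h'⟩
      rwa [← he h]
    · exact ⟨⟨Θ, hΘ⟩, fun _ _ => rfl, fun x hx => hx.resolve_right fun ⟨i, hi, _⟩ => hj ⟨i, hi⟩⟩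
  choose step s1 s2 using hstep
  have hw : ∀ x, Adapted n lam w (fun q : M × ℝ => (w q.1, q)) x := fun x =>
    ⟨.of_forall fun q => (w.contMDiff.contMDiffAt.comp q contMDiffAt_fst).prodMk
      contMDiffAt_id, .of_forall fun _ => rfl, .of_forall fun _ => rfl⟩
  let t : ℕ → T := fun j => Nat.rec ⟨_, hw⟩ step j
  have hfin : ∀ x, ∃ O ∈ 𝓝 x, ∃ K, ∀ j ≥ K, ∀ q : M × ℝ, q.1 ∈ O → (t j).1 q = (t K).1 q := by
    intro x
    obtain ⟨O, hO, hf⟩ := χ.locallyFinite.closure x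
    refine ⟨O, hO, hf.toFinset.sup fun i => e i + 1, fun j hj q hq => ?_⟩
    induction j, hj using Nat.le_induction with
    | base => rfl
    | succ j hj ih =>
      rw [← ih]
      refine s1 j (t j) q fun i hi hqi => ?_
      have h1 : i ∈ hf.toFinset := hf.mem_toFinset.2 ⟨q.1, hqi, hq⟩
      have h2 := (Finset.le_sup (f := fun i => e i + 1) h1).trans hj
      omega
  choose O hO K hK using hfin
  have hlim : ∀ x, ∀ j ≥ K x, ∀ q : M × ℝ, q.1 ∈ O x → (t (K q.1)).1 q = (t j).1 q := by
    intro x j hj q hq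
    rw [← hK q.1 (max (K q.1) (K x)) (le_max_left _ _) q (mem_of_mem_nhds (hO q.1)), hK x _ (le_max_right _ _) q hq, hK x j hj q hq]
  have hgerm : ∀ x, ∀ j ≥ K x, ∀ᶠ x' in 𝓝 x,
      (fun q : M × ℝ => (t (K q.1)).1 q) =ᶠ[𝓝 (x', 0)] (t j).1 := by
    intro x j hj
    filter_upwards [eventually_eventually_nhds.2 (hO x)] with x' hx'
    filter_upwards [continuousAt_fst.eventually hx'] with q hq using hlim x j hj q hq
  refine ⟨fun q => (t (K q.1)).1 q, fun x =>
    ⟨((t (K x)).2 x).congr (hgerm x _ le_rfl).self_of_nhds, ?_⟩⟩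
  set i := χ.ind x (Set.mem_univ x)
  have hn : ∀ j ≥ e i + 1, ∀ᶠ x' in 𝓝 x, NormalAt A.metric (t j).1 x' := by
    intro j hj
    induction j, hj using Nat.le_induction with
    | base => exact s2 (e i) (t (e i)) x (Or.inr ⟨i, rfl, χ.eventuallyEq_one x (Set.mem_univ x)⟩)
    | succ j hj ih => exact s2 j (t j) x (Or.inl ih)
  exact (hn (max (e i + 1) (K x)) (le_max_left _ _)).self_of_nhds.congr
    (hgerm x _ (le_max_right _ _)).self_of_nhds

end

section

/-! ### Diffeomorphisms near `u = 0` -/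

/-- A map that is the identity on a set, and locally injective there, is injective near the set. -/
lemma exists_injOn {X : Type*} [TopologicalSpace X] [TopologicalSpace.MetrizableSpace X] {Z : Set X}
    {f : X → X} (hf : ∀ z ∈ Z, f z = z) (hc : ∀ z ∈ Z, ContinuousAt f z)
    (hi : ∀ z ∈ Z, ∃ N ∈ 𝓝 z, Set.InjOn f N) : ∃ W, IsOpen W ∧ Z ⊆ W ∧ Set.InjOn f W := by
  let := TopologicalSpace.metrizableSpaceMetric X
  have h : ∀ z : Z, ∃ r > 0, Set.InjOn f (ball z (3 * r)) := fun z => by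
    obtain ⟨N, hN, h⟩ := hi z z.2
    obtain ⟨r, hr, hb⟩ := Metric.mem_nhds_iff.1 hN
    exact ⟨r / 3, by positivity, h.mono (by rwa [mul_div_cancel₀ r (by norm_num)])⟩
  choose r hr hi using h
  let O : Z → Set X := fun z => ball z (r z) ∩ f ⁻¹' ball z (r z)
  refine ⟨⋃ z, interior (O z), isOpen_iUnion fun _ => isOpen_interior, fun z hz =>
    Set.mem_iUnion.2 ⟨⟨z, hz⟩, mem_interior_iff_mem_nhds.2 (Filter.inter_mem
      (Metric.ball_mem_nhds _ (hr _)) (hc z hz (by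
        rw [hf z hz]; exact Metric.ball_mem_nhds _ (hr ⟨z, hz⟩))))⟩, ?_⟩
  have key : ∀ z z' : Z, r z' ≤ r z → ∀ p ∈ O z, ∀ p' ∈ O z', f p = f p' → p = p' := by
    rintro z z' hz p ⟨h1, h2⟩ p' ⟨h3, h4⟩ e
    simp only [Set.mem_preimage, Metric.mem_ball] at h1 h2 h3 h4
    refine hi z (Metric.mem_ball.2 (h1.trans (by linarith [hr z]))) (Metric.mem_ball.2 ?_) e
    rw [e] at h2
    have h5 := dist_triangle p' z' z
    have h6 := dist_triangle_left (z' : X) z (f p')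
    linarith
  intro p hp p' hp' e
  obtain ⟨z, hz⟩ := Set.mem_iUnion.1 hp
  obtain ⟨z', hz'⟩ := Set.mem_iUnion.1 hp'
  rcases le_total (r z') (r z) with h | h
  · exact key z z' h p (interior_subset hz) p' (interior_subset hz') e
  · exact (key z' z h p' (interior_subset hz') p (interior_subset hz) e.symm).symm

variable {n : ℕ} {M : Type*} [TopologicalSpace M] [ChartedSpace (𝔼 n) M] [IsManifold (𝓡 n) ∞ M]
  {lam : ℝ} {w : M → ℝ} {Θ : M × ℝ → 𝒳 M}

/-- The inverse function theorem for the map `M × ℝ → M × ℝ` induced by an adapted map. -/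
lemma Adapted.exists_inverse {x : M} (h : Adapted n lam w Θ x)
    (hi : ∀ a, fderiv ℝ (localExpr x x (fiberMap Θ)) (0, 𝔠 n x x, 0) a = 0 → a = 0) :
    (∃ N ∈ 𝓝 (x, (0 : ℝ)), Set.InjOn (fun q => (Θ q).2) N) ∧ ∀ᶠ q in 𝓝 (x, (0 : ℝ)), ∃ η : M × ℝ → M
    × ℝ, η (Θ q).2 = q ∧ ContMDiffAt (𝓡₁ n) (𝓡₁ n) ∞ η (Θ q).2 ∧ ∀ᶠ z in 𝓝 (Θ q).2, (Θ (η z)).2 = z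
    := by
  set κ := 𝔠 n x
  have hx : x ∈ κ.source := _root_.mem_chart_source _ x
  set F : 𝔼 n × ℝ → 𝔼 n × ℝ := fun z => (localExpr x x (fiberMap Θ) (0, z)).2
  have hFq : ∀ q : M × ℝ, q.1 ∈ κ.source → F (κ q.1, q.2) = (κ (Θ q).2.1, (Θ q).2.2) := by
    intro q hq
    simp only [F, localExpr, fiberMap, param, coords]
    rw [κ.left_inv hq]
  have hs : ∀ q : M × ℝ, q.1 ∈ κ.source → ContMDiffAt (𝓡₁ n) (model n) ∞ Θ q →
      (Θ q).2.1 ∈ κ.source → ContDiffAt ℝ ∞ (localExpr x x (fiberMap Θ)) (0, κ q.1, q.2) := by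
    intro q h1 h2 h3
    have e : (param x ((0, κ q.1, q.2) : Coord n)).2 = q := Prod.ext (κ.left_inv h1) rfl
    exact contDiffAt_localExpr (κ.map_source h1) (contMDiffAt_fiberMap (by rwa [e]))
      (by rw [fiberMap, e]; exact h3)
  have hF : ∀ {z}, ContDiffAt ℝ ∞ (localExpr x x (fiberMap Θ)) (0, z) → ContDiffAt ℝ ∞ F z :=
    fun hz => contDiffAt_snd.comp _ (ContDiffAt.comp (f := fun z => ((0 : ℝ), z)) _ hz
      (contDiffAt_const.prodMk contDiffAt_id))
  have hev := h.eventually_source (x₁ := x) hx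
  have h0 := hs (x, 0) hx h.smooth.self_of_nhds hev.self_of_nhds.2
  -- the derivative at the base point
  have hd := differentiableAt_of_smooth h0
  have hinj : Injective (fderiv ℝ F (κ x, 0)).toLinearMap := by
    refine (injective_iff_map_eq_zero _).2 fun b hb => ?_
    have e1 : HasFDerivAt F ((sndL ℝ ℝ _).comp
        ((fderiv ℝ (localExpr x x (fiberMap Θ)) (0, κ x, 0)).comp
          (ContinuousLinearMap.inr ℝ ℝ _))) (κ x, 0) := (sndL ℝ ℝ (𝔼 n × ℝ)).hasFDerivAt.comp _
        (hd.hasFDerivAt.comp _ (hasFDerivAt_prodMk_right (0 : ℝ) (κ x, (0 : ℝ))))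
    rw [e1.fderiv] at hb
    set T := fderiv ℝ (localExpr (n := n) x x (fiberMap Θ)) (0, κ x, 0)
    have e2 := hi ((0, b) - (T (0, b)).1 • coordVec n iV) (by
      rw [map_sub, map_smul, fderiv_localExpr_v hd]
      exact Prod.ext (by simp [coordVec]) (by simpa [coordVec, Prod.mk_zero_zero] using hb))
    simpa [coordVec, Prod.mk_zero_zero] using congrArg Prod.snd e2
  set f₀ := (LinearEquiv.ofInjectiveEndo _ hinj).toContinuousLinearEquiv
  have hf₀ : (f₀ : 𝔼 n × ℝ →L[ℝ] 𝔼 n × ℝ) = fderiv ℝ F (κ x, 0) := by ext1 <;> rfl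
  have hc : Tendsto (fun q : M × ℝ => (κ q.1, q.2)) (𝓝 (x, 0)) (𝓝 (κ x, 0)) :=
    (ContinuousAt.comp (f := Prod.fst) (x := (x, (0 : ℝ))) (κ.continuousAt hx)
      continuousAt_fst).prodMk continuousAt_snd
  constructor
  · have h1 := (hF h0).hasStrictFDerivAt' (f' := (f₀ : _ →L[ℝ] _)) (by
      rw [hf₀]; exact (differentiableAt_of_smooth (hF h0)).hasFDerivAt) (by simp)
    set e := h1.toOpenPartialHomeomorph F
    refine ⟨_, hev.and (hc.eventually (e.open_source.mem_nhds
      h1.mem_toOpenPartialHomeomorph_source)), fun q hq q' hq' hqq => ?_⟩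
    have h2 := e.injOn hq.2 hq'.2 (by
      change F _ = F _
      rw [hFq q hq.1.1, hFq q' hq'.1.1, show (Θ q).2 = (Θ q').2 from hqq])
    exact Prod.ext (κ.injOn hq.1.1 hq'.1.1 (Prod.mk.inj h2).1) (Prod.mk.inj h2).2
  · have h1 := ((hF h0).continuousAt_fderiv (by simp)).eventually
      (by rw [← hf₀]; exact ContinuousLinearEquiv.nhds f₀)
    filter_upwards [hev, h.smooth, hc.eventually h1] with q a1 a2 a3
    obtain ⟨f', hf'⟩ := a3
    have b1 := hF (hs q a1.1 a2 a1.2)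
    have b2 : HasFDerivAt F (f' : _ →L[ℝ] _) (κ q.1, q.2) := by
      rw [hf']; exact (differentiableAt_of_smooth b1).hasFDerivAt
    have b3 := b1.hasStrictFDerivAt' b2 (by simp)
    set g := b1.localInverse b2 (by simp)
    have g1 : g (F (κ q.1, q.2)) = (κ q.1, q.2) := b3.localInverse_apply_image
    have g2 : ContDiffAt ℝ ∞ g (F (κ q.1, q.2)) := b1.to_localInverse b2 (by simp)
    have g3 : ∀ᶠ z in 𝓝 (F (κ q.1, q.2)), F (g z) = z := b3.eventually_right_inverse
    rw [hFq q a1.1] at g1 g2 g3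
    set η : M × ℝ → M × ℝ := fun q => (chartMap x (fun z => ((0 : ℝ), g z)) q).2 with hη
    have hη' : ∀ z, η z = (κ.symm (g (κ z.1, z.2)).1, (g (κ z.1, z.2)).2) := fun z => rfl
    have c1 : η (Θ q).2 = q := by rw [hη', g1]; exact Prod.ext (κ.left_inv a1.1) rfl
    have c2 : ContMDiffAt (𝓡₁ n) (𝓡₁ n) ∞ η (Θ q).2 :=
      contMDiffAt_snd.comp _ (contMDiffAt_chartMap a1.2 (contDiffAt_const.prodMk g2)
        (by rw [g1]; exact κ.map_source a1.1))
    refine ⟨η, c1, c2, ?_⟩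
    have c3 : Tendsto (fun z : M × ℝ => (κ z.1, z.2)) (𝓝 (Θ q).2)
        (𝓝 (κ (Θ q).2.1, (Θ q).2.2)) := (ContinuousAt.comp (f := Prod.fst) (κ.continuousAt a1.2)
        continuousAt_fst).prodMk continuousAt_snd
    have c4 : Tendsto (fun z => (Θ (η z)).2.1) (𝓝 (Θ q).2) (𝓝 (Θ q).2.1) := by
      have := a2.continuousAt
      rw [← c1] at this
      have h5 := continuousAt_fst.comp (continuousAt_snd.comp
        (ContinuousAt.comp this c2.continuousAt))
      simpa only [ContinuousAt, Function.comp_def, c1] using h5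
    have c5 : ∀ᶠ z in 𝓝 (Θ q).2, (g (κ z.1, z.2)).1 ∈ κ.target :=
      (c3.eventually (continuousAt_fst.comp g2.continuousAt |>.eventually
        (κ.open_target.mem_nhds (by simp only [comp_apply, g1]; exact κ.map_source a1.1))))
    filter_upwards [c3.eventually g3, c4.eventually (κ.open_source.mem_nhds a1.2),
      continuousAt_fst.eventually (κ.open_source.mem_nhds a1.2), c5] with z d1 d2 d3 d4
    have d5 := hFq (η z) (κ.map_target d4)
    have d6 : (κ (η z).1, (η z).2) = g (κ z.1, z.2) := Prod.ext (κ.right_inv d4) rfl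
    rw [d6, d1] at d5
    exact Prod.ext (κ.injOn d2 d3 (congrArg Prod.fst d5).symm) (congrArg Prod.snd d5).symm

/-- An adapted map that is a local diffeomorphism along `u = 0` is a diffeomorphism near `u = 0`. -/
lemma exists_openPartialHomeomorph [T2Space M] [SecondCountableTopology M]
    (h : ∀ x, Adapted n lam w Θ x)
    (hi : ∀ x a, fderiv ℝ (localExpr x x (fiberMap Θ)) (0, 𝔠 n x x, 0) a = 0 → a = 0)
    {P : M × ℝ → Prop} (hP : ∀ x, ∀ᶠ q in 𝓝 (x, 0), P q) : ∃ (ψ : OpenPartialHomeomorph (𝒳 M) (𝒳 M))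
    (Θ' : M × ℝ → 𝒳 M) (W W' : Set (M × ℝ)), ⇑ψ = fiberMap Θ ∧ ⇑ψ.symm = fiberMap Θ' ∧ ψ.source =
    Prod.snd ⁻¹' W ∧ ψ.target = Prod.snd ⁻¹' W' ∧ (∀ x, (x, 0) ∈ W) ∧ (∀ q ∈ W, P q) ∧ ContMDiffOn
    (model n) (model n) ∞ ψ ψ.source ∧ ContMDiffOn (model n) (model n) ∞ ψ.symm ψ.target := by
  have : LocallyCompactSpace M := Manifold.locallyCompact_of_finiteDimensional (𝓡 n)
  have hz : ∀ z ∈ Set.range fun x : M => (x, (0 : ℝ)), (Θ z).2 = z := by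
    rintro _ ⟨x, rfl⟩
    simp only [(h x).start.self_of_nhds]
  obtain ⟨W₀, o1, o2, o3⟩ := exists_injOn (f := fun q => (Θ q).2) hz
    (by rintro _ ⟨x, rfl⟩
        exact continuousAt_snd.comp (h x).smooth.self_of_nhds.continuousAt)
    (by rintro _ ⟨x, rfl⟩; exact ((h x).exists_inverse (hi x)).1)
  let R : M × ℝ → Prop := fun q => (P q ∧ ContMDiffAt (𝓡₁ n) (model n) ∞ Θ q) ∧
    ∃ η : M × ℝ → M × ℝ, η (Θ q).2 = q ∧ ContMDiffAt (𝓡₁ n) (𝓡₁ n) ∞ η (Θ q).2 ∧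
      ∀ᶠ z in 𝓝 (Θ q).2, (Θ (η z)).2 = z
  set W := W₀ ∩ interior {q | R q} with hW
  have hWo : IsOpen W := o1.inter isOpen_interior
  have hWR : ∀ q ∈ W, R q := fun q hq => show q ∈ {q | R q} from interior_subset hq.2
  have hWx : ∀ x, (x, 0) ∈ W := fun x => ⟨o2 ⟨x, rfl⟩, mem_interior_iff_mem_nhds.2
    (((hP x).and (h x).smooth).and ((h x).exists_inverse (hi x)).2)⟩
  have hinj : Set.InjOn (fun q => (Θ q).2) W := o3.mono Set.inter_subset_left
  set W' := (fun q => (Θ q).2) '' W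
  have hne : ∀ z ∈ W', ∃ q ∈ W, (Θ q).2 = z := fun z hz => hz
  classical
  let inv : M × ℝ → M × ℝ := fun z => if hz : z ∈ W' then (hne z hz).choose else z
  have inv1 : ∀ q ∈ W, inv (Θ q).2 = q := fun q hq => by
    have hz : (Θ q).2 ∈ W' := ⟨q, hq, rfl⟩
    simp only [inv, dif_pos hz]
    exact hinj (hne _ hz).choose_spec.1 hq (hne _ hz).choose_spec.2
  have hloc : ∀ q ∈ W, W' ∈ 𝓝 (Θ q).2 ∧ ContMDiffAt (𝓡₁ n) (𝓡₁ n) ∞ inv (Θ q).2 := by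
    intro q hq
    obtain ⟨-, η, e1, e2, e3⟩ := hWR q hq
    have e4 : ∀ᶠ z in 𝓝 (Θ q).2, η z ∈ W := e2.continuousAt.eventually (hWo.mem_nhds (by rwa [e1]))
    refine ⟨by filter_upwards [e3, e4] with z a1 a2 using ⟨η z, a2, a1⟩,
      e2.congr_of_eventuallyEq ?_⟩
    filter_upwards [e3, e4] with z a1 a2
    have := inv1 _ a2
    rwa [a1] at this
  have hW'o : IsOpen W' := isOpen_iff_mem_nhds.2 (by rintro _ ⟨q, hq, rfl⟩; exact (hloc q hq).1)
  let Θ' : M × ℝ → 𝒳 M := fun z => (-(Θ (inv z)).1, inv z)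
  have s1 : ContMDiffOn (model n) (model n) ∞ (fiberMap Θ) (Prod.snd ⁻¹' W) := fun p hp =>
    (contMDiffAt_fiberMap (hWR _ hp).1.2).contMDiffWithinAt
  have s2 : ContMDiffOn (model n) (model n) ∞ (fiberMap Θ') (Prod.snd ⁻¹' W') := by
    rintro ⟨v, _⟩ ⟨q, hq, rfl⟩
    have a1 := (hloc q hq).2
    have a2 : ContMDiffAt (𝓡₁ n) (model n) ∞ (fun z => Θ (inv z)) (Θ q).2 :=
      ContMDiffAt.comp (g := Θ) _ (by rw [inv1 q hq]; exact (hWR q hq).1.2) a1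
    exact (contMDiffAt_fiberMap (Θ := Θ') (p := (v, (Θ q).2))
      ((contMDiffAt_fst.comp _ a2).neg.prodMk a1)).contMDiffWithinAt
  exact ⟨{
    toFun := fiberMap Θ
    invFun := fiberMap Θ'
    source := Prod.snd ⁻¹' W
    target := Prod.snd ⁻¹' W'
    map_source' := fun p hp => ⟨p.2, hp, rfl⟩
    map_target' := by
      rintro ⟨v, _⟩ ⟨q, hq, rfl⟩
      simp only [fiberMap, Θ', Set.mem_preimage, inv1 q hq]
      exact hq
    left_inv' := fun p hp => by simp [fiberMap, Θ', inv1 _ hp]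
    right_inv' := by
      rintro ⟨v, _⟩ ⟨q, hq, rfl⟩
      simp [fiberMap, Θ', inv1 q hq]
    open_source := hWo.preimage continuous_snd
    open_target := hW'o.preimage continuous_snd
    continuousOn_toFun := s1.continuousOn
    continuousOn_invFun := s2.continuousOn }, Θ', W, W', rfl, rfl, rfl, rfl, hWx,
    fun q hq => (hWR q hq).1.1, s1, s2⟩

end

section

/-! ### Ambient-equivalence -/

section Equivalence

open Slab

variable {n : ℕ} {M : Type*} [TopologicalSpace M] [ChartedSpace (𝔼 n) M] [IsManifold (𝓡 n) ∞ M]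
  {lam : ℝ} {w : M → ℝ} {Θ : M × ℝ → 𝒳 M} {g : RiemannianMetric n M} {φ φ₁ φ₂ : C^∞⟮𝓡 n, M; ℝ⟯}
  {A A₁ A₂ : AmbientData n M} {k : 𝒯 n M} {ψ χ : 𝒳 M → 𝒳 M} {p : 𝒳 M}

lemma pullback_pullbackForm (hχ : MDifferentiableAt (model n) (model n) χ p)
    (hψ : MDifferentiableAt (model n) (model n) ψ (χ p)) (a b : TangentSpace (model n) p) : pullback
    (model n) (model n) χ (pullbackForm ψ k) p a b = pullback (model n) (model n) (ψ ∘ χ) k p a b :=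
    by
  have e : ∀ a : Coord n, dmap (ψ ∘ χ) p a = dmap ψ (χ p) (dmap χ p a) := fun a =>
    congrArg (fun T : Coord n →L[ℝ] Coord n => T a) (mfderiv_comp p hψ hχ)
  change formAt (pullbackForm ψ k) (χ p) (dmap χ p a) (dmap χ p b) =
    formAt k (ψ (χ p)) (dmap (ψ ∘ χ) p a) (dmap (ψ ∘ χ) p b)
  rw [formAt_pullbackForm]
  exact formAt_congr rfl (e a).symm (e b).symm

lemma pullback_of_eventuallyEq_id (h : ψ =ᶠ[𝓝 p] id) (a b : TangentSpace (model n) p) :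
    k p a b = pullback (model n) (model n) ψ k p a b := by
  have e : ∀ a : Coord n, (show Coord n from mfderiv (model n) (model n) ψ p a) = a := by
    intro a
    rw [h.mfderiv_eq, mfderiv_id]; rfl
  exact (formAt_congr (k := k) h.self_of_nhds (e a) (e b)).symm

variable {x₀ : M} {c : 𝔼 n} {r : ℝ}

/-- The jets of a weighted ambient space that has been put in normal form. -/
lemma IsWeightedAmbient.hasFormal_normal (hA : IsWeightedAmbient g φ lam A)
    (hΘ : ∀ x, Adapted n lam w Θ x ∧ NormalAt A.metric Θ x) (hr : 0 < r)
    (hc : closedBall c r ⊆ (𝔠 n x₀).target) : (∃ G f, HasFormal lam (pullbackForm (fiberMap Θ)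
    A.metric) (fun p => A.density (fiberMap Θ p)) x₀ c hr G f ∧ ∀ I, G iU I = if I = iV then 1 else
    0) ∧ (∀ y ∈ (slab c r hr).S, ∀ i j, components x₀ (fun p a b => pullbackForm (fiberMap Θ)
    A.metric p a b) y (idxX i) (idxX j) = g.inner (param x₀ y).2.1 (dchart x₀ y.2.1 (coordVec n
    (idxX i)).2.1) (dchart x₀ y.2.1 (coordVec n (idxX j)).2.1)) ∧ ∀ y ∈ (slab c r hr).S, ∀ a, fderiv
    ℝ (localExpr x₀ x₀ (fiberMap Θ)) y a = 0 → a = 0 := by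
  obtain ⟨G, f, H⟩ := hA.hasFormal x₀ hr hc
  have L := Adapted.isLocalMap (hr := hr) hc fun ξ _ => (hΘ ((𝔠 n x₀).symm ξ)).1
  have hN := (L.normalAt_iff H).2 fun ξ _ => (hΘ _).2
  have hN' : ∀ I, pullMat L.jetMap.pull (jacobian (slab c r hr).formal L.coordJets) G iU I -
      (if I = iV then 1 else 0) ∈ (slab c r hr).formal.m := fun I => by
    rw [hN, sub_self]; exact zero_mem _
  refine ⟨⟨_, _, ⟨hc, L.hasJets_pullbackForm H, ?_, H.ambient.pull
    (L.isFormalMap_of_normal H (fun ξ _ => (hΘ _).1) hN')⟩, hN⟩, fun y hy i j => ?_,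
    fun y hy a => L.injective H (fun ξ _ => (hΘ _).1) hN' hy a⟩
  · refine (L.jetMap.hasJet_pull H.density).congr fun y hy => ?_
    filter_upwards [L.eventually hy] with z hz
    exact congrArg A.density (param_coords hz.2.2)
  · have hz := (L.eventually hy).self_of_nhds
    refine (pullback_dparam A.metric hz.1 (hz.2.1.mdifferentiableAt (by simp)) hz.2.2 _ _).trans ?_
    have hl := ((hΘ _).1.eventually_localExpr hz.1).self_of_nhds hy.2
    have hd := L.differentiableAt hy
    set T := fderiv ℝ (localExpr (n := n) x₀ x₀ (fiberMap Θ)) y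
    have hT : ∀ i, (T (coordVec n (idxX i))).2 = (coordVec n (idxX i)).2 := fun i =>
      (hΘ _).1.fderiv_snd (hc hy.1) hy.2 hd rfl
    have h1 := hA.metric_zero (localExpr x₀ x₀ (fiberMap Θ) y).1 (param x₀ y).2.1
      ((T (coordVec n (idxX i))).1, dchart x₀ y.2.1 (coordVec n (idxX i)).2.1)
      ((T (coordVec n (idxX j))).1, dchart x₀ y.2.1 (coordVec n (idxX j)).2.1)
    rw [pullForm_apply, ← h1]
    have e : ∀ i, dparam x₀ (localExpr x₀ x₀ (fiberMap Θ) y) (T (coordVec n (idxX i))) =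
        ((T (coordVec n (idxX i))).1, dchart x₀ y.2.1 (coordVec n (idxX i)).2.1, 0) := fun i => by
      rw [dparam_apply (y := localExpr x₀ x₀ (fiberMap Θ) y) (by rw [hl]; exact hc hy.1), hT, hl]
      rfl
    refine formAt_congr ?_ (e i) (e j)
    rw [hl]; rfl

/-- Two weighted ambient spaces put in normal form agree to infinite order. -/
lemma exists_hasFormal_normal {w₁ w₂ : M → ℝ} {Θ₁ Θ₂ : M × ℝ → 𝒳 M}
    (h₁ : IsWeightedAmbient g φ₁ lam A₁) (h₂ : IsWeightedAmbient g φ₂ lam A₂)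
    (hΘ₁ : ∀ x, Adapted n lam w₁ Θ₁ x ∧ NormalAt A₁.metric Θ₁ x)
    (hΘ₂ : ∀ x, Adapted n lam w₂ Θ₂ x ∧ NormalAt A₂.metric Θ₂ x)
    (hw : ∀ x, φ₁ x - w₁ x = φ₂ x - w₂ x) (hr : 0 < r) (hc : closedBall c r ⊆ (𝔠 n x₀).target) : ∃ G
    f, HasFormal lam (pullbackForm (fiberMap Θ₁) A₁.metric) (fun p => A₁.density (fiberMap Θ₁ p)) x₀
    c hr G f ∧ HasFormal lam (pullbackForm (fiberMap Θ₂) A₂.metric)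
    (fun p => A₂.density (fiberMap Θ₂ p)) x₀ c hr G f := by
  obtain ⟨⟨G₁, f₁, H₁, N₁⟩, I₁, -⟩ := h₁.hasFormal_normal hΘ₁ hr hc
  obtain ⟨⟨G₂, f₂, H₂, N₂⟩, I₂, -⟩ := h₂.hasFormal_normal hΘ₂ hr hc
  obtain ⟨rfl, rfl⟩ := IsFormalAmbient.unique H₁.ambient H₂.ambient N₁ N₂ (fun i j => by
      refine ((H₂.metric _ _).sub (H₁.metric _ _)).mem_ideal_iff.2 fun y hy => ?_
      rw [I₁ y hy, I₂ y hy, sub_self]) (by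
      refine (H₂.density.sub H₁.density).mem_ideal_iff.2 fun y hy => ?_
      simp only [fiberMap, param, hy.2, (hΘ₁ _).1.start.self_of_nhds, (hΘ₂ _).1.start.self_of_nhds,
        h₁.initial_density, h₂.initial_density]
      linear_combination -hw _)
  exact ⟨_, _, H₁, H₂⟩

lemma IsWeightedAmbient.injective_normal (hA : IsWeightedAmbient g φ lam A)
    (hΘ : ∀ x, Adapted n lam w Θ x ∧ NormalAt A.metric Θ x) (x : M) (a : Coord n) :
    fderiv ℝ (localExpr x x (fiberMap Θ)) (0, 𝔠 n x x, 0) a = 0 → a = 0 := by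
  obtain ⟨r, hr, hc⟩ := exists_closedBall_subset (mem_chart_target (𝔼 n) x)
  exact (hA.hasFormal_normal hΘ hr hc).2.2 _ ⟨mem_closedBall_self hr.le, rfl⟩ a

lemma Adapted.eventually_mem {x : M} (h : Adapted n lam w Θ x) (hA : IsWeightedAmbient g φ lam A) :
    ∀ᶠ q in 𝓝 (x, 0), (0, (Θ q).2) ∈ A.carrier ∧ lam * (Θ q).2.2 = lam * q.2 := by
  have h1 : ContinuousAt (fun q => ((0 : ℝ), (Θ q).2)) (x, 0) :=
    continuousAt_const.prodMk (continuousAt_snd.comp h.smooth.self_of_nhds.continuousAt)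
  refine (h1.eventually (hA.isOpen.mem_nhds ?_)).and h.scale
  simp only [h.start.self_of_nhds]
  exact hA.zero_mem 0 x

lemma fiberMap_dilation {s : ℝ} (h : lam * (Θ p.2).2.2 = lam * p.2.2) :
    fiberMap Θ (dilation lam s p) = dilation lam s (fiberMap Θ p) := by
  simp only [fiberMap, dilation, Prod.mk.eta, h]
  rw [add_right_comm]

/-- Any two weighted ambient spaces are ambient-equivalent. -/
lemma ambientEquivalent [T2Space M] [SecondCountableTopology M] (h₁ : IsWeightedAmbient g φ₁ lam A₁)
    (h₂ : IsWeightedAmbient g φ₂ lam A₂) : AmbientEquivalent φ₁ φ₂ lam A₁ A₂ := by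
  obtain ⟨Θ₁, hΘ₁⟩ := h₁.exists_normal 0
  obtain ⟨Θ₂, hΘ₂⟩ := h₂.exists_normal (φ₂ - φ₁)
  have start₁ : ∀ x, Θ₁ (x, 0) = (0, x, 0) := fun x => (hΘ₁ x).1.start.self_of_nhds
  have start₂ : ∀ x, Θ₂ (x, 0) = (φ₂ x - φ₁ x, x, 0) := fun x => (hΘ₂ x).1.start.self_of_nhds
  obtain ⟨ψ₁, Θ', W₁, W₁', e₁, e₁', s₁, t₁, z₁, P₁, c₁, c₁'⟩ :=
    exists_openPartialHomeomorph (fun x => (hΘ₁ x).1) (h₁.injective_normal hΘ₁)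
      fun x => (hΘ₁ x).1.eventually_mem h₁
  obtain ⟨ψ₂, Θ'', W₂, W₂', e₂, e₂', s₂, t₂, z₂, P₂, c₂, c₂'⟩ :=
    exists_openPartialHomeomorph (fun x => (hΘ₂ x).1) (h₂.injective_normal hΘ₂)
      fun x => (hΘ₂ x).1.eventually_mem h₂
  have zs₁ : ∀ v x, (v, x, (0 : ℝ)) ∈ ψ₁.source := fun v x => by rw [s₁]; exact z₁ x
  have zs₂ : ∀ v x, (v, x, (0 : ℝ)) ∈ ψ₂.source := fun v x => by rw [s₂]; exact z₂ x
  have p₁ : ∀ v x, ψ₁ (v, x, (0 : ℝ)) = (v, x, 0) := fun v x => by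
    rw [e₁, fiberMap, start₁, add_zero]
  have p₂ : ∀ v x, ψ₂ (v, x, (0 : ℝ)) = (v + (φ₂ x - φ₁ x), x, 0) := fun v x => by
    rw [e₂, fiberMap, start₂]
  have i₁ : ∀ v x, ψ₁.symm (v, x, (0 : ℝ)) = (v, x, 0) := fun v x => by
    rw [← p₁, ψ₁.left_inv (zs₁ v x), p₁]
  have zt₁ : ∀ v x, (v, x, (0 : ℝ)) ∈ ψ₁.target := fun v x => by
    rw [← p₁]; exact ψ₁.map_source (zs₁ v x)
  -- the maps shift `v` equivariantly and preserve `λ u`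
  have car : ∀ {A : AmbientData n M} {φ : C^∞⟮𝓡 n, M; ℝ⟯}, IsWeightedAmbient g φ lam A →
      ∀ {p : 𝒳 M}, (0, p.2) ∈ A.carrier → p ∈ A.carrier := fun hA p hp => by
    simpa using hA.translate_mem hp p.1
  set ψ := ψ₁.symm.trans ψ₂ with hψ
  have hs : ∀ p, p ∈ ψ.source ↔ p ∈ ψ₁.target ∧ ψ₁.symm p ∈ ψ₂.source := fun p => by
    rw [hψ, OpenPartialHomeomorph.trans_source]; rfl
  have ht : ∀ p, p ∈ ψ.target ↔ p ∈ ψ₂.target ∧ ψ₂.symm p ∈ ψ₁.source := fun p => by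
    rw [hψ, OpenPartialHomeomorph.trans_target]; rfl
  have hψa : ∀ p, ψ p = ψ₂ (ψ₁.symm p) := fun _ => rfl
  have sub₁ : ∀ p ∈ ψ₁.target, p ∈ A₁.carrier ∧ lam * (ψ₁.symm p).2.2 = lam * p.2.2 := by
    intro p hp
    have h3 := ψ₁.map_target hp
    rw [s₁] at h3
    have h4 := P₁ _ h3
    have h5 := ψ₁.right_inv hp
    rw [e₁] at h5
    have h6 := congrArg Prod.snd h5
    rw [show (Θ₁ (ψ₁.symm p).2).2 = p.2 from h6] at h4
    exact ⟨car h₁ h4.1, h4.2.symm⟩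
  have sub₂ : ∀ p ∈ ψ₂.target, p ∈ A₂.carrier := by
    intro p hp
    have h3 := ψ₂.map_target hp
    rw [s₂] at h3
    have h4 := P₂ _ h3
    have h5 := ψ₂.right_inv hp
    rw [e₂] at h5
    have h6 := congrArg Prod.snd h5
    rw [show (Θ₂ (ψ₂.symm p).2).2 = p.2 from h6] at h4
    exact car h₂ h4.1
  have zψ : ∀ v x, (v, x, (0 : ℝ)) ∈ ψ.source := fun v x =>
    (hs _).2 ⟨zt₁ v x, by rw [i₁]; exact zs₂ v x⟩
  have pψ : ∀ v x, ψ (v, x, (0 : ℝ)) = (v + (φ₂ x - φ₁ x), x, 0) := fun v x => by rw [hψa, i₁, p₂]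
  have cψ : ContMDiffOn (model n) (model n) ∞ ψ ψ.source := fun p hp =>
    ((c₂.contMDiffAt (ψ₂.open_source.mem_nhds ((hs p).1 hp).2)).comp p
      (c₁'.contMDiffAt (ψ₁.open_target.mem_nhds ((hs p).1 hp).1))).contMDiffWithinAt
  have cψ' : ContMDiffOn (model n) (model n) ∞ ψ.symm ψ.target := fun p hp =>
    ((c₁.contMDiffAt (ψ₁.open_source.mem_nhds ((ht p).1 hp).2)).comp p
      (c₂'.contMDiffAt (ψ₂.open_target.mem_nhds ((ht p).1 hp).1))).contMDiffWithinAt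
  -- the jets along `u = 0`
  have key : ∀ x₀ : M, ∀ ξ ∈ (𝔠 n x₀).target, ∃ r, ∃ hr : 0 < r,
      ∃ G f, (slab ξ r hr).HasJets (components x₀ fun p a b => A₁.metric p a b) G ∧
        (slab ξ r hr).HasJets (components x₀ fun p a b => pullbackForm ψ A₂.metric p a b) G ∧
        (slab ξ r hr).HasJet (fun y => A₁.density (param x₀ y)) f ∧
        (slab ξ r hr).HasJet (fun y => A₂.density (ψ (param x₀ y))) f := by
    intro x₀ ξ hξ
    obtain ⟨r, hr, hc⟩ := exists_closedBall_subset hξ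
    obtain ⟨G, f, H₁, H₂⟩ := exists_hasFormal_normal h₁ h₂ hΘ₁ hΘ₂ (fun x => by simp) hr hc
    have hp : ∀ y ∈ (slab ξ r hr).S, ∀ᶠ p in 𝓝 (param x₀ y), p ∈ ψ.source := fun y hy =>
      ψ.open_source.mem_nhds (by rw [param, hy.2]; exact zψ _ _)
    have L : IsLocalMap x₀ x₀ ξ ξ hr hr ψ₁.symm :=
      { subset := hc
        smooth := fun y hy => (hp y hy).mono fun p hp =>
          c₁'.contMDiffAt (ψ₁.open_target.mem_nhds ((hs p).1 hp).1)
        source := fun y hy => by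
          rw [param, hy.2, i₁]
          exact (𝔠 n x₀).map_target (hc hy.1)
        maps := fun y hy => by
          rw [localExpr, show ψ₁.symm (param x₀ y) = param x₀ y by rw [param, hy.2, i₁],
            coords_param (hc hy.1)]
          exact hy }
    have hj : ∀ {p}, p ∈ ψ.source → MDifferentiableAt (model n) (model n) ψ₁.symm p ∧
        MDifferentiableAt (model n) (model n) (fiberMap Θ₁) (ψ₁.symm p) ∧
        MDifferentiableAt (model n) (model n) (fiberMap Θ₂) (ψ₁.symm p) := fun {p} hp => by
      rw [← e₁, ← e₂]
      have h3 := (hs p).1 hp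
      exact ⟨(c₁'.contMDiffAt (ψ₁.open_target.mem_nhds h3.1)).mdifferentiableAt (by simp),
        (c₁.contMDiffAt (ψ₁.open_source.mem_nhds (ψ₁.map_target h3.1))).mdifferentiableAt (by simp),
        (c₂.contMDiffAt (ψ₂.open_source.mem_nhds h3.2)).mdifferentiableAt (by simp)⟩
    have hq : ∀ y ∈ (slab ξ r hr).S, ∀ᶠ z in 𝓝 y, param x₀ z ∈ ψ.source ∧
        param x₀ (localExpr x₀ x₀ ψ₁.symm z) = ψ₁.symm (param x₀ z) := fun y hy => by
      filter_upwards [L.eventually hy,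
        (contMDiffAt_param (hc hy.1)).continuousAt.eventually (hp y hy)] with z a1 a2
      exact ⟨a2, param_coords a1.2.2⟩
    refine ⟨r, hr, _, _, L.hasJets_pull H₁.metric fun y hy => ?_,
      L.hasJets_pull H₂.metric fun y hy => ?_, (L.jetMap.hasJet_pull H₁.density).congr fun y hy => ?_,
      (L.jetMap.hasJet_pull H₂.density).congr fun y hy => ?_⟩
    · filter_upwards [hp y hy] with p hp a b
      rw [pullback_pullbackForm (hj hp).1 (hj hp).2.1]
      refine pullback_of_eventuallyEq_id ?_ a b
      filter_upwards [ψ₁.open_target.mem_nhds ((hs p).1 hp).1] with p' hp'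
      rw [comp_apply, ← e₁, ψ₁.right_inv hp', id]
    · filter_upwards [hp y hy] with p hp a b
      rw [pullback_pullbackForm (hj hp).1 (hj hp).2.2, ← e₂]
      rfl
    · filter_upwards [hq y hy] with z hz
      refine congrArg A₁.density ?_
      rw [hz.2, ← e₁, ψ₁.right_inv ((hs _).1 hz.1).1]
    · filter_upwards [hq y hy] with z hz
      refine congrArg A₂.density ?_
      rw [hz.2, ← e₂, hψa]
  refine ⟨ψ, cψ, cψ', fun p hp => (sub₁ p ((hs p).1 hp).1).1, fun p hp => sub₂ p ((ht p).1 hp).1,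
    fun v x => ⟨zψ v x, ?_⟩, fun p hp => ⟨(h₁.invariant p (sub₁ p ((hs p).1 hp).1).1).1, fun s => ?_⟩,
    fun p hp => ⟨(h₂.invariant p (sub₂ p ((ht p).1 hp).1)).1, fun s => ?_⟩, fun s p hp => ?_,
    fun v x => by rw [pψ, add_sub_assoc], fun x₀ v ξ hξ I J => ?_, fun v x => ?_⟩
  · have := ψ.map_source (zψ (v - (φ₂ x - φ₁ x)) x)
    rwa [pψ, sub_add_cancel] at this
  · rw [hs, e₁', t₁, s₂] at hp ⊢
    exact hp
  · rw [ht, e₂', t₂, s₁] at hp ⊢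
    exact hp
  · have h3 := (hs p).1 hp
    have h4 := (sub₁ p h3.1).2
    have h5 := h3.2
    rw [s₂] at h5
    rw [hψa, hψa]
    rw [e₁'] at h4 h5 ⊢
    rw [e₂, fiberMap_dilation h4, fiberMap_dilation (P₂ _ h5).2]
  · obtain ⟨r, hr, G, f, H₁, H₂, -⟩ := key x₀ ξ hξ
    exact slab_oInfty (H₁ I J) (H₂ I J) v (mem_closedBall_self hr.le)
  · obtain ⟨r, hr, G, f, -, -, H₁, H₂⟩ := key x _ (mem_chart_target (𝔼 n) x)
    have := slab_oInfty H₁ H₂ v (mem_closedBall_self hr.le)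
    simpa [param] using this

end Equivalence

end

end WeightedAmbient

end

theorem theorem1p1 (n : ℕ) {M : Type*} [TopologicalSpace M]
    [ChartedSpace (EuclideanSpace ℝ (Fin n)) M] [IsManifold (𝓡 n) ∞ M]
    [T2Space M] [SecondCountableTopology M]
    (g : WeightedAmbient.RiemannianMetric n M) (φ : C^∞⟮𝓡 n, M; ℝ⟯) (lam : ℝ) :
    -- existence of a weighted ambient space, even of one in normal form relative to `(g, φ)`
    (∃ A : WeightedAmbient.AmbientData n M,
      WeightedAmbient.IsWeightedAmbient g φ lam A ∧ WeightedAmbient.IsNormal g A) ∧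
    -- uniqueness up to ambient-equivalence, for all representatives of the class
    (∀ φ₁ ∈ WeightedAmbient.conformalClass φ, ∀ φ₂ ∈ WeightedAmbient.conformalClass φ,
      ∀ A₁ A₂ : WeightedAmbient.AmbientData n M,
      WeightedAmbient.IsWeightedAmbient g φ₁ lam A₁ → WeightedAmbient.IsWeightedAmbient g φ₂ lam A₂ →
        WeightedAmbient.AmbientEquivalent φ₁ φ₂ lam A₁ A₂) ∧
    -- two normal forms relative to the same `(g, φ)` agree to infinite order
    (∀ A₁ A₂ : WeightedAmbient.AmbientData n M,
      WeightedAmbient.IsWeightedAmbient g φ lam A₁ → WeightedAmbient.IsNormal g A₁ →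
      WeightedAmbient.IsWeightedAmbient g φ lam A₂ → WeightedAmbient.IsNormal g A₂ →
        WeightedAmbient.FormOInfty (fun p a b => A₁.metric p a b - A₂.metric p a b) ∧
        WeightedAmbient.FunOInfty (fun p => A₁.density p - A₂.density p)) := by
  exact ⟨WeightedAmbient.exists_normal g φ lam,
    fun _ _ _ _ _ _ h₁ h₂ => WeightedAmbient.ambientEquivalent h₁ h₂,
    fun _ _ h₁ n₁ h₂ n₂ => WeightedAmbient.normal_unique h₁ n₁ h₂ n₂⟩
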